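/- **Regex.** Let $\Sigma$ be a finite terminal alphabet and $\Xi$ an infinite set of variables. *Regex* are built from $\varepsilon$, terminals $a\in\Sigma$ and variable references $\&x$ ($x\in\Xi$) by concatenation, disjunction, Kleene plus and variable bindings $\langle x:\alpha\rangle$, where $x$ must neither be bound nor referenced in $\alpha$; in addition $\emptyset$ alone is a regex. Let $\Gamma$ consist of the brackets $\vdash_x,\dashv_x$ $(x\in\Xi)$. Let $\alpha_{\mathcal R}$ be the proper regular expression obtained from $\alpha$ by replacing $\&x$ by $x$ and $\langle x:\beta\rangle$ by $\vdash_x\beta\dashv_x$, and $\mathcal R(\alpha)$ its language. The dereference $\mathcal D(r)$ of $r\in\mathcal R(\alpha)$ replaces, from left to right, each occurrence of $x$ by the (dereferenced) content $v$ of the nearest factor $\vdash_x v\dashv_x$ to its left (by $\varepsilon$ if there is none) and deletes all brackets; $\mathcal L(\alpha)=\{\mathcal D(r): r\in\mathcal R(\alpha)\}$. Let $\tilde\alpha$ be $\alpha_{\mathcal R}$ with its symbol occurrences marked $1,2,3,\dots$ from left to right; $\mathcal R(\tilde\alpha)$ is its language, and $\tilde\Gamma$ is the set of marked brackets. **Determinism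 of regex.** $\alpha$ is *not deterministic* if there are $\rho_1,\rho_2\in\mathcal R(\tilde\alpha)$, marked words $r,s_1,s_2$ and $\gamma_1,\gamma_2\in\tilde\Gamma^*$ such that (1) $\rho_1=r\gamma_1a_{(i)}s_1$, $\rho_2=r\gamma_2a_{(j)}s_2$ with $a\in\Sigma$, $i\ne j$; or (2) $\rho_1=r\gamma_1x_{(i)}s_1$, $\rho_2=r\gamma_2\chi_{(j)}s_2$ with $x\in\Xi$, $\chi\in\Sigma\cup\Xi$, $i\neq j$; or (3) $\rho_1=r\gamma_1\chi_{(i)}s_1$, $\rho_2=r\gamma_2\chi_{(i)}s_2$ with $\chi\in\Sigma\cup\Xi$, $\gamma_1\ne\gamma_2$; or (4) $\rho_1=r\gamma_1$, $\rho_2=r\gamma_2$ with $\gamma_1\neq\gamma_2$. Otherwise it is *deterministic*. **Automata.** A *memory automaton with trap state* (TMFA) over $\Sigma$ has a finite set $Q$ of states with an initial state $q_0$, final states $F$ and a trap state, a finite set $K$ of memories, and a transition function $\delta:Q\times(\Sigma\cup\{\varepsilon\}\cup K)\to\mathcal P(Q\times\{\mathsf o,\mathsf c,\mathsf r,\diamond\}^K)$;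 at the trap state the letters and $\varepsilon$ only give loops with all instructions $\diamond$, and there are no recalls. Each memory has a content in $\Sigma^*$ and is open or closed; initially all are empty and closed. A transition $(p,s)\in\delta(q,b)$ consumes $v=b$ if $b\in\Sigma\cup\{\varepsilon\}$; if $b\in K$, it requires $s_b=\mathsf c$ and consumes the current content $v$ of $b$. Each memory $i$ then behaves as follows: $s_i=\mathsf o$ opens it with content $v$, $\mathsf c$ closes it with unchanged content, $\mathsf r$ empties and closes it, and $\diamond$ appends $v$ if it is open and otherwise changes nothing. If recalling a content $vv'$ (with $s_b=\mathsf c$) fails because the remaining input starts with $v$ but does not continue with the first letter of $v'\neq\varepsilon$, the automaton can consume $v$ and move to the trap state with unchanged memories. A word is accepted if some computation consumes it and ends in $F$. The automaton is *$\varepsilon$-free* if no state other than the trap state has an $\varepsilon$-transition; its trap state is *rejecting* if it is not in $F$; it is *deterministic* if $|\delta(q,b)|\le1$ for all $q,b$ and, for every state $q$ other than the trap state, $\delta(q,b)\neq\emptyset$ with $b\in\{\varepsilon\}\cup K$ implies $\delta(q,b')=\emptyset$ for all $b'\ne b$. **The Glushkov automaton $\mathcal M(\alpha)$.** Its memories are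 the variables of $\alpha$ and one further memory $0$. Its states are the initial state, the trap state, and the marked occurrences of terminals and variable references in $\tilde\alpha$ (*nodes*). For nodes $u,v$ and $\nu\in\tilde\Gamma^*$ there is an *edge* $(u,\nu,v)$ if $u\nu v$ is a factor of a word in $\mathcal R(\tilde\alpha)$; likewise, with the initial state in place of $u$ and a sink in place of $v$, if $\nu v$ is a prefix, $u\nu$ a suffix, or $\nu$ an element of $\mathcal R(\tilde\alpha)$. The *net action* of $\nu$ on $x$ is $\diamond$ if $\nu$ contains no bracket of $x$, $\mathsf o$ if the last one is $\vdash_x$, and, if the last one is $\dashv_x$, $\mathsf r$ or $\mathsf c$ according to whether $\vdash_x$ occurs in $\nu$ or not. A state is final iff it has an edge to the sink. An edge $(u,\nu,v)$ to a node $v$ gives a transition from $u$ to $v$ with the net actions of $\nu$ as instructions ($\diamond$ for memory $0$): for $v=a_{(i)}$ with $a \in \Sigma$, it reads $a$; for $v=x_{(i)}$, it recalls memory $x$, with $s_x$ replaced by $\mathsf c$, unless $\nu$ resets $x$, in which case it recalls the (always empty) memory $0$ with $s_0=\mathsf c$. If two edges $(u,\nu_1,v)$, $(u,\nu_2,v)$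 with $\nu_1\ne\nu_2$ both lead to the sink or give the same transition, then two transitions from the initial state to the trap state are added, both recalling and closing memory $0$; one closes all other memories, the other leaves them unchanged. **Theorem.** For every regex $\alpha$ with $n$ occurrences of terminals and variable references, $\mathcal M(\alpha)$ is an $\varepsilon$-free TMFA with $n+2$ states and a rejecting trap state, $\mathcal L(\mathcal M(\alpha))=\mathcal L(\alpha)$, and $\mathcal M(\alpha)$ is deterministic if and only if $\alpha$ is deterministic. Moreover, there is an algorithm (a program of a unit-cost random access machine with addition and subtraction, in which letters and variables are represented by natural numbers) that, given an alphabet $\Sigma$ with $|\Sigma|\ge1$ and a regex $\alpha$ over $\Sigma$ whose syntax tree has $|\alpha|$ nodes, halts in time $O(|\Sigma|\,|\alpha|\,\max(n,1))$; if $\alpha$ is deterministic, it outputs $\mathcal M(\alpha)$ (the final states and all transitions, listed explicitly), and otherwise it reports that $\alpha$ is not deterministic. -/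

import Mathlib

/-! ### Regular expressions with back-references -/

/-- Syntax trees of regular expressions with back-references over the terminal alphabet `A` and
the variable alphabet `X`. -/
inductive Regex (A : Type*) (X : Type*) where
  | empty : Regex A X
  | eps : Regex A X
  | sym (a : A) : Regex A X
  | ref (x : X) : Regex A X
  | cat (α β : Regex A X) : Regex A X
  | alt (α β : Regex A X) : Regex A X
  | plus (α : Regex A X) : Regex A X
  | bind (x : X) (α : Regex A X) : Regex A X

namespace Regex

/-- The set of variables that are referenced or bound in a regex. -/
def var {A : Type*} {X : Type*} : Regex A X → Set X
  | empty => ∅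
  | eps => ∅
  | sym _ => ∅
  | ref x => {x}
  | cat α β => α.var ∪ β.var
  | alt α β => α.var ∪ β.var
  | plus α => α.var
  | bind x α => insert x α.var

/-- No `∅` occurs, and no variable occurs inside a binding of itself. -/
def WellFormed {A : Type*} {X : Type*} : Regex A X → Prop
  | empty => False
  | eps => True
  | sym _ => True
  | ref _ => True
  | cat α β => α.WellFormed ∧ β.WellFormed
  | alt α β => α.WellFormed ∧ β.WellFormed
  | plus α => α.WellFormed
  | bind x α => α.WellFormed ∧ x ∉ α.var

/-- The syntax trees that are regex: `∅` is allowed only on its own. -/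
def IsRX {A : Type*} {X : Type*} (α : Regex A X) : Prop :=
  α = empty ∨ α.WellFormed

/-- The number of occurrences of terminals and of variable references. -/
def occ {A : Type*} {X : Type*} : Regex A X → ℕ
  | empty => 0
  | eps => 0
  | sym _ => 1
  | ref _ => 1
  | cat α β => α.occ + β.occ
  | alt α β => α.occ + β.occ
  | plus α => α.occ
  | bind _ α => α.occ

/-- The size `|α|`: the number of nodes of the syntax tree. -/
def size {A : Type*} {X : Type*} : Regex A X → ℕ
  | empty => 1
  | eps => 1
  | sym _ => 1
  | ref _ => 1
  | cat α β => α.size + β.size + 1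
  | alt α β => α.size + β.size + 1
  | plus α => α.size + 1
  | bind _ α => α.size + 1

theorem finite_var {A : Type*} {X : Type*} (α : Regex A X) : α.var.Finite := by
  induction α with
  | empty => exact Set.finite_empty
  | eps => exact Set.finite_empty
  | sym a => exact Set.finite_empty
  | ref x => exact Set.finite_singleton x
  | cat α β h₁ h₂ => exact h₁.union h₂
  | alt α β h₁ h₂ => exact h₁.union h₂
  | plus α h => exact h
  | bind x α h => exact h.insert x

end Regex

/-! ### Ref-words and their dereferences -/

/-- The symbols of ref-words: terminals, variable references, and for every variable `x` an
opening bracket `op x` and a closing bracket `cl x`. -/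
inductive RefSym (A : Type*) (X : Type*) where
  | letter (a : A) : RefSym A X
  | var (x : X) : RefSym A X
  | op (x : X) : RefSym A X
  | cl (x : X) : RefSym A X

namespace RefSym

/-- The symbol is `op x` or `cl x` for some variable `x`. -/
def IsBracket {A : Type*} {X : Type*} : RefSym A X → Prop
  | letter _ => False
  | var _ => False
  | op _ => True
  | cl _ => True

end RefSym

/-- Proper regular expressions over an alphabet `B`. -/
inductive RefExpr (B : Type*) where
  | zero : RefExpr B
  | eps : RefExpr B
  | sym (b : B) : RefExpr B
  | cat (r t : RefExpr B) : RefExpr B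
  | alt (r t : RefExpr B) : RefExpr B
  | plus (r : RefExpr B) : RefExpr B

namespace RefExpr

/-- The language of a proper regular expression; `plus` is one or more repetitions. -/
def lang {B : Type*} : RefExpr B → Language B
  | zero => 0
  | eps => 1
  | sym b => {[b]}
  | cat r t => r.lang * t.lang
  | alt r t => r.lang + t.lang
  | plus r => r.lang * KStar.kstar r.lang

/-- The occurrences of symbols, from left to right. -/
def symbols {B : Type*} : RefExpr B → List B
  | zero => []
  | eps => []
  | sym b => [b]
  | cat r t => r.symbols ++ t.symbols
  | alt r t => r.symbols ++ t.symbols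
  | plus r => r.symbols

/-- Mark the occurrences of symbols from left to right by `i`, `i + 1`, `i + 2`, and so on. -/
def mark {B : Type*} : RefExpr B → ℕ → RefExpr (B × ℕ)
  | zero, _ => zero
  | eps, _ => eps
  | sym b, i => sym (b, i)
  | cat r t, i => cat (r.mark i) (t.mark (i + r.symbols.length))
  | alt r t, i => alt (r.mark i) (t.mark (i + r.symbols.length))
  | plus r, i => plus (r.mark i)

end RefExpr

section Deref

open scoped Classical in
/-- The content `v` of the rightmost factor `(op x) v (cl x)` of `w`; it is empty if there is
no such factor. -/
noncomputable def lastBinding {A : Type*} {X : Type*} (x : X) (w : List (RefSym A X)) :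
    List (RefSym A X) :=
  ((w.reverse.dropWhile (fun c => decide (c ≠ RefSym.cl x))).tail.takeWhile
    (fun c => decide (c ≠ RefSym.op x))).reverse

/-- Keep only the terminals of a ref-word. -/
def terminals {A : Type*} {X : Type*} (w : List (RefSym A X)) : List A :=
  w.filterMap (fun c => match c with
    | RefSym.letter a => some a
    | _ => none)

/-- Replace, from left to right, every variable reference of a ref-word by the terminals of the
factor that it points to; `w` is the part of the ref-word that has been treated before. -/
noncomputable def resolve {A : Type*} {X : Type*} (w : List (RefSym A X)) :
    List (RefSym A X) → List (RefSym A X)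
  | [] => w
  | RefSym.letter a :: r => resolve (w ++ [RefSym.letter a]) r
  | RefSym.op x :: r => resolve (w ++ [RefSym.op x]) r
  | RefSym.cl x :: r => resolve (w ++ [RefSym.cl x]) r
  | RefSym.var x :: r =>
      resolve (w ++ (terminals (lastBinding x w)).map RefSym.letter) r

/-- The dereference of a ref-word. -/
noncomputable def deref {A : Type*} {X : Type*} (r : List (RefSym A X)) : List A :=
  terminals (resolve [] r)

end Deref

namespace Regex

/-- The proper regular expression that generates the ref-words of a regex. -/
def toRef {A : Type*} {X : Type*} : Regex A X → RefExpr (RefSym A X)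
  | empty => RefExpr.zero
  | eps => RefExpr.eps
  | sym a => RefExpr.sym (RefSym.letter a)
  | ref x => RefExpr.sym (RefSym.var x)
  | cat α β => RefExpr.cat α.toRef β.toRef
  | alt α β => RefExpr.alt α.toRef β.toRef
  | plus α => RefExpr.plus α.toRef
  | bind x α => RefExpr.cat (RefExpr.sym (RefSym.op x))
      (RefExpr.cat α.toRef (RefExpr.sym (RefSym.cl x)))

/-- The ref-language of a regex. -/
def refLang {A : Type*} {X : Type*} (α : Regex A X) : Language (RefSym A X) :=
  α.toRef.lang

/-- The language of a regex. -/
def lang {A : Type*} {X : Type*} (α : Regex A X) : Language A :=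
  {w | ∃ r ∈ α.refLang, deref r = w}

/-- The marked regex: all occurrences of symbols are marked by `1, 2, 3, …`. -/
def marked {A : Type*} {X : Type*} (α : Regex A X) : RefExpr (RefSym A X × ℕ) :=
  α.toRef.mark 1

/-- The language of marked ref-words. -/
def markedLang {A : Type*} {X : Type*} (α : Regex A X) : Language (RefSym A X × ℕ) :=
  α.marked.lang

/-- A word that consists of marked brackets only. -/
def IsBracketWord {A : Type*} {X : Type*} (γ : List (RefSym A X × ℕ)) : Prop :=
  ∀ c ∈ γ, c.1.IsBracket

/-- A regex is not deterministic if two marked ref-words satisfy one of four conditions. -/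
def NotDeterministic {A : Type*} {X : Type*} (α : Regex A X) : Prop :=
  ∃ ρ₁ ∈ α.markedLang, ∃ ρ₂ ∈ α.markedLang, ∃ r s₁ s₂ γ₁ γ₂ : List (RefSym A X × ℕ),
    IsBracketWord γ₁ ∧ IsBracketWord γ₂ ∧
    ((∃ (a : A) (i j : ℕ), i ≠ j ∧
        ρ₁ = r ++ γ₁ ++ [(RefSym.letter a, i)] ++ s₁ ∧
        ρ₂ = r ++ γ₂ ++ [(RefSym.letter a, j)] ++ s₂) ∨
     (∃ (x : X) (χ : RefSym A X) (i j : ℕ), ¬ χ.IsBracket ∧ i ≠ j ∧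
        ρ₁ = r ++ γ₁ ++ [(RefSym.var x, i)] ++ s₁ ∧
        ρ₂ = r ++ γ₂ ++ [(χ, j)] ++ s₂) ∨
     (∃ (χ : RefSym A X) (i : ℕ), ¬ χ.IsBracket ∧ γ₁ ≠ γ₂ ∧
        ρ₁ = r ++ γ₁ ++ [(χ, i)] ++ s₁ ∧
        ρ₂ = r ++ γ₂ ++ [(χ, i)] ++ s₂) ∨
     (γ₁ ≠ γ₂ ∧ ρ₁ = r ++ γ₁ ∧ ρ₂ = r ++ γ₂))

def Deterministic {A : Type*} {X : Type*} (α : Regex A X) : Prop :=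
  ¬ α.NotDeterministic

end Regex

/-! ### Memory automata with trap state -/

/-- Memory instructions: open, close, reset, leave unchanged. -/
inductive MemInstr where
  | opn : MemInstr
  | cls : MemInstr
  | rst : MemInstr
  | unch : MemInstr

/-- What a transition reads: a terminal, nothing, or the content of a memory. -/
inductive TransLabel (A : Type*) (K : Type*) where
  | letter (a : A) : TransLabel A K
  | eps : TransLabel A K
  | recall (i : K) : TransLabel A K

/-- Memory automata with trap state over the alphabet `A`, with the finite set `Q` of states and
with memories that are indexed by the finite set `K`. -/
structure TMFA (A : Type*) (Q : Type*) (K : Type*) where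
  finite_states : Finite Q
  finite_memories : Finite K
  trap : Q
  init : Q
  final : Set Q
  δ : Q → TransLabel A K → Set (Q × (K → MemInstr))
  trap_letter : ∀ a, δ trap (TransLabel.letter a) = {(trap, fun _ => MemInstr.unch)}
  trap_eps : δ trap TransLabel.eps = {(trap, fun _ => MemInstr.unch)}
  trap_recall : ∀ i, δ trap (TransLabel.recall i) = ∅

namespace TMFA

/-- A configuration: the state, the remaining input, and for every memory its content together
with its status (`true` for open, `false` for closed). -/
structure Config (A : Type*) (Q : Type*) (K : Type*) where
  state : Q
  input : List A
  mem : K → List A × Bool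

/-- The new configuration of a memory with configuration `m`, under the instruction `s`, in a
step that consumes `v`. -/
def memStep {A : Type*} (v : List A) (s : MemInstr) (m : List A × Bool) : List A × Bool :=
  match s, m with
  | MemInstr.unch, (u, true) => (u ++ v, true)
  | MemInstr.unch, (u, false) => (u, false)
  | MemInstr.opn, _ => (v, true)
  | MemInstr.cls, (u, _) => (u, false)
  | MemInstr.rst, _ => ([], false)

/-- `Reads mem b s v`: with the memories `mem`, a transition with label `b` and instructions `s`
consumes `v`. A memory that is recalled has to be closed by the same transition. -/
def Reads {A : Type*} {K : Type*} (mem : K → List A × Bool) (b : TransLabel A K)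
    (s : K → MemInstr) (v : List A) : Prop :=
  match b with
  | TransLabel.letter a => v = [a]
  | TransLabel.eps => v = []
  | TransLabel.recall i => s i = MemInstr.cls ∧ v = (mem i).1

/-- One step of a computation; `fail` is a memory recall failure. -/
inductive Step {A : Type*} {Q : Type*} {K : Type*} (M : TMFA A Q K) :
    Config A Q K → Config A Q K → Prop
  | move (q p : Q) (b : TransLabel A K) (s : K → MemInstr) (v w : List A)
      (mem : K → List A × Bool) (hδ : (p, s) ∈ M.δ q b) (hv : Reads mem b s v) :
      Step M ⟨q, v ++ w, mem⟩ ⟨p, w, fun i => memStep v (s i) (mem i)⟩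
  | fail (q p : Q) (i : K) (s : K → MemInstr) (v v' w : List A)
      (mem : K → List A × Bool) (hδ : (p, s) ∈ M.δ q (TransLabel.recall i))
      (hs : s i = MemInstr.cls) (hu : (mem i).1 = v ++ v') (hv' : v' ≠ [])
      (hw : v'.head? ≠ w.head?) :
      Step M ⟨q, v ++ w, mem⟩ ⟨M.trap, w, mem⟩

/-- The accepted language. -/
def lang {A : Type*} {Q : Type*} {K : Type*} (M : TMFA A Q K) : Language A :=
  {w | ∃ (q : Q) (mem : K → List A × Bool), q ∈ M.final ∧
    Relation.ReflTransGen M.Step ⟨M.init, w, fun _ => ([], false)⟩ ⟨q, [], mem⟩}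

/-- The trap state is rejecting. -/
def RejectingTrap {A : Type*} {Q : Type*} {K : Type*} (M : TMFA A Q K) : Prop :=
  M.trap ∉ M.final

/-- No `ε`-transitions, except for the obligatory one from the trap state to itself. -/
def EpsFree {A : Type*} {Q : Type*} {K : Type*} (M : TMFA A Q K) : Prop :=
  ∀ q, q ≠ M.trap → M.δ q TransLabel.eps = ∅

/-- Determinism: at most one transition for every state and every label, and a state with an
`ε`-transition or a memory recall transition has no transition with another label. The trap
state, whose transitions are prescribed, is exempt from the second condition. -/
def Deterministic {A : Type*} {Q : Type*} {K : Type*} (M : TMFA A Q K) : Prop :=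
  (∀ q b, (M.δ q b).Subsingleton) ∧
  ∀ q, q ≠ M.trap → ∀ b, (b = TransLabel.eps ∨ ∃ i, b = TransLabel.recall i) →
    (M.δ q b).Nonempty → ∀ b', b' ≠ b → M.δ q b' = ∅

end TMFA

/-! ### The Glushkov automaton of a regex -/

open scoped Classical in
/-- The net action on the variable `x` of a word `ν` of brackets. -/
noncomputable def netAction {A : Type*} {X : Type*} (ν : List (RefSym A X)) (x : X) : MemInstr :=
  match (ν.filter (fun c => decide (c = RefSym.op x ∨ c = RefSym.cl x))).getLast? with
  | none => MemInstr.unch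
  | some (RefSym.op _) => MemInstr.opn
  | some _ => if RefSym.op x ∈ ν then MemInstr.rst else MemInstr.cls

namespace Regex

/-- The marked terminals and marked variable references of a regex. -/
def Node {A : Type*} {X : Type*} (α : Regex A X) : Type _ :=
  {c : RefSym A X × ℕ // c ∈ α.marked.symbols ∧ ¬ c.1.IsBracket}

/-- The edges of the memory occurrence graph. As a source, `none` is the source node; as a target,
`none` is the sink node. There is an edge from `u` to `v` with label `ν` if the bracket word `ν`
leads from `u` (or the beginning) to `v` (or the end) in some marked ref-word. -/
def Edge {A : Type*} {X : Type*} (α : Regex A X) (u : Option α.Node)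
    (ν : List (RefSym A X × ℕ)) (v : Option α.Node) : Prop :=
  IsBracketWord ν ∧ ∃ l r : List (RefSym A X × ℕ), l ++ ν ++ r ∈ α.markedLang ∧
    l.getLast? = u.map Subtype.val ∧ r.head? = v.map Subtype.val

/-- The states of the Glushkov automaton. -/
inductive GState {A : Type*} {X : Type*} (α : Regex A X) where
  | trap : GState α
  | init : GState α
  | node (u : α.Node) : GState α

/-- The memories of the Glushkov automaton: one for every variable of `α`, and an additional one
(`none`) that is always empty. -/
abbrev GMem {A : Type*} {X : Type*} (α : Regex A X) : Type _ := Option α.var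

/-- The memory instructions for an edge label; the additional memory is left unchanged. -/
noncomputable def edgeInstr {A : Type*} {X : Type*} (α : Regex A X)
    (ν : List (RefSym A X × ℕ)) : α.GMem → MemInstr
  | none => MemInstr.unch
  | some x => netAction (ν.map Prod.fst) x

open scoped Classical in
/-- An edge with label `ν` to the node `v` gives a transition with label `b` and instructions `s`.
A terminal is read. For a reference to `x`, the memory of `x` is recalled (and hence closed);
but if `ν` resets `x`, then the reference has the value `ε`, and the transition recalls the
additional memory and resets `x`, since recalling `x` would yield the old content. -/
def IsEdgeTransition {A : Type*} {X : Type*} (α : Regex A X) (ν : List (RefSym A X × ℕ))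
    (v : α.Node) (b : TransLabel A α.GMem) (s : α.GMem → MemInstr) : Prop :=
  (∃ a : A, v.1.1 = RefSym.letter a ∧ b = TransLabel.letter a ∧ s = α.edgeInstr ν) ∨
  (∃ x : α.var, v.1.1 = RefSym.var x.1 ∧ α.edgeInstr ν (some x) ≠ MemInstr.rst ∧
    b = TransLabel.recall (some x) ∧
    s = Function.update (α.edgeInstr ν) (some x) MemInstr.cls) ∨
  (∃ x : α.var, v.1.1 = RefSym.var x.1 ∧ α.edgeInstr ν (some x) = MemInstr.rst ∧
    b = TransLabel.recall none ∧
    s = Function.update (α.edgeInstr ν) none MemInstr.cls)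

/-- The memory occurrence graph has two edges with different labels that its interpretation as an
automaton does not distinguish: they lead to the sink, or they give the same transition. -/
def HiddenAmbiguity {A : Type*} {X : Type*} (α : Regex A X) : Prop :=
  ∃ (u : Option α.Node) (ν₁ ν₂ : List (RefSym A X × ℕ)), ν₁ ≠ ν₂ ∧
    ((α.Edge u ν₁ none ∧ α.Edge u ν₂ none) ∨
     ∃ (v : α.Node) (b : TransLabel A α.GMem) (s : α.GMem → MemInstr),
       α.Edge u ν₁ (some v) ∧ α.Edge u ν₂ (some v) ∧
       α.IsEdgeTransition ν₁ v b s ∧ α.IsEdgeTransition ν₂ v b s)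

/-- The transitions that are read off from the edges with source `u`. -/
def edgeTransitions {A : Type*} {X : Type*} (α : Regex A X) (u : Option α.Node)
    (b : TransLabel A α.GMem) : Set (α.GState × (α.GMem → MemInstr)) :=
  {t | ∃ (v : α.Node) (ν : List (RefSym A X × ℕ)),
    t.1 = GState.node v ∧ α.Edge u ν (some v) ∧ α.IsEdgeTransition ν v b t.2}

/-- In the presence of a hidden ambiguity, two transitions with the same label and different
instructions lead from the initial state to the (rejecting) trap state. -/
def ambiguityTransitions {A : Type*} {X : Type*} (α : Regex A X)
    (b : TransLabel A α.GMem) : Set (α.GState × (α.GMem → MemInstr)) :=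
  {t | α.HiddenAmbiguity ∧ b = TransLabel.recall none ∧ t.1 = GState.trap ∧
    t.2 none = MemInstr.cls ∧
    ((∀ x : α.var, t.2 (some x) = MemInstr.unch) ∨ (∀ x : α.var, t.2 (some x) = MemInstr.cls))}

def transitions {A : Type*} {X : Type*} (α : Regex A X) :
    α.GState → TransLabel A α.GMem → Set (α.GState × (α.GMem → MemInstr))
  | GState.trap, TransLabel.letter _ => {(GState.trap, fun _ => MemInstr.unch)}
  | GState.trap, TransLabel.eps => {(GState.trap, fun _ => MemInstr.unch)}
  | GState.trap, TransLabel.recall _ => ∅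
  | GState.init, b => α.edgeTransitions none b ∪ α.ambiguityTransitions b
  | GState.node u, b => α.edgeTransitions (some u) b

/-- The initial state or a node is final if it has an edge to the sink. -/
def finalStates {A : Type*} {X : Type*} (α : Regex A X) : Set α.GState :=
  {q | match q with
    | GState.trap => False
    | GState.init => ∃ ν, α.Edge none ν none
    | GState.node u => ∃ ν, α.Edge (some u) ν none}

theorem finite_gState {A : Type*} {X : Type*} (α : Regex A X) : Finite α.GState := by
  have hL : Finite {c // c ∈ α.marked.symbols} :=
    (List.finite_toSet α.marked.symbols).to_subtype
  have hN : Finite α.Node :=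
    Finite.of_injective (β := {c // c ∈ α.marked.symbols}) (fun u => ⟨u.1, u.2.1⟩)
      (fun u v h => Subtype.ext (congrArg (fun c => c.1) h))
  refine Finite.of_surjective (α := Option (Option α.Node)) (fun o => match o with
    | none => GState.trap
    | some none => GState.init
    | some (some u) => GState.node u) ?_
  rintro (_ | _ | u)
  · exact ⟨none, rfl⟩
  · exact ⟨some none, rfl⟩
  · exact ⟨some (some u), rfl⟩

theorem finite_gMem {A : Type*} {X : Type*} (α : Regex A X) : Finite α.GMem := by
  have := α.finite_var.to_subtype
  infer_instance

/-- The (generalized) Glushkov automaton of a regex. -/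
def glushkov {A : Type*} {X : Type*} (α : Regex A X) : TMFA A α.GState α.GMem where
  finite_states := α.finite_gState
  finite_memories := α.finite_gMem
  trap := GState.trap
  init := GState.init
  final := α.finalStates
  δ := α.transitions
  trap_letter := fun _ => rfl
  trap_eps := rfl
  trap_recall := fun _ => rfl

end Regex

/-! ### Programs for a unit-cost random access machine

The memory consists of arrays of natural numbers, which are addressed indirectly. A program is a
structured program and refers to finitely many arrays. Additions, truncated subtractions, tests,
and accesses to the memory have unit cost. -/

/-- The content of the memory: `σ k i` is cell `i` of array `k`. -/
abbrev RamStore := ℕ → ℕ → ℕ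

inductive RamExpr where
  | const (n : ℕ) : RamExpr
  | load (k : ℕ) (e : RamExpr) : RamExpr
  | add (e f : RamExpr) : RamExpr
  | sub (e f : RamExpr) : RamExpr

namespace RamExpr

def eval (σ : RamStore) : RamExpr → ℕ
  | const n => n
  | load k e => σ k (e.eval σ)
  | add e f => e.eval σ + f.eval σ
  | sub e f => e.eval σ - f.eval σ

def cost : RamExpr → ℕ
  | const _ => 1
  | load _ e => e.cost + 1
  | add e f => e.cost + f.cost + 1
  | sub e f => e.cost + f.cost + 1

end RamExpr

/-- Programs: do nothing, store the value of `f` in the cell of array `k` given by the value of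
`e`, sequential composition, case distinction whether the value of `e` is not zero, and
repetition as long as the value of `e` is not zero. -/
inductive RamProg where
  | skip : RamProg
  | store (k : ℕ) (e f : RamExpr) : RamProg
  | seq (p q : RamProg) : RamProg
  | cond (e : RamExpr) (p q : RamProg) : RamProg
  | loop (e : RamExpr) (p : RamProg) : RamProg

namespace RamProg

/-- `Exec p σ σ' t`: started in `σ`, the program `p` halts in `σ'` after `t` steps. -/
inductive Exec : RamProg → RamStore → RamStore → ℕ → Prop
  | skip (σ : RamStore) : Exec skip σ σ 1
  | store (k : ℕ) (e f : RamExpr) (σ : RamStore) :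
      Exec (store k e f) σ
        (Function.update σ k (Function.update (σ k) (e.eval σ) (f.eval σ)))
        (e.cost + f.cost + 1)
  | seq {p q : RamProg} {σ σ' σ'' : RamStore} {t t' : ℕ} :
      Exec p σ σ' t → Exec q σ' σ'' t' → Exec (seq p q) σ σ'' (t + t')
  | cond_true {e : RamExpr} {p q : RamProg} {σ σ' : RamStore} {t : ℕ} :
      e.eval σ ≠ 0 → Exec p σ σ' t → Exec (cond e p q) σ σ' (e.cost + 1 + t)
  | cond_false {e : RamExpr} {p q : RamProg} {σ σ' : RamStore} {t : ℕ} :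
      e.eval σ = 0 → Exec q σ σ' t → Exec (cond e p q) σ σ' (e.cost + 1 + t)
  | loop_done {e : RamExpr} {p : RamProg} {σ : RamStore} :
      e.eval σ = 0 → Exec (loop e p) σ σ (e.cost + 1)
  | loop_step {e : RamExpr} {p : RamProg} {σ σ' σ'' : RamStore} {t t' : ℕ} :
      e.eval σ ≠ 0 → Exec p σ σ' t → Exec (loop e p) σ' σ'' t' →
      Exec (loop e p) σ σ'' (e.cost + 1 + t + t')

/-- The initial memory on an input: array `0` holds the length of the input followed by the
input, and all other cells are zero. -/
def initStore (input : List ℕ) : RamStore := fun k i =>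
  if k = 0 then (input.length :: input).getD i 0 else 0

/-- On the given input, the program halts after `t` steps, and then array `1` holds the length of
the output followed by the output. -/
def Computes (p : RamProg) (input output : List ℕ) (t : ℕ) : Prop :=
  ∃ σ : RamStore, Exec p (initStore input) σ t ∧
    ∀ i ≤ output.length, σ 1 i = (output.length :: output).getD i 0

end RamProg

/-! ### Encodings as lists of natural numbers -/

/-- A regex in reverse Polish notation, with two numbers for every node of the syntax tree. -/
def Regex.encode {s : ℕ} : Regex (Fin s) ℕ → List ℕ
  | Regex.empty => [0, 0]
  | Regex.eps => [1, 0]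
  | Regex.sym a => [2, a]
  | Regex.ref x => [3, x]
  | Regex.cat α β => α.encode ++ β.encode ++ [4, 0]
  | Regex.alt α β => α.encode ++ β.encode ++ [5, 0]
  | Regex.plus α => α.encode ++ [6, 0]
  | Regex.bind x α => α.encode ++ [7, x]

def MemInstr.encode : MemInstr → ℕ
  | MemInstr.opn => 0
  | MemInstr.cls => 1
  | MemInstr.rst => 2
  | MemInstr.unch => 3

def TransLabel.encode {s k : ℕ} {K : Type*} (eK : K ≃ Fin k) : TransLabel (Fin s) K → List ℕ
  | TransLabel.letter a => [0, a]
  | TransLabel.eps => [1, 0]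
  | TransLabel.recall i => [2, eK i]

/-- `code` is an explicit description of the automaton `M`, for some numbering of the states and of
the memories: the numbers of states, terminals and memories, the initial state, the trap state,
the list of the final states, and the list of all transitions (source, label, target, and all
memory instructions). -/
def TMFA.IsEncoding {s : ℕ} {Q : Type*} {K : Type*} (M : TMFA (Fin s) Q K) (code : List ℕ) :
    Prop :=
  ∃ (m k : ℕ) (eQ : Q ≃ Fin m) (eK : K ≃ Fin k) (fs : List Q)
    (ts : List (Q × TransLabel (Fin s) K × Q × (K → MemInstr))),
    fs.Nodup ∧ (∀ q, q ∈ fs ↔ q ∈ M.final) ∧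
    ts.Nodup ∧ (∀ t, t ∈ ts ↔ t.2.2 ∈ M.δ t.1 t.2.1) ∧
    code = [m, s, k, (eQ M.init : ℕ), (eQ M.trap : ℕ)] ++
      fs.length :: fs.map (fun q => (eQ q : ℕ)) ++
      ts.length :: ts.flatMap (fun t => (eQ t.1 : ℕ) :: t.2.1.encode eK ++
        (eQ t.2.2.1 : ℕ) :: List.ofFn (fun i => (t.2.2.2 (eK.symm i)).encode))

/-! ### Marked proper regular expressions -/

namespace RefExpr

variable {B : Type*}

/-! Marks make every symbol occurrence unique, so the language of a marked expression is local
(`isLocal_lang`): two words through the same occurrence may exchange their continuations after it.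
Hence the past of a word matters only through the last node `u` that it has passed, and everything
can be phrased in terms of edges `(u, ν, v)`.

Determinism. In the four clauses of the definition, the brackets at the end of the common prefix `r`
can be moved into `γ₁` and `γ₂`; what remains of the prefix is empty or ends in a node. So a regex
fails to be deterministic iff some source has two edges whose targets clash, or two edges with the
same target and different labels (`Conflict`, `notDeterministic_iff`). Clashing edges give two
transitions with the same letter, or a recall beside another transition. Two labels for one target
give different transitions, which is forbidden again, or they are indistinguishable (the same
transition, or edges to the sink), and exactly then the ambiguity transitions have been added
(`glushkov_deterministic_iff`).

Language. In a well-formed regex the brackets of each variable alternate, and no reference to `x`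
stands inside a binding of `x` (`track_refLang`). Therefore the content of the closed memory `x` is
the last binding of `x` (`memRun_spec`), and a bracket word acts on a memory by its net action
(`memRun_brackets`). One transition then consumes the value of its target node and updates all
memories correctly (`IsEdgeTransition.spec`); the recall of the additional memory covers labels that
empty the variable just before its reference. Induction along a marked word and along a computation
gives the two inclusions (`exists_accepting_run`, `reachable_config`); recall failures only lead
into the rejecting trap.

Edges by recursion. In general a source may have infinitely many labels. Without conflicts, every
subexpression has at most one bracket word, every node at most one word to the exit, and every
entrance one word that leads to it; `nullW`, `outW` and `targets` compute these by structural
recursion. `NullOK` and `InOK` state that no choice was ambiguous, and their failure is itself a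
conflict (`conflict_of_not_nullOK`, `conflict_of_not_inOK`). Comparing words would take too long,
but comparing lengths is enough: of two ways to the same entrance, both begin by leaving the same
subexpression, so one word is a prefix of the other (`agree_iff`, `inOK_iff`).

Net actions. Order the instructions as unchanged, close, reset, open. The net action of a
concatenation is the maximum of the two, unless the first word leaves the variable open
(`netPrio_append`). A path climbs from its source to a turning node and descends to its target; a
binding of `x` that it leaves, passes or enters contributes 1, 2 or 3. Thus one traversal of the
syntax tree yields the net actions on all variables for one target (`ev`, `netPrio_source`).

Time. The input is in reverse Polish notation, so traversals are plain loops over positions, and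
structural induction proves them correct (`up_eq_iterate`, `down_eq_iterate`). Each of the `n + 1`
sources needs a fixed number of traversals and one more for every target. Transitions are written
only as long as no conflict has been found; then the targets of a source carry different letters, or
there is only one target, so there are at most `|Σ|` of them (`length_srcReached_le`). The bound
follows from `n + 1 ≤ 2 * max n 1`. -/

theorem mem_lang_plus {r : RefExpr B} {w : List B} :
    w ∈ (plus r).lang ↔ ∃ S : List (List B), S ≠ [] ∧ S.flatten = w ∧ ∀ y ∈ S, y ∈ r.lang := by
  simp only [lang, Language.mem_mul, Language.mem_kstar]
  constructor
  · rintro ⟨a, ha, b, ⟨S, rfl, hS⟩, rfl⟩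
    exact ⟨a :: S, by simp, by simp, by simpa [ha] using hS⟩
  · rintro ⟨S, hne, rfl, hS⟩
    obtain ⟨a, S, rfl⟩ := List.exists_cons_of_ne_nil hne
    exact ⟨a, hS a (by simp), S.flatten, ⟨S, rfl, fun y hy => hS y (by simp [hy])⟩, by simp⟩

theorem mem_lang_cat {r t : RefExpr B} {w : List B} :
    w ∈ (cat r t).lang ↔ ∃ a ∈ r.lang, ∃ b ∈ t.lang, a ++ b = w := Language.mem_mul

theorem mem_lang_alt {r t : RefExpr B} {w : List B} :
    w ∈ (alt r t).lang ↔ w ∈ r.lang ∨ w ∈ t.lang := Language.mem_add _ _ _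

theorem mem_lang_sym {b : B} {w : List B} : w ∈ (sym b).lang ↔ w = [b] := Iff.rfl

theorem mem_lang_eps {w : List B} : w ∈ (eps : RefExpr B).lang ↔ w = [] := Iff.rfl

theorem not_mem_lang_zero {w : List B} : w ∉ (zero : RefExpr B).lang := Language.notMem_zero w

theorem mem_symbols_of_mem_lang {r : RefExpr B} :
    ∀ {w : List B}, w ∈ r.lang → ∀ c ∈ w, c ∈ r.symbols := by
  induction r with
  | zero => intro w hw; exact absurd hw not_mem_lang_zero
  | eps => rintro w rfl; simp
  | sym b => rintro w rfl; simp [symbols]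
  | cat r t hr ht =>
    rintro w hw c hc
    obtain ⟨a, ha, b, hb, rfl⟩ := mem_lang_cat.1 hw
    rw [symbols, List.mem_append]
    exact (List.mem_append.1 hc).imp (hr ha c) (ht hb c)
  | alt r t hr ht =>
    rintro w hw c hc
    rw [symbols, List.mem_append]
    exact (mem_lang_alt.1 hw).imp (fun h => hr h c hc) (fun h => ht h c hc)
  | plus r hr =>
    rintro w hw c hc
    obtain ⟨S, -, rfl, hS⟩ := mem_lang_plus.1 hw
    obtain ⟨y, hy, hcy⟩ := List.mem_flatten.1 hc
    exact hr (hS y hy) c hcy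

/-- A language is local if it contains, with two words through a symbol, also the word that
continues the first one like the second one after this symbol. -/
def IsLocal (L : Language B) : Prop :=
  ∀ (c : B) (l₁ r₁ l₂ r₂ : List B), l₁ ++ c :: r₁ ∈ L → l₂ ++ c :: r₂ ∈ L → l₁ ++ c :: r₂ ∈ L

/-- The occurrence of `c` falls into one iteration; `p` and `q` collect the iterations before and
after it. They may be empty although the empty word need not belong to the iterated language, hence
the disjunctions. -/
theorem exists_factor_of_mem_plus {r : RefExpr B} {c : B} {l t : List B}
    (h : l ++ c :: t ∈ (plus r).lang) :
    ∃ p l' t' q, l = p ++ l' ∧ t = t' ++ q ∧ l' ++ c :: t' ∈ r.lang ∧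
      (p = [] ∨ p ∈ (plus r).lang) ∧ (q = [] ∨ q ∈ (plus r).lang) := by
  obtain ⟨S, -, hw, hS⟩ := mem_lang_plus.1 h
  clear h
  induction S generalizing l with
  | nil => simp at hw
  | cons y S ih =>
    rw [List.flatten_cons] at hw
    have hS' : ∀ z ∈ S, z ∈ r.lang := fun z hz => hS z (by simp [hz])
    have hy : y ∈ r.lang := hS y (by simp)
    rcases List.append_eq_append_iff.1 hw with ⟨a', rfl, h2⟩ | ⟨c', rfl, h2⟩
    · obtain ⟨p, l', t', q, rfl, rfl, h3, h4, h5⟩ := ih h2 hS'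
      refine ⟨y ++ p, l', t', q, by simp, rfl, h3, Or.inr ?_, h5⟩
      rcases h4 with rfl | h4
      · exact mem_lang_plus.2 ⟨[y], by simp, by simp, by simpa using hy⟩
      · obtain ⟨S', -, rfl, hS'⟩ := mem_lang_plus.1 h4
        exact mem_lang_plus.2 ⟨y :: S', by simp, by simp, by simpa [hy] using hS'⟩
    -- The first iteration may end exactly before `c`; then `c` is the first symbol of what follows,
    -- and the left context is empty there.
    · rcases List.cons_eq_append_iff.1 h2 with ⟨rfl, h3⟩ | ⟨t', rfl, rfl⟩
      · obtain ⟨p, l', t', q, h6, rfl, h3, h4, h5⟩ := ih (l := []) (by simp [h3]) hS'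
        obtain ⟨rfl, rfl⟩ : p = [] ∧ l' = [] := by simpa using h6.symm
        refine ⟨l, [], t', q, by simp, rfl, h3, Or.inr ?_, h5⟩
        exact mem_lang_plus.2 ⟨[l], by simp, by simp, by simpa using hy⟩
      · refine ⟨[], l, t', S.flatten, rfl, rfl, hy, Or.inl rfl, ?_⟩
        rcases S with _ | ⟨z, S⟩
        · exact Or.inl rfl
        · exact Or.inr (mem_lang_plus.2 ⟨z :: S, by simp, rfl, hS'⟩)

theorem mem_plus_of_mem {r : RefExpr B} {w : List B} (h : w ∈ r.lang) : w ∈ (plus r).lang :=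
  mem_lang_plus.2 ⟨[w], by simp, by simp, by simpa using h⟩

theorem append_mem_plus {r : RefExpr B} {v w : List B} (hv : v ∈ (plus r).lang)
    (hw : w ∈ (plus r).lang) : v ++ w ∈ (plus r).lang := by
  obtain ⟨S, h, rfl, hS⟩ := mem_lang_plus.1 hv
  obtain ⟨T, -, rfl, hT⟩ := mem_lang_plus.1 hw
  exact mem_lang_plus.2 ⟨S ++ T, by simp [h], by simp,
    fun y hy => (List.mem_append.1 hy).elim (hS y) (hT y)⟩

theorem sandwich_mem_plus {r : RefExpr B} {p w q : List B} (hp : p = [] ∨ p ∈ (plus r).lang)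
    (hw : w ∈ r.lang) (hq : q = [] ∨ q ∈ (plus r).lang) : p ++ w ++ q ∈ (plus r).lang := by
  have h1 : p ++ w ∈ (plus r).lang := by
    rcases hp with rfl | hp
    · exact mem_plus_of_mem hw
    · exact append_mem_plus hp (mem_plus_of_mem hw)
  rcases hq with rfl | hq
  · simpa using h1
  · exact append_mem_plus h1 hq

/-- A symbol that occurs once in the expression has only one place in the syntax tree. Both words
therefore pass through the same leaf, and they can be spliced in the smallest subexpression around
it; for an iteration, the earlier iterations come from the first word and the later ones from the
second. -/
theorem isLocal_lang {r : RefExpr B} (hr : r.symbols.Nodup) : IsLocal r.lang := by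
  induction r with
  | zero => intro c l₁ r₁ l₂ r₂ h; exact absurd h not_mem_lang_zero
  | eps => intro c l₁ r₁ l₂ r₂ h; simp [mem_lang_eps] at h
  | sym b =>
    intro c l₁ r₁ l₂ r₂ h h'
    rw [mem_lang_sym, List.append_eq_singleton_iff] at h h'
    rw [mem_lang_sym, List.append_eq_singleton_iff]
    rcases h with ⟨rfl, h⟩ | ⟨rfl, h⟩
    · rcases h' with ⟨rfl, h'⟩ | ⟨rfl, h'⟩
      · exact Or.inl ⟨rfl, h'⟩
      · simp at h'
    · simp at h
  | cat r t ihr iht =>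
    intro c l₁ r₁ l₂ r₂ h h'
    rw [symbols, List.nodup_append] at hr
    obtain ⟨hr, ht, hd⟩ := hr
    -- `c` lies in the left or in the right factor; if it is the first symbol after the border, it
    -- belongs to the right one.
    have key : ∀ l s, l ++ c :: s ∈ (cat r t).lang →
        (∃ x y, x ++ y = s ∧ l ++ c :: x ∈ r.lang ∧ y ∈ t.lang) ∨
        (∃ x y, x ++ y = l ∧ x ∈ r.lang ∧ y ++ c :: s ∈ t.lang) := by
      intro l s hl
      obtain ⟨a, ha, b, hb, hab⟩ := mem_lang_cat.1 hl
      rcases List.append_eq_append_iff.1 hab with ⟨a', rfl, h2⟩ | ⟨c', rfl, h2⟩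
      · exact Or.inr ⟨a, a', rfl, ha, h2 ▸ hb⟩
      · rcases List.cons_eq_append_iff.1 h2 with ⟨rfl, h3⟩ | ⟨t', rfl, rfl⟩
        · exact Or.inr ⟨l, [], by simp, by simpa using ha, by simpa [← h3] using hb⟩
        · exact Or.inl ⟨t', b, rfl, ha, hb⟩
    rcases key _ _ h with ⟨x, y, rfl, h1, h2⟩ | ⟨x, y, rfl, h1, h2⟩ <;>
    rcases key _ _ h' with ⟨x', y', rfl, h1', h2'⟩ | ⟨x', y', rfl, h1', h2'⟩
    · exact mem_lang_cat.2 ⟨_, ihr hr c _ _ _ _ h1 h1', y', h2', by simp⟩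
    -- In the mixed cases `c` would be a symbol of both factors.
    · exact absurd rfl (hd c (mem_symbols_of_mem_lang h1 c (by simp)) c
        (mem_symbols_of_mem_lang h2' c (by simp)))
    · exact absurd rfl (hd c (mem_symbols_of_mem_lang h1' c (by simp)) c
        (mem_symbols_of_mem_lang h2 c (by simp)))
    · exact mem_lang_cat.2 ⟨_, h1, _, iht ht c _ _ _ _ h2 h2', by simp⟩
  | alt r t ihr iht =>
    intro c l₁ r₁ l₂ r₂ h h'
    rw [symbols, List.nodup_append] at hr
    obtain ⟨hr, ht, hd⟩ := hr
    rw [mem_lang_alt] at h h' ⊢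
    rcases h with h | h <;> rcases h' with h' | h'
    · exact Or.inl (ihr hr c _ _ _ _ h h')
    · exact absurd rfl (hd c (mem_symbols_of_mem_lang h c (by simp)) c
        (mem_symbols_of_mem_lang h' c (by simp)))
    · exact absurd rfl (hd c (mem_symbols_of_mem_lang h' c (by simp)) c
        (mem_symbols_of_mem_lang h c (by simp)))
    · exact Or.inr (iht ht c _ _ _ _ h h')
  | plus r ih =>
    intro c l₁ r₁ l₂ r₂ h h'
    obtain ⟨p, l, t, q, rfl, rfl, h1, h2, h3⟩ := exists_factor_of_mem_plus h
    obtain ⟨p', l', t', q', rfl, rfl, h1', h2', h3'⟩ := exists_factor_of_mem_plus h'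
    have := sandwich_mem_plus h2 (ih hr c _ _ _ _ h1 h1') h3'
    simpa using this

theorem symbols_mark_fst (r : RefExpr B) (i : ℕ) : (r.mark i).symbols.map Prod.fst = r.symbols := by
  induction r generalizing i <;> simp [mark, symbols, *]

theorem symbols_mark_snd (r : RefExpr B) (i : ℕ) :
    (r.mark i).symbols.map Prod.snd = List.range' i r.symbols.length := by
  induction r generalizing i <;> simp [mark, symbols, List.range'_append_1, *]

theorem nodup_symbols_mark (r : RefExpr B) (i : ℕ) : (r.mark i).symbols.Nodup := by
  apply List.Nodup.of_map Prod.snd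
  rw [symbols_mark_snd]
  exact List.nodup_range'

/-- Erasing marks is a letter-to-letter homomorphism, which commutes with all regular operations. It
carries statements about marked words over to ref-words and back. -/
theorem lang_mark (r : RefExpr B) (i : ℕ) : Language.map Prod.fst (r.mark i).lang = r.lang := by
  induction r generalizing i with
  | zero => exact Set.image_empty _
  | eps => exact (Set.image_singleton).trans rfl
  | sym b => exact (Set.image_singleton).trans rfl
  | cat r t hr ht => simp [mark, lang, hr, ht]
  | alt r t hr ht => simp [mark, lang, hr, ht]
  | plus r hr => simp [mark, lang, hr, Language.map_kstar]

theorem eq_of_mark_eq {r : RefExpr B} {i : ℕ} {c d : B × ℕ} (hc : c ∈ (r.mark i).symbols)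
    (hd : d ∈ (r.mark i).symbols) (h : c.2 = d.2) : c = d := by
  have : ((r.mark i).symbols.map Prod.snd).Nodup := by
    rw [symbols_mark_snd]; exact List.nodup_range'
  exact List.inj_on_of_nodup_map this hc hd h

end RefExpr

/-! ### Determinism in terms of the memory occurrence graph -/

namespace Regex

variable {A X : Type*}

theorem isLocal_markedLang (α : Regex A X) : RefExpr.IsLocal α.markedLang :=
  RefExpr.isLocal_lang (RefExpr.nodup_symbols_mark _ _)

theorem mem_symbols_of_mem_markedLang {α : Regex A X} {w : List (RefSym A X × ℕ)}
    (h : w ∈ α.markedLang) : ∀ c ∈ w, c ∈ α.marked.symbols :=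
  RefExpr.mem_symbols_of_mem_lang h

theorem Node.eq_of_mark_eq {α : Regex A X} {u v : α.Node} (h : u.1.2 = v.1.2) : u = v :=
  Subtype.ext (RefExpr.eq_of_mark_eq u.2.1 v.2.1 h)

@[simp]
theorem map_val_some {α : Regex A X} (v : α.Node) :
    (some v).map Subtype.val = some v.1 := rfl

@[simp]
theorem map_val_none {α : Regex A X} :
    (none : Option α.Node).map Subtype.val = none := rfl

/-- Two different nodes that a deterministic regex must not offer as alternatives. -/
def Clash {α : Regex A X} (v₁ v₂ : α.Node) : Prop :=
  v₁ ≠ v₂ ∧ ((∃ a, v₁.1.1 = RefSym.letter a ∧ v₂.1.1 = RefSym.letter a) ∨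
    ∃ x, v₁.1.1 = RefSym.var x)

/-- Some node has two edges that a deterministic regex must not have. -/
def Conflict (α : Regex A X) : Prop :=
  ∃ (u : Option α.Node) (ν₁ ν₂ : List (RefSym A X × ℕ)) (v₁ v₂ : Option α.Node),
    α.Edge u ν₁ v₁ ∧ α.Edge u ν₂ v₂ ∧
    ((v₁ = v₂ ∧ ν₁ ≠ ν₂) ∨ ∃ n₁ n₂, v₁ = some n₁ ∧ v₂ = some n₂ ∧ Clash n₁ n₂)

/-- Split off the longest suffix of brackets: what remains is empty or ends in a node, and this is
the source. -/
theorem exists_source (α : Regex A X) (r : List (RefSym A X × ℕ))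
    (hr : ∀ c ∈ r, c ∈ α.marked.symbols) :
    ∃ (u : Option α.Node) (l μ : List (RefSym A X × ℕ)), r = l ++ μ ∧ IsBracketWord μ ∧
      l.getLast? = u.map Subtype.val := by
  induction r using List.reverseRecOn with
  | nil => exact ⟨none, [], [], rfl, by simp [IsBracketWord], rfl⟩
  | append_singleton r c ih =>
    by_cases hc : c.1.IsBracket
    · obtain ⟨u, l, μ, rfl, hμ, hl⟩ := ih fun d hd => hr d (by simp at hd ⊢; tauto)
      refine ⟨u, l, μ ++ [c], by simp, ?_, hl⟩
      intro d hd
      rcases List.mem_append.1 hd with hd | hd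
      · exact hμ d hd
      · rw [List.mem_singleton.1 hd]; exact hc
    · exact ⟨some ⟨c, hr c (by simp), hc⟩, r ++ [c], [], by simp, by simp [IsBracketWord],
        List.getLast?_concat.trans rfl⟩

/-- The two edges may be witnessed by words with different pasts; locality at `u` replaces the past
of the second by that of the first. -/
theorem exists_common_prefix {α : Regex A X} {u : Option α.Node}
    {ν₁ ν₂ : List (RefSym A X × ℕ)} {v₁ v₂ : Option α.Node}
    (h₁ : α.Edge u ν₁ v₁) (h₂ : α.Edge u ν₂ v₂) :
    ∃ l s₁ s₂, l ++ ν₁ ++ s₁ ∈ α.markedLang ∧ l ++ ν₂ ++ s₂ ∈ α.markedLang ∧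
      s₁.head? = v₁.map Subtype.val ∧ s₂.head? = v₂.map Subtype.val := by
  obtain ⟨-, l₁, r₁, hm₁, hl₁, hr₁⟩ := h₁
  obtain ⟨-, l₂, r₂, hm₂, hl₂, hr₂⟩ := h₂
  cases u with
  | none =>
    obtain rfl : l₁ = [] := by simpa using hl₁
    obtain rfl : l₂ = [] := by simpa using hl₂
    exact ⟨[], r₁, r₂, hm₁, hm₂, hr₁, hr₂⟩
  | some u =>
    obtain ⟨l₁, rfl⟩ := List.getLast?_eq_some_iff.1 hl₁
    obtain ⟨l₂, rfl⟩ := List.getLast?_eq_some_iff.1 hl₂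
    refine ⟨l₁ ++ [u.1], r₁, r₂, hm₁, ?_, hr₁, hr₂⟩
    have := α.isLocal_markedLang u.1 l₁ (ν₁ ++ r₁) l₂ (ν₂ ++ r₂) (by simpa using hm₁)
      (by simpa using hm₂)
    simpa using this

/-- The trailing brackets `μ` of the common prefix are moved into both labels, which keeps different
labels different. Then the first two clauses are clashes, and the last two are different labels for
the same node or for the sink. Conversely, two edges with the same source can be read off from words
with a common prefix. -/
theorem notDeterministic_iff (α : Regex A X) : α.NotDeterministic ↔ α.Conflict := by
  constructor
  · rintro ⟨ρ₁, h₁, ρ₂, h₂, r, s₁, s₂, γ₁, γ₂, hγ₁, hγ₂, h⟩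
    have split : ∀ {w : List (RefSym A X × ℕ)}, r ++ w ∈ α.markedLang →
        ∃ (u : Option α.Node) (l μ : List (RefSym A X × ℕ)), r = l ++ μ ∧ IsBracketWord μ ∧
        l.getLast? = u.map Subtype.val := fun hw => α.exists_source r fun c hc =>
          mem_symbols_of_mem_markedLang hw c (by simp [hc])
    have node : ∀ {χ : RefSym A X} {i : ℕ} {w s : List (RefSym A X × ℕ)}, ¬ χ.IsBracket →
        w ++ [(χ, i)] ++ s ∈ α.markedLang → ∃ n : α.Node, n.1 = (χ, i) :=
      fun hχ hw => ⟨⟨_, mem_symbols_of_mem_markedLang hw _ (by simp), hχ⟩, rfl⟩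
    rcases h with ⟨a, i, j, hij, rfl, rfl⟩ | ⟨x, χ, i, j, hχ, hij, rfl, rfl⟩ |
      ⟨χ, i, hχ, hγ, rfl, rfl⟩ | ⟨hγ, rfl, rfl⟩
    · obtain ⟨n₁, hn₁⟩ := node (by simp [RefSym.IsBracket]) h₁
      obtain ⟨n₂, hn₂⟩ := node (by simp [RefSym.IsBracket]) h₂
      obtain ⟨u, l, μ, rfl, hμ, hl⟩ := split (by simpa using h₁)
      refine ⟨u, μ ++ γ₁, μ ++ γ₂, some n₁, some n₂,
        ⟨?_, l, (RefSym.letter a, i) :: s₁, by simpa using h₁, hl, by simp [hn₁]⟩,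
        ⟨?_, l, (RefSym.letter a, j) :: s₂, by simpa using h₂, hl, by simp [hn₂]⟩,
        Or.inr ⟨n₁, n₂, rfl, rfl, ?_, Or.inl ⟨a, by rw [hn₁], by rw [hn₂]⟩⟩⟩
      · exact fun c hc => (List.mem_append.1 hc).elim (hμ c) (hγ₁ c)
      · exact fun c hc => (List.mem_append.1 hc).elim (hμ c) (hγ₂ c)
      · rintro rfl
        rw [hn₁] at hn₂
        exact hij (congrArg Prod.snd hn₂)
    · obtain ⟨n₁, hn₁⟩ := node (by simp [RefSym.IsBracket]) h₁
      obtain ⟨n₂, hn₂⟩ := node hχ h₂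
      obtain ⟨u, l, μ, rfl, hμ, hl⟩ := split (by simpa using h₁)
      refine ⟨u, μ ++ γ₁, μ ++ γ₂, some n₁, some n₂,
        ⟨?_, l, (RefSym.var x, i) :: s₁, by simpa using h₁, hl, by simp [hn₁]⟩,
        ⟨?_, l, (χ, j) :: s₂, by simpa using h₂, hl, by simp [hn₂]⟩,
        Or.inr ⟨n₁, n₂, rfl, rfl, ?_, Or.inr ⟨x, by rw [hn₁]⟩⟩⟩
      · exact fun c hc => (List.mem_append.1 hc).elim (hμ c) (hγ₁ c)
      · exact fun c hc => (List.mem_append.1 hc).elim (hμ c) (hγ₂ c)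
      · rintro rfl
        rw [hn₁] at hn₂
        exact hij (congrArg Prod.snd hn₂)
    · obtain ⟨n₁, hn₁⟩ := node hχ h₁
      obtain ⟨u, l, μ, rfl, hμ, hl⟩ := split (by simpa using h₁)
      refine ⟨u, μ ++ γ₁, μ ++ γ₂, some n₁, some n₁,
        ⟨?_, l, (χ, i) :: s₁, by simpa using h₁, hl, by simp [hn₁]⟩,
        ⟨?_, l, (χ, i) :: s₂, by simpa using h₂, hl, by simp [hn₁]⟩,
        Or.inl ⟨rfl, by simpa using hγ⟩⟩
      · exact fun c hc => (List.mem_append.1 hc).elim (hμ c) (hγ₁ c)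
      · exact fun c hc => (List.mem_append.1 hc).elim (hμ c) (hγ₂ c)
    · obtain ⟨u, l, μ, rfl, hμ, hl⟩ := split h₁
      refine ⟨u, μ ++ γ₁, μ ++ γ₂, none, none,
        ⟨?_, l, [], by simpa using h₁, hl, by simp⟩,
        ⟨?_, l, [], by simpa using h₂, hl, by simp⟩, Or.inl ⟨rfl, by simpa using hγ⟩⟩
      · exact fun c hc => (List.mem_append.1 hc).elim (hμ c) (hγ₁ c)
      · exact fun c hc => (List.mem_append.1 hc).elim (hμ c) (hγ₂ c)
  · rintro ⟨u, ν₁, ν₂, v₁, v₂, h₁, h₂, h⟩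
    obtain ⟨l, s₁, s₂, hm₁, hm₂, hs₁, hs₂⟩ := exists_common_prefix h₁ h₂
    have tail : ∀ {s : List (RefSym A X × ℕ)} {n : α.Node},
        s.head? = (some n).map Subtype.val → ∃ t, s = (n.1.1, n.1.2) :: t := fun {s n} hs => by
      cases s with
      | nil => simp at hs
      | cons c t => exact ⟨t, by simpa using hs⟩
    refine ⟨_, hm₁, _, hm₂, l, ?_⟩
    rcases h with ⟨rfl, hν⟩ | ⟨n₁, n₂, rfl, rfl, hn, h⟩
    · cases v₁ with
      | none =>
        obtain rfl : s₁ = [] := by simpa using hs₁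
        obtain rfl : s₂ = [] := by simpa using hs₂
        exact ⟨[], [], ν₁, ν₂, h₁.1, h₂.1, Or.inr (Or.inr (Or.inr ⟨hν, by simp, by simp⟩))⟩
      | some n =>
        obtain ⟨t₁, rfl⟩ := tail hs₁
        obtain ⟨t₂, rfl⟩ := tail hs₂
        exact ⟨t₁, t₂, ν₁, ν₂, h₁.1, h₂.1,
          Or.inr (Or.inr (Or.inl ⟨n.1.1, n.1.2, n.2.2, hν, by simp, by simp⟩))⟩
    · obtain ⟨t₁, rfl⟩ := tail hs₁
      obtain ⟨t₂, rfl⟩ := tail hs₂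
      have hij : n₁.1.2 ≠ n₂.1.2 := fun hij => hn (Node.eq_of_mark_eq hij)
      rcases h with ⟨a, ha₁, ha₂⟩ | ⟨x, hx⟩
      · exact ⟨t₁, t₂, ν₁, ν₂, h₁.1, h₂.1, Or.inl ⟨a, n₁.1.2, n₂.1.2, hij,
          by simp [ha₁], by simp [ha₂]⟩⟩
      · exact ⟨t₁, t₂, ν₁, ν₂, h₁.1, h₂.1, Or.inr (Or.inl ⟨x, n₂.1.1, n₁.1.2, n₂.1.2, n₂.2.2, hij,
          by simp [hx], by simp⟩)⟩

/-! ### States, and determinism of the Glushkov automaton -/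

theorem length_filter_symbols (α : Regex A X) [DecidablePred (RefSym.IsBracket (A := A) (X := X))] :
    (α.toRef.symbols.filter fun c => ¬ c.IsBracket).length = α.occ := by
  induction α <;> simp_all [toRef, RefExpr.symbols, occ, RefSym.IsBracket]

theorem card_node (α : Regex A X) : Nat.card α.Node = α.occ := by
  classical
  have e : α.Node ≃ {c // c ∈ α.marked.symbols.filter fun c => ¬ c.1.IsBracket} :=
    Equiv.subtypeEquivRight fun c => by simp
  have hnd : (α.marked.symbols.filter fun c => ¬ c.1.IsBracket).Nodup :=
    (RefExpr.nodup_symbols_mark _ _).filter _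
  rw [Nat.card_congr (e.trans (List.Nodup.getEquiv _ hnd).symm), Nat.card_fin,
    ← length_filter_symbols, ← RefExpr.symbols_mark_fst α.toRef 1, List.filter_map,
    List.length_map]
  rfl

theorem card_gState (α : Regex A X) : Nat.card α.GState = α.occ + 2 := by
  have e : α.GState ≃ Option (Option α.Node) :=
    { toFun := fun q => match q with
        | GState.trap => none
        | GState.init => some none
        | GState.node u => some (some u)
      invFun := fun o => match o with
        | none => GState.trap
        | some none => GState.init
        | some (some u) => GState.node u
      left_inv := by rintro (_ | _ | u) <;> rfl
      right_inv := by rintro (_ | _ | u) <;> rfl }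
  have hS := α.finite_gState
  have : Finite (Option (Option α.Node)) := Finite.of_equiv _ e
  have h1 : Finite (Option α.Node) := Finite.of_injective _ (Option.some_injective _)
  have h2 : Finite α.Node := Finite.of_injective _ (Option.some_injective _)
  rw [Nat.card_congr e, Finite.card_option, Finite.card_option, card_node]

theorem glushkov_epsFree (α : Regex A X) : α.glushkov.EpsFree := by
  have h : ∀ u, α.edgeTransitions u TransLabel.eps = ∅ := fun u =>
    Set.eq_empty_of_forall_notMem <| by
      rintro t ⟨v, ν, -, -, ⟨a, -, h, -⟩ | ⟨x, -, -, h, -⟩ | ⟨x, -, -, h, -⟩⟩ <;> cases h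
  rintro (_ | _ | u) hq
  · exact absurd rfl hq
  · show α.edgeTransitions none _ ∪ α.ambiguityTransitions _ = ∅
    rw [h, Set.empty_union]
    exact Set.eq_empty_of_forall_notMem (by rintro t ⟨-, h, -⟩; cases h)
  · exact h _

theorem glushkov_rejectingTrap (α : Regex A X) : α.glushkov.RejectingTrap := fun h => h

/-- The state of a source node. -/
def srcState {α : Regex A X} : Option α.Node → α.GState
  | none => GState.init
  | some u => GState.node u

theorem edgeTransitions_subset (α : Regex A X) (u : Option α.Node) (b : TransLabel A α.GMem) :
    α.edgeTransitions u b ⊆ α.glushkov.δ (srcState u) b := by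
  cases u with
  | none => exact Set.subset_union_left
  | some u => exact subset_rfl

theorem mem_var_of_mem_symbols {α : Regex A X} {x : X} :
    (RefSym.op x ∈ α.toRef.symbols ∨ RefSym.cl x ∈ α.toRef.symbols ∨
      RefSym.var x ∈ α.toRef.symbols) → x ∈ α.var := by
  induction α <;> simp_all [toRef, RefExpr.symbols, var] <;> tauto

theorem Node.mem_symbols {α : Regex A X} (v : α.Node) : v.1.1 ∈ α.toRef.symbols := by
  rw [← RefExpr.symbols_mark_fst _ 1]
  exact List.mem_map_of_mem v.2.1

theorem exists_isEdgeTransition {α : Regex A X} (ν : List (RefSym A X × ℕ)) (v : α.Node) :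
    ∃ b s, α.IsEdgeTransition ν v b s := by
  rcases hv : v.1.1 with a | x | x | x
  · exact ⟨_, _, Or.inl ⟨a, hv, rfl, rfl⟩⟩
  · have hx : x ∈ α.var := mem_var_of_mem_symbols (Or.inr (Or.inr (hv ▸ v.mem_symbols)))
    by_cases h : α.edgeInstr ν (some ⟨x, hx⟩) = MemInstr.rst
    · exact ⟨_, _, Or.inr (Or.inr ⟨⟨x, hx⟩, hv, h, rfl, rfl⟩)⟩
    · exact ⟨_, _, Or.inr (Or.inl ⟨⟨x, hx⟩, hv, h, rfl, rfl⟩)⟩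
  · exact absurd (by rw [hv]; trivial) v.2.2
  · exact absurd (by rw [hv]; trivial) v.2.2

theorem IsEdgeTransition.label_recall {α : Regex A X} {ν : List (RefSym A X × ℕ)} {v : α.Node}
    {b : TransLabel A α.GMem} {s : α.GMem → MemInstr} (h : α.IsEdgeTransition ν v b s) {x : X}
    (hx : v.1.1 = RefSym.var x) : ∃ i, b = TransLabel.recall i := by
  rcases h with ⟨a, ha, -⟩ | ⟨x, -, -, hb, -⟩ | ⟨x, -, -, hb, -⟩
  · rw [ha] at hx; cases hx
  · exact ⟨_, hb⟩
  · exact ⟨_, hb⟩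

theorem IsEdgeTransition.eq_var {α : Regex A X} {ν : List (RefSym A X × ℕ)} {v : α.Node}
    {i : α.GMem} {s : α.GMem → MemInstr} (h : α.IsEdgeTransition ν v (TransLabel.recall i) s) :
    ∃ x, v.1.1 = RefSym.var x := by
  rcases h with ⟨a, -, hb, -⟩ | ⟨x, hx, -⟩ | ⟨x, hx, -⟩
  · cases hb
  · exact ⟨_, hx⟩
  · exact ⟨_, hx⟩

theorem IsEdgeTransition.eq_letter {α : Regex A X} {ν : List (RefSym A X × ℕ)} {v : α.Node}
    {a : A} {s : α.GMem → MemInstr} (h : α.IsEdgeTransition ν v (TransLabel.letter a) s) :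
    v.1.1 = RefSym.letter a := by
  rcases h with ⟨b, hv, hb, -⟩ | ⟨x, -, -, hb, -⟩ | ⟨x, -, -, hb, -⟩
  · cases hb; exact hv
  · cases hb
  · cases hb

theorem IsEdgeTransition.unique {α : Regex A X} {ν : List (RefSym A X × ℕ)} {v : α.Node}
    {b b' : TransLabel A α.GMem} {s s' : α.GMem → MemInstr} (h : α.IsEdgeTransition ν v b s)
    (h' : α.IsEdgeTransition ν v b' s') : b = b' ∧ s = s' := by
  rcases h with ⟨a, ha, rfl, rfl⟩ | ⟨x, hx, hn, rfl, rfl⟩ | ⟨x, hx, hn, rfl, rfl⟩ <;>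
  rcases h' with ⟨a', ha', rfl, rfl⟩ | ⟨x', hx', hn', rfl, rfl⟩ | ⟨x', hx', hn', rfl, rfl⟩
  · rw [ha] at ha'; cases ha'; exact ⟨rfl, rfl⟩
  · rw [ha] at hx'; cases hx'
  · rw [ha] at hx'; cases hx'
  · rw [hx] at ha'; cases ha'
  · rw [hx] at hx'; obtain rfl : x = x' := Subtype.ext (by simpa using hx'); exact ⟨rfl, rfl⟩
  · rw [hx] at hx'; obtain rfl : x = x' := Subtype.ext (by simpa using hx'); exact absurd hn' hn
  · rw [hx] at ha'; cases ha'
  · rw [hx] at hx'; obtain rfl : x = x' := Subtype.ext (by simpa using hx'); exact absurd hn hn'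
  · exact ⟨rfl, rfl⟩

theorem HiddenAmbiguity.conflict {α : Regex A X} (h : α.HiddenAmbiguity) : α.Conflict := by
  obtain ⟨u, ν₁, ν₂, hν, ⟨h₁, h₂⟩ | ⟨v, b, s, h₁, h₂, -⟩⟩ := h
  · exact ⟨u, ν₁, ν₂, none, none, h₁, h₂, Or.inl ⟨rfl, hν⟩⟩
  · exact ⟨u, ν₁, ν₂, some v, some v, h₁, h₂, Or.inl ⟨rfl, hν⟩⟩

theorem Edge.exists_var {α : Regex A X} {u v : Option α.Node} {ν : List (RefSym A X × ℕ)}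
    (h : α.Edge u ν v) (hν : ν ≠ []) : Nonempty α.var := by
  obtain ⟨c, ν, rfl⟩ := List.exists_cons_of_ne_nil hν
  obtain ⟨hb, l, r, hm, -⟩ := h
  have hc := hb c (by simp)
  have hs : c.1 ∈ α.toRef.symbols := by
    rw [← RefExpr.symbols_mark_fst _ 1]
    exact List.mem_map_of_mem (mem_symbols_of_mem_markedLang hm c (by simp))
  rcases hc' : c.1 with a | x | x | x
  · rw [hc'] at hc; exact hc.elim
  · rw [hc'] at hc; exact hc.elim
  · exact ⟨x, mem_var_of_mem_symbols (Or.inl (hc' ▸ hs))⟩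
  · exact ⟨x, mem_var_of_mem_symbols (Or.inr (Or.inl (hc' ▸ hs)))⟩

/-- Of two different labels one is nonempty, so it contains a bracket. Without any variable the two
ambiguity transitions would coincide and would not destroy determinism. -/
theorem HiddenAmbiguity.exists_var {α : Regex A X} (h : α.HiddenAmbiguity) : Nonempty α.var := by
  obtain ⟨u, ν₁, ν₂, hν, h⟩ := h
  have : ∃ v w, α.Edge u ν₁ v ∧ α.Edge u ν₂ w := by
    rcases h with ⟨h₁, h₂⟩ | ⟨v, b, s, h₁, h₂, -⟩
    · exact ⟨_, _, h₁, h₂⟩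
    · exact ⟨_, _, h₁, h₂⟩
  obtain ⟨v, w, h₁, h₂⟩ := this
  by_cases h : ν₁ = []
  · exact h₂.exists_var fun h' => hν (h.trans h'.symm)
  · exact h₁.exists_var h

theorem HiddenAmbiguity.not_deterministic {α : Regex A X} (h : α.HiddenAmbiguity) :
    ¬ α.glushkov.Deterministic := by
  intro hd
  obtain ⟨x⟩ := h.exists_var
  have key : ∀ e : MemInstr, e = MemInstr.unch ∨ e = MemInstr.cls →
      (GState.trap, (fun o => match o with
        | none => MemInstr.cls
        | some _ => e : α.GMem → MemInstr)) ∈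
        α.glushkov.δ GState.init (TransLabel.recall none) := fun e he =>
    Or.inr ⟨h, rfl, rfl, rfl, he.imp (fun he _ => he) (fun he _ => he)⟩
  have := hd.1 GState.init (TransLabel.recall none) (key _ (Or.inl rfl)) (key _ (Or.inr rfl))
  have := congrFun (congrArg Prod.snd this) (some x)
  cases this

/-- A clash repeats a letter or puts a recall beside another transition. Two labels for one node
give distinguishable transitions, which violates determinism directly, or indistinguishable ones,
and then the ambiguity transitions violate it, as they do for two edges to the sink. -/
theorem Conflict.not_deterministic {α : Regex A X} (h : α.Conflict) :
    ¬ α.glushkov.Deterministic := by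
  obtain ⟨u, ν₁, ν₂, v₁, v₂, h₁, h₂, h⟩ := h
  intro hd
  have htrap : srcState u ≠ α.glushkov.trap := by cases u <;> exact fun h => by cases h
  have same : ∀ {b s s'} {n₁ n₂ : α.Node}, v₁ = some n₁ → v₂ = some n₂ →
      α.IsEdgeTransition ν₁ n₁ b s → α.IsEdgeTransition ν₂ n₂ b s' → n₁ = n₂ ∧ s = s' := by
    rintro b s s' n₁ n₂ rfl rfl t₁ t₂
    have := hd.1 (srcState u) b
      (α.edgeTransitions_subset u b (a := (GState.node n₁, s)) ⟨n₁, ν₁, rfl, h₁, t₁⟩)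
      (α.edgeTransitions_subset u b (a := (GState.node n₂, s')) ⟨n₂, ν₂, rfl, h₂, t₂⟩)
    simpa using this
  -- A reference as first target gives a recall transition, beside which the second clause of
  -- determinism tolerates no other label.
  have labels : ∀ {b b' s s'} {n₁ n₂ : α.Node} {x : X}, v₁ = some n₁ → v₂ = some n₂ →
      n₁.1.1 = RefSym.var x →
      α.IsEdgeTransition ν₁ n₁ b s → α.IsEdgeTransition ν₂ n₂ b' s' → b' = b := by
    rintro b b' s s' n₁ n₂ x rfl rfl hx t₁ t₂
    by_contra hb
    have hne : (α.glushkov.δ (srcState u) b).Nonempty :=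
      ⟨_, α.edgeTransitions_subset u b (a := (GState.node n₁, s)) ⟨n₁, ν₁, rfl, h₁, t₁⟩⟩
    have := hd.2 _ htrap b (Or.inr (t₁.label_recall hx)) hne b' hb
    have h' := α.edgeTransitions_subset u b' (a := (GState.node n₂, s')) ⟨n₂, ν₂, rfl, h₂, t₂⟩
    rw [this] at h'
    exact h'
  rcases h with ⟨rfl, hν⟩ | ⟨n₁, n₂, rfl, rfl, hn, h⟩
  · cases v₁ with
    | none => exact HiddenAmbiguity.not_deterministic ⟨u, ν₁, ν₂, hν, Or.inl ⟨h₁, h₂⟩⟩ hd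
    | some n =>
      obtain ⟨b, s, t₁⟩ := exists_isEdgeTransition ν₁ n
      obtain ⟨b', s', t₂⟩ := exists_isEdgeTransition ν₂ n
      have hb : b' = b := by
        rcases hv : n.1.1 with a | x | x | x
        · rcases t₁ with ⟨a₁, ha₁, rfl, -⟩ | ⟨x, hx, -⟩ | ⟨x, hx, -⟩
          · rcases t₂ with ⟨a₂, ha₂, rfl, -⟩ | ⟨x, hx, -⟩ | ⟨x, hx, -⟩
            · rw [ha₁] at ha₂; cases ha₂; rfl
            · rw [hv] at hx; cases hx
            · rw [hv] at hx; cases hx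
          · rw [hv] at hx; cases hx
          · rw [hv] at hx; cases hx
        · exact labels rfl rfl hv t₁ t₂
        · exact absurd (by rw [hv]; trivial) n.2.2
        · exact absurd (by rw [hv]; trivial) n.2.2
      subst hb
      -- Determinism makes the two transitions equal although their labels differ: this is a hidden
      -- ambiguity.
      obtain ⟨-, rfl⟩ := same rfl rfl t₁ t₂
      exact HiddenAmbiguity.not_deterministic ⟨u, ν₁, ν₂, hν, Or.inr ⟨n, _, _, h₁, h₂, t₁, t₂⟩⟩ hd
  · obtain ⟨b, s, t₁⟩ := exists_isEdgeTransition ν₁ n₁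
    obtain ⟨b', s', t₂⟩ := exists_isEdgeTransition ν₂ n₂
    have hb : b' = b := by
      rcases h with ⟨a, ha₁, ha₂⟩ | ⟨x, hx⟩
      · rcases t₁ with ⟨a₁, ha₁', rfl, -⟩ | ⟨x, hx, -⟩ | ⟨x, hx, -⟩
        · rcases t₂ with ⟨a₂, ha₂', rfl, -⟩ | ⟨x, hx, -⟩ | ⟨x, hx, -⟩
          · rw [ha₁] at ha₁'; rw [ha₂] at ha₂'; cases ha₁'; cases ha₂'; rfl
          · rw [ha₂] at hx; cases hx
          · rw [ha₂] at hx; cases hx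
        · rw [ha₁] at hx; cases hx
        · rw [ha₁] at hx; cases hx
      · exact labels rfl rfl hx t₁ t₂
    subst hb
    exact hn (same rfl rfl t₁ t₂).1

/-- The ambiguity transitions exist only under a hidden ambiguity, which is a conflict. -/
theorem glushkov_δ_subset_of_not_conflict {α : Regex A X} (h : ¬ α.Conflict)
    (u : Option α.Node) (b : TransLabel A α.GMem) :
    α.glushkov.δ (srcState u) b = α.edgeTransitions u b := by
  refine Set.Subset.antisymm ?_ (α.edgeTransitions_subset u b)
  cases u with
  | none =>
    rintro t (ht | ht)
    · exact ht
    · exact absurd ht.1.conflict h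
  | some u => exact subset_rfl

theorem exists_srcState_eq {α : Regex A X} {q : α.GState} (hq : q ≠ GState.trap) :
    ∃ u : Option α.Node, q = srcState u := by
  rcases q with _ | _ | u
  · exact absurd rfl hq
  · exact ⟨none, rfl⟩
  · exact ⟨some u, rfl⟩

/-- Outside the trap, every transition now comes from an edge, and an edge determines its
transition. Two transitions with the same label, or a recall beside another transition, come from
two edges with clashing targets or with different labels for one target. -/
theorem glushkov_deterministic_of_not_conflict {α : Regex A X} (h : ¬ α.Conflict) :
    α.glushkov.Deterministic := by
  constructor
  · intro q b
    by_cases hq : q = GState.trap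
    · subst hq
      cases b
      · exact Set.subsingleton_singleton
      · exact Set.subsingleton_singleton
      · exact Set.subsingleton_empty
    obtain ⟨u, rfl⟩ := exists_srcState_eq hq
    rw [glushkov_δ_subset_of_not_conflict h]
    rintro ⟨p₁, s₁⟩ ⟨v₁, ν₁, rfl, h₁, t₁⟩ ⟨p₂, s₂⟩ ⟨v₂, ν₂, rfl, h₂, t₂⟩
    have hv : v₁ = v₂ := by
      by_contra hv
      refine h ⟨u, ν₁, ν₂, some v₁, some v₂, h₁, h₂, Or.inr ⟨v₁, v₂, rfl, rfl, hv, ?_⟩⟩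
      rcases b with a | _ | i
      · exact Or.inl ⟨a, t₁.eq_letter, t₂.eq_letter⟩
      · rcases t₁ with ⟨_, _, hb, -⟩ | ⟨_, _, _, hb, -⟩ | ⟨_, _, _, hb, -⟩ <;> cases hb
      · exact Or.inr t₁.eq_var
    subst hv
    have hν : ν₁ = ν₂ := by
      by_contra hν
      exact h ⟨u, ν₁, ν₂, some v₁, some v₁, h₁, h₂, Or.inl ⟨rfl, hν⟩⟩
    subst hν
    exact congrArg _ (t₁.unique t₂).2
  · intro q hq b hb hne b' hb'
    obtain ⟨u, rfl⟩ := exists_srcState_eq hq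
    rw [glushkov_δ_subset_of_not_conflict h] at hne ⊢
    obtain ⟨t, v₁, ν₁, -, h₁, t₁⟩ := hne
    refine Set.eq_empty_of_forall_notMem ?_
    rintro t' ⟨v₂, ν₂, -, h₂, t₂⟩
    obtain ⟨x, hx⟩ : ∃ x, v₁.1.1 = RefSym.var x := by
      rcases hb with rfl | ⟨i, rfl⟩
      · rcases t₁ with ⟨_, _, hb, -⟩ | ⟨_, _, _, hb, -⟩ | ⟨_, _, _, hb, -⟩ <;> cases hb
      · exact t₁.eq_var
    have hv : v₁ = v₂ := by
      by_contra hv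
      exact h ⟨u, ν₁, ν₂, some v₁, some v₂, h₁, h₂,
        Or.inr ⟨v₁, v₂, rfl, rfl, hv, Or.inr ⟨x, hx⟩⟩⟩
    subst hv
    have hν : ν₁ = ν₂ := by
      by_contra hν
      exact h ⟨u, ν₁, ν₂, some v₁, some v₁, h₁, h₂, Or.inl ⟨rfl, hν⟩⟩
    subst hν
    exact hb' (t₂.unique t₁).1

theorem deterministic_iff_not_conflict (α : Regex A X) : α.Deterministic ↔ ¬ α.Conflict :=
  not_congr α.notDeterministic_iff

theorem glushkov_deterministic_iff (α : Regex A X) :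
    α.glushkov.Deterministic ↔ α.Deterministic := by
  rw [deterministic_iff_not_conflict]
  exact ⟨fun hd h => h.not_deterministic hd, glushkov_deterministic_of_not_conflict⟩

end Regex

/-! ### Brackets and memories -/

section Memories

variable {A X : Type*}

open scoped Classical in
/-- Follow the brackets of the variable `x` along a ref-word, starting with the given status (open
or not): `none` if a bracket or a reference is at a wrong place. -/
noncomputable def track (x : X) : Bool → List (RefSym A X) → Option Bool
  | b, [] => some b
  | b, c :: w =>
    if c = RefSym.op x then (if b then none else track x true w)
    else if c = RefSym.cl x then (if b then track x false w else none)
    else if c = RefSym.var x then (if b then none else track x b w)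
    else track x b w

theorem track_append (x : X) (v w : List (RefSym A X)) (b : Bool) :
    track x b (v ++ w) = (track x b v).bind fun b' => track x b' w := by
  induction v generalizing b with
  | nil => rfl
  | cons c v ih =>
    simp only [List.cons_append, track]
    split_ifs <;> simp [ih]

theorem track_eq_of_forall {x : X} {w : List (RefSym A X)} (b : Bool)
    (h : ∀ c ∈ w, c ≠ RefSym.op x ∧ c ≠ RefSym.cl x ∧ c ≠ RefSym.var x) :
    track x b w = some b := by
  induction w with
  | nil => rfl
  | cons c w ih =>
    obtain ⟨h1, h2, h3⟩ := h c (by simp)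
    simp only [track, if_neg h1, if_neg h2, if_neg h3]
    exact ih fun d hd => h d (by simp [hd])

/-- Every subexpression starts and ends with `x` closed. Only a binding of `x` itself opens it, and
well-formedness bans `x` from its body, so that the body cannot disturb the open status. -/
theorem Regex.track_refLang {α : Regex A X} (hα : α.WellFormed) (x : X) {w : List (RefSym A X)}
    (hw : w ∈ α.refLang) : track x false w = some false := by
  induction α generalizing w with
  | empty => exact absurd hw RefExpr.not_mem_lang_zero
  | eps => obtain rfl : w = [] := hw; rfl
  | sym a => obtain rfl : w = [_] := hw; simp [track]
  | ref y => obtain rfl : w = [_] := hw; simp [track]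
  | cat β γ hβ hγ =>
    obtain ⟨a, ha, b, hb, rfl⟩ := RefExpr.mem_lang_cat.1 hw
    rw [track_append, hβ hα.1 ha]
    exact hγ hα.2 hb
  | alt β γ hβ hγ =>
    exact (RefExpr.mem_lang_alt.1 hw).elim (hβ hα.1) (hγ hα.2)
  | plus β hβ =>
    obtain ⟨S, -, rfl, hS⟩ := RefExpr.mem_lang_plus.1 hw
    clear hw
    induction S with
    | nil => rfl
    | cons y S ih =>
      rw [List.flatten_cons, track_append, hβ hα (hS y (by simp))]
      exact ih fun z hz => hS z (by simp [hz])
  | bind y β hβ =>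
    obtain ⟨a, rfl, b, hb, rfl⟩ := RefExpr.mem_lang_cat.1 hw
    obtain ⟨v, hv, c, rfl, rfl⟩ := RefExpr.mem_lang_cat.1 hb
    by_cases hxy : y = x
    · subst hxy
      have : track y true v = some true := by
        refine track_eq_of_forall _ fun c hc => ?_
        have := RefExpr.mem_symbols_of_mem_lang hv c hc
        refine ⟨?_, ?_, ?_⟩ <;> rintro rfl <;> exact hα.2 (mem_var_of_mem_symbols (by tauto))
      simp [track, track_append, this]
    · simp [track, track_append, hβ hα.1 hv, hxy]

open scoped Classical in
/-- The content and the status of the memory `x` after a word without variable references. -/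
noncomputable def memRun (x : X) : List A × Bool → List (RefSym A X) → List A × Bool
  | m, [] => m
  | m, c :: w => memRun x (match c with
    | RefSym.letter a => (if m.2 then m.1 ++ [a] else m.1, m.2)
    | RefSym.var _ => m
    | RefSym.op y => if y = x then ([], true) else m
    | RefSym.cl y => if y = x then (m.1, false) else m) w

theorem memRun_append (x : X) (m : List A × Bool) (v w : List (RefSym A X)) :
    memRun x m (v ++ w) = memRun x (memRun x m v) w := by
  induction v generalizing m with
  | nil => rfl
  | cons c v ih => simp only [List.cons_append, memRun, ih]

theorem memRun_letters (x : X) (m : List A × Bool) (v : List A) :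
    memRun x m (v.map RefSym.letter) = (if m.2 then m.1 ++ v else m.1, m.2) := by
  induction v generalizing m with
  | nil => simp [memRun]
  | cons a v ih =>
    rw [List.map_cons, memRun, ih]
    rcases m with ⟨u, _ | _⟩ <;> simp

open scoped Classical in
theorem lastBinding_append_singleton (x : X) (w : List (RefSym A X)) (c : RefSym A X)
    (hc : c ≠ RefSym.cl x) : lastBinding x (w ++ [c]) = lastBinding x w := by
  simp [lastBinding, hc]

open scoped Classical in
theorem lastBinding_close (x : X) (p q : List (RefSym A X)) (hq : RefSym.op x ∉ q) :
    lastBinding x (p ++ RefSym.op x :: q ++ [RefSym.cl x]) = q := by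
  have : (q.reverse ++ RefSym.op x :: p.reverse).takeWhile
      (fun c => decide (c ≠ RefSym.op x)) = q.reverse := by
    rw [List.takeWhile_append_of_pos]
    · simp
    · intro c hc
      simp only [ne_eq, decide_not, Bool.not_eq_eq_eq_not, Bool.not_true, decide_eq_false_iff_not]
      rintro rfl
      exact hq (by simpa using hc)
  simp only [ne_eq, decide_not] at this
  simp [lastBinding, this]

theorem terminals_append (v w : List (RefSym A X)) :
    terminals (v ++ w) = terminals v ++ terminals w := List.filterMap_append

theorem terminals_letters (v : List A) :
    terminals (v.map (RefSym.letter : A → RefSym A X)) = v := by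
  simp [terminals, List.filterMap_map]

/-- Induction on prefixes. While `x` is open, the memory collects the terminals behind the last `op
x`; the third claim keeps this splitting. The next `cl x` turns exactly this factor into the last
binding, and only a further `cl x` can change it. -/
theorem memRun_spec (x : X) (w : List (RefSym A X)) (b : Bool)
    (h : track x false w = some b) :
    (memRun x ([], false) w).2 = b ∧
    (b = false → terminals (lastBinding x w) = (memRun x ([], false) w).1) ∧
    (b = true → ∃ p q, w = p ++ RefSym.op x :: q ∧ RefSym.op x ∉ q ∧
      terminals q = (memRun x ([], false) w).1) := by
  induction w using List.reverseRecOn generalizing b with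
  | nil =>
    obtain rfl : false = b := by simpa [track] using h
    simp [memRun, lastBinding, terminals]
  | append_singleton w c ih =>
    rw [track_append] at h
    obtain ⟨b', hb', h⟩ := Option.bind_eq_some_iff.1 h
    obtain ⟨h1, h2, h3⟩ := ih b' hb'
    rw [memRun_append]
    rcases c with a | y | y | y
    · obtain rfl : b' = b := by simpa [track] using h
      rw [lastBinding_append_singleton _ _ _ (by simp)]
      refine ⟨by simp [memRun, h1], fun hb => ?_, fun hb => ?_⟩
      · subst hb
        rw [h2 rfl]
        simp [memRun, h1]
      · subst hb
        obtain ⟨p, q, rfl, hq, hq'⟩ := h3 rfl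
        exact ⟨p, q ++ [RefSym.letter a], by simp, by simpa using hq, by
          rw [terminals_append, hq']; simp [memRun, h1, terminals]⟩
    · obtain rfl : b' = b := by
        by_cases hyx : y = x
        · subst hyx
          cases b' <;> simp [track] at h ⊢; exact h
        · simpa [track, hyx] using h
      rw [lastBinding_append_singleton _ _ _ (by simp)]
      refine ⟨h1, h2, fun hb => ?_⟩
      obtain ⟨p, q, rfl, hq, hq'⟩ := h3 hb
      refine ⟨p, q ++ [RefSym.var y], by simp, by simpa using hq, ?_⟩
      rw [terminals_append, hq']
      simp [memRun, terminals]
    · rw [lastBinding_append_singleton _ _ _ (by simp)]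
      by_cases hyx : y = x
      · subst hyx
        obtain rfl : true = b := by cases b' <;> simp [track] at h; exact h.symm
        refine ⟨by simp [memRun], by simp, fun _ => ⟨w, [], by simp, by simp, ?_⟩⟩
        simp [memRun, terminals]
      · obtain rfl : b' = b := by simpa [track, hyx] using h
        have : memRun x (memRun x ([], false) w) [RefSym.op y] = memRun x ([], false) w := by
          simp [memRun, hyx]
        rw [this]
        refine ⟨h1, h2, fun hb => ?_⟩
        obtain ⟨p, q, rfl, hq, hq'⟩ := h3 hb
        refine ⟨p, q ++ [RefSym.op y], by simp, by simp [hq, Ne.symm hyx], ?_⟩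
        rw [terminals_append, hq']
        simp [terminals]
    · by_cases hyx : y = x
      · subst hyx
        obtain ⟨rfl, rfl⟩ : b' = true ∧ false = b := by
          cases b' <;> simp [track] at h
          exact ⟨rfl, h.symm⟩
        obtain ⟨p, q, rfl, hq, hq'⟩ := h3 rfl
        refine ⟨by simp [memRun], fun _ => ?_, by simp⟩
        rw [lastBinding_close _ _ _ hq, hq']
        simp [memRun]
      · obtain rfl : b' = b := by simpa [track, hyx] using h
        have : memRun x (memRun x ([], false) w) [RefSym.cl y] = memRun x ([], false) w := by
          simp [memRun, hyx]
        rw [this, lastBinding_append_singleton _ _ _ (by simp [hyx])]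
        refine ⟨h1, h2, fun hb => ?_⟩
        obtain ⟨p, q, rfl, hq, hq'⟩ := h3 hb
        refine ⟨p, q ++ [RefSym.cl y], by simp, by simp [hq], ?_⟩
        rw [terminals_append, hq']
        simp [terminals]

/-- What a terminal or a variable reference contributes to the dereference, after `w`. -/
noncomputable def symValue (w : List (RefSym A X)) : RefSym A X → List A
  | RefSym.letter a => [a]
  | RefSym.var x => terminals (lastBinding x w)
  | RefSym.op _ => []
  | RefSym.cl _ => []

theorem resolve_append (w r s : List (RefSym A X)) :
    resolve w (r ++ s) = resolve (resolve w r) s := by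
  induction r generalizing w with
  | nil => rfl
  | cons c r ih => rcases c with a | x | x | x <;> simp only [List.cons_append, resolve, ih]

theorem resolve_singleton (w : List (RefSym A X)) {c : RefSym A X} (hc : ¬ c.IsBracket) :
    resolve w [c] = w ++ (symValue w c).map RefSym.letter := by
  rcases c with a | x | x | x
  · rfl
  · rfl
  · exact absurd trivial hc
  · exact absurd trivial hc

theorem resolve_brackets (w ν : List (RefSym A X)) (hν : ∀ c ∈ ν, c.IsBracket) :
    resolve w ν = w ++ ν := by
  induction ν generalizing w with
  | nil => simp [resolve]
  | cons c ν ih =>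
    have := hν c (by simp)
    have ih := fun w => ih w fun d hd => hν d (by simp [hd])
    rcases c with a | x | x | x
    · exact this.elim
    · exact this.elim
    · rw [resolve, ih]; simp
    · rw [resolve, ih]; simp

theorem track_letters (x : X) (b : Bool) (v : List A) :
    track x b (v.map RefSym.letter) = some b :=
  track_eq_of_forall b (by simp)

/-- A reference is replaced by terminals, which do not affect the status, and where it is admitted
it leaves the status unchanged itself. -/
theorem track_resolve (x : X) (r : List (RefSym A X)) (b : Bool)
    (h : track x false r = some b) : track x false (resolve [] r) = some b := by
  induction r using List.reverseRecOn generalizing b with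
  | nil => simpa [resolve] using h
  | append_singleton r c ih =>
    rw [track_append] at h
    obtain ⟨b', hb', h⟩ := Option.bind_eq_some_iff.1 h
    have ih := ih b' hb'
    rw [resolve_append]
    by_cases hc : c.IsBracket
    · rw [resolve_brackets _ _ (by simpa using hc), track_append, ih]
      exact h
    · rw [resolve_singleton _ hc, track_append, ih, Option.bind_some, track_letters]
      rcases c with a | y | y | y
      · simpa [track] using h
      · by_cases hyx : y = x
        · subst hyx
          cases b' <;> simp [track] at h ⊢; exact h
        · simpa [track, hyx] using h
      · exact absurd trivial hc
      · exact absurd trivial hc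

open scoped Classical in
theorem netAction_append_singleton (x : X) (ν : List (RefSym A X)) (c : RefSym A X) :
    netAction (ν ++ [c]) x = if c = RefSym.op x then MemInstr.opn
      else if c = RefSym.cl x then (if RefSym.op x ∈ ν then MemInstr.rst else MemInstr.cls)
      else netAction ν x := by
  by_cases h1 : c = RefSym.op x
  · subst h1; simp [netAction]
  · by_cases h2 : c = RefSym.cl x
    · subst h2; simp [netAction]
    · simp [netAction, h1, h2, Ne.symm h1]

open scoped Classical in
theorem memRun_brackets_fst (x : X) (m : List A × Bool) (ν : List (RefSym A X))
    (hν : ∀ c ∈ ν, c.IsBracket) :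
    (memRun x m ν).1 = if RefSym.op x ∈ ν then [] else m.1 := by
  induction ν using List.reverseRecOn with
  | nil => simp [memRun]
  | append_singleton ν c ih =>
    have hc := hν c (by simp)
    have ih := ih fun d hd => hν d (by simp [hd])
    rw [memRun_append]
    rcases c with a | y | y | y
    · exact hc.elim
    · exact hc.elim
    · by_cases hyx : y = x
      · simp [memRun, hyx]
      · simp [memRun, hyx, ih, Ne.symm hyx]
    · by_cases hyx : y = x
      · simp [memRun, hyx, ih]
      · simp [memRun, hyx, ih]

/-- `op x` empties the memory and `cl x` keeps its content. So the status depends on the last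
bracket of `x`, and the content on whether `op x` occurs at all: these are the distinctions that the
net action makes. -/
theorem memRun_brackets (x : X) (m : List A × Bool) (ν : List (RefSym A X))
    (hν : ∀ c ∈ ν, c.IsBracket) :
    memRun x m ν = TMFA.memStep [] (netAction ν x) m := by
  classical
  induction ν using List.reverseRecOn with
  | nil => rcases m with ⟨u, _ | _⟩ <;> simp [memRun, netAction, TMFA.memStep]
  | append_singleton ν c ih =>
    have hc := hν c (by simp)
    have hν' : ∀ c ∈ ν, c.IsBracket := fun d hd => hν d (by simp [hd])
    have ih := ih hν'
    rw [memRun_append, netAction_append_singleton]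
    rcases c with a | y | y | y
    · exact hc.elim
    · exact hc.elim
    · by_cases hyx : y = x
      · simp [memRun, hyx, TMFA.memStep]
      · simp [memRun, hyx, ih]
    · by_cases hyx : y = x
      · have := memRun_brackets_fst x m ν hν'
        by_cases ho : RefSym.op x ∈ ν
        · rw [if_pos ho] at this
          simp [memRun, hyx, this, ho, TMFA.memStep]
        · rw [if_neg ho] at this
          simp [memRun, hyx, this, ho, TMFA.memStep]
      · simp [memRun, hyx, ih]

/-- The brackets act before the value of the next node is appended, whereas the automaton does both
in one step; `memStep` combines the two effects. -/
theorem memRun_step (x : X) (m : List A × Bool) (ν : List (RefSym A X)) (v : List A)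
    (hν : ∀ c ∈ ν, c.IsBracket) :
    memRun x m (ν ++ v.map RefSym.letter) = TMFA.memStep v (netAction ν x) m := by
  rw [memRun_append, memRun_letters, memRun_brackets x m ν hν]
  rcases m with ⟨u, _ | _⟩ <;> cases netAction ν x <;> simp [TMFA.memStep]

end Memories

/-! ### The language of the Glushkov automaton -/

namespace Regex

variable {A X : Type*}

/-- The memories of the Glushkov automaton after a marked ref-word. -/
noncomputable def memOf (α : Regex A X) (l : List (RefSym A X × ℕ)) : α.GMem → List A × Bool
  | none => ([], false)
  | some x => memRun x.1 ([], false) (resolve [] (l.map Prod.fst))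

theorem memOf_nil (α : Regex A X) : α.memOf [] = fun _ => ([], false) := by
  funext i
  cases i <;> simp [memOf, resolve, memRun]

theorem map_fst_mem_refLang {α : Regex A X} {w : List (RefSym A X × ℕ)}
    (h : w ∈ α.markedLang) : w.map Prod.fst ∈ α.refLang := by
  rw [refLang, ← RefExpr.lang_mark α.toRef 1]
  exact ⟨w, h, rfl⟩

theorem track_prefix {α : Regex A X} (hα : α.IsRX) {l s : List (RefSym A X × ℕ)}
    (h : l ++ s ∈ α.markedLang) (x : X) : ∃ b, track x false (l.map Prod.fst) = some b := by
  have h' := map_fst_mem_refLang h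
  rcases hα with rfl | hα
  · exact absurd h' RefExpr.not_mem_lang_zero
  · have := track_refLang hα x h'
    rw [List.map_append, track_append, Option.bind_eq_some_iff] at this
    obtain ⟨b, hb, -⟩ := this
    exact ⟨b, hb⟩

/-- The value of the node `c` after `l`. -/
noncomputable def nodeValue (l : List (RefSym A X × ℕ)) (c : RefSym A X × ℕ) : List A :=
  symValue (resolve [] (l.map Prod.fst)) c.1

theorem IsBracketWord.map_fst {ν : List (RefSym A X × ℕ)} (hν : IsBracketWord ν) :
    ∀ c ∈ ν.map Prod.fst, c.IsBracket := by
  simpa [IsBracketWord] using hν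

theorem resolve_node {l ν : List (RefSym A X × ℕ)} {c : RefSym A X × ℕ} (hν : IsBracketWord ν)
    (hc : ¬ c.1.IsBracket) :
    resolve [] ((l ++ ν ++ [c]).map Prod.fst) = resolve [] (l.map Prod.fst) ++
      (ν.map Prod.fst ++ (nodeValue (l ++ ν) c).map RefSym.letter) := by
  have h : resolve [] ((l ++ ν).map Prod.fst) =
      resolve [] (l.map Prod.fst) ++ ν.map Prod.fst := by
    rw [List.map_append, resolve_append, resolve_brackets _ _ hν.map_fst]
  rw [nodeValue, List.map_append (l₁ := l ++ ν), resolve_append, List.map_singleton,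
    resolve_singleton _ hc, h, List.append_assoc]

theorem terminals_brackets {ν : List (RefSym A X)} (hν : ∀ c ∈ ν, c.IsBracket) :
    terminals ν = [] := by
  rw [terminals, List.filterMap_eq_nil_iff]
  intro c hc
  have := hν c hc
  rcases c with a | x | x | x
  · exact this.elim
  · exact this.elim
  · rfl
  · rfl

theorem terminals_resolve_node {l ν : List (RefSym A X × ℕ)} {c : RefSym A X × ℕ}
    (hν : IsBracketWord ν) (hc : ¬ c.1.IsBracket) :
    terminals (resolve [] ((l ++ ν ++ [c]).map Prod.fst)) =
      terminals (resolve [] (l.map Prod.fst)) ++ nodeValue (l ++ ν) c := by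
  rw [resolve_node hν hc, terminals_append, terminals_append, terminals_letters,
    terminals_brackets hν.map_fst, List.nil_append]

theorem deref_brackets {l ν : List (RefSym A X × ℕ)} (hν : IsBracketWord ν) :
    deref ((l ++ ν).map Prod.fst) = terminals (resolve [] (l.map Prod.fst)) := by
  have hν' := hν.map_fst
  rw [deref, List.map_append, resolve_append, resolve_brackets _ _ hν', terminals_append,
    terminals_brackets hν', List.append_nil]

open scoped Classical in
-- The simulation step: the transition can only consume the value of the target node, and it leads
-- from the memories for `l` to those for the prolonged prefix. The memory contents are those from
-- before `ν`, while the reference is evaluated after `ν`; the point is that a closed variable that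
-- is not reset has the same content at both moments.
theorem IsEdgeTransition.spec {α : Regex A X} (hα : α.IsRX) {l ν s : List (RefSym A X × ℕ)}
    {n : α.Node} (hν : IsBracketWord ν) (h : l ++ ν ++ [n.1] ++ s ∈ α.markedLang)
    {b : TransLabel A α.GMem} {t : α.GMem → MemInstr} (ht : α.IsEdgeTransition ν n b t) :
    (∀ v, TMFA.Reads (α.memOf l) b t v ↔ v = nodeValue (l ++ ν) n.1) ∧
    (fun i => TMFA.memStep (nodeValue (l ++ ν) n.1) (t i) (α.memOf l i)) =
      α.memOf (l ++ ν ++ [n.1]) := by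
  have hν' := hν.map_fst
  have hmem : ∀ x : α.var, TMFA.memStep (nodeValue (l ++ ν) n.1) (α.edgeInstr ν (some x))
      (α.memOf l (some x)) = α.memOf (l ++ ν ++ [n.1]) (some x) := by
    intro x
    have h := resolve_node (c := n.1) (l := l) hν n.2.2
    simp only [memOf]
    rw [h, memRun_append, memRun_step _ _ _ _ hν']
    rfl
  rcases ht with ⟨a, ha, rfl, rfl⟩ | ⟨x, hx, hr, rfl, rfl⟩ | ⟨x, hx, hr, rfl, rfl⟩
  · have hv : nodeValue (l ++ ν) n.1 = [a] := by rw [nodeValue, ha]; rfl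
    refine ⟨fun v => by rw [hv]; rfl, ?_⟩
    funext i
    rcases i with _ | x
    · rfl
    · exact hmem x
  all_goals
    obtain ⟨b, hb⟩ := track_prefix hα h x.1
    rw [List.map_append, track_append] at hb
    obtain ⟨b', hb', hb⟩ := Option.bind_eq_some_iff.1 hb
    -- `track` fails at a reference to an open variable, so `x` is closed after `ν` and its memory
    -- holds the last binding.
    obtain rfl : b' = false := by
      rw [List.map_singleton, hx] at hb
      cases b'
      · rfl
      · simp [track] at hb
    obtain ⟨h1, h2, -⟩ := memRun_spec x.1 _ _ (track_resolve _ _ _ hb')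
    have h2 := h2 rfl
    rw [List.map_append, resolve_append, resolve_brackets _ _ hν', memRun_append,
      memRun_brackets _ _ _ hν'] at h1 h2
    have hv : nodeValue (l ++ ν) n.1 =
        (TMFA.memStep [] (α.edgeInstr ν (some x)) (α.memOf l (some x))).1 := by
      rw [nodeValue, hx]
      simp only [symValue]
      rw [List.map_append, resolve_append, resolve_brackets _ _ hν', h2]
      rfl
    replace h1 : (TMFA.memStep [] (α.edgeInstr ν (some x)) (α.memOf l (some x))).2 = false := h1
  -- Since `x` is closed afterwards and not reset, its instruction is to close, or to leave a closed
  -- memory unchanged. Both keep the content, and replacing the instruction by closing changes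
  -- nothing.
  · have hv' : nodeValue (l ++ ν) n.1 = (α.memOf l (some x)).1 := by
      rw [hv]
      revert h1 hr
      rcases α.memOf l (some x) with ⟨u, _ | _⟩ <;>
        cases α.edgeInstr ν (some x) <;> simp [TMFA.memStep]
    refine ⟨fun v => by simp [TMFA.Reads, hv'], ?_⟩
    funext i
    by_cases hi : i = some x
    · subst hi
      rw [← hmem, Function.update_self]
      revert h1 hr
      generalize nodeValue (l ++ ν) n.1 = v
      rcases α.memOf l (some x) with ⟨u, _ | _⟩ <;>
        cases α.edgeInstr ν (some x) <;> simp [TMFA.memStep]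
    · rw [Function.update_of_ne hi]
      rcases i with _ | y
      · rfl
      · exact hmem y
  -- After a reset the reference has the value `ε`, which is what the always empty memory delivers.
  · have hv' : nodeValue (l ++ ν) n.1 = [] := by
      rw [hv, hr]; rfl
    refine ⟨fun v => by simp [TMFA.Reads, hv', memOf], ?_⟩
    funext i
    rcases i with _ | y
    · rw [Function.update_self]; rfl
    · rw [Function.update_of_ne (by simp)]
      exact hmem y

theorem exists_split_brackets (s : List (RefSym A X × ℕ)) :
    ∃ ν s', s = ν ++ s' ∧ IsBracketWord ν ∧ ∀ c ∈ s'.head?, ¬ c.1.IsBracket := by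
  induction s with
  | nil => exact ⟨[], [], rfl, by simp [IsBracketWord], by simp⟩
  | cons c s ih =>
    by_cases hc : c.1.IsBracket
    · obtain ⟨ν, s', rfl, hν, hs⟩ := ih
      exact ⟨c :: ν, s', rfl, by simpa [IsBracketWord, hc] using hν, hs⟩
    · exact ⟨[], c :: s, rfl, by simp [IsBracketWord], by simpa using hc⟩

/-- Induction on a bound for the length of the marked word `s` still ahead: its leading brackets and
its first node form an edge, whose transition consumes the value of this node. `w` is the part of
the dereference that has not been consumed yet. -/
theorem exists_accepting_run {α : Regex A X} (hα : α.IsRX) (N : ℕ) :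
    ∀ (s l : List (RefSym A X × ℕ)) (u : Option α.Node) (w : List A), s.length ≤ N →
      l ++ s ∈ α.markedLang → l.getLast? = u.map Subtype.val →
      deref ((l ++ s).map Prod.fst) = terminals (resolve [] (l.map Prod.fst)) ++ w →
      ∃ q ∈ α.finalStates, ∃ mem, Relation.ReflTransGen α.glushkov.Step
        ⟨srcState u, w, α.memOf l⟩ ⟨q, [], mem⟩ := by
  induction N with
  | zero =>
    intro s l u w hs hm hl hw
    obtain rfl : s = [] := by simpa using hs
    rw [deref_brackets (by simp [IsBracketWord]), List.self_eq_append_right] at hw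
    subst hw
    have : ∃ ν, α.Edge u ν none := ⟨[], by simp [IsBracketWord], l, [], by simpa using hm, hl, rfl⟩
    exact ⟨srcState u, by cases u <;> exact this, _, Relation.ReflTransGen.refl⟩
  | succ N ih =>
    intro s l u w hs hm hl hw
    obtain ⟨ν, s', rfl, hν, hs'⟩ := exists_split_brackets s
    rcases s' with _ | ⟨c, s'⟩
    · rw [List.append_nil, deref_brackets hν, List.self_eq_append_right] at hw
      subst hw
      have : ∃ ν, α.Edge u ν none := ⟨ν, hν, l, [], by simpa using hm, hl, rfl⟩
      exact ⟨srcState u, by cases u <;> exact this, _, Relation.ReflTransGen.refl⟩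
    · have hc : ¬ c.1.IsBracket := hs' c (by simp)
      let n : α.Node := ⟨c, mem_symbols_of_mem_markedLang hm c (by simp), hc⟩
      have hn : n.1 = c := rfl
      have hm' : l ++ ν ++ [n.1] ++ s' ∈ α.markedLang := by simpa [n] using hm
      obtain ⟨b, t, ht⟩ := exists_isEdgeTransition ν n
      obtain ⟨h1, h2⟩ := ht.spec hα hν hm'
      obtain ⟨w', hw'⟩ : ∃ w', w = nodeValue (l ++ ν) n.1 ++ w' := by
        have h3 : l ++ (ν ++ c :: s') = l ++ ν ++ [n.1] ++ s' := by simp [n]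
        -- Dereferencing only appends to what has been treated, so the value of the next node is a
        -- prefix of the remaining input.
        have h4 : ∀ r r' : List (RefSym A X), ∃ w', terminals (resolve r r') = terminals r ++ w' := by
          intro r r'
          induction r' generalizing r with
          | nil => exact ⟨[], by simp [resolve]⟩
          | cons d r' ih =>
            rcases d with a | x | x | x <;> rw [resolve] <;>
            · obtain ⟨w', hw'⟩ := ih (r ++ _)
              rw [hw', terminals_append, List.append_assoc]
              exact ⟨_, rfl⟩
        rw [h3, deref, List.map_append, resolve_append] at hw
        obtain ⟨w', h5⟩ := h4 (resolve [] ((l ++ ν ++ [n.1]).map Prod.fst)) (s'.map Prod.fst)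
        rw [h5, terminals_resolve_node hν hc, List.append_assoc] at hw
        exact ⟨w', (List.append_cancel_left hw).symm⟩
      subst hw'
      obtain ⟨q, hq, mem, hrun⟩ := ih s' (l ++ ν ++ [n.1]) (some n) w'
        (by simp only [List.length_append, List.length_cons] at hs; omega) hm'
        (List.getLast?_concat.trans rfl)
        (by rw [hn, terminals_resolve_node hν hc, List.append_assoc (terminals _), ← hn, ← hw]; simp [n])
      refine ⟨q, hq, mem, Relation.ReflTransGen.head ?_ hrun⟩
      rw [← h2]
      refine TMFA.Step.move _ _ b t _ _ _ (α.edgeTransitions_subset u b ?_) ((h1 _).2 rfl)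
      exact ⟨n, ν, rfl, ⟨hν, l, c :: s', by simpa using hm, hl, rfl⟩, ht⟩

/-- The invariant of computations: outside the trap, a configuration belongs to a prefix `l` of a
marked word that ends in the current node. Recall failures and ambiguity transitions lead into the
trap, which is never left. -/
theorem reachable_config {α : Regex A X} (hα : α.IsRX) {w : List A}
    (hne : ∃ ρ, ρ ∈ α.markedLang) {c : TMFA.Config A α.GState α.GMem}
    (h : Relation.ReflTransGen α.glushkov.Step ⟨GState.init, w, fun _ => ([], false)⟩ c) :
    c.state = GState.trap ∨ ∃ (u : Option α.Node) (l s : List (RefSym A X × ℕ)),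
      c.state = srcState u ∧ l ++ s ∈ α.markedLang ∧ l.getLast? = u.map Subtype.val ∧
      c.mem = α.memOf l ∧ w = terminals (resolve [] (l.map Prod.fst)) ++ c.input := by
  induction h with
  | refl =>
    obtain ⟨ρ, hρ⟩ := hne
    exact Or.inr ⟨none, [], ρ, rfl, hρ, rfl, α.memOf_nil.symm, rfl⟩
  | tail _ hstep ih =>
    rcases hstep with ⟨q, p, b, t, v, w', mem, hδ, hv⟩ | ⟨q, p, i, t, v, v', w', mem, hδ⟩
    · rcases ih with hq | ⟨u, l, s, rfl, hm, hl, rfl, hw⟩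
      · replace hq : q = GState.trap := hq
        subst hq
        left
        rcases b with a | _ | i
        · exact congrArg Prod.fst hδ
        · exact congrArg Prod.fst hδ
        · exact hδ.elim
      · have hδ' : p = GState.trap ∨ (p, t) ∈ α.edgeTransitions u b := by
          cases u with
          | none =>
            rcases hδ with h | h
            · exact Or.inr h
            · exact Or.inl h.2.2.1
          | some u => exact Or.inr hδ
        rcases hδ' with hp | ⟨n, ν, rfl, hE, ht⟩
        · exact Or.inl hp
        right
        -- The edge may be witnessed by a word with another past; locality attaches it to `l`.
        obtain ⟨s', hm'⟩ : ∃ s', l ++ ν ++ [n.1] ++ s' ∈ α.markedLang := by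
          obtain ⟨hν, l', r', hm', hl', hr'⟩ := hE
          obtain ⟨s', rfl⟩ : ∃ s', r' = n.1 :: s' := by
            cases r' with
            | nil => cases hr'
            | cons c r' => exact ⟨r', by rw [Option.some.inj hr']⟩
          cases u with
          | none =>
            obtain rfl : l = [] := by simpa using hl
            obtain rfl : l' = [] := by simpa using hl'
            exact ⟨s', by simpa using hm'⟩
          | some u =>
            obtain ⟨l₁, rfl⟩ := List.getLast?_eq_some_iff.1 hl
            obtain ⟨l₂, rfl⟩ := List.getLast?_eq_some_iff.1 hl'
            have := α.isLocal_markedLang u.1 l₁ s l₂ (ν ++ n.1 :: s') (by simpa using hm)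
              (by simpa using hm')
            exact ⟨s', by simpa using this⟩
        obtain ⟨h1, h2⟩ := ht.spec hα hE.1 hm'
        obtain rfl := (h1 v).1 hv
        refine ⟨some n, l ++ ν ++ [n.1], s', rfl, hm', List.getLast?_concat.trans rfl, h2, ?_⟩
        rw [terminals_resolve_node hE.1 n.2.2, List.append_assoc]
        exact hw
    · exact Or.inl rfl

theorem glushkov_lang {α : Regex A X} (hα : α.IsRX) : α.glushkov.lang = α.lang := by
  ext w
  constructor
  · rintro ⟨q, mem, hq, hrun⟩
    have hne : ∃ ρ, ρ ∈ α.markedLang := by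
      rcases q with _ | _ | u
      · exact hq.elim
      · obtain ⟨ν, -, l, r, hm, -⟩ := hq
        exact ⟨_, hm⟩
      · obtain ⟨ν, -, l, r, hm, -⟩ := hq
        exact ⟨_, hm⟩
    rcases reachable_config hα hne hrun with h | ⟨u, l, s, hqu, hm, hl, -, hw⟩
    · replace h : q = GState.trap := h
      subst h
      exact hq.elim
    · replace hqu : q = srcState u := hqu
      subst hqu
      obtain ⟨ν, hE⟩ : ∃ ν, α.Edge u ν none := by cases u <;> exact hq
      obtain ⟨hν, l', r', hm', hl', hr'⟩ := hE
      obtain rfl : r' = [] := by simpa using hr'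
      -- Locality once more: the bracket word that makes the state final may follow the past `l` of
      -- this computation.
      have hm'' : l ++ ν ∈ α.markedLang := by
        cases u with
        | none =>
          obtain rfl : l = [] := by simpa using hl
          obtain rfl : l' = [] := by simpa using hl'
          simpa using hm'
        | some u =>
          obtain ⟨l₁, rfl⟩ := List.getLast?_eq_some_iff.1 hl
          obtain ⟨l₂, rfl⟩ := List.getLast?_eq_some_iff.1 hl'
          have := α.isLocal_markedLang u.1 l₁ s l₂ ν (by simpa using hm) (by simpa using hm')
          simpa using this
      refine ⟨_, map_fst_mem_refLang hm'', ?_⟩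
      rw [deref_brackets hν, hw]
      simp
  · rintro ⟨r, hr, rfl⟩
    rw [refLang, ← RefExpr.lang_mark α.toRef 1] at hr
    obtain ⟨ρ, hρ, rfl⟩ := hr
    obtain ⟨q, hq, mem, hrun⟩ := exists_accepting_run hα ρ.length ρ [] none _ le_rfl hρ rfl
      (by simp [resolve, terminals]; rfl)
    rw [memOf_nil] at hrun
    exact ⟨q, mem, hq, hrun⟩

end Regex

/-! ### Bracket words that lead to and from nodes, for proper regular expressions -/

namespace RefExpr

variable {A X : Type*}

local notation "Sym" => (RefSym A X × ℕ)

/-- `ν` leads from `c` to the end. -/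
def Lasts (r : RefExpr Sym) (c : Sym) (ν : List Sym) : Prop := ∃ l, l ++ c :: ν ∈ r.lang

/-- `ν` leads from the beginning to `d`. -/
def Firsts (r : RefExpr Sym) (ν : List Sym) (d : Sym) : Prop := ∃ t, ν ++ d :: t ∈ r.lang

/-- `ν` leads from `c` to `d`. -/
def Follows (r : RefExpr Sym) (c : Sym) (ν : List Sym) (d : Sym) : Prop :=
  ∃ l t, l ++ c :: (ν ++ d :: t) ∈ r.lang

/-- Either `c` lies in the right factor, or it lies in the left one and `ν` runs through the whole
right factor. That `r` generates some word is needed only to put one in front of a word of `t`. -/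
theorem lasts_cat {r t : RefExpr Sym} {c : Sym} {ν : List Sym}
    (hr : ∃ y, y ∈ r.lang) :
    (cat r t).Lasts c ν ↔ t.Lasts c ν ∨ ∃ ν₁ ν₂, ν = ν₁ ++ ν₂ ∧ r.Lasts c ν₁ ∧ ν₂ ∈ t.lang := by
  constructor
  · rintro ⟨l, hl⟩
    obtain ⟨a, ha, b, hb, hab⟩ := mem_lang_cat.1 hl
    rcases List.append_eq_append_iff.1 hab with ⟨a', rfl, rfl⟩ | ⟨c', rfl, h2⟩
    · exact Or.inl ⟨a', hb⟩
    · rcases List.cons_eq_append_iff.1 h2 with ⟨rfl, rfl⟩ | ⟨t', rfl, rfl⟩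
      · exact Or.inl ⟨[], hb⟩
      · exact Or.inr ⟨t', b, rfl, ⟨l, ha⟩, hb⟩
  · rintro (⟨l, hl⟩ | ⟨ν₁, ν₂, rfl, ⟨l, hl⟩, h⟩)
    · obtain ⟨y, hy⟩ := hr
      exact ⟨y ++ l, mem_lang_cat.2 ⟨y, hy, _, hl, by simp⟩⟩
    · exact ⟨l, mem_lang_cat.2 ⟨_, hl, _, h, by simp⟩⟩

theorem firsts_cat {r t : RefExpr Sym} {d : Sym} {ν : List Sym}
    (ht : ∃ y, y ∈ t.lang) :
    (cat r t).Firsts ν d ↔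
      r.Firsts ν d ∨ ∃ ν₁ ν₂, ν = ν₁ ++ ν₂ ∧ ν₁ ∈ r.lang ∧ t.Firsts ν₂ d := by
  constructor
  · rintro ⟨s, hs⟩
    obtain ⟨a, ha, b, hb, hab⟩ := mem_lang_cat.1 hs
    rcases List.append_eq_append_iff.1 hab with ⟨a', rfl, rfl⟩ | ⟨c', rfl, h2⟩
    · exact Or.inr ⟨a, a', rfl, ha, s, hb⟩
    · rcases List.cons_eq_append_iff.1 h2 with ⟨rfl, rfl⟩ | ⟨t', rfl, rfl⟩
      · exact Or.inr ⟨ν, [], by simp, by simpa using ha, s, hb⟩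
      · exact Or.inl ⟨t', ha⟩
  · rintro (⟨s, hs⟩ | ⟨ν₁, ν₂, rfl, h, s, hs⟩)
    · obtain ⟨y, hy⟩ := ht
      exact ⟨s ++ y, mem_lang_cat.2 ⟨_, hs, y, hy, by simp⟩⟩
    · exact ⟨s, mem_lang_cat.2 ⟨_, h, _, hs, by simp⟩⟩

theorem follows_cat {r t : RefExpr Sym} {c d : Sym} {ν : List Sym}
    (hr : ∃ y, y ∈ r.lang)
    (ht : ∃ y, y ∈ t.lang) :
    (cat r t).Follows c ν d ↔ r.Follows c ν d ∨ t.Follows c ν d ∨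
      ∃ ν₁ ν₂, ν = ν₁ ++ ν₂ ∧ r.Lasts c ν₁ ∧ t.Firsts ν₂ d := by
  constructor
  · rintro ⟨l, s, hs⟩
    obtain ⟨a, ha, b, hb, hab⟩ := mem_lang_cat.1 hs
    rcases List.append_eq_append_iff.1 hab with ⟨a', rfl, rfl⟩ | ⟨c', rfl, h2⟩
    · exact Or.inr (Or.inl ⟨a', s, hb⟩)
    · rcases List.cons_eq_append_iff.1 h2 with ⟨rfl, rfl⟩ | ⟨t', rfl, h3⟩
      · exact Or.inr (Or.inl ⟨[], s, hb⟩)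
      · rcases List.append_eq_append_iff.1 h3 with ⟨a', rfl, h4⟩ | ⟨c', rfl, h4⟩
        · rcases List.cons_eq_append_iff.1 h4 with ⟨rfl, rfl⟩ | ⟨t', rfl, rfl⟩
          · exact Or.inr (Or.inr ⟨ν, [], by simp, ⟨l, by simpa using ha⟩, s, hb⟩)
          · exact Or.inl ⟨l, t', ha⟩
        · exact Or.inr (Or.inr ⟨t', c', rfl, ⟨l, ha⟩, s, h4 ▸ hb⟩)
  · obtain ⟨y, hy⟩ := hr
    obtain ⟨z, hz⟩ := ht
    rintro (⟨l, s, hs⟩ | ⟨l, s, hs⟩ | ⟨ν₁, ν₂, rfl, ⟨l, hl⟩, s, hs⟩)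
    · exact ⟨l, s ++ z, mem_lang_cat.2 ⟨_, hs, z, hz, by simp⟩⟩
    · exact ⟨y ++ l, s, mem_lang_cat.2 ⟨y, hy, _, hs, by simp⟩⟩
    · exact ⟨l, s, mem_lang_cat.2 ⟨_, hl, _, hs, by simp⟩⟩

/-- An iteration that ends before `d` consists of brackets and is empty by `h0`; so `ν` and `d`
belong to the first iteration that is not empty. -/
theorem firsts_plus {r : RefExpr Sym} {d : Sym} {ν : List Sym}
    (hν : Regex.IsBracketWord ν) (h0 : ∀ y ∈ r.lang, Regex.IsBracketWord y → y = []) :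
    (plus r).Firsts ν d ↔ r.Firsts ν d := by
  constructor
  · rintro ⟨s, hs⟩
    obtain ⟨S, -, hw, hS⟩ := mem_lang_plus.1 hs
    clear hs
    induction S with
    | nil => simp at hw
    | cons y S ih =>
      have hy := hS y (by simp)
      rw [List.flatten_cons] at hw
      rcases List.append_eq_append_iff.1 hw with ⟨a', rfl, h2⟩ | ⟨c', rfl, h2⟩
      · obtain rfl := h0 y hy fun c hc => hν c (by simp [hc])
        exact ih (by simpa using hw) fun z hz => hS z (by simp [hz])
      · rcases List.cons_eq_append_iff.1 h2 with ⟨rfl, h3⟩ | ⟨t', rfl, h3⟩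
        · obtain rfl : ν = [] := by simpa using h0 _ hy (by simpa using hν)
          exact ih (by simp [h3]) fun z hz => hS z (by simp [hz])
        · exact ⟨t', hy⟩
  · rintro ⟨s, hs⟩
    exact ⟨s, mem_plus_of_mem hs⟩

theorem mem_plus_bracket {r : RefExpr Sym} {ν : List Sym}
    (hν : Regex.IsBracketWord ν) (h0 : ∀ y ∈ r.lang, Regex.IsBracketWord y → y = []) :
    ν ∈ (plus r).lang ↔ ν ∈ r.lang := by
  refine ⟨fun h => ?_, mem_plus_of_mem⟩
  obtain ⟨S, hne, rfl, hS⟩ := mem_lang_plus.1 h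
  have : ∀ y ∈ S, y = [] := fun y hy => h0 y (hS y hy) fun c hc =>
    hν c (List.mem_flatten.2 ⟨y, hy, hc⟩)
  obtain ⟨y, S, rfl⟩ := List.exists_cons_of_ne_nil hne
  have h1 : (y :: S).flatten = [] := List.flatten_eq_nil_iff.2 this
  rw [h1, ← this y (by simp)]
  exact hS y (by simp)

theorem lasts_plus {r : RefExpr Sym} {c : Sym} {ν : List Sym}
    (hν : Regex.IsBracketWord ν) (h0 : ∀ y ∈ r.lang, Regex.IsBracketWord y → y = []) :
    (plus r).Lasts c ν ↔ r.Lasts c ν := by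
  constructor
  · rintro ⟨l, hl⟩
    obtain ⟨p, l', t', q, rfl, rfl, h, -, hq⟩ := exists_factor_of_mem_plus hl
    have hq' : Regex.IsBracketWord q := fun e he => hν e (by simp [he])
    obtain rfl : q = [] := by
      rcases hq with rfl | hq
      · rfl
      · exact h0 q ((mem_plus_bracket hq' h0).1 hq) hq'
    exact ⟨l', by simpa using h⟩
  · rintro ⟨l, hl⟩
    exact ⟨l, mem_plus_of_mem hl⟩

/-- If `d` lies in a later iteration than `c`, the iterations strictly between them are bracket
words, hence empty by `h0`, and `ν` is a way out followed by a way in. -/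
theorem follows_plus {r : RefExpr Sym} {c d : Sym} {ν : List Sym}
    (hν : Regex.IsBracketWord ν)
    (h0 : ∀ y ∈ r.lang, Regex.IsBracketWord y → y = []) :
    (plus r).Follows c ν d ↔ r.Follows c ν d ∨
      ∃ ν₁ ν₂, ν = ν₁ ++ ν₂ ∧ r.Lasts c ν₁ ∧ r.Firsts ν₂ d := by
  constructor
  · rintro ⟨l, s, hs⟩
    obtain ⟨p, l', t', q, rfl, h1, h, -, hq⟩ := exists_factor_of_mem_plus hs
    have key : ∀ ν₁ ν₂, ν = ν₁ ++ ν₂ → q = ν₂ ++ d :: s → t' = ν₁ →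
        ∃ ν₁ ν₂, ν = ν₁ ++ ν₂ ∧ r.Lasts c ν₁ ∧ r.Firsts ν₂ d := by
      rintro ν₁ ν₂ rfl rfl rfl
      refine ⟨_, ν₂, rfl, ⟨l', h⟩, (firsts_plus (fun e he => hν e (by simp [he])) h0).1 ?_⟩
      rcases hq with hq | hq
      · simp at hq
      · exact ⟨s, hq⟩
    rcases List.append_eq_append_iff.1 h1 with ⟨a', rfl, h4⟩ | ⟨c', h3, h4⟩
    · rcases List.cons_eq_append_iff.1 h4 with ⟨rfl, h5⟩ | ⟨t', rfl, rfl⟩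
      · exact Or.inr (key ν [] (by simp) (by simp [h5]) (by simp))
      · exact Or.inl ⟨l', t', h⟩
    · exact Or.inr (key t' c' h3 h4 rfl)
  · rintro (⟨l, s, hs⟩ | ⟨ν₁, ν₂, rfl, ⟨l, hl⟩, s, hs⟩)
    · exact ⟨l, s, mem_plus_of_mem hs⟩
    · refine ⟨l, s, ?_⟩
      have := append_mem_plus (mem_plus_of_mem hl) (mem_plus_of_mem hs)
      simpa using this

end RefExpr

/-! ### The edges of the memory occurrence graph by structural recursion -/

namespace Regex

variable {A X : Type*}

local notation "Sym" => (RefSym A X × ℕ)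

theorem append_cons_mem_sym {b c : Sym} {l ν : List Sym} :
    l ++ c :: ν ∈ (RefExpr.sym b).lang ↔ l = [] ∧ c = b ∧ ν = [] := by
  rw [RefExpr.mem_lang_sym, List.append_eq_singleton_iff]
  simp

/-- The number of symbol occurrences in the proper regular expression. -/
def slen (β : Regex A X) : ℕ := β.toRef.symbols.length

/-- The bracket word of the marked expression, provided that there is only one. -/
def nullW : Regex A X → ℕ → Option (List Sym)
  | empty, _ => none
  | eps, _ => some []
  | sym _, _ => none
  | ref _, _ => none
  | cat β γ, i => (nullW β i).bind fun v => (nullW γ (i + β.slen)).map fun w => v ++ w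
  | alt β γ, i => (nullW β i).or (nullW γ (i + β.slen))
  | plus β, i => nullW β i
  | bind x β, i => (nullW β (i + 1)).map fun w =>
      (RefSym.op x, i) :: (w ++ [(RefSym.cl x, i + 1 + β.slen)])

/-- Every subexpression has at most one bracket word. -/
def NullOK : Regex A X → ℕ → Prop
  | cat β γ, i => NullOK β i ∧ NullOK γ (i + β.slen)
  | alt β γ, i => NullOK β i ∧ NullOK γ (i + β.slen) ∧
      ∀ v w, nullW β i = some v → nullW γ (i + β.slen) = some w → v = [] ∧ w = []
  | plus β, i => NullOK β i ∧ ∀ v, nullW β i = some v → v = []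
  | bind _ β, i => NullOK β (i + 1)
  | _, _ => True

open scoped Classical in
/-- The bracket word that leads from `c` to the end of the marked expression. -/
noncomputable def outW (c : Sym) : Regex A X → ℕ → Option (List Sym)
  | empty, _ => none
  | eps, _ => none
  | sym a, i => if c = (RefSym.letter a, i) then some [] else none
  | ref x, i => if c = (RefSym.var x, i) then some [] else none
  | cat β γ, i => (outW c γ (i + β.slen)).or
      ((outW c β i).bind fun v => (nullW γ (i + β.slen)).map fun w => v ++ w)
  | alt β γ, i => (outW c β i).or (outW c γ (i + β.slen))
  | plus β, i => outW c β i
  | bind x β, i => (outW c β (i + 1)).map fun w => w ++ [(RefSym.cl x, i + 1 + β.slen)]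

/-- A node that can be reached, the bracket word that leads to it, its position in reverse Polish
notation, and the position where the path towards it starts to descend. -/
structure Target (A X : Type*) where
  node : RefSym A X × ℕ
  word : List (RefSym A X × ℕ)
  pos : ℕ
  turn : ℕ

/-- Enter a subexpression, either from the exit of an earlier subexpression by descending at
position `p`, or in another way. -/
def enter (v : Option (List Sym)) (p : ℕ) (w : Option (List Sym × ℕ)) :
    Option (List Sym × ℕ) :=
  (v.map fun v => (v, p)).or w

/-- Continue a path along the bracket word of a subexpression. -/
def pass (w : Option (List Sym × ℕ)) (n : Option (List Sym)) : Option (List Sym × ℕ) :=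
  w.bind fun v => n.map fun n => (v.1 ++ n, v.2)

/-- The nodes of the subexpression at position `o` with marks from `i` that can be reached from
`c`, either inside of it or by the entrance, where `w` leads to the entrance. -/
noncomputable def targets (c : Sym) :
    Regex A X → ℕ → ℕ → Option (List Sym × ℕ) → List (Target A X)
  | empty, _, _, _ => []
  | eps, _, _, _ => []
  | sym a, o, i, w => (w.map fun v => (⟨(RefSym.letter a, i), v.1, o, v.2⟩ : Target A X)).toList
  | ref x, o, i, w => (w.map fun v => (⟨(RefSym.var x, i), v.1, o, v.2⟩ : Target A X)).toList
  | cat β γ, o, i, w => targets c γ (o + β.size) (i + β.slen)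
        (enter (outW c β i) (o + β.size + γ.size) (pass w (nullW β i))) ++
      targets c β o i w
  | alt β γ, o, i, w => targets c γ (o + β.size) (i + β.slen) w ++ targets c β o i w
  | plus β, o, i, w => targets c β o i (enter (outW c β i) (o + β.size) w)
  | bind x β, o, i, w => targets c β o (i + 1) (w.map fun v => (v.1 ++ [(RefSym.op x, i)], v.2))

/-- The two ways to an entrance have the same bracket word. -/
def Agree (v : Option (List Sym)) (w : Option (List Sym × ℕ)) : Prop :=
  ∀ a b p, v = some a → w = some (b, p) → a = b

/-- All ways to the same entrance have the same bracket word. -/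
def InOK (c : Sym) : Regex A X → ℕ → ℕ → Option (List Sym × ℕ) → Prop
  | cat β γ, o, i, w => InOK c γ (o + β.size) (i + β.slen)
        (enter (outW c β i) (o + β.size + γ.size) (pass w (nullW β i))) ∧
      InOK c β o i w ∧ Agree (outW c β i) (pass w (nullW β i))
  | alt β γ, o, i, w => InOK c γ (o + β.size) (i + β.slen) w ∧ InOK c β o i w
  | plus β, o, i, w => InOK c β o i (enter (outW c β i) (o + β.size) w) ∧ Agree (outW c β i) w
  | bind x β, o, i, w => InOK c β o (i + 1) (w.map fun v => (v.1 ++ [(RefSym.op x, i)], v.2))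
  | _, _, _, _ => True

theorem mark_cat (β γ : Regex A X) (i : ℕ) : (cat β γ).toRef.mark i =
    RefExpr.cat (β.toRef.mark i) (γ.toRef.mark (i + β.slen)) := rfl

theorem mark_alt (β γ : Regex A X) (i : ℕ) : (alt β γ).toRef.mark i =
    RefExpr.alt (β.toRef.mark i) (γ.toRef.mark (i + β.slen)) := rfl

theorem mark_plus (β : Regex A X) (i : ℕ) : (plus β).toRef.mark i =
    RefExpr.plus (β.toRef.mark i) := rfl

theorem mark_bind (x : X) (β : Regex A X) (i : ℕ) : (bind x β).toRef.mark i =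
    RefExpr.cat (RefExpr.sym (RefSym.op x, i)) (RefExpr.cat (β.toRef.mark (i + 1))
      (RefExpr.sym (RefSym.cl x, i + 1 + β.slen))) := rfl

theorem exists_mem_lang {β : Regex A X} (h : β.WellFormed) (i : ℕ) :
    ∃ y, y ∈ (β.toRef.mark i).lang := by
  induction β generalizing i with
  | empty => exact h.elim
  | eps => exact ⟨[], rfl⟩
  | sym a => exact ⟨_, rfl⟩
  | ref x => exact ⟨_, rfl⟩
  | cat β γ hβ hγ =>
    obtain ⟨y, hy⟩ := hβ h.1 i
    obtain ⟨z, hz⟩ := hγ h.2 (i + β.slen)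
    exact ⟨_, RefExpr.mem_lang_cat.2 ⟨y, hy, z, hz, rfl⟩⟩
  | alt β γ hβ hγ =>
    obtain ⟨y, hy⟩ := hβ h.1 i
    exact ⟨y, RefExpr.mem_lang_alt.2 (Or.inl hy)⟩
  | plus β hβ =>
    obtain ⟨y, hy⟩ := hβ h i
    exact ⟨y, RefExpr.mem_plus_of_mem hy⟩
  | bind x β hβ =>
    obtain ⟨y, hy⟩ := hβ h.1 (i + 1)
    exact ⟨_, RefExpr.mem_lang_cat.2 ⟨_, rfl, _, RefExpr.mem_lang_cat.2 ⟨y, hy, _, rfl, rfl⟩, rfl⟩⟩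

theorem isBracketWord_append {v w : List Sym} :
    IsBracketWord (v ++ w) ↔ IsBracketWord v ∧ IsBracketWord w := by
  simp only [IsBracketWord, List.mem_append]
  exact ⟨fun h => ⟨fun c hc => h c (Or.inl hc), fun c hc => h c (Or.inr hc)⟩,
    fun h c hc => hc.elim (h.1 c) (h.2 c)⟩

theorem isBracketWord_nil : IsBracketWord ([] : List Sym) := by simp [IsBracketWord]

theorem isBracketWord_op (x : X) (i : ℕ) : IsBracketWord [((RefSym.op x, i) : Sym)] := by
  simp [IsBracketWord, RefSym.IsBracket]

theorem isBracketWord_cl (x : X) (i : ℕ) : IsBracketWord [((RefSym.cl x, i) : Sym)] := by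
  simp [IsBracketWord, RefSym.IsBracket]

theorem nullW_mem {β : Regex A X} {i : ℕ} {ν : List Sym} (h : nullW β i = some ν) :
    ν ∈ (β.toRef.mark i).lang ∧ IsBracketWord ν := by
  induction β generalizing i ν with
  | empty => simp [nullW] at h
  | eps =>
    obtain rfl : [] = ν := by simpa [nullW] using h
    exact ⟨rfl, isBracketWord_nil⟩
  | sym a => simp [nullW] at h
  | ref x => simp [nullW] at h
  | cat β γ hβ hγ =>
    simp only [nullW, Option.bind_eq_some_iff, Option.map_eq_some_iff] at h
    obtain ⟨v, hv, w, hw, rfl⟩ := h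
    obtain ⟨h1, h2⟩ := hβ hv
    obtain ⟨h3, h4⟩ := hγ hw
    exact ⟨RefExpr.mem_lang_cat.2 ⟨v, h1, w, h3, rfl⟩, isBracketWord_append.2 ⟨h2, h4⟩⟩
  | alt β γ hβ hγ =>
    simp only [nullW, Option.or_eq_some_iff] at h
    rcases h with h | ⟨-, h⟩
    · exact ⟨RefExpr.mem_lang_alt.2 (Or.inl (hβ h).1), (hβ h).2⟩
    · exact ⟨RefExpr.mem_lang_alt.2 (Or.inr (hγ h).1), (hγ h).2⟩
  | plus β hβ => exact ⟨RefExpr.mem_plus_of_mem (hβ h).1, (hβ h).2⟩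
  | bind x β hβ =>
    simp only [nullW, Option.map_eq_some_iff] at h
    obtain ⟨v, hv, rfl⟩ := h
    obtain ⟨h1, h2⟩ := hβ hv
    refine ⟨RefExpr.mem_lang_cat.2 ⟨_, rfl, _, RefExpr.mem_lang_cat.2 ⟨v, h1, _, rfl, rfl⟩, rfl⟩, ?_⟩
    exact (isBracketWord_append (v := [_])).2
      ⟨isBracketWord_op x i, isBracketWord_append.2 ⟨h2, isBracketWord_cl x _⟩⟩

/-- `NullOK` makes the choices of `nullW` harmless: if both alternatives have bracket words, both
are empty, and repeating the empty word gives nothing new. Soundness, in contrast, holds without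
this condition. -/
theorem nullW_complete {β : Regex A X} {i : ℕ} {ν : List Sym} (h : β.NullOK i)
    (hν : ν ∈ (β.toRef.mark i).lang) (hb : IsBracketWord ν) : nullW β i = some ν := by
  induction β generalizing i ν with
  | empty => exact absurd hν RefExpr.not_mem_lang_zero
  | eps => obtain rfl : ν = [] := hν; rfl
  | sym a => obtain rfl : ν = [_] := hν; exact False.elim (hb _ (List.mem_singleton_self _))
  | ref x => obtain rfl : ν = [_] := hν; exact False.elim (hb _ (List.mem_singleton_self _))
  | cat β γ hβ hγ =>
    obtain ⟨v, hv, w, hw, rfl⟩ := RefExpr.mem_lang_cat.1 hν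
    obtain ⟨h1, h2⟩ := isBracketWord_append.1 hb
    rw [nullW, hβ h.1 hv h1]
    exact congrArg (Option.map _) (hγ h.2 hw h2)
  | alt β γ hβ hγ =>
    rw [nullW]
    rcases RefExpr.mem_lang_alt.1 hν with h1 | h1
    · rw [hβ h.1 h1 hb, Option.some_or]
    · have h2 := hγ h.2.1 h1 hb
      cases h3 : nullW β i with
      | none => exact h2
      | some v =>
        obtain ⟨rfl, rfl⟩ := h.2.2 v ν h3 h2
        rfl
  | plus β hβ =>
    refine hβ h.1 ((RefExpr.mem_plus_bracket hb fun y hy hb => ?_).1 hν) hb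
    exact h.2 y (hβ h.1 hy hb)
  | bind x β hβ =>
    obtain ⟨v, rfl, w, hw, rfl⟩ := RefExpr.mem_lang_cat.1 hν
    obtain ⟨y, hy, z, rfl, rfl⟩ := RefExpr.mem_lang_cat.1 hw
    have h1 := (isBracketWord_append.1 (isBracketWord_append.1 hb).2).1
    rw [nullW, hβ h hy h1]
    rfl

theorem NullOK.eq_nil {β : Regex A X} {i : ℕ} (h : (plus β).NullOK i) :
    ∀ y ∈ (β.toRef.mark i).lang, IsBracketWord y → y = [] :=
  fun y hy hb => h.2 y (nullW_complete h.1 hy hb)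

theorem outW_lasts {c : Sym} {β : Regex A X} {i : ℕ} {ν : List Sym}
    (h0 : β.WellFormed) (h : outW c β i = some ν) :
    (β.toRef.mark i).Lasts c ν ∧ IsBracketWord ν := by
  induction β generalizing i ν with
  | empty => simp [outW] at h
  | eps => simp [outW] at h
  | sym a =>
    obtain ⟨rfl, rfl⟩ : c = _ ∧ [] = ν := by simpa [outW] using h
    exact ⟨⟨[], rfl⟩, isBracketWord_nil⟩
  | ref x =>
    obtain ⟨rfl, rfl⟩ : c = _ ∧ [] = ν := by simpa [outW] using h
    exact ⟨⟨[], rfl⟩, isBracketWord_nil⟩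
  | cat β γ hβ hγ =>
    simp only [outW, Option.or_eq_some_iff, Option.bind_eq_some_iff, Option.map_eq_some_iff] at h
    rcases h with h | ⟨-, v, hv, w, hw, rfl⟩
    · obtain ⟨⟨l, hl⟩, h2⟩ := hγ h0.2 h
      obtain ⟨y, hy⟩ := exists_mem_lang h0.1 i
      exact ⟨⟨y ++ l, RefExpr.mem_lang_cat.2 ⟨y, hy, _, hl, by simp⟩⟩, h2⟩
    · obtain ⟨⟨l, hl⟩, h2⟩ := hβ h0.1 hv
      obtain ⟨h3, h4⟩ := nullW_mem hw
      exact ⟨⟨l, RefExpr.mem_lang_cat.2 ⟨_, hl, _, h3, by simp⟩⟩, isBracketWord_append.2 ⟨h2, h4⟩⟩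
  | alt β γ hβ hγ =>
    simp only [outW, Option.or_eq_some_iff] at h
    rcases h with h | ⟨-, h⟩
    · obtain ⟨⟨l, hl⟩, h2⟩ := hβ h0.1 h
      exact ⟨⟨l, RefExpr.mem_lang_alt.2 (Or.inl hl)⟩, h2⟩
    · obtain ⟨⟨l, hl⟩, h2⟩ := hγ h0.2 h
      exact ⟨⟨l, RefExpr.mem_lang_alt.2 (Or.inr hl)⟩, h2⟩
  | plus β hβ =>
    obtain ⟨⟨l, hl⟩, h2⟩ := hβ h0 h
    exact ⟨⟨l, RefExpr.mem_plus_of_mem hl⟩, h2⟩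
  | bind x β hβ =>
    simp only [outW, Option.map_eq_some_iff] at h
    obtain ⟨v, hv, rfl⟩ := h
    obtain ⟨⟨l, hl⟩, h2⟩ := hβ h0.1 hv
    refine ⟨⟨(RefSym.op x, i) :: l, RefExpr.mem_lang_cat.2 ⟨_, rfl, _,
      RefExpr.mem_lang_cat.2 ⟨_, hl, _, rfl, rfl⟩, ?_⟩⟩,
      isBracketWord_append.2 ⟨h2, isBracketWord_cl x _⟩⟩
    simp only [slen, List.append_assoc, List.cons_append, List.nil_append]
    rfl

theorem mem_symbols_of_lasts {r : RefExpr Sym} {c : Sym} {ν : List Sym} (h : r.Lasts c ν) :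
    c ∈ r.symbols := by
  obtain ⟨l, hl⟩ := h
  exact RefExpr.mem_symbols_of_mem_lang hl c (by simp)

theorem not_mem_symbols_right {β γ : Regex A X} {i : ℕ} {c : Sym}
    (h : c ∈ (β.toRef.mark i).symbols) : c ∉ (γ.toRef.mark (i + β.slen)).symbols := by
  have h1 := RefExpr.nodup_symbols_mark (cat β γ).toRef i
  rw [mark_cat, RefExpr.symbols, List.nodup_append] at h1
  exact fun h2 => h1.2.2 c h c h2 rfl

/-- `c` lies in only one of the two factors because marks are unique, so the order of preference in
`outW` is irrelevant; for the parts that are passed, `nullW_complete` applies. -/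
theorem outW_complete {c : Sym} {β : Regex A X} {i : ℕ} {ν : List Sym} (h0 : β.WellFormed)
    (h : β.NullOK i) (hc : ¬ c.1.IsBracket) (hν : (β.toRef.mark i).Lasts c ν)
    (hb : IsBracketWord ν) : outW c β i = some ν := by
  induction β generalizing i ν with
  | empty => exact h0.elim
  | eps =>
    obtain ⟨l, hl⟩ := hν
    have hl : l ++ c :: ν = [] := hl
    simp at hl
  | sym a =>
    obtain ⟨l, hl⟩ := hν
    obtain ⟨rfl, rfl, rfl⟩ := append_cons_mem_sym.1 hl
    simp [outW]
  | ref a =>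
    obtain ⟨l, hl⟩ := hν
    obtain ⟨rfl, rfl, rfl⟩ := append_cons_mem_sym.1 hl
    simp [outW]
  | cat β γ hβ hγ =>
    rw [mark_cat, RefExpr.lasts_cat (exists_mem_lang h0.1 i)] at hν
    rw [outW]
    rcases hν with hν | ⟨v, w, rfl, hv, hw⟩
    · rw [hγ h0.2 h.2 hν hb, Option.some_or]
    · obtain ⟨h1, h2⟩ := isBracketWord_append.1 hb
      rw [hβ h0.1 h.1 hv h1, nullW_complete h.2 hw h2]
      have : outW c γ (i + β.slen) = none := by
        rw [Option.eq_none_iff_forall_not_mem]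
        intro u hu
        exact not_mem_symbols_right (mem_symbols_of_lasts hv)
          (mem_symbols_of_lasts (outW_lasts h0.2 hu).1)
      rw [this]
      rfl
  | alt β γ hβ hγ =>
    obtain ⟨l, hl⟩ := hν
    rw [outW]
    rcases RefExpr.mem_lang_alt.1 hl with hl | hl
    · rw [hβ h0.1 h.1 ⟨l, hl⟩ hb, Option.some_or]
    · have : outW c β i = none := by
        rw [Option.eq_none_iff_forall_not_mem]
        intro u hu
        exact not_mem_symbols_right (mem_symbols_of_lasts (outW_lasts h0.1 hu).1)
          (mem_symbols_of_lasts ⟨l, hl⟩)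
      rw [this, Option.none_or]
      exact hγ h0.2 h.2.1 ⟨l, hl⟩ hb
  | plus β hβ =>
    exact hβ h0 h.1 ((RefExpr.lasts_plus hb h.eq_nil).1 hν) hb
  | bind x β hβ =>
    rw [mark_bind, RefExpr.lasts_cat ⟨_, rfl⟩] at hν
    rcases hν with hν | ⟨v, w, rfl, ⟨l, hl⟩, -⟩
    · rw [RefExpr.lasts_cat (exists_mem_lang h0.1 _)] at hν
      rcases hν with ⟨l, hl⟩ | ⟨v, w, rfl, hv, rfl⟩
      · obtain ⟨rfl, rfl, rfl⟩ := append_cons_mem_sym.1 hl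
        exact absurd trivial hc
      · rw [outW, hβ h0.1 h hv (isBracketWord_append.1 hb).1]
        rfl
    · obtain ⟨rfl, rfl, rfl⟩ := append_cons_mem_sym.1 hl
      exact absurd trivial hc

theorem outW_iff {c : Sym} {β : Regex A X} {i : ℕ} {ν : List Sym} (h0 : β.WellFormed)
    (h : β.NullOK i) (hc : ¬ c.1.IsBracket) :
    outW c β i = some ν ↔ (β.toRef.mark i).Lasts c ν ∧ IsBracketWord ν :=
  ⟨outW_lasts h0, fun h' => outW_complete h0 h hc h'.1 h'.2⟩

theorem nullW_iff {β : Regex A X} {i : ℕ} {ν : List Sym} (h : β.NullOK i) :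
    nullW β i = some ν ↔ ν ∈ (β.toRef.mark i).lang ∧ IsBracketWord ν :=
  ⟨nullW_mem, fun h' => nullW_complete h h'.1 h'.2⟩

/-- The word `v` leads to the entrance. -/
def Enters (w : Option (List Sym × ℕ)) (v : List Sym) : Prop := ∃ p, w = some (v, p)

/-- `enter` prefers one of two ways; if they agree, no word is lost. -/
theorem enters_enter {a : Option (List Sym)} {p : ℕ} {w : Option (List Sym × ℕ)}
    (h : Agree a w) (v : List Sym) : Enters (enter a p w) v ↔ a = some v ∨ Enters w v := by
  cases a with
  | none => simp [Enters, enter]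
  | some a =>
    simp only [Enters, enter, Option.map_some, Option.some_or, Option.some.injEq, Prod.mk.injEq]
    constructor
    · rintro ⟨_, h1, -⟩
      exact Or.inl h1
    · rintro (h1 | ⟨q, rfl⟩)
      · exact ⟨p, h1, rfl⟩
      · exact ⟨p, h a v q rfl rfl, rfl⟩

theorem enters_pass {w : Option (List Sym × ℕ)} {n : Option (List Sym)} {v : List Sym} :
    Enters (pass w n) v ↔ ∃ v₁ v₂, v = v₁ ++ v₂ ∧ Enters w v₁ ∧ n = some v₂ := by
  constructor
  · rintro ⟨p, hp⟩
    simp only [pass, Option.bind_eq_some_iff, Option.map_eq_some_iff, Prod.mk.injEq] at hp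
    obtain ⟨⟨v₁, q⟩, rfl, v₂, rfl, rfl, rfl⟩ := hp
    exact ⟨v₁, v₂, rfl, ⟨_, rfl⟩, rfl⟩
  · rintro ⟨v₁, v₂, rfl, ⟨p, rfl⟩, rfl⟩
    exact ⟨p, rfl⟩

theorem enters_map {w : Option (List Sym × ℕ)} {u v : List Sym} :
    Enters (w.map fun a => (a.1 ++ u, a.2)) v ↔ ∃ v₁, v = v₁ ++ u ∧ Enters w v₁ := by
  constructor
  · rintro ⟨p, hp⟩
    simp only [Option.map_eq_some_iff, Prod.mk.injEq] at hp
    obtain ⟨⟨v₁, q⟩, rfl, rfl, rfl⟩ := hp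
    exact ⟨v₁, rfl, ⟨_, rfl⟩⟩
  · rintro ⟨v₁, rfl, ⟨p, rfl⟩⟩
    exact ⟨p, rfl⟩

/-- The node `d` can be reached by the bracket word `ν`. -/
def Reach (c : Sym) (β : Regex A X) (i : ℕ) (w : Option (List Sym × ℕ)) (ν : List Sym)
    (d : Sym) : Prop :=
  (β.toRef.mark i).Follows c ν d ∨
    ∃ v ν', ν = v ++ ν' ∧ Enters w v ∧ (β.toRef.mark i).Firsts ν' d

theorem reach_leaf {c b : Sym} {β : Regex A X} {i : ℕ} (hβ : β.toRef.mark i = RefExpr.sym b)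
    (w : Option (List Sym × ℕ)) (ν : List Sym) (d : Sym) :
    Reach c β i w ν d ↔ d = b ∧ Enters w ν := by
  rw [Reach, hβ]
  constructor
  · rintro (⟨l, t, h⟩ | ⟨v, ν', rfl, hv, t, h⟩)
    · have := congrArg List.length h
      simp at this
      omega
    · obtain ⟨rfl, rfl, rfl⟩ := append_cons_mem_sym.1 h
      exact ⟨rfl, by simpa using hv⟩
  · rintro ⟨rfl, h⟩
    exact Or.inr ⟨ν, [], by simp, h, [], rfl⟩

/-- The entrance of `γ` is reached by leaving `β` from `c`, or from the common entrance by passing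
`β` along its bracket word; `w'` stands for both. -/
theorem reach_cat {c d : Sym} {β γ : Regex A X} {i : ℕ} {w w' : Option (List Sym × ℕ)}
    {ν : List Sym} (h0 : (cat β γ).WellFormed) (h : (cat β γ).NullOK i)
    (hc : ¬ c.1.IsBracket) (hν : IsBracketWord ν)
    (hw' : ∀ v, Enters w' v ↔ outW c β i = some v ∨ Enters (pass w (nullW β i)) v) :
    Reach c (cat β γ) i w ν d ↔ Reach c γ (i + β.slen) w' ν d ∨ Reach c β i w ν d := by
  simp only [Reach, hw', mark_cat]
  rw [RefExpr.follows_cat (exists_mem_lang h0.1 i) (exists_mem_lang h0.2 _)]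
  simp only [RefExpr.firsts_cat (exists_mem_lang h0.2 _), enters_pass]
  constructor
  · rintro ((h1 | h1 | ⟨ν₁, ν₂, rfl, h1, h2⟩) | ⟨v, ν', rfl, hv, h1 | ⟨ν₁, ν₂, rfl, h1, h2⟩⟩)
    · exact Or.inr (Or.inl h1)
    · exact Or.inl (Or.inl h1)
    · refine Or.inl (Or.inr ⟨ν₁, ν₂, rfl, Or.inl ?_, h2⟩)
      exact outW_complete h0.1 h.1 hc h1 (isBracketWord_append.1 hν).1
    · exact Or.inr (Or.inr ⟨v, ν', rfl, hv, h1⟩)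
    · refine Or.inl (Or.inr ⟨v ++ ν₁, ν₂, by simp, Or.inr ⟨v, ν₁, rfl, hv, ?_⟩, h2⟩)
      exact nullW_complete h.1 h1 (isBracketWord_append.1 (isBracketWord_append.1 hν).2).1
  · rintro ((h1 | ⟨v, ν', rfl, hv | ⟨v₁, v₂, rfl, hv, h1⟩, h2⟩) | (h1 | ⟨v, ν', rfl, hv, h1⟩))
    · exact Or.inl (Or.inr (Or.inl h1))
    · exact Or.inl (Or.inr (Or.inr ⟨v, ν', rfl, (outW_lasts h0.1 hv).1, h2⟩))
    · exact Or.inr ⟨v₁, v₂ ++ ν', by simp, hv, Or.inr ⟨v₂, ν', rfl, (nullW_mem h1).1, h2⟩⟩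
    · exact Or.inl (Or.inl h1)
    · exact Or.inr ⟨v, ν', rfl, hv, Or.inl h1⟩

theorem reach_alt {c d : Sym} {β γ : Regex A X} {i : ℕ} {w : Option (List Sym × ℕ)}
    {ν : List Sym} :
    Reach c (alt β γ) i w ν d ↔ Reach c γ (i + β.slen) w ν d ∨ Reach c β i w ν d := by
  simp only [Reach, mark_alt, RefExpr.Follows, RefExpr.Firsts, RefExpr.mem_lang_alt]
  constructor
  · rintro (⟨l, t, h | h⟩ | ⟨v, ν', rfl, hv, t, h | h⟩)
    · exact Or.inr (Or.inl ⟨l, t, h⟩)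
    · exact Or.inl (Or.inl ⟨l, t, h⟩)
    · exact Or.inr (Or.inr ⟨v, ν', rfl, hv, t, h⟩)
    · exact Or.inl (Or.inr ⟨v, ν', rfl, hv, t, h⟩)
  · rintro ((⟨l, t, h⟩ | ⟨v, ν', rfl, hv, t, h⟩) | (⟨l, t, h⟩ | ⟨v, ν', rfl, hv, t, h⟩))
    · exact Or.inl ⟨l, t, Or.inr h⟩
    · exact Or.inr ⟨v, ν', rfl, hv, t, Or.inr h⟩
    · exact Or.inl ⟨l, t, Or.inl h⟩
    · exact Or.inr ⟨v, ν', rfl, hv, t, Or.inl h⟩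

/-- The body is entered from outside or, after leaving it from `c`, once more; intermediate
iterations contribute nothing because the body has no nonempty bracket word. -/
theorem reach_plus {c d : Sym} {β : Regex A X} {i : ℕ} {w w' : Option (List Sym × ℕ)}
    {ν : List Sym} (h0 : (plus β).WellFormed) (h : (plus β).NullOK i)
    (hc : ¬ c.1.IsBracket) (hν : IsBracketWord ν)
    (hw' : ∀ v, Enters w' v ↔ outW c β i = some v ∨ Enters w v) :
    Reach c (plus β) i w ν d ↔ Reach c β i w' ν d := by
  simp only [Reach, hw', mark_plus]
  rw [RefExpr.follows_plus hν h.eq_nil]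
  constructor
  · rintro ((h1 | ⟨ν₁, ν₂, rfl, h1, h2⟩) | ⟨v, ν', rfl, hv, h1⟩)
    · exact Or.inl h1
    · refine Or.inr ⟨ν₁, ν₂, rfl, Or.inl ?_, h2⟩
      exact outW_complete h0 h.1 hc h1 (isBracketWord_append.1 hν).1
    · refine Or.inr ⟨v, ν', rfl, Or.inr hv, ?_⟩
      exact (RefExpr.firsts_plus (isBracketWord_append.1 hν).2 h.eq_nil).1 h1
  · rintro (h1 | ⟨v, ν', rfl, hv | hv, h2⟩)
    · exact Or.inl (Or.inl h1)
    · exact Or.inl (Or.inr ⟨v, ν', rfl, (outW_lasts (β := β) h0 hv).1, h2⟩)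
    · refine Or.inr ⟨v, ν', rfl, hv, ?_⟩
      exact (RefExpr.firsts_plus (isBracketWord_append.1 hν).2 h.eq_nil).2 h2

theorem reach_bind {c d : Sym} {x : X} {β : Regex A X} {i : ℕ} {w : Option (List Sym × ℕ)}
    {ν : List Sym} (h0 : (bind x β).WellFormed) (hc : ¬ c.1.IsBracket) (hd : ¬ d.1.IsBracket) :
    Reach c (bind x β) i w ν d ↔
      Reach c β (i + 1) (w.map fun v => (v.1 ++ [(RefSym.op x, i)], v.2)) ν d := by
  have hn := exists_mem_lang h0.1 (i + 1)
  have hn' : ∃ y, y ∈ (RefExpr.cat (β.toRef.mark (i + 1))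
      (RefExpr.sym (RefSym.cl x, i + 1 + β.slen))).lang :=
    ⟨_, RefExpr.mem_lang_cat.2 ⟨_, hn.choose_spec, _, rfl, rfl⟩⟩
  -- `c` and `d` are not brackets, so the two bracket leaves of the binding neither start nor end a
  -- path; this disposes of most cases of the concatenations.
  have hl : ∀ {b : Sym} {μ : List Sym}, b.1.IsBracket → ¬ (RefExpr.sym b).Lasts c μ := by
    rintro b μ hb ⟨l, hl⟩
    obtain ⟨-, rfl, -⟩ := append_cons_mem_sym.1 hl
    exact hc hb
  have hf : ∀ {b : Sym} {μ : List Sym}, b.1.IsBracket → ¬ (RefExpr.sym b).Firsts μ d := by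
    rintro b μ hb ⟨l, hl⟩
    obtain ⟨-, rfl, -⟩ := append_cons_mem_sym.1 hl
    exact hd hb
  have hF : ∀ {b : Sym} {μ : List Sym}, b.1.IsBracket → ¬ (RefExpr.sym b).Follows c μ d := by
    rintro b μ hb ⟨l, t, hl⟩
    obtain ⟨-, rfl, -⟩ := append_cons_mem_sym.1 hl
    exact hc hb
  have ho : ((RefSym.op x, i) : Sym).1.IsBracket := trivial
  have hcl : ((RefSym.cl x, i + 1 + β.slen) : Sym).1.IsBracket := trivial
  have hf2 : ∀ μ, (RefExpr.cat (β.toRef.mark (i + 1))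
      (RefExpr.sym (RefSym.cl x, i + 1 + β.slen))).Firsts μ d ↔
        (β.toRef.mark (i + 1)).Firsts μ d := fun μ => by
    rw [RefExpr.firsts_cat ⟨_, rfl⟩]
    simp only [hf hcl, and_false, or_false, exists_false]
  simp only [Reach, mark_bind]
  rw [RefExpr.follows_cat ⟨_, rfl⟩ hn', RefExpr.follows_cat hn ⟨_, rfl⟩]
  simp only [RefExpr.firsts_cat hn', hf2,
    enters_map, hl ho, hF ho, hF hcl, hf ho, hf hcl, false_and, and_false, false_or, or_false,
    exists_false]
  refine or_congr Iff.rfl ⟨?_, ?_⟩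
  · rintro ⟨v, ν', rfl, hv, ν₁, ν₂, rfl, rfl, h⟩
    exact ⟨v ++ [_], ν₂, by simp, ⟨v, rfl, hv⟩, h⟩
  · rintro ⟨v, ν', rfl, ⟨v₁, rfl, hv⟩, h⟩
    exact ⟨v₁, [_] ++ ν', by simp, hv, [_], ν', rfl, rfl, h⟩

theorem pass_bracket {w : Option (List Sym × ℕ)} {β : Regex A X} {i : ℕ}
    (hw : ∀ v, Enters w v → IsBracketWord v) {v : List Sym} (h : Enters (pass w (nullW β i)) v) :
    IsBracketWord v := by
  obtain ⟨v₁, v₂, rfl, h1, h2⟩ := enters_pass.1 h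
  exact isBracketWord_append.2 ⟨hw v₁ h1, (nullW_mem h2).2⟩

theorem mem_leaf_targets_iff {b c : Sym} {β : Regex A X} {o i : ℕ} {w : Option (List Sym × ℕ)}
    (hb : ¬ b.1.IsBracket) (hβ : β.toRef.mark i = RefExpr.sym b)
    (hw : ∀ v, Enters w v → IsBracketWord v) (d : Sym) (ν : List Sym) :
    (∃ e ∈ (w.map fun v => (⟨b, v.1, o, v.2⟩ : Target A X)).toList, e.node = d ∧ e.word = ν) ↔
      IsBracketWord ν ∧ ¬ d.1.IsBracket ∧ Reach c β i w ν d := by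
  rw [reach_leaf hβ]
  constructor
  · rintro ⟨e, he, rfl, rfl⟩
    rw [Option.mem_toList, Option.map_eq_some_iff] at he
    obtain ⟨⟨v, p⟩, rfl, rfl⟩ := he
    exact ⟨hw v ⟨p, rfl⟩, hb, rfl, p, rfl⟩
  · rintro ⟨-, -, rfl, p, rfl⟩
    exact ⟨⟨d, ν, o, p⟩, by simp, rfl, rfl⟩

/-- Under the two uniqueness conditions a single word represents all ways to an entrance. So the
recursion may hand down one word instead of a set of words, and the lemmas on `Reach` match its
clauses. -/
theorem mem_targets_iff {c : Sym} {β : Regex A X} (hc : ¬ c.1.IsBracket)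
    (h0 : β.WellFormed) {o i : ℕ} {w : Option (List Sym × ℕ)} (h : β.NullOK i)
    (hw : ∀ v, Enters w v → IsBracketWord v) (hI : β.InOK c o i w) (d : Sym) (ν : List Sym) :
    (∃ e ∈ targets c β o i w, e.node = d ∧ e.word = ν) ↔
      IsBracketWord ν ∧ ¬ d.1.IsBracket ∧ Reach c β i w ν d := by
  induction β generalizing o i w with
  | empty => exact h0.elim
  | eps =>
    constructor
    · rintro ⟨e, he, -⟩
      exact absurd he (by simp [targets])
    · rintro ⟨-, -, ⟨l, t, h⟩ | ⟨v, ν', rfl, hv, t, h⟩⟩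
      · have h : l ++ c :: (ν ++ d :: t) = [] := h
        simp at h
      · have h : ν' ++ d :: t = [] := h
        simp at h
  | sym a => exact mem_leaf_targets_iff (β := sym a) (by exact id) rfl hw d ν
  | ref x => exact mem_leaf_targets_iff (β := ref x) (by exact id) rfl hw d ν
  | cat β γ hβ hγ =>
    have hw' := fun v => enters_enter (p := o + β.size + γ.size) hI.2.2 v
    have hwb : ∀ v, Enters (enter (outW c β i) (o + β.size + γ.size) (pass w (nullW β i))) v →
        IsBracketWord v := fun v hv => ((hw' v).1 hv).elim (fun h => (outW_lasts h0.1 h).2)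
          (pass_bracket hw)
    have h1 := hβ h0.1 h.1 hw hI.2.1
    have h2 := hγ h0.2 h.2 hwb hI.1
    simp only [targets, List.mem_append, or_and_right, exists_or]
    rw [h1, h2, ← and_or_left, ← and_or_left]
    exact and_congr_right fun hν => and_congr_right fun _ => (reach_cat h0 h hc hν hw').symm
  | alt β γ hβ hγ =>
    have h1 := hβ h0.1 h.1 hw hI.2
    have h2 := hγ h0.2 h.2.1 hw hI.1
    simp only [targets, List.mem_append, or_and_right, exists_or]
    rw [h1, h2, ← and_or_left, ← and_or_left, reach_alt]
  | plus β hβ =>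
    have hw' := fun v => enters_enter (p := o + β.size) hI.2 v
    have h1 := hβ h0 h.1 (fun v hv => ((hw' v).1 hv).elim (fun h => (outW_lasts (β := β) h0 h).2)
      (hw v)) hI.1
    rw [targets, h1]
    exact and_congr_right fun hν => and_congr_right fun _ => (reach_plus h0 h hc hν hw').symm
  | bind x β hβ =>
    have h1 := hβ h0.1 h (fun v hv => by
      obtain ⟨v, rfl, hv'⟩ := enters_map.1 hv
      exact isBracketWord_append.2 ⟨hw v hv', isBracketWord_op x i⟩) hI
    rw [targets, h1]
    exact and_congr_right fun hν => and_congr_right fun hd => (reach_bind h0 hc hd).symm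

end Regex

/-! ### Determinism by structural recursion -/

namespace Regex

variable {A X : Type*}

local notation "Sym" => (RefSym A X × ℕ)

theorem lang_mark_one (α : Regex A X) : (α.toRef.mark 1).lang = α.markedLang := rfl

theorem mem_lang_bind {x : X} {β : Regex A X} {i : ℕ} {y : List Sym}
    (hy : y ∈ (β.toRef.mark (i + 1)).lang) :
    (RefSym.op x, i) :: (y ++ [(RefSym.cl x, i + 1 + β.slen)]) ∈
      ((bind x β).toRef.mark i).lang :=
  RefExpr.mem_lang_cat.2 ⟨_, rfl, _, RefExpr.mem_lang_cat.2 ⟨y, hy, _, rfl, rfl⟩, rfl⟩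

/-- The brackets at the start of the common rest `r` are added to both labels; they lead to the same
next node or to the sink, and a common suffix does not hide the difference. The pasts may differ,
since an edge only remembers its source. -/
theorem conflict_of_words {α : Regex A X} {u : Option α.Node} {l₁ l₂ γ₁ γ₂ r : List Sym}
    (h₁ : l₁ ++ γ₁ ++ r ∈ α.markedLang) (h₂ : l₂ ++ γ₂ ++ r ∈ α.markedLang)
    (hl₁ : l₁.getLast? = u.map Subtype.val) (hl₂ : l₂.getLast? = u.map Subtype.val)
    (hγ₁ : IsBracketWord γ₁) (hγ₂ : IsBracketWord γ₂) (hne : γ₁ ≠ γ₂) : α.Conflict := by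
  obtain ⟨μ, s, rfl, hμ, hs⟩ := exists_split_brackets r
  obtain ⟨v, hv⟩ : ∃ v : Option α.Node, s.head? = v.map Subtype.val := by
    rcases s with _ | ⟨c, s⟩
    · exact ⟨none, rfl⟩
    · exact ⟨some ⟨c, mem_symbols_of_mem_markedLang h₁ c (by simp), hs c (by simp)⟩, rfl⟩
  exact ⟨u, γ₁ ++ μ, γ₂ ++ μ, v, v,
    ⟨isBracketWord_append.2 ⟨hγ₁, hμ⟩, l₁, s, by simpa using h₁, hl₁, hv⟩,
    ⟨isBracketWord_append.2 ⟨hγ₂, hμ⟩, l₂, s, by simpa using h₂, hl₂, hv⟩,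
    Or.inl ⟨rfl, by simpa using hne⟩⟩

/-- The common past need not end in a node; its trailing brackets are moved into both labels. -/
theorem conflict_of_null_words {α : Regex A X} {l γ₁ γ₂ r : List Sym}
    (h₁ : l ++ γ₁ ++ r ∈ α.markedLang) (h₂ : l ++ γ₂ ++ r ∈ α.markedLang)
    (hγ₁ : IsBracketWord γ₁) (hγ₂ : IsBracketWord γ₂) (hne : γ₁ ≠ γ₂) : α.Conflict := by
  obtain ⟨u, l, μ, rfl, hμ, hl⟩ := α.exists_source l fun c hc =>
    mem_symbols_of_mem_markedLang h₁ c (by simp [hc])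
  refine conflict_of_words (γ₁ := μ ++ γ₁) (γ₂ := μ ++ γ₂) (r := r) ?_ ?_ hl hl
    (isBracketWord_append.2 ⟨hμ, hγ₁⟩) (isBracketWord_append.2 ⟨hμ, hγ₂⟩) (by simpa using hne)
  · simpa using h₁
  · simpa using h₂

/-- `l` and `r` form a context that completes every word of `β` to a marked word. A violation
consists of two alternatives with bracket words that are not both empty, or of a nonempty bracket
word that may be repeated; either way, two different bracket words fit into the same context. -/
theorem conflict_of_not_nullOK {α β : Regex A X} {i : ℕ} {l r : List Sym} (h0 : β.WellFormed)
    (h : ∀ y ∈ (β.toRef.mark i).lang, l ++ y ++ r ∈ α.markedLang) (hβ : ¬ β.NullOK i) :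
    α.Conflict := by
  induction β generalizing i l r with
  | empty => exact h0.elim
  | eps => exact absurd trivial hβ
  | sym a => exact absurd trivial hβ
  | ref x => exact absurd trivial hβ
  | cat β γ ihβ ihγ =>
    obtain ⟨y, hy⟩ := exists_mem_lang h0.1 i
    obtain ⟨z, hz⟩ := exists_mem_lang h0.2 (i + β.slen)
    by_cases h1 : β.NullOK i
    · refine ihγ (i := i + β.slen) (l := l ++ y) (r := r) h0.2 (fun z hz => ?_)
        fun h2 => hβ ⟨h1, h2⟩
      simpa using h _ (RefExpr.mem_lang_cat.2 ⟨y, hy, z, hz, rfl⟩)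
    · refine ihβ (l := l) (r := z ++ r) h0.1 (fun y hy => ?_) h1
      simpa using h _ (RefExpr.mem_lang_cat.2 ⟨y, hy, z, hz, rfl⟩)
  | alt β γ ihβ ihγ =>
    by_cases h1 : β.NullOK i
    · by_cases h2 : γ.NullOK (i + β.slen)
      · have : ∃ v w, nullW β i = some v ∧ nullW γ (i + β.slen) = some w ∧ ¬ (v = [] ∧ w = []) := by
          by_contra hcon
          push Not at hcon
          exact hβ ⟨h1, h2, fun v w hv hw => ⟨(hcon v w hv hw).1, (hcon v w hv hw).2⟩⟩
        obtain ⟨v, w, hv, hw, hvw⟩ := this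
        obtain ⟨hv, hvb⟩ := nullW_mem hv
        obtain ⟨hw, hwb⟩ := nullW_mem hw
        refine conflict_of_null_words (h v (RefExpr.mem_lang_alt.2 (Or.inl hv)))
          (h w (RefExpr.mem_lang_alt.2 (Or.inr hw))) hvb hwb ?_
        -- Equal nonempty words of the two alternatives would share a marked symbol.
        rintro rfl
        rcases v with _ | ⟨c, v⟩
        · exact hvw ⟨rfl, rfl⟩
        · exact not_mem_symbols_right (RefExpr.mem_symbols_of_mem_lang hv c (by simp))
            (RefExpr.mem_symbols_of_mem_lang hw c (by simp))
      · exact ihγ h0.2 (fun y hy => h y (RefExpr.mem_lang_alt.2 (Or.inr hy))) h2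
    · exact ihβ h0.1 (fun y hy => h y (RefExpr.mem_lang_alt.2 (Or.inl hy))) h1
  | plus β ihβ =>
    by_cases h1 : β.NullOK i
    · have : ∃ v, nullW β i = some v ∧ v ≠ [] := by
        by_contra hcon
        push Not at hcon
        exact hβ ⟨h1, hcon⟩
      obtain ⟨v, hv, hne⟩ := this
      obtain ⟨hv, hvb⟩ := nullW_mem hv
      -- One and two iterations of the nonempty bracket word compete.
      refine conflict_of_null_words (h v (RefExpr.mem_plus_of_mem hv))
        (h (v ++ v) (RefExpr.append_mem_plus (RefExpr.mem_plus_of_mem hv)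
          (RefExpr.mem_plus_of_mem hv))) hvb (isBracketWord_append.2 ⟨hvb, hvb⟩) ?_
      simpa using hne
    · exact ihβ h0 (fun y hy => h y (RefExpr.mem_plus_of_mem hy)) h1
  | bind x β ihβ =>
    refine ihβ (i := i + 1) (l := l ++ [(RefSym.op x, i)]) (r := (RefSym.cl x, i + 1 + β.slen) :: r)
      h0.1 (fun y hy => ?_) hβ
    simpa using h _ (mem_lang_bind hy)

theorem conflict_of_not_agree {α : Regex A X} {u : Option α.Node} {a : Option (List Sym)}
    {w : Option (List Sym × ℕ)} {y r : List Sym}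
    (ha : ∀ v, a = some v → IsBracketWord v ∧
      ∃ l, l.getLast? = u.map Subtype.val ∧ l ++ v ++ (y ++ r) ∈ α.markedLang)
    (hw : ∀ v, Enters w v → IsBracketWord v ∧
      ∃ l, l.getLast? = u.map Subtype.val ∧ l ++ v ++ (y ++ r) ∈ α.markedLang)
    (h : ¬ Agree a w) : α.Conflict := by
  obtain ⟨v, v', p, rfl, rfl, hne⟩ : ∃ v v' p, a = some v ∧ w = some (v', p) ∧ v ≠ v' := by
    by_contra hcon
    push Not at hcon
    exact h hcon
  obtain ⟨hb, l, hl, hm⟩ := ha v rfl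
  obtain ⟨hb', l', hl', hm'⟩ := hw v' ⟨p, rfl⟩
  exact conflict_of_words hm hm' hl hl' hb hb' hne

/-- Two words that disagree lead from the source to the same entrance, and every word of the
subexpression continues both, so they are different labels on the way to a common target. `hu`
identifies occurrences of `c` with the source; for the beginning it holds vacuously, since the mark
`0` does not occur. `w` is only assumed to be compatible with all words of `β` because the recursion
changes the subexpression. -/
theorem conflict_of_not_inOK {α β : Regex A X} {c : Sym} {u : Option α.Node}
    (hu : ∀ l t, l ++ c :: t ∈ α.markedLang → some c = u.map Subtype.val)
    {o i : ℕ} {w : Option (List Sym × ℕ)} {l₀ r : List Sym} (h0 : β.WellFormed)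
    (h : ∀ y ∈ (β.toRef.mark i).lang, l₀ ++ y ++ r ∈ α.markedLang)
    (hw : ∀ v, Enters w v → IsBracketWord v ∧ ∀ y ∈ (β.toRef.mark i).lang,
      ∃ l, l.getLast? = u.map Subtype.val ∧ l ++ v ++ (y ++ r) ∈ α.markedLang)
    (hI : ¬ β.InOK c o i w) : α.Conflict := by
  have enter_or : ∀ {a : Option (List Sym)} {p : ℕ} {w : Option (List Sym × ℕ)} {v : List Sym},
      Enters (enter a p w) v → a = some v ∨ Enters w v := by
    rintro a p w v ⟨q, hq⟩
    rw [enter, Option.or_eq_some_iff, Option.map_eq_some_iff] at hq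
    rcases hq with ⟨v', h1, h2⟩ | ⟨-, h2⟩
    · cases h2; exact Or.inl h1
    · exact Or.inr ⟨q, h2⟩
  induction β generalizing o i w l₀ r with
  | empty => exact h0.elim
  | eps => exact absurd trivial hI
  | sym a => exact absurd trivial hI
  | ref x => exact absurd trivial hI
  | cat β γ ihβ ihγ =>
    obtain ⟨y, hy⟩ := exists_mem_lang h0.1 i
    obtain ⟨z, hz⟩ := exists_mem_lang h0.2 (i + β.slen)
    have key1 : ∀ z ∈ (γ.toRef.mark (i + β.slen)).lang, ∀ v, outW c β i = some v →
        IsBracketWord v ∧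
        ∃ l, l.getLast? = u.map Subtype.val ∧ l ++ v ++ (z ++ r) ∈ α.markedLang := by
      intro z hz v hv
      obtain ⟨⟨l, hl⟩, hb⟩ := outW_lasts h0.1 hv
      have h1 := h _ (RefExpr.mem_lang_cat.2 ⟨_, hl, z, hz, rfl⟩)
      refine ⟨hb, l₀ ++ (l ++ [c]), ?_, by simpa using h1⟩
      rw [← List.append_assoc, List.getLast?_concat]
      exact hu (l₀ ++ l) (v ++ (z ++ r)) (by simpa using h1)
    have key2 : ∀ z ∈ (γ.toRef.mark (i + β.slen)).lang, ∀ v, Enters (pass w (nullW β i)) v →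
        IsBracketWord v ∧
        ∃ l, l.getLast? = u.map Subtype.val ∧ l ++ v ++ (z ++ r) ∈ α.markedLang := by
      intro z hz v hv
      obtain ⟨v₁, v₂, rfl, h1, h2⟩ := enters_pass.1 hv
      obtain ⟨h2, h3⟩ := nullW_mem h2
      obtain ⟨h4, h5⟩ := hw v₁ h1
      obtain ⟨l, hl, hm⟩ := h5 _ (RefExpr.mem_lang_cat.2 ⟨_, h2, z, hz, rfl⟩)
      exact ⟨isBracketWord_append.2 ⟨h4, h3⟩, l, hl, by simpa using hm⟩
    by_cases hA : Agree (outW c β i) (pass w (nullW β i))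
    · by_cases h1 : β.InOK c o i w
      · refine ihγ (l₀ := l₀ ++ y) (r := r) h0.2 (fun z hz => ?_) (fun v hv => ?_)
          fun h2 => hI ⟨h2, h1, hA⟩
        · simpa using h _ (RefExpr.mem_lang_cat.2 ⟨y, hy, z, hz, rfl⟩)
        · rcases enter_or hv with hv | hv
          · exact ⟨(key1 z hz v hv).1, fun z hz => (key1 z hz v hv).2⟩
          · exact ⟨(key2 z hz v hv).1, fun z hz => (key2 z hz v hv).2⟩
      · refine ihβ (l₀ := l₀) (r := z ++ r) h0.1 (fun y hy => ?_) (fun v hv => ?_) h1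
        · simpa using h _ (RefExpr.mem_lang_cat.2 ⟨y, hy, z, hz, rfl⟩)
        · refine ⟨(hw v hv).1, fun y hy => ?_⟩
          obtain ⟨l, hl, hm⟩ := (hw v hv).2 _ (RefExpr.mem_lang_cat.2 ⟨y, hy, z, hz, rfl⟩)
          exact ⟨l, hl, by simpa using hm⟩
    · exact conflict_of_not_agree (key1 z hz) (key2 z hz) hA
  | alt β γ ihβ ihγ =>
    by_cases h1 : γ.InOK c (o + β.size) (i + β.slen) w
    · refine ihβ (l₀ := l₀) (r := r) h0.1 (fun y hy => h y (RefExpr.mem_lang_alt.2 (Or.inl hy)))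
        (fun v hv => ⟨(hw v hv).1, fun y hy => ?_⟩) fun h2 => hI ⟨h1, h2⟩
      exact (hw v hv).2 y (RefExpr.mem_lang_alt.2 (Or.inl hy))
    · refine ihγ (l₀ := l₀) (r := r) h0.2 (fun y hy => h y (RefExpr.mem_lang_alt.2 (Or.inr hy)))
        (fun v hv => ⟨(hw v hv).1, fun y hy => ?_⟩) h1
      exact (hw v hv).2 y (RefExpr.mem_lang_alt.2 (Or.inr hy))
  | plus β ihβ =>
    obtain ⟨y, hy⟩ := exists_mem_lang (β := β) h0 i
    have key1 : ∀ z ∈ (β.toRef.mark i).lang, ∀ v, outW c β i = some v →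
        IsBracketWord v ∧
        ∃ l, l.getLast? = u.map Subtype.val ∧ l ++ v ++ (z ++ r) ∈ α.markedLang := by
      intro z hz v hv
      obtain ⟨⟨l, hl⟩, hb⟩ := outW_lasts (β := β) h0 hv
      have h1 := h _ (RefExpr.append_mem_plus (RefExpr.mem_plus_of_mem hl)
        (RefExpr.mem_plus_of_mem hz))
      refine ⟨hb, l₀ ++ (l ++ [c]), ?_, by simpa using h1⟩
      rw [← List.append_assoc, List.getLast?_concat]
      exact hu (l₀ ++ l) (v ++ (z ++ r)) (by simpa using h1)
    have key2 : ∀ z ∈ (β.toRef.mark i).lang, ∀ v, Enters w v → IsBracketWord v ∧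
        ∃ l, l.getLast? = u.map Subtype.val ∧ l ++ v ++ (z ++ r) ∈ α.markedLang :=
      fun z hz v hv => ⟨(hw v hv).1, (hw v hv).2 z (RefExpr.mem_plus_of_mem hz)⟩
    by_cases hA : Agree (outW c β i) w
    · refine ihβ (l₀ := l₀) (r := r) h0 (fun y hy => h y (RefExpr.mem_plus_of_mem hy))
        (fun v hv => ?_) fun h2 => hI ⟨h2, hA⟩
      rcases enter_or hv with hv | hv
      · exact ⟨(key1 y hy v hv).1, fun z hz => (key1 z hz v hv).2⟩
      · exact ⟨(key2 y hy v hv).1, fun z hz => (key2 z hz v hv).2⟩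
    · exact conflict_of_not_agree (key1 y hy) (key2 y hy) hA
  | bind x β ihβ =>
    refine ihβ (l₀ := l₀ ++ [(RefSym.op x, i)]) (r := (RefSym.cl x, i + 1 + β.slen) :: r)
      h0.1 (fun y hy => ?_) (fun v hv => ?_) hI
    · simpa using h _ (mem_lang_bind hy)
    · obtain ⟨v, rfl, hv'⟩ := enters_map.1 hv
      refine ⟨isBracketWord_append.2 ⟨(hw v hv').1, isBracketWord_op x i⟩, fun y hy => ?_⟩
      obtain ⟨l, hl, hm⟩ := (hw v hv').2 _ (mem_lang_bind hy)
      exact ⟨l, hl, by simpa using hm⟩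

/-- The marked symbol and the entrance that represent a source node; the mark `0` stands for the
beginning. -/
def IsSource (α : Regex A X) (u : Option α.Node) (c : Sym) (w : Option (List Sym × ℕ)) : Prop :=
  ¬ c.1.IsBracket ∧ match u with
    | some n => c = n.1 ∧ w = none
    | none => c.2 = 0 ∧ w = some ([], α.size)

theorem mark_pos_of_mem_symbols {α : Regex A X} {c : Sym} (h : c ∈ α.marked.symbols) :
    1 ≤ c.2 := by
  have : c.2 ∈ α.marked.symbols.map Prod.snd := List.mem_map_of_mem h
  rw [marked, RefExpr.symbols_mark_snd, List.mem_range'_1] at this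
  exact this.1

theorem IsSource.bracket {α : Regex A X} {u : Option α.Node} {c : Sym}
    {w : Option (List Sym × ℕ)} (h : α.IsSource u c w) (v : List Sym) (hv : Enters w v) :
    v = [] := by
  obtain ⟨p, rfl⟩ := hv
  rcases u with _ | n
  · have := h.2.2
    simp at this
    exact this.1
  · exact absurd h.2.2 (by simp)

theorem IsSource.eq {α : Regex A X} {u : Option α.Node} {c : Sym}
    {w : Option (List Sym × ℕ)} (h : α.IsSource u c w) (l t : List Sym)
    (hm : l ++ c :: t ∈ α.markedLang) : some c = u.map Subtype.val := by
  rcases u with _ | n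
  · have := mark_pos_of_mem_symbols (mem_symbols_of_mem_markedLang hm c (by simp))
    rw [h.2.1] at this
    omega
  · rw [h.2.1]
    rfl

/-- A node as source comes without an entrance, so only paths inside of the expression count. The
beginning has the empty entrance word, and its symbol does not occur, so only paths through the
entrance count. -/
theorem edge_iff_reach {α : Regex A X} {u : Option α.Node} {c : Sym}
    {w : Option (List Sym × ℕ)} (h : α.IsSource u c w) (ν : List Sym) (n : α.Node) :
    α.Edge u ν (some n) ↔ IsBracketWord ν ∧ Reach c α 1 w ν n.1 := by
  refine and_congr_right fun hν => ⟨?_, ?_⟩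
  · rintro ⟨l, r, hm, hl, hr⟩
    obtain ⟨s, rfl⟩ : ∃ s', r = n.1 :: s' := by
      cases r with
      | nil => cases hr
      | cons c r => exact ⟨r, by rw [Option.some.inj hr]⟩
    rcases u with _ | m
    · obtain rfl : l = [] := by simpa [lang_mark_one] using hl
      refine Or.inr ⟨[], ν, rfl, ⟨_, h.2.2⟩, s, hm⟩
    · obtain ⟨l, rfl⟩ := List.getLast?_eq_some_iff.1 hl
      refine Or.inl ⟨l, s, ?_⟩
      rw [h.2.1]
      simpa [lang_mark_one] using hm
  · rintro (⟨l, t, hm⟩ | ⟨v, ν, rfl, hv, t, hm⟩)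
    · exact ⟨l ++ [c], n.1 :: t, by simpa [lang_mark_one] using hm, by
        rw [List.getLast?_concat]; exact h.eq l _ hm, rfl⟩
    · rcases u with _ | m
      · rw [h.bracket v hv]
        exact ⟨[], n.1 :: t, hm, rfl, rfl⟩
      · obtain ⟨p, hp⟩ := hv
        rw [h.2.2] at hp
        cases hp

theorem edge_some_iff {α : Regex A X} {u : Option α.Node} {c : Sym}
    {w : Option (List Sym × ℕ)} (h : α.IsSource u c w) (h0 : α.WellFormed) (hN : α.NullOK 1)
    (hI : α.InOK c 0 1 w) (ν : List Sym) (n : α.Node) :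
    α.Edge u ν (some n) ↔ ∃ e ∈ targets c α 0 1 w, e.node = n.1 ∧ e.word = ν := by
  rw [edge_iff_reach h, mem_targets_iff h.1 h0 hN
    (fun v hv => by rw [h.bracket v hv]; exact isBracketWord_nil) hI]
  exact and_congr_right fun _ => (and_iff_right n.2.2).symm

theorem edge_none_none_iff {α : Regex A X} (hN : α.NullOK 1) (ν : List Sym) :
    α.Edge none ν none ↔ nullW α 1 = some ν := by
  rw [nullW_iff hN, and_comm]
  refine and_congr_right fun hν => ⟨?_, fun h => ⟨[], [], by simpa [lang_mark_one] using h, rfl, rfl⟩⟩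
  rintro ⟨l, r, hm, hl, hr⟩
  obtain rfl : l = [] := by simpa [lang_mark_one] using hl
  obtain rfl : r = [] := by simpa using hr
  simpa [lang_mark_one] using hm

theorem edge_some_none_iff {α : Regex A X} (h0 : α.WellFormed) (hN : α.NullOK 1) (n : α.Node)
    (ν : List Sym) : α.Edge (some n) ν none ↔ outW n.1 α 1 = some ν := by
  rw [outW_iff h0 hN n.2.2, and_comm]
  refine and_congr_right fun hν => ⟨?_, ?_⟩
  · rintro ⟨l, r, hm, hl, hr⟩
    obtain rfl : r = [] := by simpa using hr
    obtain ⟨l, rfl⟩ := List.getLast?_eq_some_iff.1 hl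
    exact ⟨l, by simpa [lang_mark_one] using hm⟩
  · rintro ⟨l, hl⟩
    exact ⟨l ++ [n.1], [], by simpa [lang_mark_one] using hl, List.getLast?_concat.trans rfl, rfl⟩

/-- `targets` visits the leaves from right to left and yields each of them at most once. Hence a
node is never listed with two words. -/
theorem nodes_sublist (c : Sym) (β : Regex A X) (o i : ℕ) (w : Option (List Sym × ℕ)) :
    ((targets c β o i w).map Target.node).Sublist (β.toRef.mark i).symbols.reverse := by
  induction β generalizing o i w with
  | empty => simp [targets]
  | eps => simp [targets]
  | sym a => cases w <;> simp [targets, toRef, RefExpr.mark, RefExpr.symbols]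
  | ref x => cases w <;> simp [targets, toRef, RefExpr.mark, RefExpr.symbols]
  | cat β γ hβ hγ =>
    rw [targets, mark_cat, RefExpr.symbols, List.reverse_append, List.map_append]
    exact (hγ _ _ _).append (hβ _ _ _)
  | alt β γ hβ hγ =>
    rw [targets, mark_alt, RefExpr.symbols, List.reverse_append, List.map_append]
    exact (hγ _ _ _).append (hβ _ _ _)
  | plus β hβ => exact hβ _ _ _
  | bind x β hβ =>
    rw [targets, mark_bind, RefExpr.symbols, RefExpr.symbols, List.reverse_append,
      RefExpr.symbols, List.reverse_append]
    refine (hβ _ _ _).trans ?_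
    rw [List.append_assoc]
    exact (List.sublist_append_left _ _).trans (List.sublist_append_right _ _)

theorem nodup_nodes (c : Sym) (β : Regex A X) (o i : ℕ) (w : Option (List Sym × ℕ)) :
    ((targets c β o i w).map Target.node).Nodup :=
  (nodes_sublist c β o i w).nodup (List.nodup_reverse.2 (RefExpr.nodup_symbols_mark _ _))

/-- No two targets exclude each other. -/
def NoClash (T : List (Target A X)) : Prop :=
  ∀ e ∈ T, ∀ e' ∈ T, e.node ≠ e'.node →
    (∀ a, ¬ (e.node.1 = RefSym.letter a ∧ e'.node.1 = RefSym.letter a)) ∧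
    ∀ x, e.node.1 ≠ RefSym.var x

/-- If `InOK` holds, targets are edges, and a clash of targets is a conflict; otherwise the two ways
to some entrance already give one. -/
theorem conflict_of_source {α : Regex A X} {u : Option α.Node} {c : Sym}
    {w : Option (List Sym × ℕ)} (h : α.IsSource u c w) (h0 : α.WellFormed) (hN : α.NullOK 1)
    (hI : ¬ (α.InOK c 0 1 w ∧ NoClash (targets c α 0 1 w))) : α.Conflict := by
  by_cases hI' : α.InOK c 0 1 w
  · have hcl : ¬ NoClash (targets c α 0 1 w) := fun h => hI ⟨hI', h⟩
    simp only [NoClash, not_forall] at hcl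
    obtain ⟨e, he, e', he', hne, hcl⟩ := hcl
    have node : ∀ {e}, e ∈ targets c α 0 1 w → ∃ n : α.Node, e.node = n.1 := fun {e} he => by
      have h1 : e.node ∈ α.marked.symbols.reverse :=
        (nodes_sublist c α 0 1 w).subset (List.mem_map_of_mem he)
      have h2 := (mem_targets_iff h.1 h0 hN
        (fun v hv => by rw [h.bracket v hv]; exact isBracketWord_nil) hI' e.node e.word).1
        ⟨e, he, rfl, rfl⟩
      exact ⟨⟨e.node, by simpa using h1, h2.2.1⟩, rfl⟩
    obtain ⟨n, hn⟩ := node he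
    obtain ⟨n', hn'⟩ := node he'
    refine ⟨u, e.word, e'.word, some n, some n', (edge_some_iff h h0 hN hI' _ _).2 ⟨e, he, hn, rfl⟩,
      (edge_some_iff h h0 hN hI' _ _).2 ⟨e', he', hn', rfl⟩, Or.inr ⟨n, n', rfl, rfl, ?_, ?_⟩⟩
    · rintro rfl
      exact hne (hn.trans hn'.symm)
    · rw [← hn, ← hn']
      by_contra hcon
      push Not at hcon
      exact hcl ⟨fun a ha => hcon.1 a ha.1 ha.2, hcon.2⟩
  · refine conflict_of_not_inOK h.eq (l₀ := []) (r := []) h0 (fun y hy => by simpa [lang_mark_one] using hy)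
      (fun v hv => ?_) hI'
    rcases u with _ | n
    · rw [h.bracket v hv]
      exact ⟨isBracketWord_nil, fun y hy => ⟨[], rfl, by simpa [lang_mark_one] using hy⟩⟩
    · obtain ⟨p, hp⟩ := hv
      rw [h.2.2] at hp
      cases hp

/-- Since a node is listed at most once among the targets, its label is unique; the label to the
sink is unique as the value of `nullW` or `outW`. Clashes are excluded by `NoClash`. -/
theorem not_conflict_of_sources {α : Regex A X} (h0 : α.WellFormed) (hN : α.NullOK 1)
    (h : ∀ u : Option α.Node, ∃ c w, α.IsSource u c w ∧ α.InOK c 0 1 w ∧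
      NoClash (targets c α 0 1 w)) : ¬ α.Conflict := by
  rintro ⟨u, ν₁, ν₂, v₁, v₂, h₁, h₂, hv⟩
  obtain ⟨c, w, hs, hI, hC⟩ := h u
  rcases hv with ⟨rfl, hne⟩ | ⟨n₁, n₂, rfl, rfl, hne, hcl⟩
  · rcases v₁ with _ | n
    · rcases u with _ | u
      · rw [edge_none_none_iff hN] at h₁ h₂
        exact hne (Option.some.inj (h₁.symm.trans h₂))
      · rw [edge_some_none_iff h0 hN] at h₁ h₂
        exact hne (Option.some.inj (h₁.symm.trans h₂))
    · obtain ⟨e, he, hn, rfl⟩ := (edge_some_iff hs h0 hN hI _ _).1 h₁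
      obtain ⟨e', he', hn', rfl⟩ := (edge_some_iff hs h0 hN hI _ _).1 h₂
      exact hne (congrArg Target.word (List.inj_on_of_nodup_map (nodup_nodes _ _ _ _ _) he he'
        (hn.trans hn'.symm)))
  · obtain ⟨e, he, hn, rfl⟩ := (edge_some_iff hs h0 hN hI _ _).1 h₁
    obtain ⟨e', he', hn', rfl⟩ := (edge_some_iff hs h0 hN hI _ _).1 h₂
    have h1 := hC e he e' he' fun h => hne (Subtype.ext (by rw [← hn, ← hn', h]))
    rcases hcl with ⟨a, ha⟩ | ⟨x, hx⟩
    · exact h1.1 a (by rw [hn, hn']; exact ha)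
    · exact h1.2 x (by rw [hn]; exact hx)

end Regex

/-! ### Net actions by structural recursion -/

/-- Numbers for memory instructions, in increasing priority. -/
def MemInstr.prio : MemInstr → ℕ
  | MemInstr.unch => 0
  | MemInstr.cls => 1
  | MemInstr.rst => 2
  | MemInstr.opn => 3

namespace Regex

variable {A X : Type*}

local notation "Sym" => (RefSym A X × ℕ)

/-- The priority of the net action of a marked bracket word. -/
noncomputable def netPrio (ν : List Sym) (x : X) : ℕ := (netAction (ν.map Prod.fst) x).prio

theorem netPrio_nil (x : X) : netPrio ([] : List Sym) x = 0 := rfl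

open scoped Classical in
theorem netPrio_append_singleton (ν : List Sym) (c : Sym) (x : X) :
    netPrio (ν ++ [c]) x = if c.1 = RefSym.op x then 3
      else if c.1 = RefSym.cl x then (if RefSym.op x ∈ ν.map Prod.fst then 2 else 1)
      else netPrio ν x := by
  rw [netPrio, List.map_append, List.map_singleton, netAction_append_singleton]
  split_ifs <;> rfl

theorem op_mem_iff (ν : List Sym) (x : X) :
    RefSym.op x ∈ ν.map Prod.fst ↔ 2 ≤ netPrio ν x := by
  classical
  induction ν using List.reverseRecOn with
  | nil => simp [netPrio_nil]
  | append_singleton ν c ih =>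
    rw [netPrio_append_singleton, List.map_append, List.mem_append, List.map_singleton,
      List.mem_singleton, eq_comm (a := RefSym.op x)]
    by_cases h1 : c.1 = RefSym.op x
    · simp [h1]
    · rw [if_neg h1]
      by_cases h2 : c.1 = RefSym.cl x
      · rw [if_pos h2]
        split_ifs with h3
        · simp [h3]
        · simp [h1, h3]
      · rw [if_neg h2, ih]
        simp [h1]

/-- The last bracket of `x` decides, and its type has to be combined with the presence of `op x`; in
the chosen order this is a maximum. The bound excludes that `ν` leaves `x` open: a closing bracket
in `μ` would then lower the priority from 3 to 2. -/
theorem netPrio_append {ν : List Sym} {x : X} (hν : netPrio ν x ≤ 2) (μ : List Sym) :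
    netPrio (ν ++ μ) x = max (netPrio ν x) (netPrio μ x) := by
  classical
  induction μ using List.reverseRecOn with
  | nil => simp [netPrio_nil]
  | append_singleton μ c ih =>
    rw [← List.append_assoc, netPrio_append_singleton, netPrio_append_singleton, ih]
    by_cases h1 : c.1 = RefSym.op x
    · rw [if_pos h1, if_pos h1]; omega
    · rw [if_neg h1, if_neg h1]
      by_cases h2 : c.1 = RefSym.cl x
      · rw [if_pos h2, if_pos h2]
        simp only [List.map_append, List.mem_append]
        have h3 := op_mem_iff ν x
        by_cases h4 : RefSym.op x ∈ ν.map Prod.fst <;> by_cases h5 : RefSym.op x ∈ μ.map Prod.fst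
        · simp only [h4, h5, true_or, if_true]; omega
        · have := h3.1 h4
          simp only [h4, h5, true_or, if_true, if_false]; omega
        · simp only [h4, h5, or_true, if_true]; omega
        · have : ¬ 2 ≤ netPrio ν x := fun h => h4 (h3.2 h)
          simp only [h4, h5, or_false, if_false]; omega
      · rw [if_neg h2, if_neg h2]

theorem netPrio_append_of_forall (ν : List Sym) {μ : List Sym} {x : X}
    (h : ∀ c ∈ μ, c.1 ≠ RefSym.op x ∧ c.1 ≠ RefSym.cl x) :
    netPrio (ν ++ μ) x = netPrio ν x := by
  classical
  induction μ using List.reverseRecOn with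
  | nil => simp
  | append_singleton μ c ih =>
    obtain ⟨h1, h2⟩ := h c (by simp)
    rw [← List.append_assoc, netPrio_append_singleton, if_neg h1, if_neg h2]
    exact ih fun d hd => h d (by simp [hd])

theorem netPrio_op [DecidableEq X] (y x : X) (i : ℕ) :
    netPrio [((RefSym.op y, i) : Sym)] x = if y = x then 3 else 0 := by
  classical
  rw [← List.nil_append [_], netPrio_append_singleton]
  by_cases h : y = x <;> simp [h, netPrio_nil]

theorem netPrio_cl [DecidableEq X] (y x : X) (i : ℕ) :
    netPrio [((RefSym.cl y, i) : Sym)] x = if y = x then 1 else 0 := by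
  classical
  rw [← List.nil_append [_], netPrio_append_singleton]
  by_cases h : y = x <;> simp [h, netPrio_nil]

theorem netPrio_enclosed [DecidableEq X] {ν : List Sym} {y x : X} (h : netPrio ν x ≤ 2) (i j : ℕ) :
    netPrio ((RefSym.op y, i) :: (ν ++ [(RefSym.cl y, j)])) x =
      max (if y = x then 2 else 0) (netPrio ν x) := by
  classical
  by_cases hyx : y = x
  · subst hyx
    rw [← List.cons_append, netPrio_append_singleton]
    simp
    omega
  · rw [← List.cons_append, netPrio_append_singleton]
    have h1 := netPrio_append (ν := [((RefSym.op y, i) : Sym)]) (x := x)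
      (by rw [netPrio_op, if_neg hyx]; omega) ν
    rw [netPrio_op, if_neg hyx, List.singleton_append] at h1
    simp [hyx, h1]

/-- The position `u` belongs to the subexpression at position `o`. -/
def InRange (u o : ℕ) (β : Regex A X) : Prop := o ≤ u ∧ u < o + β.size

instance (u o : ℕ) (β : Regex A X) : Decidable (InRange u o β) :=
  inferInstanceAs (Decidable (_ ∧ _))

section Events

variable [DecidableEq X]

/-- The priority of the net action on `x` of the bracket word of a subexpression. -/
def evN : Regex A X → ℕ → X → ℕ
  | cat β γ, i, x => max (evN β i x) (evN γ (i + β.slen) x)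
  | alt β γ, i, x => max (if (nullW β i).isSome then evN β i x else 0)
      (if (nullW γ (i + β.slen)).isSome then evN γ (i + β.slen) x else 0)
  | plus β, i, x => evN β i x
  | bind y β, i, x => max (if y = x then 2 else 0) (evN β (i + 1) x)
  | _, _, _ => 0

/-- The priority of the net action on `x` of the bracket word from position `u` to the exit. -/
def evO (u : ℕ) : Regex A X → ℕ → ℕ → X → ℕ
  | cat β γ, o, i, x => max (max (evO u β o i x) (evO u γ (o + β.size) (i + β.slen) x))
      (if InRange u o β then evN γ (i + β.slen) x else 0)
  | alt β γ, o, i, x => max (evO u β o i x) (evO u γ (o + β.size) (i + β.slen) x)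
  | plus β, o, i, x => evO u β o i x
  | bind y β, o, i, x => max (if y = x ∧ InRange u o β then 1 else 0) (evO u β o (i + 1) x)
  | _, _, _, _ => 0

/-- The priority of the net action on `x` of the bracket word from the entrance to position `v`. -/
def evF (v : ℕ) : Regex A X → ℕ → ℕ → X → ℕ
  | cat β γ, o, i, x => max (max (evF v β o i x) (evF v γ (o + β.size) (i + β.slen) x))
      (if InRange v (o + β.size) γ then evN β i x else 0)
  | alt β γ, o, i, x => max (evF v β o i x) (evF v γ (o + β.size) (i + β.slen) x)
  | plus β, o, i, x => evF v β o i x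
  | bind y β, o, i, x => max (if y = x ∧ InRange v o β then 3 else 0) (evF v β o (i + 1) x)
  | _, _, _, _ => 0

/-- The priority of the net action on `x` of the path from position `u` to position `v` that starts
to descend at position `P`, as far as it passes through a subexpression; `act` tells whether the
path passes along the bracket word of the subexpression. -/
def ev (u v P : ℕ) : Regex A X → ℕ → ℕ → Bool → X → ℕ
  | cat β γ, o, i, act, x => max
      (ev u v P β o i (act || (decide (o + β.size + γ.size < P) &&
        decide (InRange v (o + β.size) γ))) x)
      (ev u v P γ (o + β.size) (i + β.slen) (act || (decide (o + β.size + γ.size < P) &&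
        decide (InRange u o β))) x)
  | alt β γ, o, i, act, x => max
      (ev u v P β o i (act && (nullW β i).isSome) x)
      (ev u v P γ (o + β.size) (i + β.slen) (act && (nullW γ (i + β.slen)).isSome) x)
  | plus β, o, i, act, x => ev u v P β o i act x
  | bind y β, o, i, act, x => max
      (if y = x then max (if act then 2 else 0) (if o + β.size < P then
        max (if InRange u o β then 1 else 0) (if InRange v o β then 3 else 0) else 0) else 0)
      (ev u v P β o (i + 1) act x)
  | _, _, _, _, _ => 0

/-- Below the turn, the three kinds of contributions separate: the subexpression is passed as a
whole, left from `u`, or entered towards `v`. The condition says that its last position `o + β.size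
- 1` is smaller than `P`. -/
theorem ev_below {u v P : ℕ} (β : Regex A X) {o i : ℕ} (act : Bool) (x : X)
    (h : o + β.size ≤ P) : ev u v P β o i act x =
      max (if act then evN β i x else 0) (max (evO u β o i x) (evF v β o i x)) := by
  induction β generalizing o i act with
  | empty => simp [ev, evN, evO, evF]
  | eps => simp [ev, evN, evO, evF]
  | sym a => simp [ev, evN, evO, evF]
  | ref x => simp [ev, evN, evO, evF]
  | cat β γ hβ hγ =>
    rw [size] at h
    have hp : o + β.size + γ.size < P := by omega
    simp only [ev, evN, evO, evF, hp]
    rw [hβ _ (by omega), hγ _ (by omega)]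
    by_cases h1 : InRange v (o + β.size) γ <;> by_cases h2 : InRange u o β <;> cases act <;>
      simp only [h1, h2, decide_true, decide_false, Bool.and_true, Bool.and_false, Bool.or_true,
        Bool.or_false, if_true, if_false, Bool.false_eq_true] <;>
      refine eq_of_forall_ge_iff fun z => ?_ <;> simp only [max_le_iff, zero_le] <;> tauto
  | alt β γ hβ hγ =>
    rw [size] at h
    simp only [ev, evN, evO, evF]
    rw [hβ _ (by omega), hγ _ (by omega)]
    cases act <;> simp only [Bool.true_and, Bool.false_and, if_true, if_false,
      Bool.false_eq_true] <;> omega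
  | plus β hβ =>
    rw [size] at h
    exact hβ act (by omega)
  | bind y β hβ =>
    rw [size] at h
    have hp : o + β.size < P := by omega
    simp only [ev, evN, evO, evF]
    rw [hβ _ (by omega), if_pos hp]
    by_cases h1 : y = x
    · simp only [h1, if_true, true_and]
      cases act <;> simp only [if_true, if_false, Bool.false_eq_true] <;> omega
    · simp only [h1, if_false, false_and]
      cases act <;> simp only [if_true, if_false, Bool.false_eq_true] <;> omega

/-- A subexpression that is not passed and contains neither end of the path is not touched by it. -/
theorem ev_off {u v P : ℕ} (β : Regex A X) {o i : ℕ} (x : X)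
    (hu : ¬ InRange u o β) (hv : ¬ InRange v o β) : ev u v P β o i false x = 0 := by
  induction β generalizing o i with
  | empty => rfl
  | eps => rfl
  | sym a => rfl
  | ref x => rfl
  | cat β γ hβ hγ =>
    simp only [InRange, size] at hu hv
    have h1 : ¬ InRange u o β := by simp only [InRange]; omega
    have h2 : ¬ InRange v (o + β.size) γ := by simp only [InRange]; omega
    simp only [ev, h1, h2, decide_false, Bool.and_false, Bool.or_false]
    rw [hβ h1 (by simp only [InRange]; omega), hγ (by simp only [InRange]; omega) h2]
    rfl
  | alt β γ hβ hγ =>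
    simp only [InRange, size] at hu hv
    simp only [ev, Bool.false_and]
    rw [hβ (by simp only [InRange]; omega) (by simp only [InRange]; omega),
      hγ (by simp only [InRange]; omega) (by simp only [InRange]; omega)]
    rfl
  | plus β hβ =>
    simp only [InRange, size] at hu hv
    exact hβ (by simp only [InRange]; omega) (by simp only [InRange]; omega)
  | bind y β hβ =>
    simp only [InRange, size] at hu hv
    have h1 : ¬ InRange u o β := by simp only [InRange]; omega
    have h2 : ¬ InRange v o β := by simp only [InRange]; omega
    simp only [ev, h1, h2, if_false, hβ h1 h2, Bool.false_eq_true]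
    simp

theorem evO_off {u : ℕ} (β : Regex A X) {o i : ℕ} (x : X) (hu : ¬ InRange u o β) :
    evO u β o i x = 0 := by
  induction β generalizing o i with
  | empty => rfl
  | eps => rfl
  | sym a => rfl
  | ref x => rfl
  | cat β γ hβ hγ =>
    simp only [InRange, size] at hu
    have h1 : ¬ InRange u o β := by simp only [InRange]; omega
    simp only [evO, h1, if_false]
    rw [hβ h1, hγ (by simp only [InRange]; omega)]
    rfl
  | alt β γ hβ hγ =>
    simp only [InRange, size] at hu
    simp only [evO]
    rw [hβ (by simp only [InRange]; omega), hγ (by simp only [InRange]; omega)]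
    rfl
  | plus β hβ =>
    simp only [InRange, size] at hu
    exact hβ (by simp only [InRange]; omega)
  | bind y β hβ =>
    simp only [InRange, size] at hu
    have h1 : ¬ InRange u o β := by simp only [InRange]; omega
    simp only [evO, h1, and_false, if_false, hβ h1]
    rfl

theorem evF_off {v : ℕ} (β : Regex A X) {o i : ℕ} (x : X) (hv : ¬ InRange v o β) :
    evF v β o i x = 0 := by
  induction β generalizing o i with
  | empty => rfl
  | eps => rfl
  | sym a => rfl
  | ref x => rfl
  | cat β γ hβ hγ =>
    simp only [InRange, size] at hv
    have h1 : ¬ InRange v (o + β.size) γ := by simp only [InRange]; omega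
    simp only [evF, h1, if_false]
    rw [hβ (by simp only [InRange]; omega), hγ h1]
    rfl
  | alt β γ hβ hγ =>
    simp only [InRange, size] at hv
    simp only [evF]
    rw [hβ (by simp only [InRange]; omega), hγ (by simp only [InRange]; omega)]
    rfl
  | plus β hβ =>
    simp only [InRange, size] at hv
    exact hβ (by simp only [InRange]; omega)
  | bind y β hβ =>
    simp only [InRange, size] at hv
    have h1 : ¬ InRange v o β := by simp only [InRange]; omega
    simp only [evF, h1, and_false, if_false, hβ h1]
    rfl

end Events

/-- The node `c` stands at position `u`. -/
def LeafAt : Regex A X → ℕ → ℕ → ℕ → Sym → Prop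
  | sym a, o, i, u, c => u = o ∧ c = (RefSym.letter a, i)
  | ref x, o, i, u, c => u = o ∧ c = (RefSym.var x, i)
  | cat β γ, o, i, u, c => LeafAt β o i u c ∨ LeafAt γ (o + β.size) (i + β.slen) u c
  | alt β γ, o, i, u, c => LeafAt β o i u c ∨ LeafAt γ (o + β.size) (i + β.slen) u c
  | plus β, o, i, u, c => LeafAt β o i u c
  | bind _ β, o, i, u, c => LeafAt β o (i + 1) u c
  | _, _, _, _, _ => False

theorem mem_symbols_bind {x : X} {β : Regex A X} {i : ℕ} {c : Sym} :
    c ∈ ((bind x β).toRef.mark i).symbols ↔ c = (RefSym.op x, i) ∨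
      c ∈ (β.toRef.mark (i + 1)).symbols ∨ c = (RefSym.cl x, i + 1 + β.slen) := by
  rw [mark_bind]
  simp [RefExpr.symbols]

theorem mem_symbols_cat {β γ : Regex A X} {i : ℕ} {c : Sym} :
    c ∈ ((cat β γ).toRef.mark i).symbols ↔
      c ∈ (β.toRef.mark i).symbols ∨ c ∈ (γ.toRef.mark (i + β.slen)).symbols := by
  rw [mark_cat, RefExpr.symbols, List.mem_append]

theorem LeafAt.spec {β : Regex A X} {o i u : ℕ} {c : Sym} (h : β.LeafAt o i u c) :
    InRange u o β ∧ c ∈ (β.toRef.mark i).symbols ∧ ¬ c.1.IsBracket := by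
  induction β generalizing o i with
  | empty => exact h.elim
  | eps => exact h.elim
  | sym a =>
    obtain ⟨rfl, rfl⟩ := h
    exact ⟨by simp [InRange, size], by simp [toRef, RefExpr.mark, RefExpr.symbols], by exact id⟩
  | ref x =>
    obtain ⟨rfl, rfl⟩ := h
    exact ⟨by simp [InRange, size], by simp [toRef, RefExpr.mark, RefExpr.symbols], by exact id⟩
  | cat β γ hβ hγ =>
    rw [mem_symbols_cat]
    simp only [InRange, size] at hβ hγ ⊢
    rcases h with h | h
    · have := hβ h
      exact ⟨by omega, Or.inl this.2.1, this.2.2⟩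
    · have := hγ h
      exact ⟨by omega, Or.inr this.2.1, this.2.2⟩
  | alt β γ hβ hγ =>
    change _ ∧ c ∈ ((cat β γ).toRef.mark i).symbols ∧ _
    rw [mem_symbols_cat]
    simp only [InRange, size] at hβ hγ ⊢
    rcases h with h | h
    · have := hβ h
      exact ⟨by omega, Or.inl this.2.1, this.2.2⟩
    · have := hγ h
      exact ⟨by omega, Or.inr this.2.1, this.2.2⟩
  | plus β hβ =>
    have := hβ h
    simp only [InRange, size] at this ⊢
    exact ⟨by omega, this.2.1, this.2.2⟩
  | bind x β hβ =>
    have := hβ h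
    rw [mem_symbols_bind]
    simp only [InRange, size] at this ⊢
    exact ⟨by omega, Or.inr (Or.inl this.2.1), this.2.2⟩

/-- The node `c` stands at position `u`, or both lie outside of the subexpression. -/
def Located (β : Regex A X) (o i u : ℕ) (c : Sym) : Prop :=
  β.LeafAt o i u c ∨ ¬ InRange u o β ∧ c ∉ (β.toRef.mark i).symbols

theorem located_cat {β γ : Regex A X} {o i u : ℕ} {c : Sym} (h : (cat β γ).Located o i u c) :
    β.Located o i u c ∧ γ.Located (o + β.size) (i + β.slen) u c := by
  rcases h with (h | h) | ⟨h1, h2⟩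
  · have := h.spec
    refine ⟨Or.inl h, Or.inr ⟨?_, not_mem_symbols_right this.2.1⟩⟩
    have := this.1
    simp only [InRange] at this ⊢
    omega
  · have := h.spec
    refine ⟨Or.inr ⟨?_, fun h' => not_mem_symbols_right h' this.2.1⟩, Or.inl h⟩
    have := this.1
    simp only [InRange] at this ⊢
    omega
  · rw [mem_symbols_cat] at h2
    simp only [InRange, size] at h1
    exact ⟨Or.inr ⟨by simp only [InRange]; omega, fun h => h2 (Or.inl h)⟩,
      Or.inr ⟨by simp only [InRange]; omega, fun h => h2 (Or.inr h)⟩⟩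

theorem located_alt {β γ : Regex A X} {o i u : ℕ} {c : Sym} (h : (alt β γ).Located o i u c) :
    β.Located o i u c ∧ γ.Located (o + β.size) (i + β.slen) u c := located_cat h

theorem located_plus {β : Regex A X} {o i u : ℕ} {c : Sym} (h : (plus β).Located o i u c) :
    β.Located o i u c := by
  rcases h with h | ⟨h1, h2⟩
  · exact Or.inl h
  · refine Or.inr ⟨?_, h2⟩
    simp only [InRange, size] at h1 ⊢
    omega

theorem located_bind {x : X} {β : Regex A X} {o i u : ℕ} {c : Sym}
    (h : (bind x β).Located o i u c) : β.Located o (i + 1) u c := by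
  rcases h with h | ⟨h1, h2⟩
  · exact Or.inl h
  · rw [mem_symbols_bind] at h2
    refine Or.inr ⟨?_, fun h => h2 (Or.inr (Or.inl h))⟩
    simp only [InRange, size] at h1 ⊢
    omega

theorem Located.inRange {β : Regex A X} {o i u : ℕ} {c : Sym} (h : β.Located o i u c)
    (hc : c ∈ (β.toRef.mark i).symbols) : InRange u o β :=
  h.elim (fun h => h.spec.1) fun h => absurd hc h.2

theorem not_inRange_right {β γ : Regex A X} {o u : ℕ} (h : InRange u o β) :
    ¬ InRange u (o + β.size) γ := by
  simp only [InRange] at *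
  omega

theorem not_inRange_left {β γ : Regex A X} {o u : ℕ} (h : InRange u (o + β.size) γ) :
    ¬ InRange u o β := by
  simp only [InRange] at *
  omega

open scoped Classical in
/-- The bracket word that leads from the beginning of the marked expression to `d`. -/
noncomputable def firstW (d : Sym) : Regex A X → ℕ → Option (List Sym)
  | empty, _ => none
  | eps, _ => none
  | sym a, i => if d = (RefSym.letter a, i) then some [] else none
  | ref x, i => if d = (RefSym.var x, i) then some [] else none
  | cat β γ, i => (firstW d β i).or
      ((nullW β i).bind fun v => (firstW d γ (i + β.slen)).map fun w => v ++ w)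
  | alt β γ, i => (firstW d β i).or (firstW d γ (i + β.slen))
  | plus β, i => firstW d β i
  | bind x β, i => (firstW d β (i + 1)).map fun w => [(RefSym.op x, i)] ++ w

theorem firstW_symbols {d : Sym} {β : Regex A X} {i : ℕ} {f : List Sym}
    (h : firstW d β i = some f) :
    d ∈ (β.toRef.mark i).symbols ∧ ∀ c ∈ f, c ∈ (β.toRef.mark i).symbols := by
  induction β generalizing i f with
  | empty => cases h
  | eps => cases h
  | sym a =>
    obtain ⟨rfl, rfl⟩ : d = _ ∧ [] = f := by simpa [firstW] using h
    simp [toRef, RefExpr.mark, RefExpr.symbols]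
  | ref y =>
    obtain ⟨rfl, rfl⟩ : d = _ ∧ [] = f := by simpa [firstW] using h
    simp [toRef, RefExpr.mark, RefExpr.symbols]
  | cat β γ hβ hγ =>
    simp only [firstW, Option.or_eq_some_iff, Option.bind_eq_some_iff, Option.map_eq_some_iff] at h
    simp only [mem_symbols_cat]
    rcases h with h | ⟨-, v, hv, w, hw, rfl⟩
    · exact ⟨Or.inl (hβ h).1, fun c hc => Or.inl ((hβ h).2 c hc)⟩
    · refine ⟨Or.inr (hγ hw).1, fun c hc => (List.mem_append.1 hc).imp (fun hc => ?_)
        ((hγ hw).2 c)⟩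
      exact RefExpr.mem_symbols_of_mem_lang (nullW_mem hv).1 c hc
  | alt β γ hβ hγ =>
    rw [firstW, Option.or_eq_some_iff] at h
    change d ∈ ((cat β γ).toRef.mark i).symbols ∧ ∀ c ∈ f, c ∈ ((cat β γ).toRef.mark i).symbols
    simp only [mem_symbols_cat]
    rcases h with h | ⟨-, h⟩
    · exact ⟨Or.inl (hβ h).1, fun c hc => Or.inl ((hβ h).2 c hc)⟩
    · exact ⟨Or.inr (hγ h).1, fun c hc => Or.inr ((hγ h).2 c hc)⟩
  | plus β hβ => exact hβ h
  | bind y β hβ =>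
    simp only [firstW, Option.map_eq_some_iff] at h
    obtain ⟨v, hv, rfl⟩ := h
    simp only [mem_symbols_bind]
    refine ⟨Or.inr (Or.inl (hβ hv).1), fun c hc => ?_⟩
    rcases List.mem_append.1 hc with hc | hc
    · exact Or.inl (List.mem_singleton.1 hc)
    · exact Or.inr (Or.inl ((hβ hv).2 c hc))

variable [DecidableEq X]

/-- The bracket word closes whatever it opens, so the priority is at most 2 and concatenation takes
maxima. For two alternatives with bracket words, both words are empty and the maximum of their
priorities is 0. -/
theorem netPrio_null {β : Regex A X} {i : ℕ} {n : List Sym} (h : β.NullOK i)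
    (hn : nullW β i = some n) (x : X) : netPrio n x = evN β i x ∧ evN β i x ≤ 2 := by
  induction β generalizing i n with
  | empty => cases hn
  | eps => cases hn; exact ⟨rfl, by simp [evN]⟩
  | sym a => cases hn
  | ref x => cases hn
  | cat β γ hβ hγ =>
    simp only [nullW, Option.bind_eq_some_iff, Option.map_eq_some_iff] at hn
    obtain ⟨v, hv, w, hw, rfl⟩ := hn
    have h1 := hβ h.1 hv
    have h2 := hγ h.2 hw
    rw [netPrio_append (by omega), evN]
    omega
  | alt β γ hβ hγ =>
    rw [evN]
    rw [nullW, Option.or_eq_some_iff] at hn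
    rcases hn with hn | ⟨h1, hn⟩
    · have h2 := hβ h.1 hn
      rw [hn, Option.isSome_some, if_pos rfl]
      cases h3 : nullW γ (i + β.slen) with
      | none => rw [Option.isSome_none, if_neg (by simp)]; omega
      | some w =>
        obtain ⟨rfl, rfl⟩ := h.2.2 _ _ hn h3
        have h4 := hγ h.2.1 h3
        rw [netPrio_nil] at h4 h2
        rw [netPrio_nil, Option.isSome_some, if_pos rfl]
        omega
    · have h2 := hγ h.2.1 hn
      rw [h1, hn, Option.isSome_some, Option.isSome_none, if_pos rfl, if_neg (by simp)]
      omega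
  | plus β hβ => exact hβ h.1 hn
  | bind y β hβ =>
    simp only [nullW, Option.map_eq_some_iff] at hn
    obtain ⟨v, hv, rfl⟩ := hn
    have h1 := hβ h hv
    rw [netPrio_enclosed (by omega), evN]
    split_ifs <;> omega

theorem netPrio_out {β : Regex A X} {o i u : ℕ} {c : Sym} {n : List Sym} (h0 : β.WellFormed)
    (h : β.NullOK i) (hl : β.Located o i u c) (hn : outW c β i = some n) (x : X) :
    netPrio n x = evO u β o i x ∧ evO u β o i x ≤ 2 := by
  induction β generalizing o i n with
  | empty => cases hn
  | eps => cases hn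
  | sym a =>
    obtain ⟨rfl, rfl⟩ : c = _ ∧ [] = n := by simpa [outW] using hn
    exact ⟨rfl, by simp [evO]⟩
  | ref y =>
    obtain ⟨rfl, rfl⟩ : c = _ ∧ [] = n := by simpa [outW] using hn
    exact ⟨rfl, by simp [evO]⟩
  | cat β γ hβ hγ =>
    obtain ⟨hl1, hl2⟩ := located_cat hl
    simp only [outW, Option.or_eq_some_iff, Option.bind_eq_some_iff, Option.map_eq_some_iff] at hn
    rcases hn with hn | ⟨-, v, hv, w, hw, rfl⟩
    · have h1 := hγ h0.2 h.2 hl2 hn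
      have h2 := not_inRange_left (hl2.inRange (mem_symbols_of_lasts (outW_lasts h0.2 hn).1))
      rw [evO, evO_off β x h2, if_neg h2]
      omega
    · have h1 := hβ h0.1 h.1 hl1 hv
      have h2 := hl1.inRange (mem_symbols_of_lasts (outW_lasts h0.1 hv).1)
      have h3 := netPrio_null h.2 hw x
      rw [netPrio_append (by omega), evO, evO_off γ x (not_inRange_right h2), if_pos h2]
      omega
  | alt β γ hβ hγ =>
    obtain ⟨hl1, hl2⟩ := located_alt hl
    rw [outW, Option.or_eq_some_iff] at hn
    rcases hn with hn | ⟨-, hn⟩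
    · have h1 := hβ h0.1 h.1 hl1 hn
      have h2 := hl1.inRange (mem_symbols_of_lasts (outW_lasts h0.1 hn).1)
      rw [evO, evO_off γ x (not_inRange_right h2)]
      omega
    · have h1 := hγ h0.2 h.2.1 hl2 hn
      have h2 := hl2.inRange (mem_symbols_of_lasts (outW_lasts h0.2 hn).1)
      rw [evO, evO_off β x (not_inRange_left h2)]
      omega
  | plus β hβ => exact hβ h0 h.1 (located_plus hl) hn
  | bind y β hβ =>
    simp only [outW, Option.map_eq_some_iff] at hn
    obtain ⟨v, hv, rfl⟩ := hn
    have h1 := hβ h0.1 h (located_bind hl) hv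
    have h2 := (located_bind hl).inRange (mem_symbols_of_lasts (outW_lasts h0.1 hv).1)
    rw [netPrio_append (by omega), evO, netPrio_cl]
    simp only [h2, and_true]
    split_ifs <;> omega

theorem netPrio_first {β : Regex A X} {o i v : ℕ} {d : Sym} {f : List Sym} (h0 : β.WellFormed)
    (h : β.NullOK i) (hl : β.Located o i v d) (hf : firstW d β i = some f) (x : X) :
    netPrio f x = evF v β o i x := by
  induction β generalizing o i f with
  | empty => cases hf
  | eps => cases hf
  | sym a =>
    obtain ⟨rfl, rfl⟩ : d = _ ∧ [] = f := by simpa [firstW] using hf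
    rfl
  | ref y =>
    obtain ⟨rfl, rfl⟩ : d = _ ∧ [] = f := by simpa [firstW] using hf
    rfl
  | cat β γ hβ hγ =>
    obtain ⟨hl1, hl2⟩ := located_cat hl
    simp only [firstW, Option.or_eq_some_iff, Option.bind_eq_some_iff, Option.map_eq_some_iff] at hf
    rcases hf with hf | ⟨-, w, hw, f, hf, rfl⟩
    · have h1 := hβ h0.1 h.1 hl1 hf
      have h2 := not_inRange_right (γ := γ) (hl1.inRange (firstW_symbols hf).1)
      rw [evF, evF_off γ x h2, if_neg h2]
      omega
    · have h1 := hγ h0.2 h.2 hl2 hf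
      have h2 := hl2.inRange (firstW_symbols hf).1
      have h3 := netPrio_null h.1 hw x
      rw [netPrio_append (by omega), evF, evF_off β x (not_inRange_left h2), if_pos h2]
      omega
  | alt β γ hβ hγ =>
    obtain ⟨hl1, hl2⟩ := located_alt hl
    rw [firstW, Option.or_eq_some_iff] at hf
    rcases hf with hf | ⟨-, hf⟩
    · have h1 := hβ h0.1 h.1 hl1 hf
      have h2 := hl1.inRange (firstW_symbols hf).1
      rw [evF, evF_off γ x (not_inRange_right h2)]
      omega
    · have h1 := hγ h0.2 h.2.1 hl2 hf
      have h2 := hl2.inRange (firstW_symbols hf).1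
      rw [evF, evF_off β x (not_inRange_left h2)]
      omega
  | plus β hβ => exact hβ h0 h.1 (located_plus hl) hf
  | bind y β hβ =>
    simp only [firstW, Option.map_eq_some_iff] at hf
    obtain ⟨f, hf, rfl⟩ := hf
    have h1 := hβ h0.1 h (located_bind hl) hf
    have h2 := (located_bind hl).inRange (firstW_symbols hf).1
    rw [evF]
    simp only [h2, and_true]
    by_cases hyx : y = x
    · subst hyx
      -- After `op y` the priority is already 3 and the maximum rule does not apply; but `y` has no
      -- brackets inside its own binding, so it stays open.
      have h3 : ∀ c ∈ f, c.1 ≠ RefSym.op y ∧ c.1 ≠ RefSym.cl y := by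
        intro c hc
        have h4 : c.1 ∈ β.toRef.symbols := by
          rw [← RefExpr.symbols_mark_fst _ (i + 1)]
          exact List.mem_map_of_mem ((firstW_symbols hf).2 c hc)
        constructor <;> intro h5 <;> rw [h5] at h4 <;>
          exact h0.2 (mem_var_of_mem_symbols (by tauto))
      have h4 := netPrio_append_of_forall [] h3
      rw [List.nil_append, netPrio_nil] at h4
      rw [netPrio_append_of_forall _ h3, netPrio_op]
      simp only [if_true]
      omega
    · rw [netPrio_append (by rw [netPrio_op, if_neg hyx]; omega), netPrio_op, h1]

/-- Two kinds of targets: the path comes through the entrance, with the turn that was fixed outside,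
or it turns inside of the subexpression. Only in the second case is its whole word known here, and
its net actions are compared with `ev`. -/
theorem netPrio_target {β : Regex A X} {c : Sym} {o i u : ℕ} {w : Option (List Sym × ℕ)}
    (h0 : β.WellFormed) (h : β.NullOK i) (hl : β.Located o i u c) {e : Target A X}
    (he : e ∈ targets c β o i w) : β.LeafAt o i e.pos e.node ∧
      ((∃ v f, w = some (v, e.turn) ∧ firstW e.node β i = some f ∧ e.word = v ++ f) ∨
        (InRange u o β ∧ InRange e.turn o β ∧
          ∀ x, netPrio e.word x = ev u e.pos e.turn β o i false x)) := by
  induction β generalizing o i w with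
  | empty => simp [targets] at he
  | eps => simp [targets] at he
  | sym a =>
    rw [targets, Option.mem_toList, Option.map_eq_some_iff] at he
    obtain ⟨⟨v, p⟩, rfl, rfl⟩ := he
    exact ⟨⟨rfl, rfl⟩, Or.inl ⟨v, [], rfl, by simp [firstW], by simp⟩⟩
  | ref a =>
    rw [targets, Option.mem_toList, Option.map_eq_some_iff] at he
    obtain ⟨⟨v, p⟩, rfl, rfl⟩ := he
    exact ⟨⟨rfl, rfl⟩, Or.inl ⟨v, [], rfl, by simp [firstW], by simp⟩⟩
  | cat β γ hβ hγ =>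
    obtain ⟨hl1, hl2⟩ := located_cat hl
    rw [targets, List.mem_append] at he
    rcases he with he | he
    · obtain ⟨h1, h2⟩ := hγ h0.2 h.2 hl2 he
      have hv := h1.spec.1
      have hv' := not_inRange_left hv
      refine ⟨Or.inr h1, ?_⟩
      rcases h2 with ⟨v, f, hw, hf, hwd⟩ | ⟨hu, ht, hx⟩
      · rw [enter, Option.or_eq_some_iff, Option.map_eq_some_iff] at hw
        rcases hw with ⟨v', hv2, hv3⟩ | ⟨-, hw⟩
        -- The path leaves `β` and descends into `γ` at this node: both children lie below the turn,
        -- and the word is an exit word of `β` followed by a first word of `γ`.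
        · obtain ⟨rfl, h4⟩ := Prod.mk.inj hv3
          have hu := hl1.inRange (mem_symbols_of_lasts (outW_lasts h0.1 hv2).1)
          have hu' := not_inRange_right (γ := γ) hu
          refine Or.inr ⟨?_, ?_, fun x => ?_⟩
          · simp only [InRange, size] at hu ⊢
            omega
          · simp only [InRange, size]
            omega
          · have h5 := netPrio_out h0.1 h.1 hl1 hv2 x
            have h6 := netPrio_first h0.2 h.2 (Or.inl h1) hf x
            rw [hwd, netPrio_append (by omega), h5.1, h6, ev, ← h4]
            simp only [lt_self_iff_false, decide_false, Bool.false_and, Bool.or_false]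
            rw [ev_below β _ _ (by omega), ev_below γ _ _ (by omega), evF_off β x hv',
              evO_off γ x hu']
            simp
        · simp only [pass, Option.bind_eq_some_iff, Option.map_eq_some_iff, Prod.mk.injEq] at hw
          obtain ⟨⟨v₁, q⟩, rfl, v₂, hv₂, rfl, rfl⟩ := hw
          refine Or.inl ⟨v₁, v₂ ++ f, rfl, ?_, by simp [hwd]⟩
          have : firstW e.node β i = none := by
            rw [Option.eq_none_iff_forall_not_mem]
            intro g hg
            exact not_mem_symbols_right (firstW_symbols hg).1 h1.spec.2.1
          rw [firstW, this, hv₂, hf]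
          rfl
      · refine Or.inr ⟨?_, ?_, fun x => ?_⟩
        · simp only [InRange, size] at hu ⊢; omega
        · simp only [InRange, size] at ht ⊢; omega
        -- The turn lies inside `γ`, so this node is not below it and `β` is not passed.
        · have hp : ¬ o + β.size + γ.size < e.turn := by simp only [InRange] at ht; omega
          rw [hx, ev]
          simp only [hp, decide_false, Bool.false_and, Bool.or_false]
          rw [ev_off β x (not_inRange_left hu) hv']
          omega
    · obtain ⟨h1, h2⟩ := hβ h0.1 h.1 hl1 he
      have hv := h1.spec.1
      refine ⟨Or.inl h1, ?_⟩
      rcases h2 with ⟨v, f, hw, hf, hwd⟩ | ⟨hu, ht, hx⟩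
      · exact Or.inl ⟨v, f, hw, by rw [firstW, hf, Option.some_or], hwd⟩
      · refine Or.inr ⟨?_, ?_, fun x => ?_⟩
        · simp only [InRange, size] at hu ⊢; omega
        · simp only [InRange, size] at ht ⊢; omega
        · have hp : ¬ o + β.size + γ.size < e.turn := by simp only [InRange] at ht; omega
          rw [hx, ev]
          simp only [hp, decide_false, Bool.false_and, Bool.or_false]
          rw [ev_off γ x (not_inRange_right hu) (not_inRange_right hv)]
          omega
  | alt β γ hβ hγ =>
    obtain ⟨hl1, hl2⟩ := located_alt hl
    rw [targets, List.mem_append] at he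
    rcases he with he | he
    · obtain ⟨h1, h2⟩ := hγ h0.2 h.2.1 hl2 he
      have hv := h1.spec.1
      refine ⟨Or.inr h1, ?_⟩
      rcases h2 with ⟨v, f, hw, hf, hwd⟩ | ⟨hu, ht, hx⟩
      · refine Or.inl ⟨v, f, hw, ?_, hwd⟩
        have : firstW e.node β i = none := by
          rw [Option.eq_none_iff_forall_not_mem]
          intro g hg
          exact not_mem_symbols_right (firstW_symbols hg).1 h1.spec.2.1
        rw [firstW, this, hf]
        rfl
      · refine Or.inr ⟨?_, ?_, fun x => ?_⟩
        · simp only [InRange, size] at hu ⊢; omega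
        · simp only [InRange, size] at ht ⊢; omega
        · rw [hx, ev]
          simp only [Bool.false_and]
          rw [ev_off β x (not_inRange_left hu) (not_inRange_left hv)]
          omega
    · obtain ⟨h1, h2⟩ := hβ h0.1 h.1 hl1 he
      have hv := h1.spec.1
      refine ⟨Or.inl h1, ?_⟩
      rcases h2 with ⟨v, f, hw, hf, hwd⟩ | ⟨hu, ht, hx⟩
      · exact Or.inl ⟨v, f, hw, by rw [firstW, hf, Option.some_or], hwd⟩
      · refine Or.inr ⟨?_, ?_, fun x => ?_⟩
        · simp only [InRange, size] at hu ⊢; omega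
        · simp only [InRange, size] at ht ⊢; omega
        · rw [hx, ev]
          simp only [Bool.false_and]
          rw [ev_off γ x (not_inRange_right hu) (not_inRange_right hv)]
          omega
  | plus β hβ =>
    have hl1 := located_plus hl
    obtain ⟨h1, h2⟩ := hβ h0 h.1 hl1 he
    refine ⟨h1, ?_⟩
    rcases h2 with ⟨v, f, hw, hf, hwd⟩ | ⟨hu, ht, hx⟩
    · rw [enter, Option.or_eq_some_iff, Option.map_eq_some_iff] at hw
      rcases hw with ⟨v', hv2, hv3⟩ | ⟨-, hw⟩
      · obtain ⟨rfl, h4⟩ := Prod.mk.inj hv3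
        have hu := hl1.inRange (mem_symbols_of_lasts (outW_lasts (β := β) h0 hv2).1)
        refine Or.inr ⟨?_, ?_, fun x => ?_⟩
        · simp only [InRange, size] at hu ⊢
          omega
        · simp only [InRange, size]
          omega
        · have h5 := netPrio_out (β := β) h0 h.1 hl1 hv2 x
          have h6 := netPrio_first (β := β) h0 h.1 (Or.inl h1) hf x
          rw [hwd, netPrio_append (by omega), h5.1, h6, ev, ev_below β _ _ (by omega)]
          simp
      · exact Or.inl ⟨v, f, hw, hf, hwd⟩
    · refine Or.inr ⟨?_, ?_, hx⟩
      · simp only [InRange, size] at hu ⊢; omega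
      · simp only [InRange, size] at ht ⊢; omega
  | bind y β hβ =>
    have hl1 := located_bind hl
    obtain ⟨h1, h2⟩ := hβ h0.1 h hl1 he
    refine ⟨h1, ?_⟩
    rcases h2 with ⟨v, f, hw, hf, hwd⟩ | ⟨hu, ht, hx⟩
    · simp only [Option.map_eq_some_iff, Prod.mk.injEq] at hw
      obtain ⟨⟨v, q⟩, rfl, rfl, rfl⟩ := hw
      exact Or.inl ⟨v, [_] ++ f, rfl, by rw [firstW, hf]; rfl, by simp [hwd]⟩
    · refine Or.inr ⟨?_, ?_, fun x => ?_⟩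
      · simp only [InRange, size] at hu ⊢; omega
      · simp only [InRange, size] at ht ⊢; omega
      · have hp : ¬ o + β.size < e.turn := by simp only [InRange] at ht; omega
        rw [hx, ev, if_neg hp]
        simp

/-- For the beginning, the turn is `α.size`, behind all positions, so the whole tree lies below it;
nothing is left, as the source is not inside of the tree. For a node, there is no entrance, and
every path turns inside. -/
theorem netPrio_source {α : Regex A X} {s : Option α.Node} {c : Sym} {u : ℕ}
    {w : Option (List Sym × ℕ)} (hs : α.IsSource s c w) (h0 : α.WellFormed) (h : α.NullOK 1)
    (hl : α.Located 0 1 u c) {e : Target A X} (he : e ∈ targets c α 0 1 w) (x : X) :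
    netPrio e.word x = ev u e.pos e.turn α 0 1 false x := by
  obtain ⟨h1, ⟨v, f, rfl, hf, hwd⟩ | ⟨-, -, hx⟩⟩ := netPrio_target h0 h hl he
  · rcases s with _ | n
    · obtain ⟨hv, ht⟩ := Prod.mk.inj (Option.some.inj hs.2.2)
      have hu : ¬ InRange u 0 α := by
        rcases hl with hl | hl
        · have := mark_pos_of_mem_symbols hl.spec.2.1
          rw [hs.2.1] at this
          omega
        · exact hl.1
      rw [hwd, hv, List.nil_append, netPrio_first h0 h (Or.inl h1) hf,
        ev_below α _ _ (by omega), evO_off α x hu]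
      simp
    · exact absurd hs.2.2 (by simp)
  · exact hx x

end Regex

/-! ### Reasoning about programs of the random access machine -/

/-- The memory after setting a cell. -/
def RamStore.upd (σ : RamStore) (k i n : ℕ) : RamStore :=
  Function.update σ k (Function.update (σ k) i n)

namespace RamStore

theorem upd_of_ne {k k' : ℕ} (h : k' ≠ k) (σ : RamStore) (i n : ℕ) : σ.upd k i n k' = σ k' := by
  rw [upd, Function.update_of_ne h]

theorem upd_eq (σ : RamStore) (k i n j : ℕ) : σ.upd k i n k j = if j = i then n else σ k j := by
  rw [upd, Function.update_self, Function.update_apply]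

theorem upd_self (σ : RamStore) (k i n : ℕ) : σ.upd k i n k i = n := by
  rw [upd_eq, if_pos rfl]

@[simp]
theorem upd_apply (σ : RamStore) (k i n k' j : ℕ) :
    σ.upd k i n k' j = if k' = k ∧ j = i then n else σ k' j := by
  by_cases h : k' = k
  · subst h
    rw [upd_eq]
    simp
  · rw [upd_of_ne h, if_neg fun h' => h h'.1]

theorem upd_id (σ : RamStore) (k i : ℕ) : σ.upd k i (σ k i) = σ := by
  rw [upd, Function.update_eq_self, Function.update_eq_self]

/-- Array `k` holds the list `L`, preceded by its length. -/
def Buf (σ : RamStore) (k : ℕ) (L : List ℕ) : Prop :=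
  ∀ i ≤ L.length, σ k i = (L.length :: L).getD i 0

theorem Buf.length {σ : RamStore} {k : ℕ} {L : List ℕ} (h : σ.Buf k L) : σ k 0 = L.length :=
  h 0 (Nat.zero_le _)

theorem Buf.getElem {σ : RamStore} {k : ℕ} {L : List ℕ} (h : σ.Buf k L) {j : ℕ}
    (hj : j < L.length) : σ k (j + 1) = L[j] := by
  rw [h (j + 1) hj, List.getD_cons_succ, List.getD_eq_getElem _ _ hj]

theorem buf_of {σ : RamStore} {k : ℕ} {L : List ℕ} (h : σ k 0 = L.length)
    (h' : ∀ j (hj : j < L.length), σ k (j + 1) = L[j]) : σ.Buf k L := by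
  rintro (_ | j) hj
  · exact h
  · rw [List.getD_cons_succ, List.getD_eq_getElem _ _ hj]
    exact h' j hj

theorem buf_nil {σ : RamStore} {k : ℕ} (h : σ k 0 = 0) : σ.Buf k [] :=
  buf_of h fun j hj => absurd hj (Nat.not_lt_zero j)

theorem Buf.congr {σ σ' : RamStore} {k : ℕ} {L : List ℕ} (h : σ.Buf k L) (h' : σ' k = σ k) :
    σ'.Buf k L := fun i hi => by rw [h', h i hi]

theorem Buf.append_singleton {σ σ' : RamStore} {k n : ℕ} {L : List ℕ} (h : σ.Buf k L)
    (h' : σ' k = ((σ.upd k (L.length + 1) n).upd k 0 (L.length + 1)) k) :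
    σ'.Buf k (L ++ [n]) := by
  refine buf_of (by rw [h', upd_self]; simp) fun j hj => ?_
  rw [h', upd_eq, if_neg (by omega), upd_eq]
  rw [List.length_append, List.length_singleton] at hj
  rcases Nat.lt_or_ge j L.length with h1 | h1
  · rw [if_neg (by omega), h.getElem h1, List.getElem_append_left h1]
  · obtain rfl : j = L.length := by omega
    rw [if_pos rfl, List.getElem_append_right h1]
    simp

end RamStore

namespace RamExpr

instance (n : ℕ) : OfNat RamExpr n := ⟨const n⟩
instance : Add RamExpr := ⟨add⟩
instance : Sub RamExpr := ⟨sub⟩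

/-- Cell `0` of array `k`. -/
def var (k : ℕ) : RamExpr := load k 0

/-- The truth value of `e ≤ f`. -/
def le (e f : RamExpr) : RamExpr := 1 - (e - f)

/-- The conjunction of truth values. -/
def conj (e f : RamExpr) : RamExpr := e + f - 1

variable (σ : RamStore) (e f : RamExpr)

@[simp]
theorem eval_ofNat (n : ℕ) : (no_index (OfNat.ofNat n : RamExpr)).eval σ = n := rfl
@[simp]
theorem eval_add : (e + f).eval σ = e.eval σ + f.eval σ := rfl
@[simp]
theorem eval_sub : (e - f).eval σ = e.eval σ - f.eval σ := rfl
@[simp]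
theorem eval_load (k : ℕ) : (load k e).eval σ = σ k (e.eval σ) := rfl
@[simp]
theorem eval_var (k : ℕ) : (var k).eval σ = σ k 0 := rfl

@[simp]
theorem eval_le : (le e f).eval σ = if e.eval σ ≤ f.eval σ then 1 else 0 := by
  change 1 - (e.eval σ - f.eval σ) = _
  split_ifs <;> omega

theorem eval_conj {p q : Prop} [Decidable p] [Decidable q] (he : e.eval σ = if p then 1 else 0)
    (hf : f.eval σ = if q then 1 else 0) : (conj e f).eval σ = if p ∧ q then 1 else 0 := by
  change e.eval σ + f.eval σ - 1 = _
  rw [he, hf]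
  by_cases hp : p <;> by_cases hq : q <;> simp [hp, hq]

end RamExpr

namespace RamProg

open RamExpr RamStore

instance : Append RamProg := ⟨seq⟩

/-- There are no loops in the program. -/
def loopFree : RamProg → Bool
  | skip => true
  | store _ _ _ => true
  | seq p q => p.loopFree && q.loopFree
  | cond _ p q => p.loopFree && q.loopFree
  | loop _ _ => false

/-- The effect of a program without loops. -/
def run : RamProg → RamStore → RamStore
  | skip, σ => σ
  | store k e f, σ => σ.upd k (e.eval σ) (f.eval σ)
  | seq p q, σ => q.run (p.run σ)
  | cond e p q, σ => if e.eval σ = 0 then q.run σ else p.run σ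
  | loop _ _, σ => σ

/-- A bound on the running time of a program without loops. -/
def maxTime : RamProg → ℕ
  | skip => 1
  | store _ e f => e.cost + f.cost + 1
  | seq p q => p.maxTime + q.maxTime
  | cond e p q => e.cost + 1 + max p.maxTime q.maxTime
  | loop _ _ => 0

/-- The arrays in which the program may change cells. -/
def writes : RamProg → List ℕ
  | skip => []
  | store k _ _ => [k]
  | seq p q => p.writes ++ q.writes
  | cond _ p q => p.writes ++ q.writes
  | loop _ p => p.writes

@[simp]
theorem run_append (p q : RamProg) (σ : RamStore) : (p ++ q).run σ = q.run (p.run σ) := rfl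
@[simp]
theorem run_store (k : ℕ) (e f : RamExpr) (σ : RamStore) :
    (store k e f).run σ = σ.upd k (e.eval σ) (f.eval σ) := rfl
@[simp]
theorem run_skip (σ : RamStore) : skip.run σ = σ := rfl
@[simp]
theorem run_cond (e : RamExpr) (p q : RamProg) (σ : RamStore) :
    (cond e p q).run σ = if e.eval σ = 0 then q.run σ else p.run σ := rfl

/-- Loop-free programs become functions, and `maxTime` depends on the program text only; it is a
constant in all later bounds. -/
theorem exec_run {p : RamProg} (h : p.loopFree = true) (σ : RamStore) :
    ∃ t, Exec p σ (p.run σ) t ∧ t ≤ p.maxTime := by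
  induction p generalizing σ with
  | skip => exact ⟨1, Exec.skip σ, le_rfl⟩
  | store k e f => exact ⟨_, Exec.store k e f σ, le_rfl⟩
  | seq p q hp hq =>
    rw [loopFree, Bool.and_eq_true] at h
    obtain ⟨t, ht, h1⟩ := hp h.1 σ
    obtain ⟨t', ht', h2⟩ := hq h.2 (p.run σ)
    exact ⟨_, Exec.seq ht ht', Nat.add_le_add h1 h2⟩
  | cond e p q hp hq =>
    rw [loopFree, Bool.and_eq_true] at h
    rw [run, maxTime]
    split_ifs with h0
    · obtain ⟨t, ht, h1⟩ := hq h.2 σ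
      exact ⟨_, Exec.cond_false h0 ht, by omega⟩
    · obtain ⟨t, ht, h1⟩ := hp h.1 σ
      exact ⟨_, Exec.cond_true h0 ht, by omega⟩
  | loop e p => cases h

theorem Exec.frame {p : RamProg} {σ σ' : RamStore} {t : ℕ} (h : Exec p σ σ' t) {k : ℕ}
    (hk : k ∉ p.writes) : σ' k = σ k := by
  induction h with
  | skip => rfl
  | store k' e f σ =>
    rw [writes, List.mem_singleton] at hk
    rw [Function.update_of_ne hk]
  | seq _ _ h1 h2 =>
    rw [writes, List.mem_append, not_or] at hk
    rw [h2 hk.2, h1 hk.1]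
  | cond_true _ _ h1 =>
    rw [writes, List.mem_append, not_or] at hk
    exact h1 hk.1
  | cond_false _ _ h1 =>
    rw [writes, List.mem_append, not_or] at hk
    exact h1 hk.2
  | loop_done => rfl
  | loop_step _ _ _ h1 h2 => rw [h2 hk, h1 hk]

theorem run_frame {p : RamProg} {k : ℕ} (hk : k ∉ p.writes) (σ : RamStore) :
    p.run σ k = σ k := by
  induction p generalizing σ with
  | skip => rfl
  | store k' e f =>
    rw [writes, List.mem_singleton] at hk
    rw [run, upd_of_ne hk]
  | seq p q hp hq =>
    rw [writes, List.mem_append, not_or] at hk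
    rw [run, hq hk.2, hp hk.1]
  | cond e p q hp hq =>
    rw [writes, List.mem_append, not_or] at hk
    rw [run]
    split_ifs
    exacts [hq hk.2 σ, hp hk.1 σ]
  | loop e p => rfl

/-- Started in `σ`, the program halts within `t` steps in a memory with the property `Q`. -/
def Runs (p : RamProg) (σ : RamStore) (t : ℕ) (Q : RamStore → Prop) : Prop :=
  ∃ σ' t', Exec p σ σ' t' ∧ t' ≤ t ∧ Q σ' ∧ ∀ k ∉ p.writes, σ' k = σ k

theorem runs_of_exec {p : RamProg} {σ σ' : RamStore} {t t' : ℕ} {Q : RamStore → Prop}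
    (h : Exec p σ σ' t') (ht : t' ≤ t) (hQ : Q σ') : Runs p σ t Q :=
  ⟨σ', t', h, ht, hQ, fun _ => h.frame⟩

theorem runs_of_loopFree {p : RamProg} {σ : RamStore} {Q : RamStore → Prop}
    (h : p.loopFree = true) (hQ : Q (p.run σ)) : Runs p σ p.maxTime Q := by
  obtain ⟨t, ht, h1⟩ := exec_run h σ
  exact runs_of_exec ht h1 hQ

theorem Runs.mono {p : RamProg} {σ : RamStore} {t t' : ℕ} {Q Q' : RamStore → Prop}
    (h : Runs p σ t Q) (ht : t ≤ t')
    (hQ : ∀ σ', Q σ' → (∀ k ∉ p.writes, σ' k = σ k) → Q' σ') : Runs p σ t' Q' := by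
  obtain ⟨σ', s, h1, h2, h3, h4⟩ := h
  exact ⟨σ', s, h1, h2.trans ht, hQ σ' h3 h4, h4⟩

theorem Runs.append {p q : RamProg} {σ : RamStore} {t t' : ℕ} {Q Q' : RamStore → Prop}
    (h : Runs p σ t Q) (h' : ∀ σ', Q σ' → (∀ k ∉ p.writes, σ' k = σ k) → Runs q σ' t' Q') :
    Runs (p ++ q) σ (t + t') Q' := by
  obtain ⟨σ', s, h1, h2, h3, h4⟩ := h
  obtain ⟨σ'', s', h5, h6, h7, -⟩ := h' σ' h3 h4
  exact runs_of_exec (Exec.seq h1 h5) (Nat.add_le_add h2 h6) h7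

theorem Runs.cond_true {e : RamExpr} {p q : RamProg} {σ : RamStore} {t : ℕ} {Q : RamStore → Prop}
    (he : e.eval σ ≠ 0) (h : Runs p σ t Q) : Runs (cond e p q) σ (e.cost + 1 + t) Q := by
  obtain ⟨σ', s, h1, h2, h3, -⟩ := h
  exact runs_of_exec (Exec.cond_true he h1) (by omega) h3

theorem Runs.cond_false {e : RamExpr} {p q : RamProg} {σ : RamStore} {t : ℕ} {Q : RamStore → Prop}
    (he : e.eval σ = 0) (h : Runs q σ t Q) : Runs (cond e p q) σ (e.cost + 1 + t) Q := by
  obtain ⟨σ', s, h1, h2, h3, -⟩ := h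
  exact runs_of_exec (Exec.cond_false he h1) (by omega) h3

/-- A loop with the invariant `I`, which depends on the number of repetitions so far. -/
theorem runs_loop {e : RamExpr} {p : RamProg} {σ : RamStore} {t N : ℕ}
    {I : ℕ → RamStore → Prop} (h0 : I 0 σ)
    (hs : ∀ j < N, ∀ σ, I j σ → e.eval σ ≠ 0 ∧ Runs p σ t (I (j + 1)))
    (hN : ∀ σ, I N σ → e.eval σ = 0) :
    Runs (loop e p) σ (N * (e.cost + 1 + t) + (e.cost + 1)) (I N) := by
  obtain ⟨d, hd⟩ : ∃ d, d = N := ⟨N, rfl⟩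
  suffices ∀ d j σ, j + d = N → I j σ → ∃ σ' t', Exec (loop e p) σ σ' t' ∧
      t' ≤ d * (e.cost + 1 + t) + (e.cost + 1) ∧ I N σ' by
    obtain ⟨σ', t', h1, h2, h3⟩ := this N 0 σ (by omega) h0
    exact runs_of_exec h1 h2 h3
  intro d
  induction d with
  | zero =>
    intro j σ hj hI
    obtain rfl : j = N := by omega
    exact ⟨σ, _, Exec.loop_done (hN σ hI), by omega, hI⟩
  | succ d ih =>
    intro j σ hj hI
    obtain ⟨he, σ', s, h1, h2, h3, -⟩ := hs j (by omega) σ hI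
    obtain ⟨σ'', s', h4, h5, h6⟩ := ih (j + 1) σ' (by omega) h3
    refine ⟨σ'', _, Exec.loop_step he h1 h4, ?_, h6⟩
    rw [Nat.succ_mul]
    omega

/-- A loop whose body has no loops. -/
theorem runs_loop_iterate {e : RamExpr} {p : RamProg} (hp : p.loopFree = true) {σ : RamStore}
    {N : ℕ} (hs : ∀ j < N, e.eval (p.run^[j] σ) ≠ 0) (hN : e.eval (p.run^[N] σ) = 0) :
    Runs (loop e p) σ (N * (e.cost + 1 + p.maxTime) + (e.cost + 1))
      (fun σ' => σ' = p.run^[N] σ) := by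
  refine runs_loop (I := fun j σ' => σ' = p.run^[j] σ) rfl ?_ ?_
  · rintro j hj _ rfl
    refine ⟨hs j hj, runs_of_loopFree hp ?_⟩
    rw [Function.iterate_succ_apply']
  · rintro _ rfl
    exact hN

theorem iterate_run_frame {p : RamProg} {k : ℕ} (hk : k ∉ p.writes) (n : ℕ) (σ : RamStore) :
    p.run^[n] σ k = σ k := by
  induction n with
  | zero => rfl
  | succ n ih => rw [Function.iterate_succ_apply', run_frame hk, ih]

/-- Append the value of `e` to the list in array `k`. -/
def push (k : ℕ) (e : RamExpr) : RamProg :=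
  store k (var k + 1) e ++ store k 0 (var k + 1)

theorem run_push {k : ℕ} {e : RamExpr} {σ : RamStore} {L : List ℕ} (h : σ.Buf k L) :
    (push k e).run σ = (σ.upd k (L.length + 1) (e.eval σ)).upd k 0 (L.length + 1) := by
  rw [push, run_append, run_store, run_store]
  simp only [eval_add, eval_var, eval_ofNat, upd_eq, h.length]
  rfl

theorem buf_push {k : ℕ} {e : RamExpr} {σ : RamStore} {L : List ℕ} (h : σ.Buf k L) :
    ((push k e).run σ).Buf k (L ++ [e.eval σ]) := by
  rw [run_push h]
  exact h.append_singleton rfl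

/-- Case distinction by the value of an expression. -/
def switch (e : RamExpr) (p₀ p₁ p₂ p₃ p₄ p₅ p₆ p₇ : RamProg) : RamProg :=
  cond (e - 6) p₇ (cond (e - 5) p₆ (cond (e - 4) p₅ (cond (e - 3) p₄ (cond (e - 2) p₃
    (cond (e - 1) p₂ (cond e p₁ p₀))))))

theorem run_switch {e : RamExpr} {p₀ p₁ p₂ p₃ p₄ p₅ p₆ p₇ : RamProg} {σ : RamStore} {n : ℕ}
    (h : e.eval σ = n) : (switch e p₀ p₁ p₂ p₃ p₄ p₅ p₆ p₇).run σ =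
      match n with
      | 0 => p₀.run σ | 1 => p₁.run σ | 2 => p₂.run σ | 3 => p₃.run σ | 4 => p₄.run σ
      | 5 => p₅.run σ | 6 => p₆.run σ | _ => p₇.run σ := by
  simp only [switch, run_cond, eval_sub, eval_ofNat, h]
  rcases n with _ | _ | _ | _ | _ | _ | _ | n <;> simp

/-- Codes of lengths: `0` stands for the absence of a word. Concatenation of words. -/
def conc (a b : ℕ) : ℕ := if a = 0 then 0 else if b = 0 then 0 else a + b - 1

/-- The first word that is present. -/
def orElse (a b : ℕ) : ℕ := if a = 0 then b else a

/-- Both words are present, and their lengths are different. -/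
def Differ (a b : ℕ) : Prop := a ≠ 0 ∧ b ≠ 0 ∧ a ≠ b

instance (a b : ℕ) : Decidable (Differ a b) := inferInstanceAs (Decidable (_ ∧ _))

def storeConc (k : ℕ) (i e f : RamExpr) : RamProg :=
  cond e (cond f (store k i (e + f - 1)) (store k i 0)) (store k i 0)

@[simp]
theorem run_storeConc (k : ℕ) (i e f : RamExpr) (σ : RamStore) :
    (storeConc k i e f).run σ = σ.upd k (i.eval σ) (conc (e.eval σ) (f.eval σ)) := by
  simp only [storeConc, run_cond, run_store, conc]
  split_ifs <;> rfl

def storeOr (k : ℕ) (i e f : RamExpr) : RamProg := cond e (store k i e) (store k i f)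

@[simp]
theorem run_storeOr (k : ℕ) (i e f : RamExpr) (σ : RamStore) :
    (storeOr k i e f).run σ = σ.upd k (i.eval σ) (orElse (e.eval σ) (f.eval σ)) := by
  simp only [storeOr, run_cond, run_store, orElse]
  split_ifs <;> rfl

/-- Choose between two values. -/
def storeIf (k : ℕ) (i c e f : RamExpr) : RamProg := cond c (store k i e) (store k i f)

@[simp]
theorem run_storeIf (k : ℕ) (i c e f : RamExpr) (σ : RamStore) :
    (storeIf k i c e f).run σ =
      σ.upd k (i.eval σ) (if c.eval σ = 0 then f.eval σ else e.eval σ) := by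
  simp only [storeIf, run_cond, run_store]
  split_ifs <;> rfl

end RamProg

/-! ### The first pass: positions, bracket words, leaves, variables -/

namespace Regex

open RamProg

variable {A X : Type*}

theorem size_pos (β : Regex A X) : 0 < β.size := by
  cases β <;> simp [size]

/-- The property `R` holds for all subexpressions, with their positions. -/
def AllSub (R : Regex A X → ℕ → Prop) : Regex A X → ℕ → Prop
  | cat β γ, o => R (cat β γ) o ∧ AllSub R β o ∧ AllSub R γ (o + β.size)
  | alt β γ, o => R (alt β γ) o ∧ AllSub R β o ∧ AllSub R γ (o + β.size)
  | plus β, o => R (plus β) o ∧ AllSub R β o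
  | bind x β, o => R (bind x β) o ∧ AllSub R β o
  | empty, o => R empty o
  | eps, o => R eps o
  | sym a, o => R (sym a) o
  | ref x, o => R (ref x) o

theorem AllSub.self {R : Regex A X → ℕ → Prop} {β : Regex A X} {o : ℕ} (h : β.AllSub R o) :
    R β o := by
  cases β
  case cat => exact h.1
  case alt => exact h.1
  case plus => exact h.1
  case bind => exact h.1
  all_goals exact h

theorem AllSub.mono {R R' : Regex A X → ℕ → Prop} {β : Regex A X} {o : ℕ} (h : β.AllSub R o)
    (hR : ∀ β' o', o ≤ o' → o' + β'.size ≤ o + β.size → R β' o' → R' β' o') :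
    β.AllSub R' o := by
  induction β generalizing o with
  | empty => exact hR _ _ le_rfl le_rfl h
  | eps => exact hR _ _ le_rfl le_rfl h
  | sym a => exact hR _ _ le_rfl le_rfl h
  | ref x => exact hR _ _ le_rfl le_rfl h
  | cat β γ hβ hγ =>
    exact ⟨hR _ _ le_rfl le_rfl h.1,
      hβ h.2.1 fun β' o' h1 h2 => hR β' o' h1 (by rw [size]; omega),
      hγ h.2.2 fun β' o' h1 h2 => hR β' o' (by omega) (by rw [size]; omega)⟩
  | alt β γ hβ hγ =>
    exact ⟨hR _ _ le_rfl le_rfl h.1,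
      hβ h.2.1 fun β' o' h1 h2 => hR β' o' h1 (by rw [size]; omega),
      hγ h.2.2 fun β' o' h1 h2 => hR β' o' (by omega) (by rw [size]; omega)⟩
  | plus β hβ =>
    exact ⟨hR _ _ le_rfl le_rfl h.1,
      hβ h.2 fun β' o' h1 h2 => hR β' o' h1 (by rw [size]; omega)⟩
  | bind x β hβ =>
    exact ⟨hR _ _ le_rfl le_rfl h.1,
      hβ h.2 fun β' o' h1 h2 => hR β' o' h1 (by rw [size]; omega)⟩

/-- Apply a function for every node of the syntax tree, children first. -/
def up {S : Type*} (F : S → S) : Regex A X → S → S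
  | cat β γ, σ => F (up F γ (up F β σ))
  | alt β γ, σ => F (up F γ (up F β σ))
  | plus β, σ => F (up F β σ)
  | bind _ β, σ => F (up F β σ)
  | empty, σ => F σ
  | eps, σ => F σ
  | sym _, σ => F σ
  | ref _, σ => F σ

/-- Apply a function for every node of the syntax tree, parents first, from right to left. -/
def down {S : Type*} (F : S → S) : Regex A X → S → S
  | cat β γ, σ => down F β (down F γ (F σ))
  | alt β γ, σ => down F β (down F γ (F σ))
  | plus β, σ => down F β (F σ)
  | bind _ β, σ => down F β (F σ)
  | empty, σ => F σ
  | eps, σ => F σ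
  | sym _, σ => F σ
  | ref _, σ => F σ

/-- Reverse Polish notation is the postorder of the syntax tree, so a flat loop over the positions
acts like a recursion over the tree; `down` is the same for decreasing positions. -/
theorem up_eq_iterate {S : Type*} (F : S → S) (β : Regex A X) (σ : S) :
    up F β σ = F^[β.size] σ := by
  induction β generalizing σ with
  | empty => rfl
  | eps => rfl
  | sym a => rfl
  | ref x => rfl
  | cat β γ hβ hγ =>
    rw [up, hβ, hγ, size, Function.iterate_succ_apply', Nat.add_comm, Function.iterate_add_apply]
  | alt β γ hβ hγ =>
    rw [up, hβ, hγ, size, Function.iterate_succ_apply', Nat.add_comm, Function.iterate_add_apply]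
  | plus β hβ => rw [up, hβ, size, Function.iterate_succ_apply']
  | bind x β hβ => rw [up, hβ, size, Function.iterate_succ_apply']

theorem down_eq_iterate {S : Type*} (F : S → S) (β : Regex A X) (σ : S) :
    down F β σ = F^[β.size] σ := by
  induction β generalizing σ with
  | empty => rfl
  | eps => rfl
  | sym a => rfl
  | ref x => rfl
  | cat β γ hβ hγ =>
    rw [down, hβ, hγ, size, Function.iterate_succ_apply, Function.iterate_add_apply]
  | alt β γ hβ hγ =>
    rw [down, hβ, hγ, size, Function.iterate_succ_apply, Function.iterate_add_apply]
  | plus β hβ => rw [down, hβ, size, Function.iterate_succ_apply]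
  | bind x β hβ => rw [down, hβ, size, Function.iterate_succ_apply]

/-- The length of the bracket word of a subexpression, increased by one; `0` if there is none. -/
def nullLen : Regex A X → ℕ
  | empty => 0
  | eps => 1
  | sym _ => 0
  | ref _ => 0
  | cat β γ => conc β.nullLen γ.nullLen
  | alt β γ => orElse β.nullLen γ.nullLen
  | plus β => β.nullLen
  | bind _ β => conc β.nullLen 3

/-- Every subexpression has at most one bracket word, in terms of lengths. -/
def NullLenOK : Regex A X → Prop
  | cat β γ => β.NullLenOK ∧ γ.NullLenOK
  | alt β γ => β.NullLenOK ∧ γ.NullLenOK ∧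
      (β.nullLen = 0 ∨ γ.nullLen = 0 ∨ β.nullLen + γ.nullLen ≤ 2)
  | plus β => β.NullLenOK ∧ β.nullLen ≤ 1
  | bind _ β => β.NullLenOK
  | _ => True

/-- The positions of the nodes. -/
def leafPos : Regex A X → ℕ → List ℕ
  | sym _, o => [o]
  | ref _, o => [o]
  | cat β γ, o => leafPos β o ++ leafPos γ (o + β.size)
  | alt β γ, o => leafPos β o ++ leafPos γ (o + β.size)
  | plus β, o => leafPos β o
  | bind _ β, o => leafPos β o
  | _, _ => []

theorem mem_leafPos {β : Regex A X} {o q : ℕ} (h : q ∈ leafPos β o) : InRange q o β := by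
  induction β generalizing o with
  | empty => cases h
  | eps => cases h
  | sym a =>
    obtain rfl : q = o := by simpa [leafPos] using h
    simp [InRange, size]
  | ref x =>
    obtain rfl : q = o := by simpa [leafPos] using h
    simp [InRange, size]
  | cat β γ hβ hγ =>
    rw [leafPos, List.mem_append] at h
    simp only [InRange, size] at hβ hγ ⊢
    rcases h with h | h
    · have := hβ h; omega
    · have := hγ h; omega
  | alt β γ hβ hγ =>
    rw [leafPos, List.mem_append] at h
    simp only [InRange, size] at hβ hγ ⊢
    rcases h with h | h
    · have := hβ h; omega
    · have := hγ h; omega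
  | plus β hβ =>
    have := hβ h
    simp only [InRange, size] at this ⊢
    omega
  | bind x β hβ =>
    have := hβ h
    simp only [InRange, size] at this ⊢
    omega

theorem length_leafPos (β : Regex A X) (o : ℕ) : (leafPos β o).length = β.occ := by
  induction β generalizing o with
  | empty => rfl
  | eps => rfl
  | sym a => rfl
  | ref x => rfl
  | cat β γ hβ hγ => rw [leafPos, List.length_append, hβ, hγ, occ]
  | alt β γ hβ hγ => rw [leafPos, List.length_append, hβ, hγ, occ]
  | plus β hβ => exact hβ o
  | bind x β hβ => exact hβ o

/-- Add an element to a list unless it is there. -/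
def addVar [DecidableEq X] (S : List X) (x : X) : List X := if x ∈ S then S else S ++ [x]

/-- Add the variables of a regex to a list. -/
def addVars [DecidableEq X] (S : List X) : Regex A X → List X
  | ref x => addVar S x
  | cat β γ => addVars (addVars S β) γ
  | alt β γ => addVars (addVars S β) γ
  | plus β => addVars S β
  | bind x β => addVar (addVars S β) x
  | _ => S

theorem mem_addVar [DecidableEq X] {S : List X} {x y : X} : y ∈ addVar S x ↔ y ∈ S ∨ y = x := by
  rw [addVar]
  split_ifs with h
  · exact ⟨Or.inl, fun h' => h'.elim id fun h' => h' ▸ h⟩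
  · simp

theorem mem_addVars [DecidableEq X] {β : Regex A X} {S : List X} {y : X} :
    y ∈ addVars S β ↔ y ∈ S ∨ y ∈ β.var := by
  induction β generalizing S with
  | empty => simp [addVars, var]
  | eps => simp [addVars, var]
  | sym a => simp [addVars, var]
  | ref x => simp [addVars, var, mem_addVar]
  | cat β γ hβ hγ => rw [addVars, hγ, hβ, var, Set.mem_union, or_assoc]
  | alt β γ hβ hγ => rw [addVars, hγ, hβ, var, Set.mem_union, or_assoc]
  | plus β hβ => exact hβ
  | bind x β hβ => rw [addVars, mem_addVar, hβ, var, Set.mem_insert_iff, or_assoc, or_comm (a := y = x)]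

/-- The array `c` holds the regex in reverse Polish notation, from position `o`. -/
def Coded {s : ℕ} (c : ℕ → ℕ) : Regex (Fin s) ℕ → ℕ → Prop
  | empty, o => c (2 + o + o) = 0
  | eps, o => c (2 + o + o) = 1
  | sym a, o => c (2 + o + o) = 2 ∧ c (3 + o + o) = a
  | ref x, o => c (2 + o + o) = 3 ∧ c (3 + o + o) = x
  | cat β γ, o => β.Coded c o ∧ γ.Coded c (o + β.size) ∧
      c (2 + (o + β.size + γ.size) + (o + β.size + γ.size)) = 4
  | alt β γ, o => β.Coded c o ∧ γ.Coded c (o + β.size) ∧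
      c (2 + (o + β.size + γ.size) + (o + β.size + γ.size)) = 5
  | plus β, o => β.Coded c o ∧ c (2 + (o + β.size) + (o + β.size)) = 6
  | bind x β, o => β.Coded c o ∧ c (2 + (o + β.size) + (o + β.size)) = 7 ∧
      c (3 + (o + β.size) + (o + β.size)) = x

theorem length_encode {s : ℕ} (β : Regex (Fin s) ℕ) : β.encode.length = β.size + β.size := by
  induction β with
  | cat β γ hβ hγ => simp [encode, size, hβ, hγ]; omega
  | alt β γ hβ hγ => simp [encode, size, hβ, hγ]; omega
  | plus β hβ => simp [encode, size, hβ]; omega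
  | bind x β hβ => simp [encode, size, hβ]; omega
  | _ => rfl

/-- Cell 0 of the input array holds the length of the input and cell 1 the size of the alphabet; so
the tree node at position `p` occupies the cells `2 + p + p` and `3 + p + p`. -/
theorem coded_of_eq {s : ℕ} {c : ℕ → ℕ} (β : Regex (Fin s) ℕ) {o : ℕ}
    (h : ∀ j (hj : j < β.encode.length), c (2 + o + o + j) = β.encode[j]) : β.Coded c o := by
  induction β generalizing o with
  | empty => exact h 0 (by simp [encode])
  | eps => exact h 0 (by simp [encode])
  | sym a => exact ⟨h 0 (by simp [encode]), by
      rw [show 3 + o + o = 2 + o + o + 1 by omega]; exact h 1 (by simp [encode])⟩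
  | ref a => exact ⟨h 0 (by simp [encode]), by
      rw [show 3 + o + o = 2 + o + o + 1 by omega]; exact h 1 (by simp [encode])⟩
  | cat β γ hβ hγ =>
    have hb := β.length_encode
    have hg := γ.length_encode
    refine ⟨hβ fun j hj => ?_, hγ fun j hj => ?_, ?_⟩
    · rw [h j (by simp [encode]; omega)]
      simp [encode, hj]
    · rw [show 2 + (o + β.size) + (o + β.size) + j = 2 + o + o + (β.encode.length + j) by omega,
        h _ (by simp [encode]; omega)]
      simp [encode, hj]
    · rw [show 2 + (o + β.size + γ.size) + (o + β.size + γ.size) =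
        2 + o + o + (β.encode.length + γ.encode.length) by omega, h _ (by simp [encode])]
      simp [encode]
  | alt β γ hβ hγ =>
    have hb := β.length_encode
    have hg := γ.length_encode
    refine ⟨hβ fun j hj => ?_, hγ fun j hj => ?_, ?_⟩
    · rw [h j (by simp [encode]; omega)]
      simp [encode, hj]
    · rw [show 2 + (o + β.size) + (o + β.size) + j = 2 + o + o + (β.encode.length + j) by omega,
        h _ (by simp [encode]; omega)]
      simp [encode, hj]
    · rw [show 2 + (o + β.size + γ.size) + (o + β.size + γ.size) =
        2 + o + o + (β.encode.length + γ.encode.length) by omega, h _ (by simp [encode])]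
      simp [encode]
  | plus β hβ =>
    have hb := β.length_encode
    refine ⟨hβ fun j hj => ?_, ?_⟩
    · rw [h j (by simp [encode]; omega)]
      simp [encode, hj]
    · rw [show 2 + (o + β.size) + (o + β.size) = 2 + o + o + β.encode.length by omega,
        h _ (by simp [encode])]
      simp [encode]
  | bind x β hβ =>
    have hb := β.length_encode
    refine ⟨hβ fun j hj => ?_, ?_, ?_⟩
    · rw [h j (by simp [encode]; omega)]
      simp [encode, hj]
    · rw [show 2 + (o + β.size) + (o + β.size) = 2 + o + o + β.encode.length by omega,
        h _ (by simp [encode])]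
      simp [encode]
    · rw [show 3 + (o + β.size) + (o + β.size) = 2 + o + o + (β.encode.length + 1) by omega,
        h _ (by simp [encode])]
      simp [encode]

end Regex

namespace RamProg

open RamExpr RamStore Regex

/-- The kind of the syntax tree node at the current position. -/
def kind : RamExpr := load 0 (2 + var 21 + var 21)

/-- The letter or variable of the syntax tree node at the current position. -/
def symbol : RamExpr := load 0 (3 + var 21 + var 21)

@[simp]
theorem eval_kind (σ : RamStore) : kind.eval σ = σ 0 (2 + σ 21 0 + σ 21 0) := rfl

@[simp]
theorem eval_symbol (σ : RamStore) : symbol.eval σ = σ 0 (3 + σ 21 0 + σ 21 0) := rfl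

/-- Record a failure unless the lengths are compatible. -/
def checkAlt (e f : RamExpr) : RamProg :=
  cond e (cond f (cond (e + f - 2) (store 24 0 1) skip) skip) skip

theorem run_checkAlt (e f : RamExpr) (σ : RamStore) : (checkAlt e f).run σ = σ.upd 24 0
    (if e.eval σ = 0 ∨ f.eval σ = 0 ∨ e.eval σ + f.eval σ ≤ 2 then σ 24 0 else 1) := by
  simp only [checkAlt, run_cond, run_store, run_skip, eval_ofNat, eval_sub, eval_add,
    Nat.sub_eq_zero_iff_le]
  by_cases h1 : e.eval σ = 0 <;> by_cases h2 : f.eval σ = 0 <;>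
    by_cases h3 : e.eval σ + f.eval σ ≤ 2 <;> simp [h1, h2, h3, upd_id]

/-- Record a failure unless the length is zero. -/
def checkPlus (e : RamExpr) : RamProg := cond (e - 1) (store 24 0 1) skip

theorem run_checkPlus (e : RamExpr) (σ : RamStore) : (checkPlus e).run σ = σ.upd 24 0
    (if e.eval σ ≤ 1 then σ 24 0 else 1) := by
  simp only [checkPlus, run_cond, run_store, run_skip, eval_ofNat, eval_sub,
    Nat.sub_eq_zero_iff_le]
  split_ifs <;> simp [upd_id]

/-- Assign a number to a variable unless it has one. -/
def newVar : RamProg :=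
  cond (load 4 symbol) skip (store 23 0 (var 23 + 1) ++ store 4 symbol (var 23))

/-- Roles of the arrays. 0: input; 1: output; 2 and 3: first position and bracket length of the
subexpression that ends at a position; 4: numbers of the variables, 0 for none yet; 5 and 6: list of
the leaf positions, and their indices; 7: exit lengths; 8 and 9: entrance lengths and turns; 10:
whether a subexpression is passed; 11: priorities of net actions, by variable number; 12: letters
met; 13: reached positions; 14 and 15: final states and transitions; 16: instruction codes. Single
cells: 20 size of the tree; 21 current position; 23 number of variables; 24 failure; 26 some
reference is reached; 27 number of leaves; 28 number of transitions; 30 and 31 position and number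
of the source; 33 and 34 target and turn; 36 left child. The others are auxiliary. -/
def scanLeaf : RamProg :=
  store 3 (var 21) 0 ++ store 2 (var 21) (var 21) ++ store 6 (var 21) (var 5) ++ push 5 (var 21)

/-- Process a node of the syntax tree in the first pass. -/
def scanNode : RamProg :=
  -- The right child ends at the preceding position, and the left child ends just before the first
  -- position of the right one.
  store 36 0 (load 2 (var 21 - 1) - 1) ++
  switch kind
    (store 3 (var 21) 0 ++ store 2 (var 21) (var 21))
    (store 3 (var 21) 1 ++ store 2 (var 21) (var 21))
    scanLeaf
    (scanLeaf ++ newVar)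
    (storeConc 3 (var 21) (load 3 (var 36)) (load 3 (var 21 - 1)) ++
      store 2 (var 21) (load 2 (var 36)))
    (checkAlt (load 3 (var 36)) (load 3 (var 21 - 1)) ++
      storeOr 3 (var 21) (load 3 (var 36)) (load 3 (var 21 - 1)) ++
      store 2 (var 21) (load 2 (var 36)))
    (checkPlus (load 3 (var 21 - 1)) ++
      store 3 (var 21) (load 3 (var 21 - 1)) ++ store 2 (var 21) (load 2 (var 21 - 1)))
    (storeConc 3 (var 21) (load 3 (var 21 - 1)) 3 ++
      store 2 (var 21) (load 2 (var 21 - 1)) ++ newVar) ++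
  store 21 0 (var 21 + 1)

/-- The variables in the list `S` are numbered from `1`. -/
structure Numbered (σ : RamStore) (S : List ℕ) : Prop where
  nodup : S.Nodup
  count : σ 23 0 = S.length
  eq : ∀ j (hj : j < S.length), σ 4 S[j] = j + 1
  zero : ∀ x ∉ S, σ 4 x = 0

theorem Numbered.congr {σ σ' : RamStore} {S : List ℕ} (h : Numbered σ S) (h1 : σ' 23 = σ 23)
    (h2 : σ' 4 = σ 4) : Numbered σ' S :=
  ⟨h.nodup, by rw [h1, h.count], fun j hj => by rw [h2, h.eq j hj],
    fun x hx => by rw [h2, h.zero x hx]⟩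

theorem run_newVar (σ : RamStore) : newVar.run σ =
    if σ 4 (symbol.eval σ) = 0 then
      (σ.upd 23 0 (σ 23 0 + 1)).upd 4 (symbol.eval σ) (σ 23 0 + 1)
    else σ := by
  simp [newVar]
  rfl

theorem numbered_newVar {σ : RamStore} {S : List ℕ} (h : Numbered σ S) {x : ℕ}
    (hx : symbol.eval σ = x) : Numbered (newVar.run σ) (addVar S x) := by
  rw [run_newVar, hx, addVar]
  by_cases hS : x ∈ S
  · obtain ⟨j, hj, rfl⟩ := List.getElem_of_mem hS
    rw [h.eq j hj, if_neg (by omega), if_pos hS]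
    exact h
  · rw [h.zero x hS, if_pos rfl, if_neg hS, h.count]
    refine ⟨?_, by simp, fun j hj => ?_, fun y hy => ?_⟩
    · exact List.nodup_append.2 ⟨h.nodup, List.nodup_singleton x, fun a ha b hb => by
        rw [List.mem_singleton.1 hb]; rintro rfl; exact hS ha⟩
    · rw [List.length_append, List.length_singleton] at hj
      rcases Nat.lt_or_ge j S.length with h1 | h1
      · have h2 : S[j] ≠ x := fun h3 => hS (h3 ▸ List.getElem_mem h1)
        simp [List.getElem_append_left h1, h2, h.eq j h1]
      · obtain rfl : j = S.length := by omega
        simp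
    · rw [List.mem_append, List.mem_singleton, not_or] at hy
      simp [hy.2, h.zero y hy.1]

/-- Array `5` lists the positions of the nodes, and array `6` holds their indices. -/
def Indexed (σ : RamStore) (L : List ℕ) : Prop :=
  σ.Buf 5 L ∧ ∀ j (hj : j < L.length), σ 6 L[j] = j

/-- Array `2` holds the first positions of the subexpressions, and array `3` holds the lengths of
their bracket words. -/
def Tabled {A X : Type*} (σ : RamStore) (β : Regex A X) (o : ℕ) : Prop :=
  σ 2 (o + β.size - 1) = o ∧ σ 3 (o + β.size - 1) = β.nullLen

/-- The effect of the first pass on a subexpression. -/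
structure Scanned {s : ℕ} (β : Regex (Fin s) ℕ) (o : ℕ) (L S : List ℕ) (σ σ' : RamStore) :
    Prop where
  pos : σ' 21 0 = o + β.size
  table : β.AllSub (Tabled σ') o
  frame : ∀ q < o, σ' 2 q = σ 2 q ∧ σ' 3 q = σ 3 q
  indexed : Indexed σ' (L ++ leafPos β o)
  numbered : Numbered σ' (addVars S β)
  fail : σ' 24 0 = 0 ↔ σ 24 0 = 0 ∧ β.NullLenOK

theorem _root_.Regex.AllSub.tabled {A X : Type*} {σ σ' : RamStore} {β : Regex A X} {o p : ℕ}
    (h : β.AllSub (Tabled σ) o) (hp : o + β.size ≤ p)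
    (h' : ∀ q < p, σ' 2 q = σ 2 q ∧ σ' 3 q = σ 3 q) : β.AllSub (Tabled σ') o :=
  h.mono fun β' o' h1 h2 h3 => by
    have := β'.size_pos
    rw [Tabled, (h' _ (by omega)).1, (h' _ (by omega)).2]
    exact h3

/-- The effect of the first pass on a node of the syntax tree at position `p`, where `l` is the
position of the left child of a binary node, by the kind of the node. -/
def scanEffect (σ : RamStore) (p l : ℕ) : ℕ → RamStore
  | 0 => ((σ.upd 36 0 l).upd 3 p 0).upd 2 p p
  | 1 => ((σ.upd 36 0 l).upd 3 p 1).upd 2 p p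
  | 2 => scanLeaf.run (σ.upd 36 0 l)
  | 3 => newVar.run (scanLeaf.run (σ.upd 36 0 l))
  | 4 => ((σ.upd 36 0 l).upd 3 p (conc (σ 3 l) (σ 3 (p - 1)))).upd 2 p (σ 2 l)
  | 5 => (((σ.upd 36 0 l).upd 24 0 (if σ 3 l = 0 ∨ σ 3 (p - 1) = 0 ∨ σ 3 l + σ 3 (p - 1) ≤ 2
      then σ 24 0 else 1)).upd 3 p (orElse (σ 3 l) (σ 3 (p - 1)))).upd 2 p (σ 2 l)
  | 6 => (((σ.upd 36 0 l).upd 24 0 (if σ 3 (p - 1) ≤ 1 then σ 24 0 else 1)).upd 3 p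
      (σ 3 (p - 1))).upd 2 p (σ 2 (p - 1))
  | _ => newVar.run (((σ.upd 36 0 l).upd 3 p (conc (σ 3 (p - 1)) 3)).upd 2 p (σ 2 (p - 1)))

theorem run_scanNode {σ : RamStore} {p n : ℕ} (hp : σ 21 0 = p) (h : σ 0 (2 + p + p) = n) :
    scanNode.run σ = (scanEffect σ p (σ 2 (p - 1) - 1) n).upd 21 0 (p + 1) := by
  have hk : kind.eval (σ.upd 36 0 (σ 2 (p - 1) - 1)) = n := by
    rw [← h]; simp [hp]
  rw [scanNode, run_append, run_append]
  rw [run_store _ _ _ σ, show RamExpr.eval σ (load 2 (var 21 - 1) - 1) = σ 2 (p - 1) - 1 by simp [hp],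
    show RamExpr.eval σ 0 = 0 from rfl, run_switch hk]
  have h1 : ∀ σ' : RamStore, σ' 21 = σ 21 →
      (store 21 0 (var 21 + 1)).run σ' = σ'.upd 21 0 (p + 1) := fun σ' h' => by simp [h', hp]
  rw [h1]
  · congr 1
    rcases n with _ | _ | _ | _ | _ | _ | _ | n
    · simp [hp, scanEffect]
    · simp [hp, scanEffect]
    · rfl
    · rfl
    · simp [hp, scanEffect]
    · simp [run_checkAlt, hp, scanEffect]
    · simp [run_checkPlus, hp, scanEffect]
    · refine congrArg newVar.run ?_
      simp only [run_append, run_storeConc, run_store, eval_var, eval_load, eval_sub, eval_ofNat,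
        upd_of_ne, ne_eq, Nat.reduceEqDiff, not_false_eq_true, hp]
  · rcases n with _ | _ | _ | _ | _ | _ | _ | n <;>
      exact (run_frame (by decide) _).trans (upd_of_ne (by decide) _ _ _)

theorem scanned_leaf {σ : RamStore} {L : List ℕ} (hL : Indexed σ L) (hp : ∀ q ∈ L, q < σ 21 0) :
    Indexed (scanLeaf.run σ) (L ++ [σ 21 0]) := by
  have h1 : (((store 3 (var 21) 0 ++ store 2 (var 21) (var 21) ++
      store 6 (var 21) (var 5)).run σ)).Buf 5 L := hL.1.congr (run_frame (by decide) σ)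
  rw [scanLeaf, run_append]
  refine ⟨?_, fun j hj => ?_⟩
  · have h2 := buf_push (e := var 21) h1
    simpa using h2
  · rw [run_frame (by decide)]
    rw [List.length_append, List.length_singleton] at hj
    rcases Nat.lt_or_ge j L.length with h3 | h3
    · have h4 := hp _ (List.getElem_mem h3)
      simp [List.getElem_append_left h3, h4.ne, hL.2 j h3]
    · obtain rfl : j = L.length := by omega
      simp [hL.1.length]

theorem Indexed.congr {σ σ' : RamStore} {L : List ℕ} (h : Indexed σ L) (h5 : σ' 5 = σ 5)
    (h6 : σ' 6 = σ 6) : Indexed σ' L :=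
  ⟨h.1.congr h5, fun j hj => by rw [h6, h.2 j hj]⟩

/-- Common to terminals and references; `h` leaves the arrays 4 and 23 open because a reference may
also number its variable. -/
theorem scanned_sym {s : ℕ} {β : Regex (Fin s) ℕ} {o : ℕ} {L S : List ℕ} {σ σ' : RamStore}
    (hp : σ 21 0 = o) (hL : Indexed σ L) (hLo : ∀ q ∈ L, q < o) (hβ : β.size = 1)
    (hβn : β.nullLen = 0) (hβL : leafPos β o = [o]) (hβA : β.NullLenOK)
    (hβR : β.AllSub (Tabled σ') o ↔ Tabled σ' β o)
    (h : ∀ k, k ≠ 21 → k ≠ 23 → k ≠ 4 → σ' k = scanLeaf.run (σ.upd 36 0 (σ 2 (o - 1) - 1)) k)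
    (h21 : σ' 21 0 = o + 1) (hS : Numbered σ' (addVars S β)) : Scanned β o L S σ σ' := by
  have hi := scanned_leaf (σ := σ.upd 36 0 (σ 2 (o - 1) - 1)) (hL.congr rfl rfl)
    (by simpa [hp] using hLo)
  have h2 := h 2 (by decide) (by decide) (by decide)
  have h3 := h 3 (by decide) (by decide) (by decide)
  have h24 := h 24 (by decide) (by decide) (by decide)
  simp [scanLeaf, push, hp] at h2 h3 h24
  refine ⟨by rw [h21, hβ], ?_, fun q hq => ?_, ?_, hS, by simp [h24, hβA]⟩
  · simp [hβR, Tabled, hβ, h2, h3, hβn]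
  · simp [h2, h3, hq.ne]
  · rw [hβL]
    simpa [hp] using hi.congr (h 5 (by decide) (by decide) (by decide))
      (h 6 (by decide) (by decide) (by decide))

theorem up_frame {A X : Type*} (β : Regex A X) {p : RamProg} {k : ℕ} (hk : k ∉ p.writes)
    (σ : RamStore) : up p.run β σ k = σ k := by
  rw [up_eq_iterate, iterate_run_frame hk]

theorem ite_eq_zero_iff {p : Prop} [Decidable p] {n : ℕ} :
    (if p then n else 1) = 0 ↔ p ∧ n = 0 := by
  split_ifs with h <;> simp [h]

/-- `L` and `S` are the leaves and variables found before position `o`. The tables at smaller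
positions are not changed, so the entries of a left child survive the treatment of the right child
and can be used by the parent. -/
theorem scanned {s : ℕ} (β : Regex (Fin s) ℕ) {o : ℕ} {L S : List ℕ} {σ : RamStore}
    (hp : σ 21 0 = o) (hc : β.Coded (σ 0) o) (hL : Indexed σ L) (hLo : ∀ q ∈ L, q < o)
    (hS : Numbered σ S) : Scanned β o L S σ (up scanNode.run β σ) := by
  induction β generalizing o L S σ with
  | empty =>
    rw [up, run_scanNode (n := 0) hp hc, scanEffect]
    exact ⟨by simp [size], by simp [AllSub, Tabled, size, nullLen],
      fun q hq => by simp [hq.ne], by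
        rw [show leafPos _ o = [] from rfl, List.append_nil]; exact hL.congr rfl rfl,
      hS.congr rfl rfl, by simp [NullLenOK]⟩
  | eps =>
    rw [up, run_scanNode (n := 1) hp hc, scanEffect]
    exact ⟨by simp [size], by simp [AllSub, Tabled, size, nullLen],
      fun q hq => by simp [hq.ne], by
        rw [show leafPos _ o = [] from rfl, List.append_nil]; exact hL.congr rfl rfl,
      hS.congr rfl rfl, by simp [NullLenOK]⟩
  | sym a =>
    rw [up, run_scanNode (n := 2) hp hc.1, scanEffect]
    refine scanned_sym hp hL hLo rfl rfl rfl trivial Iff.rfl (fun k h1 _ _ => upd_of_ne h1 _ _ _)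
      (by simp) (hS.congr ?_ ?_)
    · rw [upd_of_ne (by decide), run_frame (by decide)]
      rfl
    · rw [upd_of_ne (by decide), run_frame (by decide)]
      rfl
  | ref x =>
    rw [up, run_scanNode (n := 3) hp hc.1, scanEffect]
    refine scanned_sym hp hL hLo rfl rfl rfl trivial Iff.rfl (fun k h1 h2 h3 => ?_)
      (by simp) (Numbered.congr (numbered_newVar (hS.congr ?_ ?_) ?_) rfl rfl)
    · rw [upd_of_ne h1, run_frame (show k ∉ [23, 4] by simp [h2, h3])]
    · rw [run_frame (by decide)]
      rfl
    · rw [run_frame (by decide)]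
      rfl
    · rw [eval_symbol, run_frame (by decide), run_frame (by decide), upd_of_ne (by decide),
        upd_of_ne (by decide), hp, hc.2]
  | cat β γ hβ hγ =>
    have h1 := hβ hp hc.1 hL hLo hS
    have h2 := hγ h1.pos (by rw [up_frame β (by decide)]; exact hc.2.1) h1.indexed
      (fun q hq => by
        rcases List.mem_append.1 hq with hq | hq
        · have := hLo q hq; omega
        · exact (mem_leafPos hq).2) h1.numbered
    have h3 : up scanNode.run γ (up scanNode.run β σ) 0 = σ 0 := by
      rw [up_frame γ (by decide), up_frame β (by decide)]
    rw [up]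
    generalize up scanNode.run γ (up scanNode.run β σ) = σ₂ at *
    generalize up scanNode.run β σ = σ₁ at *
    have hF := run_scanNode (n := 4) h2.pos (by rw [h3]; exact hc.2.2)
    have s1 := (h1.table.tabled le_rfl h2.frame).self
    have s2 := h2.table.self
    rw [Tabled] at s1 s2
    rw [scanEffect, s2.1, s2.2, s1.1, s1.2] at hF
    generalize scanNode.run σ₂ = σ₃ at hF ⊢
    have hf : ∀ q < o + β.size + γ.size, σ₃ 2 q = σ₂ 2 q ∧ σ₃ 3 q = σ₂ 3 q := fun q hq => by
      simp [hF, hq.ne]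
    refine ⟨?_, ⟨?_, (h1.table.tabled le_rfl h2.frame).tabled (Nat.le_add_right _ _) hf,
      h2.table.tabled le_rfl hf⟩, fun q hq => ?_, ?_, ?_, ?_⟩
    · simp [hF, size, Nat.add_assoc]
    · simp [hF, Tabled, size, nullLen, ← Nat.add_assoc]
    · have := hf q (by omega)
      have := h2.frame q (by omega)
      have := h1.frame q hq
      omega
    · rw [leafPos, ← List.append_assoc]
      exact h2.indexed.congr (by rw [hF]; rfl) (by rw [hF]; rfl)
    · exact h2.numbered.congr (by rw [hF]; rfl) (by rw [hF]; rfl)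
    · simp [hF, h2.fail, h1.fail, NullLenOK, and_assoc]
  | alt β γ hβ hγ =>
    have h1 := hβ hp hc.1 hL hLo hS
    have h2 := hγ h1.pos (by rw [up_frame β (by decide)]; exact hc.2.1) h1.indexed
      (fun q hq => by
        rcases List.mem_append.1 hq with hq | hq
        · have := hLo q hq; omega
        · exact (mem_leafPos hq).2) h1.numbered
    have h3 : up scanNode.run γ (up scanNode.run β σ) 0 = σ 0 := by
      rw [up_frame γ (by decide), up_frame β (by decide)]
    rw [up]
    generalize up scanNode.run γ (up scanNode.run β σ) = σ₂ at *
    generalize up scanNode.run β σ = σ₁ at *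
    have hF := run_scanNode (n := 5) h2.pos (by rw [h3]; exact hc.2.2)
    have s1 := (h1.table.tabled le_rfl h2.frame).self
    have s2 := h2.table.self
    rw [Tabled] at s1 s2
    rw [scanEffect, s2.1, s2.2, s1.1, s1.2] at hF
    generalize scanNode.run σ₂ = σ₃ at hF ⊢
    have hf : ∀ q < o + β.size + γ.size, σ₃ 2 q = σ₂ 2 q ∧ σ₃ 3 q = σ₂ 3 q := fun q hq => by
      simp [hF, hq.ne]
    refine ⟨?_, ⟨?_, (h1.table.tabled le_rfl h2.frame).tabled (Nat.le_add_right _ _) hf,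
      h2.table.tabled le_rfl hf⟩, fun q hq => ?_, ?_, ?_, ?_⟩
    · simp [hF, size, Nat.add_assoc]
    · simp [hF, Tabled, size, nullLen, ← Nat.add_assoc]
    · have := hf q (by omega)
      have := h2.frame q (by omega)
      have := h1.frame q hq
      omega
    · rw [leafPos, ← List.append_assoc]
      exact h2.indexed.congr (by rw [hF]; rfl) (by rw [hF]; rfl)
    · exact h2.numbered.congr (by rw [hF]; rfl) (by rw [hF]; rfl)
    · have h4 := h2.fail
      rw [h1.fail] at h4
      have h5 : σ₃ 24 0 = if β.nullLen = 0 ∨ γ.nullLen = 0 ∨ β.nullLen + γ.nullLen ≤ 2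
          then σ₂ 24 0 else 1 := by simp [hF]
      rw [h5, ite_eq_zero_iff, h4, NullLenOK]
      tauto
  | plus β hβ =>
    have h1 := hβ hp hc.1 hL hLo hS
    have h3 : up scanNode.run β σ 0 = σ 0 := up_frame β (by decide) σ
    rw [up]
    generalize up scanNode.run β σ = σ₁ at *
    have hF := run_scanNode (n := 6) h1.pos (by rw [h3]; exact hc.2)
    have s1 := h1.table.self
    rw [Tabled] at s1
    rw [scanEffect, s1.1, s1.2] at hF
    generalize scanNode.run σ₁ = σ₃ at hF ⊢
    have hf : ∀ q < o + β.size, σ₃ 2 q = σ₁ 2 q ∧ σ₃ 3 q = σ₁ 3 q := fun q hq => by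
      simp [hF, hq.ne]
    refine ⟨?_, ⟨?_, h1.table.tabled le_rfl hf⟩, fun q hq => ?_, ?_, ?_, ?_⟩
    · simp [hF, size, Nat.add_assoc]
    · simp [hF, Tabled, size, nullLen, ← Nat.add_assoc]
    · have := hf q (by omega)
      have := h1.frame q hq
      omega
    · exact h1.indexed.congr (by rw [hF]; rfl) (by rw [hF]; rfl)
    · exact h1.numbered.congr (by rw [hF]; rfl) (by rw [hF]; rfl)
    · have h4 := h1.fail
      have h5 : σ₃ 24 0 = if β.nullLen ≤ 1 then σ₁ 24 0 else 1 := by simp [hF]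
      rw [h5, ite_eq_zero_iff, h4, NullLenOK]
      tauto
  | bind x β hβ =>
    have h1 := hβ hp hc.1 hL hLo hS
    have h3 : up scanNode.run β σ 0 = σ 0 := up_frame β (by decide) σ
    rw [up]
    generalize up scanNode.run β σ = σ₁ at *
    have hF := run_scanNode (n := 7) h1.pos (by rw [h3]; exact hc.2.1)
    have s1 := h1.table.self
    rw [Tabled] at s1
    change _ = (newVar.run (((σ₁.upd 36 0 _).upd 3 (o + β.size) (conc (σ₁ 3 (o + β.size - 1)) 3)).upd 2
      (o + β.size) (σ₁ 2 (o + β.size - 1)))).upd 21 0 (o + β.size + 1) at hF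
    rw [s1.1, s1.2] at hF
    generalize scanNode.run σ₁ = σ₃ at hF ⊢
    generalize hB : ((σ₁.upd 36 0 (o - 1)).upd 3 (o + β.size) (conc β.nullLen 3)).upd 2
      (o + β.size) o = B at hF
    have hN : ∀ k, k ≠ 23 → k ≠ 4 → newVar.run B k = B k := fun k h2 h3 =>
      run_frame (show k ∉ [23, 4] by simp [h2, h3]) B
    have hf : ∀ q < o + β.size, σ₃ 2 q = σ₁ 2 q ∧ σ₃ 3 q = σ₁ 3 q := fun q hq => by
      simp only [hF, upd_apply, Nat.reduceEqDiff, false_and, if_false]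
      rw [hN 2 (by decide) (by decide), hN 3 (by decide) (by decide), ← hB]
      simp [hq.ne]
    refine ⟨?_, ⟨?_, h1.table.tabled le_rfl hf⟩, fun q hq => ?_, ?_, ?_, ?_⟩
    · simp [hF, size, Nat.add_assoc]
    · rw [hF, Tabled, upd_of_ne (by decide), upd_of_ne (by decide), hN 2 (by decide) (by decide),
        hN 3 (by decide) (by decide), ← hB]
      simp [size, nullLen, ← Nat.add_assoc]
    · have := hf q (by omega)
      have := h1.frame q hq
      omega
    · exact h1.indexed.congr (by rw [hF, upd_of_ne (by decide), hN _ (by decide) (by decide), ← hB]; rfl)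
        (by rw [hF, upd_of_ne (by decide), hN _ (by decide) (by decide), ← hB]; rfl)
    · refine Numbered.congr (numbered_newVar (h1.numbered.congr (σ' := B) ?_ ?_) (x := x) ?_) ?_ ?_
      · rw [← hB]; rfl
      · rw [← hB]; rfl
      · rw [← hB, eval_symbol]
        simp [h3, h1.pos, hc.2.2]
      · rw [hF]; rfl
      · rw [hF]; rfl
    · rw [hF, upd_of_ne (by decide), hN 24 (by decide) (by decide), ← hB]
      simp [h1.fail, NullLenOK]

end RamProg

/-! ### The passes for a source: exits, entrances, net actions -/

namespace Regex

open RamProg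

variable {A X : Type*}

/-- The length of the bracket word from position `u` to the exit, increased by one; `0` if there
is none. -/
def outLen (u : ℕ) : Regex A X → ℕ → ℕ
  | empty, _ => 0
  | eps, _ => 0
  | sym _, o => if u = o then 1 else 0
  | ref _, o => if u = o then 1 else 0
  | cat β γ, o => orElse (outLen u γ (o + β.size)) (conc (outLen u β o) γ.nullLen)
  | alt β γ, o => orElse (outLen u β o) (outLen u γ (o + β.size))
  | plus β, o => outLen u β o
  | bind _ β, o => conc (outLen u β o) 2

/-- The positions of the nodes that can be reached, the positions where the paths start to descend,
and the symbols; `n` is the code for the length of the bracket word that leads to the entrance, and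
`t` is the position where the path to the entrance starts to descend. -/
def reached (u : ℕ) : Regex A X → ℕ → ℕ → ℕ → List (ℕ × ℕ × RefSym A X)
  | empty, _, _, _ => []
  | eps, _, _, _ => []
  | sym a, o, n, t => if n = 0 then [] else [(o, t, RefSym.letter a)]
  | ref x, o, n, t => if n = 0 then [] else [(o, t, RefSym.var x)]
  | cat β γ, o, n, t => reached u γ (o + β.size) (orElse (outLen u β o) (conc n β.nullLen))
      (if outLen u β o = 0 then t else o + β.size + γ.size) ++ reached u β o n t
  | alt β γ, o, n, t => reached u γ (o + β.size) n t ++ reached u β o n t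
  | plus β, o, n, t => reached u β o (orElse (outLen u β o) n)
      (if outLen u β o = 0 then t else o + β.size)
  | bind _ β, o, n, t => reached u β o (conc n 2) t

/-- All ways to the same entrance have bracket words of the same length. -/
def InLenOK (u : ℕ) : Regex A X → ℕ → ℕ → Prop
  | empty, _, _ => True
  | eps, _, _ => True
  | sym _, _, _ => True
  | ref _, _, _ => True
  | cat β γ, o, n => InLenOK u γ (o + β.size) (orElse (outLen u β o) (conc n β.nullLen)) ∧
      InLenOK u β o n ∧ ¬ Differ (outLen u β o) (conc n β.nullLen)
  | alt β γ, o, n => InLenOK u γ (o + β.size) n ∧ InLenOK u β o n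
  | plus β, o, n => InLenOK u β o (orElse (outLen u β o) n) ∧ ¬ Differ (outLen u β o) n
  | bind _ β, o, n => InLenOK u β o (conc n 2)

theorem mem_reached {u : ℕ} {β : Regex A X} {o n t : ℕ} {e : ℕ × ℕ × RefSym A X}
    (h : e ∈ reached u β o n t) : InRange e.1 o β := by
  induction β generalizing o n t with
  | empty => cases h
  | eps => cases h
  | sym a =>
    rw [reached] at h
    split_ifs at h
    · cases h
    · rw [List.mem_singleton.1 h]
      simp [InRange, size]
  | ref x =>
    rw [reached] at h
    split_ifs at h
    · cases h
    · rw [List.mem_singleton.1 h]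
      simp [InRange, size]
  | cat β γ hβ hγ =>
    rw [reached, List.mem_append] at h
    simp only [InRange, size] at hβ hγ ⊢
    rcases h with h | h
    · have := hγ h; omega
    · have := hβ h; omega
  | alt β γ hβ hγ =>
    rw [reached, List.mem_append] at h
    simp only [InRange, size] at hβ hγ ⊢
    rcases h with h | h
    · have := hγ h; omega
    · have := hβ h; omega
  | plus β hβ =>
    have := hβ h
    simp only [InRange, size] at this ⊢
    omega
  | bind x β hβ =>
    have := hβ h
    simp only [InRange, size] at this ⊢
    omega

/-- The priority of the net action on the variable with number `j` of the path from position `u`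
to position `v`; see `ev`. -/
def netNum (f : X → ℕ) (u v P : ℕ) : Regex A X → ℕ → Bool → ℕ → ℕ
  | empty, _, _, _ => 0
  | eps, _, _, _ => 0
  | sym _, _, _, _ => 0
  | ref _, _, _, _ => 0
  | cat β γ, o, act, j => max
      (netNum f u v P β o (act || (decide (o + β.size + γ.size < P) &&
        decide (InRange v (o + β.size) γ))) j)
      (netNum f u v P γ (o + β.size) (act || (decide (o + β.size + γ.size < P) &&
        decide (InRange u o β))) j)
  | alt β γ, o, act, j => max
      (netNum f u v P β o (act && decide (β.nullLen ≠ 0)) j)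
      (netNum f u v P γ (o + β.size) (act && decide (γ.nullLen ≠ 0)) j)
  | plus β, o, act, j => netNum f u v P β o act j
  | bind y β, o, act, j => max
      (if f y = j then max (if act then 2 else 0) (if o + β.size < P then
        max (if InRange u o β then 1 else 0) (if InRange v o β then 3 else 0) else 0) else 0)
      (netNum f u v P β o act j)

end Regex

namespace RamProg

open RamExpr RamStore Regex

theorem _root_.RamStore.upd_upd (σ : RamStore) (k i m n : ℕ) :
    (σ.upd k i m).upd k i n = σ.upd k i n := by
  funext k' j
  simp only [upd_apply]
  split_ifs <;> rfl

/-- Process a node of the syntax tree in the pass for exits. -/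
def exitNode : RamProg :=
  store 36 0 (load 2 (var 21 - 1) - 1) ++
  switch kind
    (store 7 (var 21) 0)
    (store 7 (var 21) 0)
    (store 7 (var 21) (conj (le (var 30) (var 21)) (le (var 21) (var 30))))
    (store 7 (var 21) (conj (le (var 30) (var 21)) (le (var 21) (var 30))))
    (storeConc 7 (var 21) (load 7 (var 36)) (load 3 (var 21 - 1)) ++
      storeOr 7 (var 21) (load 7 (var 21 - 1)) (load 7 (var 21)))
    (storeOr 7 (var 21) (load 7 (var 36)) (load 7 (var 21 - 1)))
    (store 7 (var 21) (load 7 (var 21 - 1)))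
    (storeConc 7 (var 21) (load 7 (var 21 - 1)) 2) ++
  store 21 0 (var 21 + 1)

/-- The value that the pass for exits computes at position `p`. -/
def exitValue (σ : RamStore) (u p l : ℕ) : ℕ → ℕ
  | 0 => 0
  | 1 => 0
  | 2 => if u = p then 1 else 0
  | 3 => if u = p then 1 else 0
  | 4 => orElse (σ 7 (p - 1)) (conc (σ 7 l) (σ 3 (p - 1)))
  | 5 => orElse (σ 7 l) (σ 7 (p - 1))
  | 6 => σ 7 (p - 1)
  | _ => conc (σ 7 (p - 1)) 2

theorem run_exitNode {σ : RamStore} {u p n : ℕ} (hp : σ 21 0 = p) (hu : σ 30 0 = u)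
    (hp0 : n = 4 → 0 < p) (h : σ 0 (2 + p + p) = n) : exitNode.run σ =
      ((σ.upd 36 0 (σ 2 (p - 1) - 1)).upd 7 p (exitValue σ u p (σ 2 (p - 1) - 1) n)).upd 21 0
        (p + 1) := by
  have hk : kind.eval (σ.upd 36 0 (σ 2 (p - 1) - 1)) = n := by
    rw [← h]; simp [hp]
  have heq : ∀ σ' : RamStore, σ' 21 0 = p → σ' 30 0 = u →
      (conj (le (var 30) (var 21)) (le (var 21) (var 30))).eval σ' = if u = p then 1 else 0 := by
    intro σ' h1 h2
    rw [eval_conj σ' (le (var 30) (var 21)) (le (var 21) (var 30)) (p := u ≤ p) (q := p ≤ u)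
      (by simp [h1, h2]) (by simp [h1, h2])]
    simp [le_antisymm_iff]
  rw [exitNode, run_append, run_append, run_store _ _ _ σ,
    show RamExpr.eval σ (load 2 (var 21 - 1) - 1) = σ 2 (p - 1) - 1 by simp [hp],
    show RamExpr.eval σ 0 = 0 from rfl, run_switch hk]
  rcases n with _ | _ | _ | _ | _ | _ | _ | n
  · simp [hp, exitValue]
  · simp [hp, exitValue]
  · simp [hp, exitValue, heq, hu]
  · simp [hp, exitValue, heq, hu]
  -- Cell `p` serves as intermediate storage, and the entry of the right child at `p - 1` must
  -- survive this; with truncated subtraction this needs `0 < p`.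
  · have : p - 1 ≠ p := by have := hp0 rfl; omega
    simp [hp, exitValue, upd_upd, this]
  · simp [hp, exitValue]
  · simp [hp, exitValue]
  · change (store 21 0 (var 21 + 1)).run ((storeConc 7 (var 21) (load 7 (var 21 - 1)) 2).run
      (σ.upd 36 0 (σ 2 (p - 1) - 1))) =
      ((σ.upd 36 0 (σ 2 (p - 1) - 1)).upd 7 p (conc (σ 7 (p - 1)) 2)).upd 21 0 (p + 1)
    simp [hp]

/-- Array `7` holds the values of `outLen`. -/
def Exits {A X : Type*} (u : ℕ) (σ : RamStore) (β : Regex A X) (o : ℕ) : Prop :=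
  σ 7 (o + β.size - 1) = outLen u β o

theorem _root_.Regex.AllSub.exits {A X : Type*} {σ σ' : RamStore} {u : ℕ} {β : Regex A X}
    {o p : ℕ} (h : β.AllSub (Exits u σ) o) (hp : o + β.size ≤ p)
    (h' : ∀ q < p, σ' 7 q = σ 7 q) : β.AllSub (Exits u σ') o :=
  h.mono fun β' o' h1 h2 h3 => by
    have := β'.size_pos
    rw [Exits, h' _ (by omega)]
    exact h3

theorem _root_.Regex.AllSub.congr_tabled {A X : Type*} {σ σ' : RamStore} {β : Regex A X}
    {o : ℕ} (h : β.AllSub (Tabled σ) o) (h2 : σ' 2 = σ 2) (h3 : σ' 3 = σ 3) :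
    β.AllSub (Tabled σ') o :=
  h.tabled le_rfl fun q _ => by rw [h2, h3]; exact ⟨rfl, rfl⟩

/-- As in the first pass, entries at earlier positions persist; the tables of the first pass lie in
arrays that are not written here. -/
theorem exits {s : ℕ} (β : Regex (Fin s) ℕ) {o u : ℕ} {σ : RamStore} (hp : σ 21 0 = o)
    (hu : σ 30 0 = u) (hc : β.Coded (σ 0) o) (ht : β.AllSub (Tabled σ) o) :
    up exitNode.run β σ 21 0 = o + β.size ∧ β.AllSub (Exits u (up exitNode.run β σ)) o ∧
      ∀ q < o, up exitNode.run β σ 7 q = σ 7 q := by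
  induction β generalizing o σ with
  | empty =>
    rw [up, run_exitNode (n := 0) hp hu (by omega) hc]
    exact ⟨by simp [size], by simp [AllSub, Exits, size, outLen, exitValue],
      fun q hq => by simp [hq.ne]⟩
  | eps =>
    rw [up, run_exitNode (n := 1) hp hu (by omega) hc]
    exact ⟨by simp [size], by simp [AllSub, Exits, size, outLen, exitValue],
      fun q hq => by simp [hq.ne]⟩
  | sym a =>
    rw [up, run_exitNode (n := 2) hp hu (by omega) hc.1]
    exact ⟨by simp [size], by simp [AllSub, Exits, size, outLen, exitValue],
      fun q hq => by simp [hq.ne]⟩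
  | ref x =>
    rw [up, run_exitNode (n := 3) hp hu (by omega) hc.1]
    exact ⟨by simp [size], by simp [AllSub, Exits, size, outLen, exitValue],
      fun q hq => by simp [hq.ne]⟩
  | cat β γ hβ hγ =>
    have fr : ∀ k, k ∉ exitNode.writes → up exitNode.run β σ k = σ k := fun k hk =>
      up_frame β hk σ
    have fr' : ∀ k, k ∉ exitNode.writes →
      up exitNode.run γ (up exitNode.run β σ) k = σ k := fun k hk =>
        (up_frame γ hk _).trans (fr k hk)
    have h1 := hβ hp hu hc.1 ht.2.1
    have h2 := hγ h1.1 (by rw [fr 30 (by decide), hu]) (by rw [fr 0 (by decide)]; exact hc.2.1)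
      (ht.2.2.congr_tabled (fr 2 (by decide)) (fr 3 (by decide)))
    rw [up]
    generalize up exitNode.run γ (up exitNode.run β σ) = σ₂ at *
    generalize up exitNode.run β σ = σ₁ at *
    have hb := β.size_pos
    have hF := run_exitNode (n := 4) h2.1 (by rw [fr' 30 (by decide), hu]) (by omega)
      (by rw [fr' 0 (by decide)]; exact hc.2.2)
    have t1 := ht.2.1.self
    have t2 := ht.2.2.self
    have s1 := (h1.2.1.exits le_rfl h2.2.2).self
    have s2 := h2.2.1.self
    rw [Exits] at s1 s2
    rw [Tabled] at t1 t2
    rw [exitValue, fr' 2 (by decide), fr' 3 (by decide), t2.1, t2.2, s2, s1] at hF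
    generalize exitNode.run σ₂ = σ₃ at hF ⊢
    have hf : ∀ q < o + β.size + γ.size, σ₃ 7 q = σ₂ 7 q := fun q hq => by simp [hF, hq.ne]
    refine ⟨by simp [hF, size, Nat.add_assoc], ⟨?_, (h1.2.1.exits le_rfl h2.2.2).exits
      (Nat.le_add_right _ _) hf, h2.2.1.exits le_rfl hf⟩, fun q hq => ?_⟩
    · simp [hF, Exits, size, outLen, ← Nat.add_assoc]
    · rw [hf q (by omega), h2.2.2 q (by omega), h1.2.2 q hq]
  | alt β γ hβ hγ =>
    have fr : ∀ k, k ∉ exitNode.writes → up exitNode.run β σ k = σ k := fun k hk =>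
      up_frame β hk σ
    have fr' : ∀ k, k ∉ exitNode.writes →
      up exitNode.run γ (up exitNode.run β σ) k = σ k := fun k hk =>
        (up_frame γ hk _).trans (fr k hk)
    have h1 := hβ hp hu hc.1 ht.2.1
    have h2 := hγ h1.1 (by rw [fr 30 (by decide), hu]) (by rw [fr 0 (by decide)]; exact hc.2.1)
      (ht.2.2.congr_tabled (fr 2 (by decide)) (fr 3 (by decide)))
    rw [up]
    generalize up exitNode.run γ (up exitNode.run β σ) = σ₂ at *
    generalize up exitNode.run β σ = σ₁ at *
    have hb := β.size_pos
    have hF := run_exitNode (n := 5) h2.1 (by rw [fr' 30 (by decide), hu]) (by omega)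
      (by rw [fr' 0 (by decide)]; exact hc.2.2)
    have t2 := ht.2.2.self
    have s1 := (h1.2.1.exits le_rfl h2.2.2).self
    have s2 := h2.2.1.self
    rw [Exits] at s1 s2
    rw [Tabled] at t2
    rw [exitValue, fr' 2 (by decide), t2.1, s2, s1] at hF
    generalize exitNode.run σ₂ = σ₃ at hF ⊢
    have hf : ∀ q < o + β.size + γ.size, σ₃ 7 q = σ₂ 7 q := fun q hq => by simp [hF, hq.ne]
    refine ⟨by simp [hF, size, Nat.add_assoc], ⟨?_, (h1.2.1.exits le_rfl h2.2.2).exits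
      (Nat.le_add_right _ _) hf, h2.2.1.exits le_rfl hf⟩, fun q hq => ?_⟩
    · simp [hF, Exits, size, outLen, ← Nat.add_assoc]
    · rw [hf q (by omega), h2.2.2 q (by omega), h1.2.2 q hq]
  | plus β hβ =>
    have fr : ∀ k, k ∉ exitNode.writes → up exitNode.run β σ k = σ k := fun k hk =>
      up_frame β hk σ
    have h1 := hβ hp hu hc.1 ht.2
    rw [up]
    generalize up exitNode.run β σ = σ₁ at *
    have hF := run_exitNode (n := 6) h1.1 (by rw [fr 30 (by decide), hu]) (by omega)
      (by rw [fr 0 (by decide)]; exact hc.2)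
    have s1 := h1.2.1.self
    rw [Exits] at s1
    rw [exitValue, s1] at hF
    generalize exitNode.run σ₁ = σ₃ at hF ⊢
    have hf : ∀ q < o + β.size, σ₃ 7 q = σ₁ 7 q := fun q hq => by simp [hF, hq.ne]
    refine ⟨by simp [hF, size, Nat.add_assoc], ⟨?_, h1.2.1.exits le_rfl hf⟩, fun q hq => ?_⟩
    · simp [hF, Exits, size, outLen, ← Nat.add_assoc]
    · rw [hf q (by omega), h1.2.2 q hq]
  | bind x β hβ =>
    have fr : ∀ k, k ∉ exitNode.writes → up exitNode.run β σ k = σ k := fun k hk =>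
      up_frame β hk σ
    have h1 := hβ hp hu hc.1 ht.2
    rw [up]
    generalize up exitNode.run β σ = σ₁ at *
    have hF := run_exitNode (n := 7) h1.1 (by rw [fr 30 (by decide), hu]) (by omega)
      (by rw [fr 0 (by decide)]; exact hc.2.1)
    have s1 := h1.2.1.self
    rw [Exits] at s1
    change _ = ((σ₁.upd 36 0 _).upd 7 _ (conc (σ₁ 7 _) 2)).upd 21 0 _ at hF
    rw [s1] at hF
    generalize exitNode.run σ₁ = σ₃ at hF ⊢
    have hf : ∀ q < o + β.size, σ₃ 7 q = σ₁ 7 q := fun q hq => by simp [hF, hq.ne]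
    refine ⟨by simp [hF, size, Nat.add_assoc], ⟨?_, h1.2.1.exits le_rfl hf⟩, fun q hq => ?_⟩
    · simp [hF, Exits, size, outLen, ← Nat.add_assoc]
    · rw [hf q (by omega), h1.2.2 q hq]

end RamProg

/-! ### The pass for entrances -/

namespace RamProg

open RamExpr RamStore Regex

/-- Record a failure if both words are present and have different lengths. -/
def checkDiffer (e f : RamExpr) : RamProg :=
  cond e (cond f (cond (e - f + (f - e)) (store 24 0 1) skip) skip) skip

theorem run_checkDiffer (e f : RamExpr) (σ : RamStore) : (checkDiffer e f).run σ =
    σ.upd 24 0 (if ¬ Differ (e.eval σ) (f.eval σ) then σ 24 0 else 1) := by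
  simp only [checkDiffer, run_cond, run_store, run_skip, eval_ofNat, eval_sub, eval_add, Differ]
  by_cases h1 : e.eval σ = 0 <;> by_cases h2 : f.eval σ = 0 <;>
    by_cases h3 : e.eval σ = f.eval σ
  all_goals simp [h1, h2, h3, upd_id]
  omega

/-- A terminal is reached. -/
def reachLetter : RamProg :=
  -- For each letter, array 12 holds one more than the number of the last source that reached it. It
  -- exceeds the number of the present source iff the letter has been met for this source already,
  -- so duplicates are found in constant time and nothing has to be cleared between sources.
  push 13 (var 21) ++ cond (load 12 symbol - var 31) (store 24 0 1) skip ++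
    store 12 symbol (var 31 + 1)

/-- A variable reference is reached. -/
def reachVar : RamProg := push 13 (var 21) ++ store 26 0 1

/-- Process a node of the syntax tree in the pass for entrances. -/
def enterNode : RamProg :=
  store 21 0 (var 21 - 1) ++ store 36 0 (load 2 (var 21 - 1) - 1) ++
  switch kind skip skip
    (cond (load 8 (var 21)) reachLetter skip)
    (cond (load 8 (var 21)) reachVar skip)
    -- The right child can be entered after passing the left child (cell of array 37) or from the
    -- exit of the left child. The latter is preferred, and then the path turns at this node.
    (storeConc 37 0 (load 8 (var 21)) (load 3 (var 36)) ++
      checkDiffer (load 7 (var 36)) (var 37) ++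
      storeOr 8 (var 21 - 1) (load 7 (var 36)) (var 37) ++
      storeIf 9 (var 21 - 1) (load 7 (var 36)) (var 21) (load 9 (var 21)) ++
      store 8 (var 36) (load 8 (var 21)) ++ store 9 (var 36) (load 9 (var 21)))
    (store 8 (var 21 - 1) (load 8 (var 21)) ++ store 9 (var 21 - 1) (load 9 (var 21)) ++
      store 8 (var 36) (load 8 (var 21)) ++ store 9 (var 36) (load 9 (var 21)))
    (checkDiffer (load 7 (var 21 - 1)) (load 8 (var 21)) ++
      storeOr 8 (var 21 - 1) (load 7 (var 21 - 1)) (load 8 (var 21)) ++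
      storeIf 9 (var 21 - 1) (load 7 (var 21 - 1)) (var 21) (load 9 (var 21)))
    (storeConc 8 (var 21 - 1) (load 8 (var 21)) 2 ++ store 9 (var 21 - 1) (load 9 (var 21)))

/-- The effect of the pass for entrances on a node at position `p`. -/
def enterEffect (σ : RamStore) (p l : ℕ) : ℕ → RamStore
  | 0 => σ
  | 1 => σ
  | 2 => if σ 8 p = 0 then σ else reachLetter.run σ
  | 3 => if σ 8 p = 0 then σ else reachVar.run σ
  | 4 => (((((σ.upd 37 0 (conc (σ 8 p) (σ 3 l))).upd 24 0
      (if ¬ Differ (σ 7 l) (conc (σ 8 p) (σ 3 l)) then σ 24 0 else 1)).upd 8 (p - 1)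
      (orElse (σ 7 l) (conc (σ 8 p) (σ 3 l)))).upd 9 (p - 1)
      (if σ 7 l = 0 then σ 9 p else p)).upd 8 l (σ 8 p)).upd 9 l (σ 9 p)
  | 5 => (((σ.upd 8 (p - 1) (σ 8 p)).upd 9 (p - 1) (σ 9 p)).upd 8 l (σ 8 p)).upd 9 l (σ 9 p)
  | 6 => ((σ.upd 24 0 (if ¬ Differ (σ 7 (p - 1)) (σ 8 p) then σ 24 0 else 1)).upd 8 (p - 1)
      (orElse (σ 7 (p - 1)) (σ 8 p))).upd 9 (p - 1) (if σ 7 (p - 1) = 0 then σ 9 p else p)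
  | _ => (σ.upd 8 (p - 1) (conc (σ 8 p) 2)).upd 9 (p - 1) (σ 9 p)

theorem run_enterNode {σ : RamStore} {p l n : ℕ} (hp : σ 21 0 = p + 1) (hp0 : 4 ≤ n → 0 < p)
    (hl : σ 2 (p - 1) = l) (h : σ 0 (2 + p + p) = n) :
    enterNode.run σ = enterEffect ((σ.upd 21 0 p).upd 36 0 (l - 1)) p (l - 1) n := by
  have h1 : (store 21 0 (var 21 - 1) ++ store 36 0 (load 2 (var 21 - 1) - 1)).run σ =
      (σ.upd 21 0 p).upd 36 0 (l - 1) := by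
    simp [hp, hl]
  rw [enterNode, run_append, h1]
  have h2 : ((σ.upd 21 0 p).upd 36 0 (l - 1)) 21 0 = p := by simp
  have h3 : ((σ.upd 21 0 p).upd 36 0 (l - 1)) 36 0 = l - 1 := by simp
  have hk : kind.eval ((σ.upd 21 0 p).upd 36 0 (l - 1)) = n := by
    rw [← h]; simp
  generalize (σ.upd 21 0 p).upd 36 0 (l - 1) = σ₀ at *
  rw [run_switch hk]
  have hne : 4 ≤ n → p ≠ p - 1 := fun h => by have := hp0 h; omega
  rcases n with _ | _ | _ | _ | _ | _ | _ | n
  · rfl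
  · rfl
  · simp [enterEffect, h2]
  · simp [enterEffect, h2]
  · simp [enterEffect, run_checkDiffer, h2, h3, hne]
  · simp [enterEffect, h2, h3, hne]
  · simp [enterEffect, run_checkDiffer, h2, hne]
  · change (storeConc 8 (var 21 - 1) (load 8 (var 21)) 2 ++
      store 9 (var 21 - 1) (load 9 (var 21))).run σ₀ =
      (σ₀.upd 8 (p - 1) (conc (σ₀ 8 p) 2)).upd 9 (p - 1) (σ₀ 9 p)
    simp [h2]

/-- The letters among the reached symbols. -/
def lettersOf {A X : Type*} (F : List (ℕ × ℕ × RefSym A X)) : List A :=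
  F.filterMap fun e => match e.2.2 with
    | RefSym.letter a => some a
    | _ => none

/-- The nodes in `F` have been reached, and there has been no failure if and only if `B` holds and
no terminal occurs twice among them; `τ` is the number of the source. -/
structure Found {s : ℕ} (τ : ℕ) (B : Prop) (F : List (ℕ × ℕ × RefSym (Fin s) ℕ))
    (σ : RamStore) : Prop where
  buf : σ.Buf 13 (F.map fun e => e.1)
  turn : ∀ e ∈ F, σ 9 e.1 = e.2.1
  seen : ∀ a : Fin s, σ 12 a ≤ τ + 1 ∧ (σ 12 a = τ + 1 ↔ a ∈ lettersOf F)
  var : σ 26 0 = 0 ↔ ∀ e ∈ F, ∀ x, e.2.2 ≠ RefSym.var x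
  fail : σ 24 0 = 0 ↔ B ∧ (lettersOf F).Nodup

theorem Found.congr {s τ : ℕ} {B B' : Prop} {F : List (ℕ × ℕ × RefSym (Fin s) ℕ)}
    {σ σ' : RamStore} (h : Found τ B F σ) (h13 : σ' 13 = σ 13) (h9 : ∀ e ∈ F, σ' 9 e.1 = σ 9 e.1)
    (h12 : σ' 12 = σ 12) (h26 : σ' 26 = σ 26)
    (h24 : σ' 24 0 = 0 ↔ σ 24 0 = 0 ∧ B') : Found τ (B ∧ B') F σ' :=
  ⟨h.buf.congr h13, fun e he => by rw [h9 e he, h.turn e he], fun a => by rw [h12]; exact h.seen a,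
    by rw [h26]; exact h.var, by rw [h24, h.fail]; tauto⟩

theorem lettersOf_append {A X : Type*} (F G : List (ℕ × ℕ × RefSym A X)) :
    lettersOf (F ++ G) = lettersOf F ++ lettersOf G :=
  List.filterMap_append

theorem run_reachLetter {σ : RamStore} {L : List ℕ} {a : ℕ} (hL : σ.Buf 13 L)
    (ha : symbol.eval σ = a) : reachLetter.run σ =
      ((((σ.upd 13 (L.length + 1) (σ 21 0)).upd 13 0 (L.length + 1)).upd 24 0
        (if σ 12 a ≤ σ 31 0 then σ 24 0 else 1)).upd 12 a (σ 31 0 + 1)) := by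
  rw [eval_symbol] at ha
  rw [reachLetter, run_append, run_append, run_push hL, run_cond]
  simp only [eval_sub, eval_load, eval_symbol, upd_of_ne, ne_eq, Nat.reduceEqDiff,
    not_false_eq_true, eval_var, Nat.sub_eq_zero_iff_le, OfNat.zero_ne_ofNat, ha]
  have h1 : (((σ.upd 13 (L.length + 1) (σ 21 0)).upd 13 0 (L.length + 1)).upd 24 0 (σ 24 0)) =
      ((σ.upd 13 (L.length + 1) (σ 21 0)).upd 13 0 (L.length + 1)) := by
    conv_rhs => rw [← upd_id ((σ.upd 13 (L.length + 1) (σ 21 0)).upd 13 0 (L.length + 1)) 24 0]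
    rfl
  split_ifs with h
  · rw [h1]
    simp [ha]
  · simp [ha]

theorem run_reachVar {σ : RamStore} {L : List ℕ} (hL : σ.Buf 13 L) : reachVar.run σ =
      ((σ.upd 13 (L.length + 1) (σ 21 0)).upd 13 0 (L.length + 1)).upd 26 0 1 := by
  rw [reachVar, run_append, run_push hL]
  simp

theorem found_letter {s τ : ℕ} {B : Prop} {F : List (ℕ × ℕ × RefSym (Fin s) ℕ)} {σ : RamStore}
    (h : Found τ B F σ) (hτ : σ 31 0 = τ) {a : Fin s} (ha : symbol.eval σ = a) {p t : ℕ}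
    (hp : σ 21 0 = p) (ht : σ 9 p = t) :
    Found τ B (F ++ [(p, t, RefSym.letter a)]) (reachLetter.run σ) := by
  have hl : lettersOf (F ++ [(p, t, RefSym.letter a)]) = lettersOf F ++ [a] := lettersOf_append _ _
  rw [run_reachLetter h.buf ha, hτ, hp]
  refine ⟨?_, fun e he => ?_, fun b => ?_, ?_, ?_⟩
  · rw [List.map_append]
    exact h.buf.append_singleton rfl
  · change σ 9 e.1 = _
    rcases List.mem_append.1 he with he | he
    · exact h.turn e he
    · rw [List.mem_singleton.1 he]
      exact ht
  · rw [hl, List.mem_append, List.mem_singleton]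
    have hb := h.seen b
    by_cases hab : b = a
    · simp [hab]
    · have : (b : ℕ) ≠ a := fun h => hab (Fin.ext h)
      simpa [this, hab] using hb
  · simp only [List.mem_append, List.mem_singleton]
    rw [show (((((σ.upd 13 (_ + 1) p).upd 13 0 _).upd 24 0 _).upd 12 _ _) 26 0) = σ 26 0 from rfl,
      h.var]
    constructor
    · rintro h1 e (he | rfl) x
      · exact h1 e he x
      · simp
    · exact fun h1 e he => h1 e (Or.inl he)
  · rw [hl, List.nodup_append]
    have ha' := h.seen a
    simp only [upd_apply, Nat.reduceEqDiff, false_and, if_false, and_self, if_true]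
    rw [ite_eq_zero_iff, h.fail]
    have : σ 12 a ≤ τ ↔ a ∉ lettersOf F := by
      rw [← ha'.2]; omega
    rw [this]
    simp only [List.nodup_singleton, true_and, List.mem_singleton, forall_eq]
    constructor
    · rintro ⟨h1, h2, h3⟩
      exact ⟨h2, h3, fun b hb hba => h1 (hba ▸ hb)⟩
    · rintro ⟨h1, h2, h3⟩
      exact ⟨fun h4 => h3 a h4 rfl, h1, h2⟩

theorem found_var {s τ : ℕ} {B : Prop} {F : List (ℕ × ℕ × RefSym (Fin s) ℕ)} {σ : RamStore}
    (h : Found τ B F σ) {x p t : ℕ} (hp : σ 21 0 = p) (ht : σ 9 p = t) :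
    Found τ B (F ++ [(p, t, RefSym.var x)]) (reachVar.run σ) := by
  have hl : lettersOf (F ++ [(p, t, RefSym.var x)]) = lettersOf F := by
    rw [lettersOf_append]; exact List.append_nil _
  rw [run_reachVar h.buf, hp]
  refine ⟨?_, fun e he => ?_, fun b => ?_, ?_, ?_⟩
  · rw [List.map_append]
    exact h.buf.append_singleton rfl
  · change σ 9 e.1 = _
    rcases List.mem_append.1 he with he | he
    · exact h.turn e he
    · rw [List.mem_singleton.1 he]
      exact ht
  · rw [hl]
    exact h.seen b
  · simp only [upd_self, Nat.one_ne_zero, false_iff, not_forall]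
    exact ⟨(p, t, RefSym.var x), by simp, x, by simp⟩
  · rw [hl]
    exact h.fail

/-- The effect of the pass for entrances on a subexpression. -/
structure Entered {s : ℕ} (β : Regex (Fin s) ℕ) (u o n t τ : ℕ) (B : Prop)
    (F : List (ℕ × ℕ × RefSym (Fin s) ℕ)) (σ σ' : RamStore) : Prop where
  pos : σ' 21 0 = o
  frame : ∀ q, q < o ∨ o + β.size ≤ q → σ' 8 q = σ 8 q ∧ σ' 9 q = σ 9 q
  found : Found τ (B ∧ InLenOK u β o n) (F ++ reached u β o n t) σ'

theorem down_frame {A X : Type*} (β : Regex A X) {p : RamProg} {k : ℕ} (hk : k ∉ p.writes)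
    (σ : RamStore) : down p.run β σ k = σ k := by
  rw [down_eq_iterate, iterate_run_frame hk]

theorem _root_.Regex.AllSub.congr_exits {A X : Type*} {σ σ' : RamStore} {u : ℕ} {β : Regex A X}
    {o : ℕ} (h : β.AllSub (Exits u σ) o) (h7 : σ' 7 = σ 7) : β.AllSub (Exits u σ') o :=
  h.exits le_rfl fun q _ => by rw [h7]

/-- The parent writes the entrance data of its children at their last positions. The right child is
treated first and changes arrays 8 and 9 only within its own range, so the data of the left child
and of the nodes found before stay intact. `F` grows from right to left through the tree, in the
order of `reached`. -/
theorem entered {s : ℕ} (β : Regex (Fin s) ℕ) {u o n t τ : ℕ} {B : Prop}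
    {F : List (ℕ × ℕ × RefSym (Fin s) ℕ)} {σ : RamStore} (hp : σ 21 0 = o + β.size)
    (hc : β.Coded (σ 0) o) (ht : β.AllSub (Tabled σ) o) (hu : β.AllSub (Exits u σ) o)
    (h8 : σ 8 (o + β.size - 1) = n) (h9 : σ 9 (o + β.size - 1) = t) (hτ : σ 31 0 = τ)
    (hF : Found τ B F σ) (hFo : ∀ e ∈ F, o + β.size ≤ e.1) :
    Entered β u o n t τ B F σ (down enterNode.run β σ) := by
  induction β generalizing o n t B F σ with
  | empty =>
    rw [down, run_enterNode (n := 0) hp (by omega) rfl hc]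
    refine ⟨by simp [enterEffect], fun q _ => ⟨rfl, rfl⟩, ?_⟩
    rw [reached, List.append_nil]
    exact hF.congr rfl (fun _ _ => rfl) rfl rfl (by simp [enterEffect, InLenOK])
  | eps =>
    rw [down, run_enterNode (n := 1) hp (by omega) rfl hc]
    refine ⟨by simp [enterEffect], fun q _ => ⟨rfl, rfl⟩, ?_⟩
    rw [reached, List.append_nil]
    exact hF.congr rfl (fun _ _ => rfl) rfl rfl (by simp [enterEffect, InLenOK])
  | sym a =>
    rw [down, run_enterNode (n := 2) hp (by omega) rfl hc.1, enterEffect]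
    have hσ : ∀ k, k ≠ 21 → k ≠ 36 → ((σ.upd 21 0 o).upd 36 0 (σ 2 (o - 1) - 1)) k = σ k :=
      fun k h1 h2 => by rw [upd_of_ne h2, upd_of_ne h1]
    have h21 : ((σ.upd 21 0 o).upd 36 0 (σ 2 (o - 1) - 1)) 21 0 = o := by simp
    generalize (σ.upd 21 0 o).upd 36 0 (σ 2 (o - 1) - 1) = σ₀ at *
    have hF' := hF.congr (σ' := σ₀) (B' := InLenOK u (Regex.sym (X := ℕ) a) o n)
      (hσ 13 (by decide) (by decide)) (fun e he => by rw [hσ 9 (by decide) (by decide)])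
      (hσ 12 (by decide) (by decide)) (hσ 26 (by decide) (by decide))
      (by rw [hσ 24 (by decide) (by decide)]; simp [InLenOK])
    simp only [size, Nat.add_sub_cancel] at h8 h9
    rw [hσ 8 (by decide) (by decide), h8]
    split_ifs with hn
    · refine ⟨h21, fun q _ => ?_, ?_⟩
      · rw [hσ 8 (by decide) (by decide), hσ 9 (by decide) (by decide)]
        exact ⟨rfl, rfl⟩
      · rw [reached, if_pos hn, List.append_nil]
        exact hF'
    · refine ⟨by rw [run_frame (by decide), h21], fun q _ => ?_, ?_⟩
      · rw [run_frame (by decide), run_frame (by decide), hσ 8 (by decide) (by decide),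
          hσ 9 (by decide) (by decide)]
        exact ⟨rfl, rfl⟩
      · rw [reached, if_neg hn]
        refine found_letter hF' (by rw [hσ 31 (by decide) (by decide), hτ]) ?_ h21
          (by rw [hσ 9 (by decide) (by decide), h9])
        rw [eval_symbol, h21, hσ 0 (by decide) (by decide), hc.2]
  | ref x =>
    rw [down, run_enterNode (n := 3) hp (by omega) rfl hc.1, enterEffect]
    have hσ : ∀ k, k ≠ 21 → k ≠ 36 → ((σ.upd 21 0 o).upd 36 0 (σ 2 (o - 1) - 1)) k = σ k :=
      fun k h1 h2 => by rw [upd_of_ne h2, upd_of_ne h1]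
    have h21 : ((σ.upd 21 0 o).upd 36 0 (σ 2 (o - 1) - 1)) 21 0 = o := by simp
    generalize (σ.upd 21 0 o).upd 36 0 (σ 2 (o - 1) - 1) = σ₀ at *
    have hF' := hF.congr (σ' := σ₀) (B' := InLenOK u (ref (A := Fin s) x) o n)
      (hσ 13 (by decide) (by decide)) (fun e he => by rw [hσ 9 (by decide) (by decide)])
      (hσ 12 (by decide) (by decide)) (hσ 26 (by decide) (by decide))
      (by rw [hσ 24 (by decide) (by decide)]; simp [InLenOK])
    simp only [size, Nat.add_sub_cancel] at h8 h9
    rw [hσ 8 (by decide) (by decide), h8]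
    split_ifs with hn
    · refine ⟨h21, fun q _ => ?_, ?_⟩
      · rw [hσ 8 (by decide) (by decide), hσ 9 (by decide) (by decide)]
        exact ⟨rfl, rfl⟩
      · rw [reached, if_pos hn, List.append_nil]
        exact hF'
    · refine ⟨by rw [run_frame (by decide), h21], fun q _ => ?_, ?_⟩
      · rw [run_frame (by decide), run_frame (by decide), hσ 8 (by decide) (by decide),
          hσ 9 (by decide) (by decide)]
        exact ⟨rfl, rfl⟩
      · rw [reached, if_neg hn]
        exact found_var hF' h21 (by rw [hσ 9 (by decide) (by decide), h9])
  | cat β γ hβ hγ =>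
    have hb := β.size_pos
    have hg := γ.size_pos
    have t1 := ht.2.1.self
    have t2 := ht.2.2.self
    have s1 := hu.2.1.self
    rw [Exits] at s1
    rw [Tabled] at t1 t2
    rw [size, ← Nat.add_assoc, ← Nat.add_assoc] at hp hFo
    rw [size, ← Nat.add_assoc, ← Nat.add_assoc, Nat.add_sub_cancel] at h8 h9
    have hE := run_enterNode (n := 4) hp (by omega) t2.1 hc.2.2
    have fr : ∀ k, k ∉ enterNode.writes → enterNode.run σ k = σ k := fun k hk => run_frame hk σ
    rw [down]
    generalize enterNode.run σ = σ₁ at *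
    simp only [enterEffect, upd_of_ne, ne_eq, Nat.reduceEqDiff, not_false_eq_true, h8, h9, s1,
      t1.2] at hE
    have hne : o + β.size + γ.size - 1 ≠ o + β.size - 1 := by omega
    -- The comparison of the two ways is recorded in the failure cell before the right child is
    -- treated; hence it becomes part of the condition `B` there.
    have h2 := hγ (o := o + β.size) (n := orElse (outLen u β o) (conc n β.nullLen))
      (t := if outLen u β o = 0 then t else o + β.size + γ.size)
      (B := B ∧ ¬ Differ (outLen u β o) (conc n β.nullLen)) (F := F) (σ := σ₁)
      (by simp [hE]) (by rw [fr 0 (by decide)]; exact hc.2.1)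
      (ht.2.2.congr_tabled (fr 2 (by decide)) (fr 3 (by decide)))
      (hu.2.2.congr_exits (fr 7 (by decide))) (by simp [hE, hne]) (by simp [hE, hne])
      (by rw [fr 31 (by decide), hτ])
      (hF.congr (by rw [hE]; rfl) (fun e he => by
        have := hFo e he
        have h3 : e.1 ≠ o + β.size + γ.size - 1 := by omega
        have h4 : e.1 ≠ o + β.size - 1 := by omega
        simp [hE, h3, h4]) (by rw [hE]; rfl) (by rw [hE]; rfl)
        (by
          rw [hE]
          simp only [upd_apply, Nat.reduceEqDiff, false_and, if_false, and_self, if_true]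
          rw [ite_eq_zero_iff, and_comm])) (fun e he => by have := hFo e he; omega)
    have fr' : ∀ k, k ∉ enterNode.writes → down enterNode.run γ σ₁ k = σ k := fun k hk =>
      (down_frame γ hk _).trans (fr k hk)
    generalize down enterNode.run γ σ₁ = σ₂ at *
    have h3 := hβ (o := o) (n := n) (t := t) (σ := σ₂) h2.pos
      (by rw [fr' 0 (by decide)]; exact hc.1)
      (ht.2.1.congr_tabled (fr' 2 (by decide)) (fr' 3 (by decide)))
      (hu.2.1.congr_exits (fr' 7 (by decide)))
      (by rw [(h2.frame _ (Or.inl (by omega))).1]; simp [hE])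
      (by rw [(h2.frame _ (Or.inl (by omega))).2]; simp [hE])
      (by rw [fr' 31 (by decide), hτ]) h2.found (fun e he => by
        rcases List.mem_append.1 he with he | he
        · have := hFo e he; omega
        · exact (mem_reached he).1)
    refine ⟨h3.pos, fun q hq => ?_, ?_⟩
    · rw [size] at hq
      have h4 : q ≠ o + β.size + γ.size - 1 := by omega
      have h5 : q ≠ o + β.size - 1 := by omega
      rw [(h3.frame q (by omega)).1, (h3.frame q (by omega)).2, (h2.frame q (by omega)).1,
        (h2.frame q (by omega)).2]
      simp [hE, h4, h5]
    · have h4 := h3.found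
      rw [List.append_assoc] at h4
      have h5 : (((B ∧ ¬ Differ (outLen u β o) (conc n β.nullLen)) ∧
          InLenOK u γ (o + β.size) (orElse (outLen u β o) (conc n β.nullLen))) ∧
          InLenOK u β o n) = (B ∧ InLenOK u (cat β γ) o n) := by
        rw [InLenOK]; exact propext (by tauto)
      rw [h5] at h4
      exact h4
  | alt β γ hβ hγ =>
    have hb := β.size_pos
    have hg := γ.size_pos
    have t2 := ht.2.2.self
    rw [Tabled] at t2
    rw [size, ← Nat.add_assoc, ← Nat.add_assoc] at hp hFo
    rw [size, ← Nat.add_assoc, ← Nat.add_assoc, Nat.add_sub_cancel] at h8 h9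
    have hE := run_enterNode (n := 5) hp (by omega) t2.1 hc.2.2
    have fr : ∀ k, k ∉ enterNode.writes → enterNode.run σ k = σ k := fun k hk => run_frame hk σ
    rw [down]
    generalize enterNode.run σ = σ₁ at *
    simp only [enterEffect, upd_of_ne, ne_eq, Nat.reduceEqDiff, not_false_eq_true, h8, h9] at hE
    have hne : o + β.size + γ.size - 1 ≠ o + β.size - 1 := by omega
    have h2 := hγ (o := o + β.size) (n := n) (t := t) (B := B ∧ True) (F := F) (σ := σ₁)
      (by simp [hE]) (by rw [fr 0 (by decide)]; exact hc.2.1)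
      (ht.2.2.congr_tabled (fr 2 (by decide)) (fr 3 (by decide)))
      (hu.2.2.congr_exits (fr 7 (by decide))) (by simp [hE, hne]) (by simp [hE, hne])
      (by rw [fr 31 (by decide), hτ])
      (hF.congr (by rw [hE]; rfl) (fun e he => by
        have := hFo e he
        have h3 : e.1 ≠ o + β.size + γ.size - 1 := by omega
        have h4 : e.1 ≠ o + β.size - 1 := by omega
        simp [hE, h3, h4]) (by rw [hE]; rfl) (by rw [hE]; rfl) (by simp [hE]))
      (fun e he => by have := hFo e he; omega)
    have fr' : ∀ k, k ∉ enterNode.writes → down enterNode.run γ σ₁ k = σ k := fun k hk =>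
      (down_frame γ hk _).trans (fr k hk)
    generalize down enterNode.run γ σ₁ = σ₂ at *
    have h3 := hβ (o := o) (n := n) (t := t) (σ := σ₂) h2.pos
      (by rw [fr' 0 (by decide)]; exact hc.1)
      (ht.2.1.congr_tabled (fr' 2 (by decide)) (fr' 3 (by decide)))
      (hu.2.1.congr_exits (fr' 7 (by decide)))
      (by rw [(h2.frame _ (Or.inl (by omega))).1]; simp [hE])
      (by rw [(h2.frame _ (Or.inl (by omega))).2]; simp [hE])
      (by rw [fr' 31 (by decide), hτ]) h2.found (fun e he => by
        rcases List.mem_append.1 he with he | he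
        · have := hFo e he; omega
        · exact (mem_reached he).1)
    refine ⟨h3.pos, fun q hq => ?_, ?_⟩
    · rw [size] at hq
      have h4 : q ≠ o + β.size + γ.size - 1 := by omega
      have h5 : q ≠ o + β.size - 1 := by omega
      rw [(h3.frame q (by omega)).1, (h3.frame q (by omega)).2, (h2.frame q (by omega)).1,
        (h2.frame q (by omega)).2]
      simp [hE, h4, h5]
    · have h4 := h3.found
      rw [List.append_assoc] at h4
      have h5 : (((B ∧ True) ∧ InLenOK u γ (o + β.size) n) ∧ InLenOK u β o n) =
          (B ∧ InLenOK u (alt β γ) o n) := by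
        rw [InLenOK]; exact propext (by tauto)
      rw [h5] at h4
      exact h4
  | plus β hβ =>
    have hb := β.size_pos
    have s1 := hu.2.self
    rw [Exits] at s1
    rw [size, ← Nat.add_assoc] at hp hFo
    rw [size, ← Nat.add_assoc, Nat.add_sub_cancel] at h8 h9
    have hE := run_enterNode (n := 6) hp (by omega) rfl hc.2
    have fr : ∀ k, k ∉ enterNode.writes → enterNode.run σ k = σ k := fun k hk => run_frame hk σ
    rw [down]
    generalize enterNode.run σ = σ₁ at *
    simp only [enterEffect, upd_of_ne, ne_eq, Nat.reduceEqDiff, not_false_eq_true, h8, h9,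
      s1] at hE
    have h2 := hβ (o := o) (n := orElse (outLen u β o) n)
      (t := if outLen u β o = 0 then t else o + β.size)
      (B := B ∧ ¬ Differ (outLen u β o) n) (F := F) (σ := σ₁)
      (by simp [hE]) (by rw [fr 0 (by decide)]; exact hc.1)
      (ht.2.congr_tabled (fr 2 (by decide)) (fr 3 (by decide)))
      (hu.2.congr_exits (fr 7 (by decide))) (by simp [hE]) (by simp [hE])
      (by rw [fr 31 (by decide), hτ])
      (hF.congr (by rw [hE]; rfl) (fun e he => by
        have := hFo e he
        have h3 : e.1 ≠ o + β.size - 1 := by omega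
        simp [hE, h3]) (by rw [hE]; rfl) (by rw [hE]; rfl)
        (by
          rw [hE]
          simp only [upd_apply, Nat.reduceEqDiff, false_and, if_false, and_self, if_true]
          rw [ite_eq_zero_iff, and_comm])) (fun e he => by have := hFo e he; omega)
    refine ⟨h2.pos, fun q hq => ?_, ?_⟩
    · rw [size] at hq
      have h4 : q ≠ o + β.size - 1 := by omega
      rw [(h2.frame q (by omega)).1, (h2.frame q (by omega)).2]
      simp [hE, h4]
    · have h4 := h2.found
      have h5 : ((B ∧ ¬ Differ (outLen u β o) n) ∧ InLenOK u β o (orElse (outLen u β o) n)) =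
          (B ∧ InLenOK u (plus β) o n) := by
        rw [InLenOK]; exact propext (by tauto)
      rw [h5] at h4
      exact h4
  | bind x β hβ =>
    have hb := β.size_pos
    rw [size, ← Nat.add_assoc] at hp hFo
    rw [size, ← Nat.add_assoc, Nat.add_sub_cancel] at h8 h9
    have hE := run_enterNode (n := 7) hp (by omega) rfl hc.2.1
    have fr : ∀ k, k ∉ enterNode.writes → enterNode.run σ k = σ k := fun k hk => run_frame hk σ
    rw [down]
    generalize enterNode.run σ = σ₁ at *
    change _ = ((((σ.upd 21 0 _).upd 36 0 _).upd 8 _ (conc (σ 8 _) 2)).upd 9 _ (σ 9 _)) at hE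
    simp only [h8, h9] at hE
    have h2 := hβ (o := o) (n := conc n 2) (t := t) (B := B ∧ True) (F := F) (σ := σ₁)
      (by simp [hE]) (by rw [fr 0 (by decide)]; exact hc.1)
      (ht.2.congr_tabled (fr 2 (by decide)) (fr 3 (by decide)))
      (hu.2.congr_exits (fr 7 (by decide))) (by simp [hE]) (by simp [hE])
      (by rw [fr 31 (by decide), hτ])
      (hF.congr (by rw [hE]; rfl) (fun e he => by
        have := hFo e he
        have h3 : e.1 ≠ o + β.size - 1 := by omega
        simp [hE, h3]) (by rw [hE]; rfl) (by rw [hE]; rfl) (by simp [hE]))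
      (fun e he => by have := hFo e he; omega)
    refine ⟨h2.pos, fun q hq => ?_, ?_⟩
    · rw [size] at hq
      have h4 : q ≠ o + β.size - 1 := by omega
      rw [(h2.frame q (by omega)).1, (h2.frame q (by omega)).2]
      simp [hE, h4]
    · have h4 := h2.found
      have h5 : ((B ∧ True) ∧ InLenOK u β o (conc n 2)) = (B ∧ InLenOK u (bind x β) o n) := by
        rw [InLenOK]; exact propext (by tauto)
      rw [h5] at h4
      exact h4

end RamProg

/-! ### The pass for net actions -/

namespace RamProg

open RamExpr RamStore Regex

/-- Raise the priority of the net action on the variable with the number in array `38`. -/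
def raise (n : RamExpr) : RamProg := store 11 (var 38) (load 11 (var 38) + (n - load 11 (var 38)))

/-- The positions from `e` to `f` include the position in array `k`, and the path starts to descend
behind the current position. -/
def passes (k : ℕ) (e f : RamExpr) : RamExpr :=
  conj (le (var 21 + 1) (var 34)) (conj (le e (var k)) (le (var k) f))

/-- The path from position `u` that starts to descend behind `p` passes through `a` to `b`. -/
def Passes (u P p a b : ℕ) : Prop := p < P ∧ a ≤ u ∧ u ≤ b

instance (u P p a b : ℕ) : Decidable (Passes u P p a b) := inferInstanceAs (Decidable (_ ∧ _))

theorem eval_passes (k : ℕ) (e f : RamExpr) (σ : RamStore) : (passes k e f).eval σ =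
    if Passes (σ k 0) (σ 34 0) (σ 21 0) (e.eval σ) (f.eval σ) then 1 else 0 :=
  eval_conj σ _ _ (p := σ 21 0 < σ 34 0) (q := e.eval σ ≤ σ k 0 ∧ σ k 0 ≤ f.eval σ)
    (eval_le σ _ _) (eval_conj σ _ _ (eval_le σ _ _) (eval_le σ _ _))

/-- Process a node of the syntax tree in the pass for net actions. -/
def actNode : RamProg :=
  store 21 0 (var 21 - 1) ++ store 36 0 (load 2 (var 21 - 1) - 1) ++
  switch kind skip skip skip skip
    -- Below the turn, a path that starts in the left child passes the right one on its way up, and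
    -- a path that ends in the right child passes the left one on its way down. Nonzero sums serve
    -- as disjunctions.
    (store 10 (var 21 - 1) (load 10 (var 21) + passes 30 (load 2 (var 36)) (var 36)) ++
      store 10 (var 36) (load 10 (var 21) + passes 33 (load 2 (var 21 - 1)) (var 21 - 1)))
    -- A path through alternatives follows one that has a bracket word. If both have one, both words
    -- are empty and it does no harm to count both.
    (storeIf 10 (var 36) (load 3 (var 36)) (load 10 (var 21)) 0 ++
      storeIf 10 (var 21 - 1) (load 3 (var 21 - 1)) (load 10 (var 21)) 0)
    (store 10 (var 21 - 1) (load 10 (var 21)))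
    (store 10 (var 21 - 1) (load 10 (var 21)) ++ store 38 0 (load 4 symbol) ++
      cond (load 10 (var 21)) (raise 2) skip ++
      cond (passes 30 (load 2 (var 21 - 1)) (var 21 - 1)) (raise 1) skip ++
      cond (passes 33 (load 2 (var 21 - 1)) (var 21 - 1)) (raise 3) skip)

theorem passes_iff_inRange {A X : Type*} {u P p o : ℕ} (β : Regex A X) :
    Passes u P p o (o + β.size - 1) ↔ p < P ∧ InRange u o β := by
  have := β.size_pos
  rw [Passes, InRange]
  omega

/-- With truncated subtraction, `m + (n - m)` is the maximum of `m` and `n`. -/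
theorem run_raise (n : ℕ) (σ : RamStore) :
    (raise (OfNat.ofNat n)).run σ = σ.upd 11 (σ 38 0) (max (σ 11 (σ 38 0)) n) := by
  rw [raise, run_store]
  simp only [eval_add, eval_sub, eval_load, eval_var, eval_ofNat]
  congr 1
  omega

theorem run_cond_raise (e : RamExpr) (n : ℕ) (σ : RamStore) :
    (cond e (raise (OfNat.ofNat n)) skip).run σ =
      σ.upd 11 (σ 38 0) (max (σ 11 (σ 38 0)) (if e.eval σ = 0 then 0 else n)) := by
  rw [run_cond, run_raise]
  split_ifs
  · rw [Nat.max_zero, upd_id]; rfl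
  · rfl

/-- The effect of the pass for net actions on a node at position `p`. -/
def actEffect (σ : RamStore) (u v P p l x : ℕ) : ℕ → RamStore
  | 0 => σ
  | 1 => σ
  | 2 => σ
  | 3 => σ
  | 4 => (σ.upd 10 (p - 1) (σ 10 p + if Passes u P p (σ 2 l) l then 1 else 0)).upd 10 l
      (σ 10 p + if Passes v P p (σ 2 (p - 1)) (p - 1) then 1 else 0)
  | 5 => (σ.upd 10 l (if σ 3 l = 0 then 0 else σ 10 p)).upd 10 (p - 1)
      (if σ 3 (p - 1) = 0 then 0 else σ 10 p)
  | 6 => σ.upd 10 (p - 1) (σ 10 p)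
  | _ => ((σ.upd 10 (p - 1) (σ 10 p)).upd 38 0 (σ 4 x)).upd 11 (σ 4 x)
      (max (max (max (σ 11 (σ 4 x)) (if σ 10 p = 0 then 0 else 2))
        (if Passes u P p (σ 2 (p - 1)) (p - 1) then 1 else 0))
        (if Passes v P p (σ 2 (p - 1)) (p - 1) then 3 else 0))

/-- The side conditions keep the cells of the children apart from the cell of the parent, whose flag
is read again after the first child has received its flag. -/
theorem run_actNode {σ : RamStore} {u v P p l n x : ℕ} (hp : σ 21 0 = p + 1)
    (hu : σ 30 0 = u) (hv : σ 33 0 = v) (hP : σ 34 0 = P)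
    (hp0 : 4 ≤ n → 0 < p) (hlp : 4 ≤ n → n ≤ 5 → l < p) (hl : σ 2 (p - 1) - 1 = l) (h : σ 0 (2 + p + p) = n)
    (hx : σ 0 (3 + p + p) = x) :
    actNode.run σ = actEffect ((σ.upd 21 0 p).upd 36 0 l) u v P p l x n := by
  have h1 : (store 21 0 (var 21 - 1) ++ store 36 0 (load 2 (var 21 - 1) - 1)).run σ =
      (σ.upd 21 0 p).upd 36 0 l := by
    simp [hp, hl]
  rw [actNode, run_append, h1]
  have h2 : ((σ.upd 21 0 p).upd 36 0 l) 21 0 = p := by simp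
  have h3 : ((σ.upd 21 0 p).upd 36 0 l) 36 0 = l := by simp
  have h4 : ((σ.upd 21 0 p).upd 36 0 l) 30 0 = u := by simp [hu]
  have h5 : ((σ.upd 21 0 p).upd 36 0 l) 33 0 = v := by simp [hv]
  have h6 : ((σ.upd 21 0 p).upd 36 0 l) 34 0 = P := by simp [hP]
  have hk : kind.eval ((σ.upd 21 0 p).upd 36 0 l) = n := by
    rw [← h]; simp
  have hs : symbol.eval ((σ.upd 21 0 p).upd 36 0 l) = x := by
    rw [← hx]; simp
  generalize (σ.upd 21 0 p).upd 36 0 l = σ₀ at *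
  rw [run_switch hk]
  have hne : 4 ≤ n → p ≠ p - 1 := fun h => by have := hp0 h; omega
  have hnl : 4 ≤ n → n ≤ 5 → p ≠ l := fun h h' => by have := hlp h h'; omega
  rw [eval_symbol, h2] at hs
  rcases n with _ | _ | _ | _ | _ | _ | _ | n
  · rfl
  · rfl
  · rfl
  · rfl
  · simp [actEffect, eval_passes, h2, h3, h4, h5, h6, hne]
  · simp [actEffect, h2, h3, hnl]
  · simp [actEffect, h2]
  · change ((store 10 (var 21 - 1) (load 10 (var 21)) ++ store 38 0 (load 4 symbol) ++
      cond (load 10 (var 21)) (raise 2) skip ++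
      cond (passes 30 (load 2 (var 21 - 1)) (var 21 - 1)) (raise 1) skip ++
      cond (passes 33 (load 2 (var 21 - 1)) (var 21 - 1)) (raise 3) skip)).run σ₀ =
      ((σ₀.upd 10 (p - 1) (σ₀ 10 p)).upd 38 0 (σ₀ 4 x)).upd 11 (σ₀ 4 x)
      (max (max (max (σ₀ 11 (σ₀ 4 x)) (if σ₀ 10 p = 0 then 0 else 2))
        (if Passes u P p (σ₀ 2 (p - 1)) (p - 1) then 1 else 0))
        (if Passes v P p (σ₀ 2 (p - 1)) (p - 1) then 3 else 0))
    have hne' : p ≠ p - 1 := hne (by omega)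
    rw [run_append, run_append, run_append, run_append, run_cond_raise _ 3, run_cond_raise _ 1,
      run_cond_raise _ 2]
    simp [eval_passes, h2, h4, h5, h6, hs, hne', upd_upd]

/-- The effect of the pass for net actions on a subexpression. -/
structure Acted {s : ℕ} (β : Regex (Fin s) ℕ) (u v P o : ℕ) (act : Bool) (σ σ' : RamStore) :
    Prop where
  pos : σ' 21 0 = o
  frame : ∀ q, q < o ∨ o + β.size ≤ q → σ' 10 q = σ 10 q
  net : ∀ j, σ' 11 j = max (σ 11 j) (netNum (σ 4) u v P β o act j)

/-- Array 11 is only changed by taking maxima, so the contributions of the bindings may be collected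
in any order, and several bindings of one variable share a cell. -/
theorem acted {s : ℕ} (β : Regex (Fin s) ℕ) {u v P o : ℕ} {act : Bool} {σ : RamStore}
    (hp : σ 21 0 = o + β.size) (hu : σ 30 0 = u) (hv : σ 33 0 = v) (hP : σ 34 0 = P)
    (hc : β.Coded (σ 0) o) (ht : β.AllSub (Tabled σ) o)
    (ha : act = decide (σ 10 (o + β.size - 1) ≠ 0)) :
    Acted β u v P o act σ (down actNode.run β σ) := by
  induction β generalizing o act σ with
  | empty =>
    rw [down, run_actNode (n := 0) hp hu hv hP (by omega) (by omega) rfl hc rfl]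
    exact ⟨by simp [actEffect], fun q _ => rfl, fun j => (Nat.max_zero _).symm⟩
  | eps =>
    rw [down, run_actNode (n := 1) hp hu hv hP (by omega) (by omega) rfl hc rfl]
    exact ⟨by simp [actEffect], fun q _ => rfl, fun j => (Nat.max_zero _).symm⟩
  | sym a =>
    rw [down, run_actNode (n := 2) hp hu hv hP (by omega) (by omega) rfl hc.1 rfl]
    exact ⟨by simp [actEffect], fun q _ => rfl, fun j => (Nat.max_zero _).symm⟩
  | ref x =>
    rw [down, run_actNode (n := 3) hp hu hv hP (by omega) (by omega) rfl hc.1 rfl]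
    exact ⟨by simp [actEffect], fun q _ => rfl, fun j => (Nat.max_zero _).symm⟩
  | cat β γ hβ hγ =>
    have hb := β.size_pos
    have hg := γ.size_pos
    have t1 := ht.2.1.self
    have t2 := ht.2.2.self
    rw [Tabled] at t1 t2
    rw [size, ← Nat.add_assoc, ← Nat.add_assoc] at hp
    rw [size, ← Nat.add_assoc, ← Nat.add_assoc, Nat.add_sub_cancel] at ha
    have hE := run_actNode (n := 4) (l := o + β.size - 1) hp hu hv hP (by omega) (by omega)
      (by rw [t2.1]) hc.2.2 rfl
    have fr : ∀ k, k ∉ actNode.writes → actNode.run σ k = σ k := fun k hk => run_frame hk σ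
    rw [down]
    generalize actNode.run σ = σ₁ at *
    simp only [actEffect, upd_of_ne, ne_eq, Nat.reduceEqDiff, not_false_eq_true, t1.1, t2.1] at hE
    have hne : o + β.size + γ.size - 1 ≠ o + β.size - 1 := by omega
    have h2 := hγ (o := o + β.size) (σ := σ₁) (act := act || (decide (o + β.size + γ.size < P) &&
        decide (InRange u o β))) (by simp [hE]) (by rw [fr 30 (by decide), hu])
      (by rw [fr 33 (by decide), hv]) (by rw [fr 34 (by decide), hP])
      (by rw [fr 0 (by decide)]; exact hc.2.1)
      (ht.2.2.congr_tabled (fr 2 (by decide)) (fr 3 (by decide)))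
      (by
        rw [ha, Bool.eq_iff_iff]
        simp only [hE, upd_apply, hne, Bool.or_eq_true, Bool.and_eq_true, decide_eq_true_eq,
          and_false, if_false, and_self, if_true]
        rw [if_congr (passes_iff_inRange _) rfl rfl]
        split_ifs with h <;> simp [h])
    have fr' : ∀ k, k ∉ actNode.writes → down actNode.run γ σ₁ k = σ k := fun k hk =>
      (down_frame γ hk _).trans (fr k hk)
    generalize down actNode.run γ σ₁ = σ₂ at *
    have h3 := hβ (o := o) (σ := σ₂) (act := act || (decide (o + β.size + γ.size < P) &&
        decide (InRange v (o + β.size) γ))) h2.pos (by rw [fr' 30 (by decide), hu])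
      (by rw [fr' 33 (by decide), hv]) (by rw [fr' 34 (by decide), hP])
      (by rw [fr' 0 (by decide)]; exact hc.1)
      (ht.2.1.congr_tabled (fr' 2 (by decide)) (fr' 3 (by decide)))
      (by
        rw [ha, Bool.eq_iff_iff, h2.frame _ (Or.inl (by omega))]
        simp only [hE, upd_apply, Bool.or_eq_true, Bool.and_eq_true, decide_eq_true_eq,
          and_self, if_true]
        rw [if_congr (passes_iff_inRange _) rfl rfl]
        split_ifs with h <;> simp [h])
    refine ⟨h3.pos, fun q hq => ?_, fun j => ?_⟩
    · rw [size] at hq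
      rw [h3.frame q (by omega), h2.frame q (by omega), hE]
      have h4 : q ≠ o + β.size + γ.size - 1 := by omega
      have h5 : q ≠ o + β.size - 1 := by omega
      simp [h4, h5]
    · rw [h3.net, h2.net, fr 4 (by decide), fr' 4 (by decide), netNum,
        show σ₁ 11 j = σ 11 j by rw [hE]; rfl]
      omega
  | alt β γ hβ hγ =>
    have hb := β.size_pos
    have hg := γ.size_pos
    have t1 := ht.2.1.self
    have t2 := ht.2.2.self
    rw [Tabled] at t1 t2
    rw [size, ← Nat.add_assoc, ← Nat.add_assoc] at hp
    rw [size, ← Nat.add_assoc, ← Nat.add_assoc, Nat.add_sub_cancel] at ha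
    have hE := run_actNode (n := 5) (l := o + β.size - 1) hp hu hv hP (by omega) (by omega)
      (by rw [t2.1]) hc.2.2 rfl
    have fr : ∀ k, k ∉ actNode.writes → actNode.run σ k = σ k := fun k hk => run_frame hk σ
    rw [down]
    generalize actNode.run σ = σ₁ at *
    simp only [actEffect, upd_of_ne, ne_eq, Nat.reduceEqDiff, not_false_eq_true, t1.2, t2.2] at hE
    have hne : o + β.size - 1 ≠ o + β.size + γ.size - 1 := by omega
    have h2 := hγ (o := o + β.size) (σ := σ₁) (act := act && decide (γ.nullLen ≠ 0))
      (by simp [hE]) (by rw [fr 30 (by decide), hu])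
      (by rw [fr 33 (by decide), hv]) (by rw [fr 34 (by decide), hP])
      (by rw [fr 0 (by decide)]; exact hc.2.1)
      (ht.2.2.congr_tabled (fr 2 (by decide)) (fr 3 (by decide)))
      (by
        rw [ha, Bool.eq_iff_iff]
        simp only [hE, upd_apply, Bool.and_eq_true, decide_eq_true_eq, and_self, if_true]
        split_ifs with h <;> simp [h])
    have fr' : ∀ k, k ∉ actNode.writes → down actNode.run γ σ₁ k = σ k := fun k hk =>
      (down_frame γ hk _).trans (fr k hk)
    generalize down actNode.run γ σ₁ = σ₂ at *
    have h3 := hβ (o := o) (σ := σ₂) (act := act && decide (β.nullLen ≠ 0))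
      h2.pos (by rw [fr' 30 (by decide), hu])
      (by rw [fr' 33 (by decide), hv]) (by rw [fr' 34 (by decide), hP])
      (by rw [fr' 0 (by decide)]; exact hc.1)
      (ht.2.1.congr_tabled (fr' 2 (by decide)) (fr' 3 (by decide)))
      (by
        rw [ha, Bool.eq_iff_iff, h2.frame _ (Or.inl (by omega))]
        simp only [hE, upd_apply, hne, Bool.and_eq_true, decide_eq_true_eq, and_self, and_false,
          if_false, if_true]
        split_ifs with h <;> simp [h])
    refine ⟨h3.pos, fun q hq => ?_, fun j => ?_⟩
    · rw [size] at hq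
      rw [h3.frame q (by omega), h2.frame q (by omega), hE]
      have h4 : q ≠ o + β.size + γ.size - 1 := by omega
      have h5 : q ≠ o + β.size - 1 := by omega
      simp [h4, h5]
    · rw [h3.net, h2.net, fr 4 (by decide), fr' 4 (by decide), netNum,
        show σ₁ 11 j = σ 11 j by rw [hE]; rfl]
      omega
  | plus β hβ =>
    have hb := β.size_pos
    rw [size, ← Nat.add_assoc] at hp
    rw [size, ← Nat.add_assoc, Nat.add_sub_cancel] at ha
    have hE := run_actNode (n := 6) hp hu hv hP (by omega) (by omega) rfl hc.2 rfl
    have fr : ∀ k, k ∉ actNode.writes → actNode.run σ k = σ k := fun k hk => run_frame hk σ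
    rw [down]
    generalize actNode.run σ = σ₁ at *
    simp only [actEffect, upd_of_ne, ne_eq, Nat.reduceEqDiff, not_false_eq_true] at hE
    have h2 := hβ (o := o) (σ := σ₁) (act := act)
      (by simp [hE]) (by rw [fr 30 (by decide), hu])
      (by rw [fr 33 (by decide), hv]) (by rw [fr 34 (by decide), hP])
      (by rw [fr 0 (by decide)]; exact hc.1)
      (ht.2.congr_tabled (fr 2 (by decide)) (fr 3 (by decide)))
      (by rw [ha]; simp [hE])
    refine ⟨h2.pos, fun q hq => ?_, fun j => ?_⟩
    · rw [size] at hq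
      rw [h2.frame q (by omega), hE]
      have h5 : q ≠ o + β.size - 1 := by omega
      simp [h5]
    · rw [h2.net, fr 4 (by decide), netNum, show σ₁ 11 j = σ 11 j by rw [hE]; rfl]
  | bind x β hβ =>
    have hb := β.size_pos
    have t1 := ht.2.self
    rw [Tabled] at t1
    rw [size, ← Nat.add_assoc] at hp
    rw [size, ← Nat.add_assoc, Nat.add_sub_cancel] at ha
    have hE := run_actNode (n := 7) hp hu hv hP (by omega) (by omega) rfl hc.2.1 hc.2.2
    have fr : ∀ k, k ∉ actNode.writes → actNode.run σ k = σ k := fun k hk => run_frame hk σ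
    rw [down]
    generalize actNode.run σ = σ₁ at *
    simp only [actEffect, upd_of_ne, ne_eq, Nat.reduceEqDiff, not_false_eq_true, t1.1] at hE
    have h2 := hβ (o := o) (σ := σ₁) (act := act)
      (by simp [hE]) (by rw [fr 30 (by decide), hu])
      (by rw [fr 33 (by decide), hv]) (by rw [fr 34 (by decide), hP])
      (by rw [fr 0 (by decide)]; exact hc.1)
      (ht.2.congr_tabled (fr 2 (by decide)) (fr 3 (by decide)))
      (by rw [ha]; simp [hE])
    refine ⟨h2.pos, fun q hq => ?_, fun j => ?_⟩
    · rw [size] at hq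
      rw [h2.frame q (by omega), hE]
      have h5 : q ≠ o + β.size - 1 := by omega
      simp [h5]
    · have h6 : σ₁ 11 j = max (σ 11 j) (if σ 4 x = j then max (if act then 2 else 0)
          (if o + β.size < P then
            max (if InRange u o β then 1 else 0) (if InRange v o β then 3 else 0) else 0) else 0) := by
        simp only [hE, upd_apply, passes_iff_inRange, ha, decide_eq_true_eq]
        by_cases h7 : σ 4 x = j
        · subst h7
          by_cases h8 : o + β.size < P <;> by_cases h9 : σ 10 (o + β.size) = 0 <;>
            simp [h8, h9, max_assoc]
        · simp [h7, Ne.symm h7]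
      rw [h2.net, fr 4 (by decide), netNum, h6, max_assoc]

end RamProg

/-! ### Lengths of bracket words -/

namespace Regex

open RamProg

variable {A X : Type*}

local notation "Sym" => (RefSym A X × ℕ)

/-- The code for the length of a word that need not exist. -/
def codeLen {S : Type*} (w : Option (List S)) : ℕ := w.elim 0 fun v => v.length + 1

theorem codeLen_ne_zero {S : Type*} {w : Option (List S)} : codeLen w ≠ 0 ↔ w.isSome := by
  cases w <;> simp [codeLen]

theorem codeLen_conc {S : Type*} (v w : Option (List S)) :
    codeLen (v.bind fun v => w.map fun w => v ++ w) = conc (codeLen v) (codeLen w) := by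
  cases v <;> cases w <;> simp [codeLen, conc]
  omega

theorem codeLen_or {S : Type*} (v w : Option (List S)) :
    codeLen (v.or w) = orElse (codeLen v) (codeLen w) := by
  cases v <;> simp [codeLen, orElse]

theorem codeLen_append_singleton {S : Type*} (v : Option (List S)) (c : S) :
    codeLen (v.map fun v => v ++ [c]) = conc (codeLen v) 2 := by
  cases v <;> simp [codeLen, conc]

theorem codeLen_nullW (β : Regex A X) (i : ℕ) : codeLen (nullW β i) = β.nullLen := by
  induction β generalizing i with
  | empty => rfl
  | eps => rfl
  | sym a => rfl
  | ref x => rfl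
  | cat β γ hβ hγ => rw [nullW, codeLen_conc, hβ, hγ, nullLen]
  | alt β γ hβ hγ => rw [nullW, codeLen_or, hβ, hγ, nullLen]
  | plus β hβ => exact hβ i
  | bind x β hβ =>
    rw [nullLen, ← hβ (i + 1), nullW]
    cases nullW β (i + 1) <;> simp [codeLen, conc]

/-- The condition only asks which words exist and whether they are empty: two nonzero codes with sum
at most 2 are both 1. -/
theorem nullOK_iff (β : Regex A X) (i : ℕ) : β.NullOK i ↔ β.NullLenOK := by
  induction β generalizing i with
  | empty => exact Iff.rfl
  | eps => exact Iff.rfl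
  | sym a => exact Iff.rfl
  | ref x => exact Iff.rfl
  | cat β γ hβ hγ => rw [NullOK, hβ, hγ, NullLenOK]
  | alt β γ hβ hγ =>
    rw [NullOK, hβ, hγ, NullLenOK, ← codeLen_nullW β i, ← codeLen_nullW γ (i + β.slen)]
    refine and_congr_right fun _ => and_congr_right fun _ => ?_
    cases nullW β i with
    | none => simp [codeLen]
    | some v =>
      cases nullW γ (i + β.slen) with
      | none => simp [codeLen]
      | some w =>
        constructor
        · intro h
          obtain ⟨rfl, rfl⟩ := h v w rfl rfl
          simp [codeLen]
        · rintro h _ _ ⟨⟩ ⟨⟩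
          simp only [codeLen, Option.elim] at h
          exact ⟨List.length_eq_zero_iff.1 (by omega), List.length_eq_zero_iff.1 (by omega)⟩
  | plus β hβ =>
    rw [NullOK, hβ, NullLenOK, ← codeLen_nullW β i]
    refine and_congr_right fun _ => ?_
    cases nullW β i with
    | none => simp [codeLen]
    | some v =>
      simp only [Option.some.injEq, forall_eq', codeLen, Option.elim, ← List.length_eq_zero_iff]
      omega
  | bind x β hβ => rw [NullOK, hβ, NullLenOK]

theorem codeLen_outW {β : Regex A X} {o i u : ℕ} {c : Sym} (hl : β.Located o i u c) :
    codeLen (outW c β i) = outLen u β o := by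
  induction β generalizing o i with
  | empty => rfl
  | eps => rfl
  | sym a =>
    rw [outW, outLen]
    rcases hl with ⟨rfl, rfl⟩ | ⟨h1, h2⟩
    · simp [codeLen]
    · have h3 : u ≠ o := by rintro rfl; exact h1 (by simp [InRange, size])
      have h4 : c ≠ (RefSym.letter a, i) := by
        rintro rfl; exact h2 (by simp [toRef, RefExpr.mark, RefExpr.symbols])
      simp [h3, h4, codeLen]
  | ref x =>
    rw [outW, outLen]
    rcases hl with ⟨rfl, rfl⟩ | ⟨h1, h2⟩
    · simp [codeLen]
    · have h3 : u ≠ o := by rintro rfl; exact h1 (by simp [InRange, size])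
      have h4 : c ≠ (RefSym.var x, i) := by
        rintro rfl; exact h2 (by simp [toRef, RefExpr.mark, RefExpr.symbols])
      simp [h3, h4, codeLen]
  | cat β γ hβ hγ =>
    obtain ⟨h1, h2⟩ := located_cat hl
    rw [outW, codeLen_or, codeLen_conc, hβ h1, hγ h2, codeLen_nullW, outLen]
  | alt β γ hβ hγ =>
    obtain ⟨h1, h2⟩ := located_alt hl
    rw [outW, codeLen_or, hβ h1, hγ h2, outLen]
  | plus β hβ => exact hβ (located_plus hl)
  | bind x β hβ => rw [outW, codeLen_append_singleton, hβ (located_bind hl), outLen]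

/-- The code for the length of the word that leads to an entrance. -/
def entryLen (w : Option (List Sym × ℕ)) : ℕ := codeLen (w.map Prod.fst)

theorem entryLen_enter (v : Option (List Sym)) (p : ℕ) (w : Option (List Sym × ℕ)) :
    entryLen (enter v p w) = orElse (codeLen v) (entryLen w) := by
  cases v <;> simp [entryLen, enter, codeLen, orElse]

theorem entryLen_pass (w : Option (List Sym × ℕ)) (n : Option (List Sym)) :
    entryLen (pass w n) = conc (entryLen w) (codeLen n) := by
  cases w <;> cases n <;> simp [entryLen, pass, codeLen, conc]
  omega

theorem entryLen_open (w : Option (List Sym × ℕ)) (c : Sym) :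
    entryLen (w.map fun v => (v.1 ++ [c], v.2)) = conc (entryLen w) 2 := by
  cases w <;> simp [entryLen, codeLen, conc]

/-- The data of a target that do not involve bracket words. -/
def Target.toReached (e : Target A X) : ℕ × ℕ × RefSym A X := (e.pos, e.turn, e.node.1)

/-- `reached` keeps only lengths where `targets` keeps words, since all decisions depend on whether
a word exists. The turn `t` is arbitrary as long as there is no entrance. -/
theorem map_targets {β : Regex A X} {o i u t : ℕ} {c : Sym} {w : Option (List Sym × ℕ)}
    (hl : β.Located o i u c) (ht : ∀ v p, w = some (v, p) → t = p) :
    (targets c β o i w).map Target.toReached = reached u β o (entryLen w) t := by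
  induction β generalizing o i w t with
  | empty => rfl
  | eps => rfl
  | sym a =>
    rcases w with _ | ⟨v, p⟩
    · simp [targets, reached, entryLen, codeLen]
    · simp [targets, reached, entryLen, codeLen, Target.toReached, ht v p rfl]
  | ref x =>
    rcases w with _ | ⟨v, p⟩
    · simp [targets, reached, entryLen, codeLen]
    · simp [targets, reached, entryLen, codeLen, Target.toReached, ht v p rfl]
  | cat β γ hβ hγ =>
    obtain ⟨h1, h2⟩ := located_cat hl
    rw [targets, List.map_append, hβ h1 ht, reached, hγ h2 (t := if outLen u β o = 0 then t else
      o + β.size + γ.size), entryLen_enter, entryLen_pass, codeLen_outW h1, codeLen_nullW]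
    intro v p hv
    rw [← codeLen_outW h1]
    cases ho : outW c β i with
    | none =>
      rw [ho] at hv
      rcases w with _ | ⟨v', p'⟩
      · cases hv
      · cases hn : nullW β i with
        | none => rw [hn] at hv; cases hv
        | some n =>
          rw [hn] at hv
          simp [enter, pass] at hv
          simp [codeLen, ht v' p' rfl, hv.2]
    | some a =>
      rw [ho] at hv
      simp [enter] at hv
      simp [codeLen, hv.2]
  | alt β γ hβ hγ =>
    obtain ⟨h1, h2⟩ := located_alt hl
    rw [targets, List.map_append, hβ h1 ht, hγ h2 ht, reached]
  | plus β hβ =>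
    have h1 := located_plus hl
    rw [targets, reached, hβ h1 (t := if outLen u β o = 0 then t else o + β.size),
      entryLen_enter, codeLen_outW h1]
    intro v p hv
    rw [← codeLen_outW h1]
    cases ho : outW c β i with
    | none =>
      rw [ho] at hv
      simpa [codeLen] using ht v p hv
    | some a =>
      rw [ho] at hv
      simp [enter] at hv
      simp [codeLen, hv.2]
  | bind x β hβ =>
    rw [targets, reached, hβ (located_bind hl) (t := t), entryLen_open]
    rintro v p hv
    rcases w with _ | ⟨v', p'⟩
    · cases hv
    · simp at hv
      rw [ht v' p' rfl, hv.2]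

theorem outW_eq_none {β : Regex A X} {i : ℕ} {c : Sym} (h0 : β.WellFormed)
    (hc : c ∉ (β.toRef.mark i).symbols) : outW c β i = none := by
  rw [Option.eq_none_iff_forall_not_mem]
  intro v hv
  exact hc (mem_symbols_of_lasts (outW_lasts h0 hv).1)

/-- A path that enters an expression in which it starts has left the expression before. -/
def Recurs (c : Sym) (β : Regex A X) (i : ℕ) (w : Option (List Sym × ℕ)) : Prop :=
  c ∈ (β.toRef.mark i).symbols → ∀ v p, w = some (v, p) →
    ∃ a, outW c β i = some a ∧ a <+: v

/-- A prefix of the same length is the whole word; for this reason the program may compare numbers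
instead of words. -/
theorem agree_iff {a : Option (List Sym)} {w : Option (List Sym × ℕ)}
    (h : ∀ v p b, a = some b → w = some (v, p) → b <+: v) :
    Agree a w ↔ ¬ Differ (codeLen a) (entryLen w) := by
  rcases a with _ | b
  · simp [Agree, Differ, codeLen]
  · rcases w with _ | ⟨v, p⟩
    · simp [Agree, Differ, codeLen, entryLen]
    · have hp := h v p b rfl rfl
      simp only [Agree, Option.some.injEq, Prod.mk.injEq, Differ, codeLen, entryLen, Option.elim,
        Option.map]
      constructor
      · intro h1
        rw [h1 b v p rfl ⟨rfl, rfl⟩]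
        simp
      · rintro h1 _ _ _ rfl ⟨rfl, rfl⟩
        exact hp.eq_of_length (by omega)

/-- If `c` lies in `β` and a path from `c` arrives at the entrance of `β`, it has left `β` before by
the unique exit word. So at every entrance with two ways, the exit word is a prefix of the other
word; `Recurs` is the form in which the induction carries this along. -/
theorem inOK_iff {β : Regex A X} {o i u : ℕ} {c : Sym} {w : Option (List Sym × ℕ)}
    (h0 : β.WellFormed) (hl : β.Located o i u c) (hr : Recurs c β i w) :
    InOK c β o i w ↔ InLenOK u β o (entryLen w) := by
  induction β generalizing o i w with
  | empty => exact Iff.rfl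
  | eps => exact Iff.rfl
  | sym a => exact Iff.rfl
  | ref x => exact Iff.rfl
  | cat β γ hβ hγ =>
    obtain ⟨h1, h2⟩ := located_cat hl
    have hr1 : Recurs c β i w := fun hc v p hw => by
      obtain ⟨a, ha, hav⟩ := hr (mem_symbols_cat.2 (Or.inl hc)) v p hw
      rw [outW, outW_eq_none h0.2 (not_mem_symbols_right hc), Option.none_or,
        Option.bind_eq_some_iff] at ha
      obtain ⟨b, hb, hba⟩ := ha
      obtain ⟨n, -, rfl⟩ := Option.map_eq_some_iff.1 hba
      exact ⟨b, hb, (List.prefix_append b n).trans hav⟩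
    have hr2 : Recurs c γ (i + β.slen)
        (enter (outW c β i) (o + β.size + γ.size) (pass w (nullW β i))) := fun hc v p hw => by
      have hc' := outW_eq_none h0.1 fun h => not_mem_symbols_right h hc
      rw [hc'] at hw
      simp only [enter, pass, Option.map_none, Option.none_or, Option.bind_eq_some_iff,
        Option.map_eq_some_iff, Prod.mk.injEq] at hw
      obtain ⟨⟨v', p'⟩, rfl, n, -, rfl, rfl⟩ := hw
      obtain ⟨a, ha, hav⟩ := hr (mem_symbols_cat.2 (Or.inr hc)) v' p' rfl
      rw [outW, hc', Option.bind_none, Option.or_none] at ha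
      exact ⟨a, ha, hav.trans (List.prefix_append _ _)⟩
    rw [InOK, hγ h0.2 h2 hr2, hβ h0.1 h1 hr1, InLenOK, agree_iff, entryLen_enter, entryLen_pass,
      codeLen_outW h1, codeLen_nullW]
    intro v p b hb hw
    simp only [pass, Option.bind_eq_some_iff, Option.map_eq_some_iff, Prod.mk.injEq] at hw
    obtain ⟨⟨v', p'⟩, rfl, n, -, rfl, rfl⟩ := hw
    obtain ⟨a, ha, hav⟩ := hr1 (mem_symbols_of_lasts (outW_lasts h0.1 hb).1) v' p' rfl
    rw [hb] at ha
    cases ha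
    exact hav.trans (List.prefix_append _ _)
  | alt β γ hβ hγ =>
    obtain ⟨h1, h2⟩ := located_alt hl
    have hr1 : Recurs c β i w := fun hc v p hw => by
      obtain ⟨a, ha, hav⟩ := hr (mem_symbols_cat.2 (Or.inl hc)) v p hw
      rw [outW, outW_eq_none h0.2 (not_mem_symbols_right hc), Option.or_none] at ha
      exact ⟨a, ha, hav⟩
    have hr2 : Recurs c γ (i + β.slen) w := fun hc v p hw => by
      obtain ⟨a, ha, hav⟩ := hr (mem_symbols_cat.2 (Or.inr hc)) v p hw
      rw [outW, outW_eq_none h0.1 fun h => not_mem_symbols_right h hc, Option.none_or] at ha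
      exact ⟨a, ha, hav⟩
    rw [InOK, hγ h0.2 h2 hr2, hβ h0.1 h1 hr1, InLenOK]
  | plus β hβ =>
    have h1 := located_plus hl
    have hr1 : Recurs c β i (enter (outW c β i) (o + β.size) w) := fun hc v p hw => by
      cases ho : outW c β i with
      | none =>
        rw [ho] at hw
        obtain ⟨a, ha, -⟩ := hr hc v p hw
        rw [outW, ho] at ha
        cases ha
      | some b =>
        rw [ho] at hw
        simp [enter] at hw
        exact ⟨b, rfl, by rw [hw.1]⟩
    rw [InOK, hβ h0 h1 hr1, InLenOK, agree_iff, entryLen_enter, codeLen_outW h1]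
    rintro v p b hb rfl
    obtain ⟨a, ha, hav⟩ := hr (mem_symbols_of_lasts (outW_lasts h0 hb).1) v p rfl
    rw [outW, hb] at ha
    cases ha
    exact hav
  | bind x β hβ =>
    have hr1 : Recurs c β (i + 1) (w.map fun v => (v.1 ++ [(RefSym.op x, i)], v.2)) :=
      fun hc v p hw => by
        rw [Option.map_eq_some_iff] at hw
        obtain ⟨⟨v', p'⟩, rfl, hw⟩ := hw
        obtain ⟨rfl, rfl⟩ := Prod.mk.inj hw
        obtain ⟨a, ha, hav⟩ := hr (mem_symbols_bind.2 (Or.inr (Or.inl hc))) v' p' rfl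
        rw [outW, Option.map_eq_some_iff] at ha
        obtain ⟨b, hb, rfl⟩ := ha
        exact ⟨b, hb, ((List.prefix_append _ _).trans hav).trans (List.prefix_append _ _)⟩
    rw [InOK, hβ h0.1 (located_bind hl) hr1, InLenOK, entryLen_open]

/-- A number must single out the variable `x` among those of the expression; apart from this, the
two recursions differ in how they test for a bracket word. -/
theorem netNum_eq [DecidableEq X] {f : X → ℕ} {u v P : ℕ} {β : Regex A X} {o i : ℕ} {act : Bool}
    {x : X} (hf : ∀ y ∈ β.var, f y = f x ↔ y = x) :
    netNum f u v P β o act (f x) = ev u v P β o i act x := by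
  have hs : ∀ (γ : Regex A X) (j : ℕ), decide (γ.nullLen ≠ 0) = (nullW γ j).isSome := fun γ j => by
    rw [← codeLen_nullW γ j, Bool.eq_iff_iff, decide_eq_true_iff, codeLen_ne_zero]
  induction β generalizing o i act with
  | empty => rfl
  | eps => rfl
  | sym a => rfl
  | ref x => rfl
  | cat β γ hβ hγ =>
    rw [netNum, ev, hβ fun y hy => hf y (Or.inl hy), hγ fun y hy => hf y (Or.inr hy)]
  | alt β γ hβ hγ =>
    rw [netNum, ev, hβ fun y hy => hf y (Or.inl hy), hγ fun y hy => hf y (Or.inr hy), hs β i,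
      hs γ (i + β.slen)]
  | plus β hβ => exact hβ hf
  | bind y β hβ =>
    rw [netNum, ev, hβ fun y hy => hf y (Or.inr hy), if_congr (hf y (Or.inl rfl)) rfl rfl]

/-- A reference clashes with every other target. So the letters must be different, and a reference
must be the only target; this is what the program can test, and it bounds the number of targets. -/
theorem noClash_iff {T : List (Target A X)} (hT : (T.map Target.node).Nodup) :
    NoClash T ↔ (lettersOf (T.map Target.toReached)).Nodup ∧
      ((∀ e ∈ T.map Target.toReached, ∀ x, e.2.2 ≠ RefSym.var x) ∨ T.length ≤ 1) := by
  have hT' : T.Pairwise fun e e' => e.node ≠ e'.node := List.pairwise_map.1 hT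
  have hl : (lettersOf (T.map Target.toReached)).Nodup ↔ T.Pairwise fun e e' =>
      ∀ a, ¬ (e.node.1 = RefSym.letter a ∧ e'.node.1 = RefSym.letter a) := by
    rw [lettersOf, List.filterMap_map, List.Nodup, List.pairwise_filterMap]
    refine List.Pairwise.iff fun {e e'} => ?_
    simp only [Function.comp_apply, Target.toReached]
    rcases e.node.1 with a | a | a | a <;> rcases e'.node.1 with b | b | b | b <;> simp [eq_comm]
  rw [hl]
  constructor
  · intro h
    refine ⟨hT'.imp_of_mem fun he he' hne => (h _ he _ he' hne).1, ?_⟩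
    by_contra! hcon
    obtain ⟨⟨_, hr, x, hx⟩, hlen⟩ := hcon
    obtain ⟨e, he, rfl⟩ := List.mem_map.1 hr
    -- Otherwise all nodes of the list would be equal, and a list without duplicates would have at
    -- most one element.
    obtain ⟨e', he', hne⟩ : ∃ e' ∈ T, e.node ≠ e'.node := by
      by_contra! hall
      have h1 : ∀ c ∈ T.map Target.node, c = e.node := fun c hc => by
        obtain ⟨e', he', rfl⟩ := List.mem_map.1 hc
        exact (hall e' he').symm
      have h2 := List.eq_replicate_of_mem h1
      rw [h2, List.nodup_replicate, List.length_map] at hT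
      omega
    exact (h e he e' he' hne).2 x hx
  · rintro ⟨h1, h2⟩ e he e' he' hne
    have hee : e ≠ e' := by rintro rfl; exact hne rfl
    have : Std.Symm fun e e' : Target A X =>
        ∀ a, ¬ (e.node.1 = RefSym.letter a ∧ e'.node.1 = RefSym.letter a) :=
      ⟨fun _ _ h a h' => h a h'.symm⟩
    refine ⟨h1.forall he he' hee, fun x hx => ?_⟩
    rcases h2 with h2 | h2
    · exact h2 _ (List.mem_map_of_mem he) x hx
    · match T, h2, he, he' with
      | [t], _, he, he' =>
        rw [List.mem_singleton] at he he'
        exact hee (he.trans he'.symm)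

/-- The nodes with their positions, from left to right. -/
def leaves : Regex A X → ℕ → ℕ → List (ℕ × RefSym A X × ℕ)
  | sym a, o, i => [(o, RefSym.letter a, i)]
  | ref x, o, i => [(o, RefSym.var x, i)]
  | cat β γ, o, i => leaves β o i ++ leaves γ (o + β.size) (i + β.slen)
  | alt β γ, o, i => leaves β o i ++ leaves γ (o + β.size) (i + β.slen)
  | plus β, o, i => leaves β o i
  | bind _ β, o, i => leaves β o (i + 1)
  | _, _, _ => []

theorem leaves_fst (β : Regex A X) (o i : ℕ) : (leaves β o i).map Prod.fst = leafPos β o := by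
  induction β generalizing o i with
  | empty => rfl
  | eps => rfl
  | sym a => rfl
  | ref x => rfl
  | cat β γ hβ hγ => rw [leaves, List.map_append, hβ, hγ, leafPos]
  | alt β γ hβ hγ => rw [leaves, List.map_append, hβ, hγ, leafPos]
  | plus β hβ => exact hβ o i
  | bind x β hβ => exact hβ o (i + 1)

open scoped Classical in
theorem leaves_snd (β : Regex A X) (o i : ℕ) : (leaves β o i).map Prod.snd =
    (β.toRef.mark i).symbols.filter fun c => decide (¬ c.1.IsBracket) := by
  induction β generalizing o i with
  | empty => rfl
  | eps => rfl
  | sym a => simp [leaves, toRef, RefExpr.mark, RefExpr.symbols, RefSym.IsBracket]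
  | ref x => simp [leaves, toRef, RefExpr.mark, RefExpr.symbols, RefSym.IsBracket]
  | cat β γ hβ hγ =>
    rw [leaves, List.map_append, hβ, hγ, mark_cat, RefExpr.symbols, List.filter_append]
  | alt β γ hβ hγ =>
    rw [leaves, List.map_append, hβ, hγ, mark_alt, RefExpr.symbols, List.filter_append]
  | plus β hβ => exact hβ o i
  | bind x β hβ =>
    rw [leaves, hβ, mark_bind]
    simp [RefExpr.symbols, RefSym.IsBracket]

theorem mem_leaves {β : Regex A X} {o i u : ℕ} {c : Sym} :
    (u, c) ∈ leaves β o i ↔ β.LeafAt o i u c := by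
  induction β generalizing o i with
  | empty => simp [leaves, LeafAt]
  | eps => simp [leaves, LeafAt]
  | sym a => simp [leaves, LeafAt]
  | ref x => simp [leaves, LeafAt]
  | cat β γ hβ hγ => rw [leaves, List.mem_append, hβ, hγ, LeafAt]
  | alt β γ hβ hγ => rw [leaves, List.mem_append, hβ, hγ, LeafAt]
  | plus β hβ => exact hβ
  | bind x β hβ => exact hβ

theorem nodup_leafPos (β : Regex A X) (o : ℕ) : (leafPos β o).Nodup := by
  have h2 : ∀ (β γ : Regex A X) (o : ℕ), (leafPos β o).Nodup → (leafPos γ (o + β.size)).Nodup →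
      (leafPos β o ++ leafPos γ (o + β.size)).Nodup := fun β γ o h h' =>
    List.nodup_append.2 ⟨h, h', fun a ha b hb hab =>
      not_inRange_right (mem_leafPos ha) (hab ▸ mem_leafPos hb)⟩
  induction β generalizing o with
  | empty => exact List.nodup_nil
  | eps => exact List.nodup_nil
  | sym a => exact List.nodup_singleton _
  | ref x => exact List.nodup_singleton _
  | cat β γ hβ hγ => exact h2 β γ o (hβ o) (hγ _)
  | alt β γ hβ hγ => exact h2 β γ o (hβ o) (hγ _)
  | plus β hβ => exact hβ o
  | bind x β hβ => exact hβ o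

theorem nodup_leaves_snd (β : Regex A X) (o i : ℕ) : ((leaves β o i).map Prod.snd).Nodup := by
  rw [leaves_snd]
  exact (RefExpr.nodup_symbols_mark _ _).filter _

end Regex

/-! ### The transitions for a source -/

namespace Regex

variable {A X : Type*}

theorem length_addVar [DecidableEq X] (S : List X) (x : X) :
    (addVar S x).length ≤ S.length + 1 := by
  rw [addVar]
  split_ifs <;> simp

/-- The number of variables is bounded by the size of the tree, so writing all memory instructions
of a transition is as cheap as a traversal. -/
theorem length_addVars [DecidableEq X] (S : List X) (β : Regex A X) :
    (addVars S β).length ≤ S.length + β.size := by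
  induction β generalizing S with
  | empty => exact Nat.le_add_right _ _
  | eps => exact Nat.le_add_right _ _
  | sym a => exact Nat.le_add_right _ _
  | ref x => exact length_addVar S x
  | cat β γ hβ hγ =>
    have h1 := hβ S
    have h2 := hγ (addVars S β)
    rw [addVars, size]
    omega
  | alt β γ hβ hγ =>
    have h1 := hβ S
    have h2 := hγ (addVars S β)
    rw [addVars, size]
    omega
  | plus β hβ => exact (hβ S).trans (Nat.le_succ _)
  | bind x β hβ =>
    have h1 := hβ S
    have h2 := length_addVar (addVars S β) x
    rw [addVars, size]
    omega

theorem netNum_eq_zero {f : X → ℕ} {u v P : ℕ} {β : Regex A X} {o : ℕ} {act : Bool}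
    {j : ℕ} (hf : ∀ y ∈ β.var, f y ≠ j) : netNum f u v P β o act j = 0 := by
  induction β generalizing o act with
  | empty => rfl
  | eps => rfl
  | sym a => rfl
  | ref x => rfl
  | cat β γ hβ hγ =>
    rw [netNum, hβ fun y hy => hf y (Or.inl hy), hγ fun y hy => hf y (Or.inr hy)]
    rfl
  | alt β γ hβ hγ =>
    rw [netNum, hβ fun y hy => hf y (Or.inl hy), hγ fun y hy => hf y (Or.inr hy)]
    rfl
  | plus β hβ => exact hβ hf
  | bind y β hβ =>
    rw [netNum, hβ fun y hy => hf y (Or.inr hy), if_neg (hf y (Or.inl rfl))]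
    rfl

/-- The numbers of the variables, from `1`. -/
def varNum [DecidableEq X] (α : Regex A X) (x : X) : ℕ :=
  if x ∈ addVars [] α then (addVars [] α).idxOf x + 1 else 0

theorem varNum_pos [DecidableEq X] {α : Regex A X} {x : X} (h : x ∈ α.var) : varNum α x ≠ 0 := by
  rw [varNum, if_pos (mem_addVars.2 (Or.inr h))]
  omega

theorem varNum_le [DecidableEq X] {α : Regex A X} {x : X} :
    varNum α x ≤ (addVars [] α).length := by
  rw [varNum]
  split_ifs with h
  · exact List.idxOf_lt_length_of_mem h
  · exact Nat.zero_le _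

theorem varNum_inj [DecidableEq X] {α : Regex A X} {x y : X} (h : x ∈ α.var) :
    varNum α y = varNum α x ↔ y = x := by
  refine ⟨fun hyx => ?_, fun h => h ▸ rfl⟩
  have hx : x ∈ addVars [] α := mem_addVars.2 (Or.inr h)
  rw [varNum, varNum, if_pos hx] at hyx
  split_ifs at hyx with hy
  exact (List.idxOf_inj hy).1 (Nat.succ.inj hyx)

/-- The encoding of a memory instruction of given priority. -/
def instrCode : ℕ → ℕ
  | 0 => 3
  | 1 => 1
  | 2 => 2
  | _ => 0

/-- The priority of the net action on the variable with number `j` for a reached node. -/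
def reachedNet [DecidableEq X] (α : Regex A X) (u : ℕ) (e : ℕ × ℕ × RefSym A X) (j : ℕ) : ℕ :=
  netNum α.varNum u e.1 e.2.1 α 0 false j

/-- The number of the memory that a transition to a reference to `x` recalls. -/
def recalled [DecidableEq X] (α : Regex A X) (u : ℕ) (e : ℕ × ℕ × RefSym A X) (x : X) : ℕ :=
  if reachedNet α u e (varNum α x) = 2 then 0 else varNum α x

/-- The transition from the source with number `j` at position `u` to a reached node. -/
def targetRow {s : ℕ} (α : Regex (Fin s) ℕ) (j u : ℕ) (e : ℕ × ℕ × RefSym (Fin s) ℕ) : List ℕ :=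
  match e.2.2 with
  | RefSym.letter a => [j, 0, a, (leafPos α 0).idxOf e.1] ++
      (List.range ((addVars [] α).length + 1)).map fun i => instrCode (reachedNet α u e i)
  | RefSym.var x => [j, 2, recalled α u e x, (leafPos α 0).idxOf e.1] ++
      (List.range ((addVars [] α).length + 1)).map fun i =>
        instrCode (if i = recalled α u e x then 1 else reachedNet α u e i)
  | _ => []

/-- The code of the syntax tree node at the position of a reached node shows its symbol. -/
def Shows {s : ℕ} (c : ℕ → ℕ) (e : ℕ × ℕ × RefSym (Fin s) ℕ) : Prop :=
  match e.2.2 with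
  | RefSym.letter a => c (2 + e.1 + e.1) = 2 ∧ c (3 + e.1 + e.1) = a
  | RefSym.var x => c (2 + e.1 + e.1) = 3 ∧ c (3 + e.1 + e.1) = x
  | _ => False

theorem shows_of_mem_reached {s : ℕ} {β : Regex (Fin s) ℕ} {u o n t : ℕ} {c : ℕ → ℕ}
    (hc : β.Coded c o) {e : ℕ × ℕ × RefSym (Fin s) ℕ} (he : e ∈ reached u β o n t) :
    Shows c e ∧ e.1 ∈ leafPos β o := by
  induction β generalizing o n t with
  | empty => cases he
  | eps => cases he
  | sym a =>
    rw [reached] at he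
    split_ifs at he
    · cases he
    · rw [List.mem_singleton.1 he]
      exact ⟨hc, List.mem_singleton_self _⟩
  | ref x =>
    rw [reached] at he
    split_ifs at he
    · cases he
    · rw [List.mem_singleton.1 he]
      exact ⟨hc, List.mem_singleton_self _⟩
  | cat β γ hβ hγ =>
    rw [reached, List.mem_append] at he
    rw [leafPos, List.mem_append]
    rcases he with he | he
    · exact ⟨(hγ hc.2.1 he).1, Or.inr (hγ hc.2.1 he).2⟩
    · exact ⟨(hβ hc.1 he).1, Or.inl (hβ hc.1 he).2⟩
  | alt β γ hβ hγ =>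
    rw [reached, List.mem_append] at he
    rw [leafPos, List.mem_append]
    rcases he with he | he
    · exact ⟨(hγ hc.2.1 he).1, Or.inr (hγ hc.2.1 he).2⟩
    · exact ⟨(hβ hc.1 he).1, Or.inl (hβ hc.1 he).2⟩
  | plus β hβ => exact hβ hc.1 he
  | bind x β hβ => exact hβ hc.1 he

end Regex

namespace RamProg

open RamExpr RamStore Regex

theorem runs_run {p : RamProg} (h : p.loopFree = true) (σ : RamStore) :
    Runs p σ p.maxTime fun σ' => σ' = p.run σ :=
  runs_of_loopFree h rfl

/-- What the first pass has computed. -/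
structure Ready {s : ℕ} (α : Regex (Fin s) ℕ) (σ : RamStore) : Prop where
  coded : α.Coded (σ 0) 0
  letters : σ 0 1 = s
  table : α.AllSub (Tabled σ) 0
  vars : σ 4 = varNum α
  varCount : σ 23 0 = (addVars [] α).length
  sources : σ.Buf 5 (leafPos α 0 ++ [α.size])
  index : ∀ q ∈ leafPos α 0, σ 6 q = (leafPos α 0).idxOf q
  instr : σ 16 = instrCode
  size : σ 20 0 = α.size
  occ : σ 27 0 = α.occ

theorem Ready.congr {s : ℕ} {α : Regex (Fin s) ℕ} {σ σ' : RamStore} (h : Ready α σ)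
    (h' : ∀ k ∈ [0, 2, 3, 4, 5, 6, 16, 20, 23, 27], σ' k = σ k) : Ready α σ' := by
  simp only [List.forall_mem_cons, List.not_mem_nil, false_imp_iff, implies_true, and_true] at h'
  obtain ⟨h0, h2, h3, h4, h5, h6, h16, h20, h23, h27⟩ := h'
  exact ⟨by rw [h0]; exact h.coded, by rw [h0, h.letters], h.table.congr_tabled h2 h3,
    by rw [h4, h.vars], by rw [h23, h.varCount], h.sources.congr h5,
    fun q hq => by rw [h6, h.index q hq], by rw [h16, h.instr], by rw [h20, h.size],
    by rw [h27, h.occ]⟩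

theorem Ready.frame {s : ℕ} {α : Regex (Fin s) ℕ} {σ σ' : RamStore} {p : RamProg}
    (h : Ready α σ) (hp : ∀ k ∈ [0, 2, 3, 4, 5, 6, 16, 20, 23, 27], k ∉ p.writes)
    (h' : ∀ k ∉ p.writes, σ' k = σ k) : Ready α σ' :=
  h.congr fun k hk => h' k (hp k hk)

theorem Runs.le {p : RamProg} {σ : RamStore} {t t' : ℕ} {Q : RamStore → Prop}
    (h : Runs p σ t Q) (ht : t ≤ t') : Runs p σ t' Q :=
  h.mono ht fun _ h _ => h

/-- A part without loops comes first. -/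
theorem Runs.step {p q : RamProg} {σ : RamStore} {t : ℕ} {Q : RamStore → Prop}
    (hp : p.loopFree = true) (h : Runs q (p.run σ) t Q) : Runs (p ++ q) σ (p.maxTime + t) Q :=
  (runs_run hp σ).append fun _ h' _ => h' ▸ h

theorem run_frame_of {p : RamProg} {L : List ℕ} {k : ℕ} (hk : k ∉ L)
    (h : ∀ k ∈ p.writes, k ∈ L) (σ : RamStore) : p.run σ k = σ k :=
  run_frame (fun h' => hk (h k h')) σ

/-- The final test of the loop is absorbed by the bound because `1 ≤ M`. The constants in the
running times come from such crude estimates. -/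
theorem loop_time {N M a t : ℕ} (h : N ≤ M) (hM : 1 ≤ M) :
    N * (a + 1 + t) + (a + 1) ≤ (2 * (a + 1) + t) * M := by
  have h1 : N * (a + 1 + t) ≤ (a + 1 + t) * M := by rw [Nat.mul_comm]; exact Nat.mul_le_mul_left _ h
  have h2 : (a + 1) * 1 ≤ (a + 1) * M := Nat.mul_le_mul_left _ hM
  nlinarith

theorem time_add {x y a b c M : ℕ} (hx : x ≤ a * M) (hy : y ≤ b * M) (h : a + b ≤ c) :
    x + y ≤ c * M :=
  (Nat.add_le_add hx hy).trans ((Nat.add_mul _ _ _).ge.trans (Nat.mul_le_mul_right _ h))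

theorem time_const {a M : ℕ} (hM : 1 ≤ M) : a ≤ a * M := Nat.le_mul_of_pos_right a hM

/-- Write and clear the instructions. -/
def emitInstr : RamProg :=
  store 39 0 0 ++ loop (var 23 + 1 - var 39) (push 15 (load 16 (load 11 (var 39))) ++
    (store 11 (var 39) 0 ++ store 39 0 (var 39 + 1)))

/-- Each priority is cleared as soon as it has been written, so the next target finds zeros again
without a separate pass. Index 0 belongs to the additional memory. -/
theorem runs_emitInstr {σ : RamStore} {T : List ℕ} {k : ℕ} (hT : σ.Buf 15 T) (hk : σ 23 0 = k)
    (hi : σ 16 = instrCode) (h0 : ∀ i, k < i → σ 11 i = 0) :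
    Runs emitInstr σ (100 * (k + 1)) fun σ' =>
      σ'.Buf 15 (T ++ (List.range (k + 1)).map fun i => instrCode (σ 11 i)) ∧
        ∀ i, σ' 11 i = 0 := by
  refine (Runs.step rfl (runs_loop (N := k + 1) (I := fun j σ' =>
      (∀ i ∉ [11, 15, 39], σ' i = σ i) ∧ σ' 39 0 = j ∧
      σ'.Buf 15 (T ++ (List.range j).map fun i => instrCode (σ 11 i)) ∧
      (∀ i < j, σ' 11 i = 0) ∧ ∀ i, j ≤ i → σ' 11 i = σ 11 i) ?_ (fun j hj σ₂ h2 =>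
        ⟨?_, runs_of_loopFree rfl ?_⟩) fun σ₂ h2 => ?_)).mono
        (time_add (time_const (Nat.succ_pos k)) (loop_time le_rfl (Nat.succ_pos k)) (by decide)) ?_
  · refine ⟨fun i hi => run_frame_of hi (by decide) σ, rfl, ?_,
      fun i hi => absurd hi (Nat.not_lt_zero i), fun i _ => rfl⟩
    rw [List.range_zero, List.map_nil, List.append_nil]
    exact hT.congr rfl
  · have := h2.1 23 (by decide)
    simp [this, h2.2.1, hk]
    omega
  · obtain ⟨hf, h39, hB, hz, hr⟩ := h2
    have h3 := buf_push (e := load 16 (load 11 (var 39))) hB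
    have h4 := fun i hi => run_frame (p := push 15 (load 16 (load 11 (var 39)))) (k := i) hi σ₂
    simp only [run_append, run_store]
    have hf' : ∀ i ∉ [11, 15, 39], (push 15 (load 16 (load 11 (var 39)))).run σ₂ i = σ i :=
      fun i hi => (run_frame_of hi (by decide) σ₂).trans (hf i hi)
    generalize (push 15 (load 16 (load 11 (var 39)))).run σ₂ = σ₃ at *
    have h5 : σ₃ 39 0 = j := by rw [h4 39 (by decide), h39]
    have h6 : σ₃ 11 = σ₂ 11 := h4 11 (by decide)
    refine ⟨fun i hi => ?_, ?_, ?_, fun i hi => ?_, fun i hi => ?_⟩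
    · rw [← hf' i hi]
      rw [List.mem_cons, List.mem_cons, List.mem_singleton] at hi
      rw [upd_of_ne (by omega), upd_of_ne (by omega)]
    · simp [h5]
    · rw [List.range_succ, List.map_append, ← List.append_assoc]
      refine Buf.congr (σ := σ₃) ?_ rfl
      convert h3 using 2
      simp [h39, hr j le_rfl, hf 16 (by decide), hi]
    · have := hz i
      simp [h5, h6]
      omega
    · simp [h5, h6, hr i (by omega)]
      omega
  · have := h2.1 23 (by decide)
    simp [this, h2.2.1, hk]
  · rintro σ' ⟨hf, h39, hB, hz, hr⟩ -
    exact ⟨hB, fun i => (Nat.lt_or_ge i (k + 1)).elim (hz i) fun h => by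
      rw [hr i h, h0 i h]⟩

/-- Write the label. -/
def emitLabel : RamProg :=
  cond (kind - 2)
    (push 15 2 ++ store 38 0 (load 4 symbol) ++
      -- Priority 2 is a reset: then the memory with number 0 is recalled instead. The recalled
      -- memory is closed by the transition, hence priority 1 afterwards.
      cond (conj (le (load 11 (var 38)) 2) (le 2 (load 11 (var 38)))) (store 38 0 0) skip ++
      push 15 (var 38) ++ store 11 (var 38) 1)
    (push 15 0 ++ push 15 symbol)

/-- Write the transition to the node at the position in array `33`. -/
def emit : RamProg :=
  (store 34 0 (load 9 (var 33)) ++ store 10 (var 20 - 1) 0 ++ store 21 0 (var 20) ++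
    store 28 0 (var 28 + 1)) ++
  (loop (var 21) actNode ++
    ((push 15 (var 31) ++ (store 21 0 (var 33) ++ (emitLabel ++ push 15 (load 6 (var 33))))) ++
      emitInstr))

theorem runs_downPass {A X : Type*} {p : RamProg} (hp : p.loopFree = true)
    (h : ∀ σ, p.run σ 21 0 = σ 21 0 - 1) {α : Regex A X} {σ : RamStore} (h21 : σ 21 0 = α.size) :
    Runs (loop (var 21) p) σ ((2 * ((var 21).cost + 1) + p.maxTime) * α.size)
      fun σ' => σ' = down p.run α σ := by
  have hj : ∀ j, p.run^[j] σ 21 0 = α.size - j := fun j => by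
    induction j with
    | zero => exact h21
    | succ j ih => rw [Function.iterate_succ_apply', h, ih]; omega
  rw [down_eq_iterate]
  refine (runs_loop_iterate (N := α.size) hp (fun j hj' => ?_) ?_).le
    (loop_time le_rfl α.size_pos)
  · rw [eval_var, hj]
    omega
  · rw [eval_var, hj]
    omega

theorem runs_upPass {A X : Type*} {p : RamProg} (hp : p.loopFree = true)
    (h : ∀ σ, p.run σ 21 0 = σ 21 0 + 1) (hw : 20 ∉ p.writes) {α : Regex A X} {σ : RamStore}
    (h20 : σ 20 0 = α.size) (h21 : σ 21 0 = 0) :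
    Runs (loop (var 20 - var 21) p) σ
      ((2 * ((var 20 - var 21).cost + 1) + p.maxTime) * α.size)
      fun σ' => σ' = up p.run α σ := by
  have hj : ∀ j, p.run^[j] σ 21 0 = j := fun j => by
    induction j with
    | zero => exact h21
    | succ j ih => rw [Function.iterate_succ_apply', h, ih]
  rw [up_eq_iterate]
  refine (runs_loop_iterate (N := α.size) hp (fun j hj' => ?_) ?_).le
    (loop_time le_rfl α.size_pos)
  · rw [eval_sub, eval_var, eval_var, hj, iterate_run_frame hw, h20]
    omega
  · rw [eval_sub, eval_var, eval_var, hj, iterate_run_frame hw, h20]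
    omega

theorem actNode_pos (σ : RamStore) : actNode.run σ 21 0 = σ 21 0 - 1 := by
  rw [actNode, run_append, run_frame (by decide), run_append, run_frame (by decide)]
  rfl

theorem enterNode_pos (σ : RamStore) : enterNode.run σ 21 0 = σ 21 0 - 1 := by
  rw [enterNode, run_append, run_frame (by decide), run_append, run_frame (by decide)]
  rfl

theorem exitNode_pos (σ : RamStore) : exitNode.run σ 21 0 = σ 21 0 + 1 := by
  rw [exitNode, run_append, run_store, eval_ofNat, upd_self, eval_add, eval_var,
    run_frame (by decide)]
  rfl

theorem scanNode_pos (σ : RamStore) : scanNode.run σ 21 0 = σ 21 0 + 1 := by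
  rw [scanNode, run_append, run_store, eval_ofNat, upd_self, eval_add, eval_var,
    run_frame (by decide)]
  rfl

theorem ifTwo_eval (σ : RamStore) :
    (conj (le (load 11 (var 38)) 2) (le 2 (load 11 (var 38)))).eval σ =
      if σ 11 (σ 38 0) = 2 then 1 else 0 := by
  rw [eval_conj σ _ _ (p := σ 11 (σ 38 0) ≤ 2) (q := 2 ≤ σ 11 (σ 38 0)) (eval_le σ _ _)
    (eval_le σ _ _)]
  simp [le_antisymm_iff]

/-- The values that `emitLabel` writes. -/
def labelCode {s : ℕ} (α : Regex (Fin s) ℕ) (u : ℕ) (e : ℕ × ℕ × RefSym (Fin s) ℕ) : List ℕ :=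
  match e.2.2 with
  | RefSym.letter a => [0, a]
  | RefSym.var x => [2, recalled α u e x]
  | _ => []

def labelNet {s : ℕ} (α : Regex (Fin s) ℕ) (u : ℕ) (e : ℕ × ℕ × RefSym (Fin s) ℕ) (i : ℕ) : ℕ :=
  match e.2.2 with
  | RefSym.var x => if i = recalled α u e x then 1 else reachedNet α u e i
  | _ => reachedNet α u e i

theorem run_emitLabel {s : ℕ} {α : Regex (Fin s) ℕ} {σ : RamStore} {u : ℕ}
    {e : ℕ × ℕ × RefSym (Fin s) ℕ} {T : List ℕ} (hT : σ.Buf 15 T) (he : Shows (σ 0) e)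
    (hp : σ 21 0 = e.1) (hv : σ 4 = varNum α) (hn : ∀ i, σ 11 i = reachedNet α u e i) :
    (emitLabel.run σ).Buf 15 (T ++ labelCode α u e) ∧
      ∀ i, emitLabel.run σ 11 i = labelNet α u e i := by
  obtain ⟨p, t, c⟩ := e
  rw [emitLabel, run_cond]
  have hk : RamExpr.eval σ (kind - 2) = σ 0 (2 + p + p) - 2 := by simp [hp]
  rw [hk]
  cases c with
  | letter a =>
    simp only [Shows] at he
    rw [he.1]
    have h1 := buf_push (e := 0) hT
    have h2 := buf_push (e := symbol) h1
    rw [if_pos rfl]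
    refine ⟨?_, fun i => ?_⟩
    · rw [List.append_assoc] at h2
      refine (congrArg (Buf _ 15) ?_).mp h2
      rw [eval_symbol, run_frame (by decide), run_frame (by decide), hp, he.2]
      rfl
    · rw [run_frame (by decide), hn]
      rfl
  | var x =>
    simp only [Shows] at he
    rw [he.1, if_neg (by decide)]
    have h1 := buf_push (e := 2) hT
    have h2 := fun k hk => run_frame (p := push 15 2) (k := k) hk σ
    simp only [run_append, run_store, run_cond, ifTwo_eval, run_skip]
    generalize (push 15 2).run σ = σ₁ at *
    have h3 : (σ₁.upd 38 (RamExpr.eval σ₁ 0) (RamExpr.eval σ₁ (load 4 symbol))) =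
        σ₁.upd 38 0 (varNum α x) := by
      simp [h2 4 (by decide), h2 0 (by decide), h2 21 (by decide), hp, he.2, hv]
    rw [h3]
    have h4 : (if (if (σ₁.upd 38 0 (varNum α x)) 11 ((σ₁.upd 38 0 (varNum α x)) 38 0) = 2
        then 1 else 0) = 0 then σ₁.upd 38 0 (varNum α x) else
        (σ₁.upd 38 0 (varNum α x)).upd 38 (RamExpr.eval (σ₁.upd 38 0 (varNum α x)) 0)
          (RamExpr.eval (σ₁.upd 38 0 (varNum α x)) 0)) =
        σ₁.upd 38 0 (recalled α u (p, t, RefSym.var x) x) := by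
      rw [recalled, ← hn, ← h2 11 (by decide)]
      by_cases h : σ₁ 11 (varNum α x) = 2
      · simp [h, upd_upd]
      · simp [h]
    rw [h4]
    have h5 := buf_push (σ := σ₁.upd 38 0 (recalled α u (p, t, RefSym.var x) x)) (e := var 38)
      (h1.congr rfl)
    have h6 := fun k hk => run_frame (p := push 15 (var 38)) (k := k) hk
      (σ₁.upd 38 0 (recalled α u (p, t, RefSym.var x) x))
    generalize (push 15 (var 38)).run (σ₁.upd 38 0 (recalled α u (p, t, RefSym.var x) x)) = σ₂ at *
    refine ⟨?_, fun i => ?_⟩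
    · rw [List.append_assoc] at h5
      refine Buf.congr (σ := σ₂) ?_ rfl
      convert h5 using 2
      simp [labelCode]
    · simp [h6 11 (by decide), h6 38 (by decide), h2 11 (by decide), hn, labelNet]
  | op x => exact he.elim
  | cl x => exact he.elim

theorem targetRow_eq {s : ℕ} {α : Regex (Fin s) ℕ} {j u : ℕ} {e : ℕ × ℕ × RefSym (Fin s) ℕ}
    {c : ℕ → ℕ} (he : Shows c e) : targetRow α j u e =
      [j] ++ labelCode α u e ++ [(leafPos α 0).idxOf e.1] ++
        (List.range ((addVars [] α).length + 1)).map fun i => instrCode (labelNet α u e i) := by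
  obtain ⟨p, t, c⟩ := e
  cases c with
  | letter a => rfl
  | var x => rfl
  | op x => exact he.elim
  | cl x => exact he.elim

/-- One traversal for the net actions and one loop over the memories, both linear in the size of the
tree. -/
theorem runs_emit {s : ℕ} {α : Regex (Fin s) ℕ} {σ : RamStore} {u j : ℕ}
    {e : ℕ × ℕ × RefSym (Fin s) ℕ} {T : List ℕ} (hR : Ready α σ) (hu : σ 30 0 = u)
    (hj : σ 31 0 = j) (hl : e.1 ∈ leafPos α 0) (hs : Shows (σ 0) e) (hv : σ 33 0 = e.1)
    (ht : σ 9 e.1 = e.2.1) (h0 : ∀ i, σ 11 i = 0) (hT : σ.Buf 15 T) :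
    Runs emit σ (1000 * α.size) fun σ' =>
      σ'.Buf 15 (T ++ targetRow α j u e) ∧ (∀ i, σ' 11 i = 0) ∧ σ' 28 0 = σ 28 0 + 1 := by
  have hk : 100 * ((addVars [] α).length + 1) ≤ 200 * α.size := by
    have h1 := length_addVars [] α
    have h2 := α.size_pos
    rw [List.length_nil] at h1
    omega
  refine (Runs.step (t := 900 * α.size) rfl ?_).le
    (time_add (time_const α.size_pos) le_rfl (by decide))
  have f1 := fun k hk => run_frame (p := store 34 0 (load 9 (var 33)) ++ store 10 (var 20 - 1) 0 ++
    store 21 0 (var 20) ++ store 28 0 (var 28 + 1)) (k := k) hk σ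
  have h21 : (store 34 0 (load 9 (var 33)) ++ store 10 (var 20 - 1) 0 ++ store 21 0 (var 20) ++
      store 28 0 (var 28 + 1)).run σ 21 0 = 0 + α.size := by
    simp [hR.size]
  have h34 : (store 34 0 (load 9 (var 33)) ++ store 10 (var 20 - 1) 0 ++ store 21 0 (var 20) ++
      store 28 0 (var 28 + 1)).run σ 34 0 = e.2.1 := by
    simp [hv, ht]
  have h10 : (store 34 0 (load 9 (var 33)) ++ store 10 (var 20 - 1) 0 ++ store 21 0 (var 20) ++
      store 28 0 (var 28 + 1)).run σ 10 (0 + α.size - 1) = 0 := by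
    simp [hR.size]
  have h28 : (store 34 0 (load 9 (var 33)) ++ store 10 (var 20 - 1) 0 ++ store 21 0 (var 20) ++
      store 28 0 (var 28 + 1)).run σ 28 0 = σ 28 0 + 1 := by
    simp
  generalize (store 34 0 (load 9 (var 33)) ++ store 10 (var 20 - 1) 0 ++ store 21 0 (var 20) ++
    store 28 0 (var 28 + 1)).run σ = σ₁ at *
  refine (Runs.append (t' := 500 * α.size) (runs_downPass rfl actNode_pos (α := α) (by simpa using h21))
    fun σ₂ h2 f2 => ?_).le (time_add le_rfl le_rfl (by decide))
  have hA := acted α (u := u) (v := e.1) (P := e.2.1) (o := 0) (act := false) (σ := σ₁) h21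
    (by rw [f1 30 (by decide), hu]) (by rw [f1 33 (by decide), hv]) h34
    (by rw [f1 0 (by decide)]; exact hR.coded)
    (hR.table.congr_tabled (f1 2 (by decide)) (f1 3 (by decide))) (by rw [h10]; rfl)
  rw [← h2] at hA
  have hn : ∀ i, σ₂ 11 i = reachedNet α u e i := fun i => by
    rw [hA.net, f1 11 (by decide), h0, f1 4 (by decide), hR.vars, Nat.zero_max]
    rfl
  refine (Runs.step (t := 200 * α.size) rfl ?_).le
    (time_add (time_const α.size_pos) le_rfl (by decide))
  rw [run_append, run_append, run_append]
  have h3 := buf_push (e := var 31) (hT.congr ((f2 15 (by decide)).trans (f1 15 (by decide))))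
  have f3 := fun k hk => run_frame (p := push 15 (var 31) ++ store 21 0 (var 33)) (k := k) hk σ₂
  have h3' : ((push 15 (var 31) ++ store 21 0 (var 33)).run σ₂).Buf 15 (T ++ [j]) := by
    have h31 : RamExpr.eval σ₂ (var 31) = j := by
      rw [eval_var, f2 31 (by decide), f1 31 (by decide), hj]
    rw [h31] at h3
    exact h3.congr rfl
  have hp : (push 15 (var 31) ++ store 21 0 (var 33)).run σ₂ 21 0 = e.1 := by
    rw [run_append, run_store, eval_ofNat, upd_self, eval_var, run_frame (by decide), f2 33 (by decide),
      f1 33 (by decide), hv]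
  rw [← run_append (push 15 (var 31))]
  have f13 : ∀ k ∉ [34, 10, 21, 28, 36, 38, 11, 15], (push 15 (var 31) ++
      store 21 0 (var 33)).run σ₂ k = σ k := fun k hk => by
    rw [run_frame_of hk (by decide), f2 k fun h => hk ((show ∀ k ∈ (loop (var 21) actNode).writes,
      k ∈ [34, 10, 21, 28, 36, 38, 11, 15] by decide) k h), f1 k fun h => hk ((show ∀ k ∈
      (store 34 0 (load 9 (var 33)) ++ store 10 (var 20 - 1) 0 ++ store 21 0 (var 20) ++
        store 28 0 (var 28 + 1)).writes, k ∈ [34, 10, 21, 28, 36, 38, 11, 15] by decide) k h)]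
  have h28' : (push 15 (var 31) ++ store 21 0 (var 33)).run σ₂ 28 0 = σ 28 0 + 1 := by
    rw [run_frame (by decide), f2 28 (by decide), h28]
  have hn' : ∀ i, (push 15 (var 31) ++ store 21 0 (var 33)).run σ₂ 11 i = reachedNet α u e i :=
    fun i => by rw [run_frame (by decide), hn]
  generalize (push 15 (var 31) ++ store 21 0 (var 33)).run σ₂ = σ₃ at *
  obtain ⟨h4, h5⟩ := run_emitLabel (α := α) (u := u) (e := e) h3' (by
    rw [f13 0 (by decide)]; exact hs) hp (by rw [f13 4 (by decide), hR.vars]) hn'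
  have f4 := fun k hk => run_frame (p := emitLabel) (k := k) hk σ₃
  have h6 := buf_push (e := load 6 (var 33)) h4
  have h33 : RamExpr.eval (emitLabel.run σ₃) (load 6 (var 33)) = (leafPos α 0).idxOf e.1 := by
    rw [eval_load, eval_var, f4 33 (by decide), f4 6 (by decide), f13 33 (by decide),
      f13 6 (by decide), hv, hR.index _ hl]
  rw [h33] at h6
  have f5 := fun k hk => run_frame (p := push 15 (load 6 (var 33))) (k := k) hk (emitLabel.run σ₃)
  generalize (push 15 (load 6 (var 33))).run (emitLabel.run σ₃) = σ₅ at *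
  refine (runs_emitInstr h6 (k := (addVars [] α).length) ?_ ?_ fun i hi => ?_).mono hk ?_
  · rw [f5 23 (by decide), f4 23 (by decide), f13 23 (by decide), hR.varCount]
  · rw [f5 16 (by decide), f4 16 (by decide), f13 16 (by decide), hR.instr]
  -- Cells behind the last variable are zero: no variable has such a number, and the recalled memory
  -- does not have one either.
  · rw [f5 11 (by decide), h5]
    have h7 : reachedNet α u e i = 0 := netNum_eq_zero fun y _ => by
      have := varNum_le (α := α) (x := y)
      omega
    rw [labelNet]
    split
    · rw [if_neg, h7]
      rw [recalled]
      have := varNum_le (α := α) (x := ‹ℕ›)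
      split_ifs <;> omega
    · exact h7
  · rintro σ₆ ⟨h7, h8⟩ f6
    refine ⟨?_, h8, ?_⟩
    · rw [targetRow_eq hs]
      simp only [f5 11 (by decide), h5] at h7
      simpa only [List.append_assoc] using h7
    · rw [f6 28 (by decide), f5 28 (by decide), f4 28 (by decide), h28']

end RamProg

/-! ### The loop over the sources -/

namespace Regex

/-- The positions that stand for the sources; the last one is for the beginning. -/
def srcPos {A X : Type*} (α : Regex A X) (j : ℕ) : ℕ := (leafPos α 0 ++ [α.size]).getD j 0

/-- The code for the length of the word that leads from a source to the entrance. -/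
def srcEntry {A X : Type*} (α : Regex A X) (u : ℕ) : ℕ := if α.size ≤ u then 1 else 0

/-- The nodes that are reached from a source. -/
def srcReached {A X : Type*} (α : Regex A X) (u : ℕ) : List (ℕ × ℕ × RefSym A X) :=
  reached u α 0 (srcEntry α u) α.size

/-- There is no conflict for the source. -/
def SourceOK {A X : Type*} (α : Regex A X) (u : ℕ) : Prop :=
  (InLenOK u α 0 (srcEntry α u) ∧ (RamProg.lettersOf (srcReached α u)).Nodup) ∧
    ((∀ e ∈ srcReached α u, ∀ x, e.2.2 ≠ RefSym.var x) ∨ (srcReached α u).length ≤ 1)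

/-- The source is final. -/
def SourceFinal {A X : Type*} (α : Regex A X) (u : ℕ) : Prop :=
  if α.size ≤ u then α.nullLen ≠ 0 else outLen u α 0 ≠ 0

instance {A X : Type*} (α : Regex A X) (u : ℕ) : Decidable (SourceFinal α u) :=
  inferInstanceAs (Decidable (ite _ _ _))

/-- The final sources. -/
def finalRows {A X : Type*} (α : Regex A X) (j : ℕ) : List ℕ :=
  (List.range j).filter fun i => decide (SourceFinal α (srcPos α i))

/-- The transitions. -/
def transRows {s : ℕ} (α : Regex (Fin s) ℕ) (j : ℕ) : List ℕ :=
  (List.range j).flatMap fun i => (srcReached α (srcPos α i)).flatMap (targetRow α i (srcPos α i))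

/-- The number of transitions. -/
def transCount {A X : Type*} (α : Regex A X) (j : ℕ) : ℕ :=
  ((List.range j).flatMap fun i => srcReached α (srcPos α i)).length

end Regex

namespace RamProg

open RamExpr RamStore Regex

/-- Without references, the targets carry different letters of an alphabet with `s` elements;
otherwise there is at most one target, and `1 ≤ s`. -/
theorem length_srcReached_le {s : ℕ} (hs : 1 ≤ s) {α : Regex (Fin s) ℕ} {c : ℕ → ℕ}
    (hc : α.Coded c 0) {u : ℕ} (h : SourceOK α u) : (srcReached α u).length ≤ s := by
  rcases h.2 with h2 | h2
  · have h1 : ∀ F : List (ℕ × ℕ × RefSym (Fin s) ℕ), (∀ e ∈ F, Shows c e) →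
        (∀ e ∈ F, ∀ x, e.2.2 ≠ RefSym.var x) → (lettersOf F).length = F.length := by
      intro F
      induction F with
      | nil => exact fun _ _ => rfl
      | cons e F ih =>
        intro h3 h4
        have h5 := ih (fun e he => h3 e (List.mem_cons_of_mem _ he))
          fun e he => h4 e (List.mem_cons_of_mem _ he)
        obtain ⟨p, t, d⟩ := e
        have h6 := h3 _ List.mem_cons_self
        cases d with
        | letter a => exact congrArg Nat.succ h5
        | var x => exact absurd rfl (h4 _ List.mem_cons_self x)
        | op x => exact h6.elim
        | cl x => exact h6.elim
    rw [← h1 (srcReached α u) (fun e he => (shows_of_mem_reached hc he).1) h2]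
    simpa using h.1.2.length_le_card
  · exact h2.trans hs

/-- Write all transitions for a source. -/
def emitAll : RamProg :=
  store 35 0 0 ++ loop (var 13 - var 35)
    ((store 35 0 (var 35 + 1) ++ store 33 0 (load 13 (var 35))) ++ emit)

/-- One run of `emit` for every reached node; `N` bounds their number and will be the size of the
alphabet. -/
theorem runs_emitAll {s : ℕ} {α : Regex (Fin s) ℕ} {σ : RamStore} {u j N : ℕ}
    {F : List (ℕ × ℕ × RefSym (Fin s) ℕ)} {T : List ℕ} (hR : Ready α σ) (hu : σ 30 0 = u)
    (hj : σ 31 0 = j) (hF : ∀ e ∈ F, Shows (σ 0) e ∧ e.1 ∈ leafPos α 0)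
    (hB : σ.Buf 13 (F.map fun e => e.1)) (ht : ∀ e ∈ F, σ 9 e.1 = e.2.1)
    (h0 : ∀ i, σ 11 i = 0) (hT : σ.Buf 15 T) (hN : F.length ≤ N) (hN1 : 1 ≤ N) :
    Runs emitAll σ (2000 * (α.size * N)) fun σ' =>
      σ'.Buf 15 (T ++ F.flatMap (targetRow α j u)) ∧ (∀ i, σ' 11 i = 0) ∧
        σ' 28 0 = σ 28 0 + F.length := by
  have hsz := α.size_pos
  have hM : 1 ≤ α.size * N := Nat.mul_pos hsz hN1
  have hlen : σ 13 0 = F.length := by rw [hB.length, List.length_map]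
  refine (Runs.step (t := 1900 * (α.size * N)) rfl ((runs_loop (N := F.length) (t := 1100 * α.size)
      (I := fun i σ' =>
      (∀ k ∉ emitAll.writes, σ' k = σ k) ∧ σ' 35 0 = i ∧
      σ'.Buf 15 (T ++ (F.take i).flatMap (targetRow α j u)) ∧ (∀ k, σ' 11 k = 0) ∧
      σ' 28 0 = σ 28 0 + i) ?_ (fun i hi σ₂ h2 => ⟨?_, ?_⟩) fun σ₂ h2 => ?_).mono ?_ ?_)).le
    (time_add (time_const hM) le_rfl (by decide))
  · exact ⟨fun k hk => run_frame (fun h => hk (by rw [emitAll]; exact List.mem_append_left _ h)) σ,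
      rfl, by simpa using hT.congr (σ' := (store 35 0 0).run σ) rfl, h0, rfl⟩
  · rw [eval_sub, eval_var, eval_var, h2.1 13 (by decide), h2.2.1, hlen]
    omega
  · obtain ⟨hf, h35, hB15, hz, h28⟩ := h2
    have he := List.getElem_mem hi
    have f3 := fun k hk => run_frame (p := store 35 0 (var 35 + 1) ++
      store 33 0 (load 13 (var 35))) (k := k) hk σ₂
    have h3 : (store 35 0 (var 35 + 1) ++ store 33 0 (load 13 (var 35))).run σ₂ 33 0 = F[i].1 := by
      simp only [run_append, run_store, eval_ofNat, upd_self, eval_load, eval_var, eval_add, h35]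
      rw [upd_of_ne (by decide), hf 13 (by decide), hB.getElem (by rw [List.length_map]; exact hi),
        List.getElem_map]
    have h4 : (store 35 0 (var 35 + 1) ++ store 33 0 (load 13 (var 35))).run σ₂ 35 0 = i + 1 := by
      simp [h35]
    have f4 : ∀ k ∉ emitAll.writes, (store 35 0 (var 35 + 1) ++
        store 33 0 (load 13 (var 35))).run σ₂ k = σ k := fun k hk => by
      rw [run_frame_of hk (by decide), hf k hk]
    refine (Runs.step (t := 1000 * α.size) rfl ?_).le
      (time_add (time_const hsz) le_rfl (by decide))
    generalize (store 35 0 (var 35 + 1) ++ store 33 0 (load 13 (var 35))).run σ₂ = σ₃ at *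
    refine (runs_emit (e := F[i]) (hR.frame (p := emitAll) (by decide) f4)
      (by rw [f4 30 (by decide), hu]) (by rw [f4 31 (by decide), hj]) (hF _ he).2
      (by rw [f4 0 (by decide)]; exact (hF _ he).1) h3 (by rw [f4 9 (by decide), ht _ he])
      (fun k => by rw [f3 11 (by decide), hz]) (hB15.congr (f3 15 (by decide)))).mono le_rfl ?_
    rintro σ₄ ⟨h5, h6, h7⟩ f5
    refine ⟨fun k hk => ?_, by rw [f5 35 (by decide), h4], ?_, h6, ?_⟩
    · rw [f5 k fun h => hk ((show ∀ k ∈ emit.writes, k ∈ emitAll.writes by decide) k h), f4 k hk]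
    · rw [List.take_add_one, List.getElem?_eq_getElem hi, List.flatMap_append, ← List.append_assoc]
      simpa using h5
    · rw [h7, f3 28 (by decide), h28, Nat.add_assoc]
  · rw [eval_sub, eval_var, eval_var, h2.1 13 (by decide), h2.2.1, hlen, Nat.sub_self]
  · have h8 : (var 13 - var 35).cost = 5 := rfl
    rw [h8]
    have h9 : F.length * (5 + 1 + 1100 * α.size) ≤ N * (1106 * α.size) :=
      Nat.mul_le_mul hN (by omega)
    have h10 : N * (1106 * α.size) = 1106 * (α.size * N) := by ring
    omega
  · rintro σ' ⟨-, -, h5, h6, h7⟩ -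
    rw [List.take_length] at h5
    exact ⟨h5, h6, h7⟩

def checkVar : RamProg := cond (var 26) (cond (var 13 - 1) (store 24 0 1) skip) skip

def pushFinal : RamProg :=
  cond (le (var 20) (var 30)) (cond (load 3 (var 20 - 1)) (push 14 (var 31)) skip)
    (cond (load 7 (var 20 - 1)) (push 14 (var 31)) skip)

/-- Process a source. -/
def source : RamProg :=
  (store 30 0 (load 5 (var 31 + 1)) ++ store 13 0 0 ++ store 26 0 0 ++ store 21 0 0) ++
  (loop (var 20 - var 21) exitNode ++
  ((store 8 (var 20 - 1) (le (var 20) (var 30)) ++ store 9 (var 20 - 1) (var 20) ++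
    store 21 0 (var 20)) ++
  (loop (var 21) enterNode ++
  ((checkVar ++ pushFinal) ++
  (cond (var 24) skip emitAll ++ store 31 0 (var 31 + 1))))))

/-- The situation before source number `j` is processed. -/
structure Running {s : ℕ} (α : Regex (Fin s) ℕ) (j : ℕ) (σ : RamStore) : Prop where
  ready : Ready α σ
  index : σ 31 0 = j
  seen : ∀ a : Fin s, σ 12 a ≤ j
  net : ∀ i, σ 11 i = 0
  finals : σ.Buf 14 (finalRows α j)
  fail : σ 24 0 = 0 ↔ α.NullLenOK ∧ ∀ i < j, SourceOK α (srcPos α i)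
  trans : σ 24 0 = 0 → σ.Buf 15 (transRows α j) ∧ σ 28 0 = transCount α j

theorem run_checkVar (σ : RamStore) : checkVar.run σ = σ.upd 24 0
    (if σ 26 0 = 0 ∨ σ 13 0 ≤ 1 then σ 24 0 else 1) := by
  simp only [checkVar, run_cond, run_store, run_skip, eval_ofNat, eval_var, eval_sub,
    Nat.sub_eq_zero_iff_le]
  by_cases h1 : σ 26 0 = 0 <;> by_cases h2 : σ 13 0 ≤ 1 <;> simp [h1, h2, upd_id]

theorem run_pushFinal {A X : Type*} {α : Regex A X} {σ : RamStore} {u : ℕ} {L : List ℕ}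
    (h20 : σ 20 0 = α.size) (hu : σ 30 0 = u)
    (h3 : σ 3 (α.size - 1) = α.nullLen) (h7 : σ 7 (α.size - 1) = outLen u α 0)
    (hL : σ.Buf 14 L) : (pushFinal.run σ).Buf 14
      (L ++ if SourceFinal α u then [σ 31 0] else []) := by
  have hp := buf_push (e := var 31) hL
  simp only [pushFinal, run_cond, eval_le, eval_var, eval_load, eval_sub, eval_ofNat, h20, hu, h3,
    h7, run_skip, SourceFinal]
  by_cases h : α.size ≤ u
  · by_cases h' : α.nullLen = 0
    · simpa [h, h'] using hL
    · simpa [h, h'] using hp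
  · by_cases h' : outLen u α 0 = 0
    · simpa [h, h'] using hL
    · simpa [h, h'] using hp

/-- Two traversals and a fixed number of tests, and then one traversal for every target. The set of
final states is recorded in any case, the transitions only if no failure has occurred. -/
theorem runs_source {s : ℕ} (hs : 1 ≤ s) {α : Regex (Fin s) ℕ} {σ : RamStore} {j : ℕ}
    (h : Running α j σ) (hj : j < α.occ + 1) :
    Runs source σ (10000 * (α.size * s)) (Running α (j + 1)) := by
  have hsz := α.size_pos
  have hM : 1 ≤ α.size * s := Nat.mul_pos hsz hs
  have hms : α.size ≤ 1 * (α.size * s) := by rw [Nat.one_mul]; exact Nat.le_mul_of_pos_right _ hs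
  have hc : ∀ c, c * α.size ≤ c * (α.size * s) := fun c => Nat.mul_le_mul_left _ (by simpa using hms)
  have hlen : (leafPos α 0 ++ [α.size]).length = α.occ + 1 := by
    rw [List.length_append, length_leafPos, List.length_singleton]
  obtain ⟨u, hu⟩ : ∃ u, u = srcPos α j := ⟨_, rfl⟩
  have hu' : σ 5 (j + 1) = u := by
    rw [h.ready.sources.getElem (by omega), hu, srcPos, List.getD_eq_getElem _ _ (by omega)]
  -- the pass for exits
  refine (Runs.step (t := 9900 * (α.size * s)) rfl ?_).le
    (time_add (time_const hM) le_rfl (by decide))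
  have f1 := fun k hk => run_frame (p := store 30 0 (load 5 (var 31 + 1)) ++ store 13 0 0 ++
    store 26 0 0 ++ store 21 0 0) (k := k) hk σ
  have hσ₁ : (store 30 0 (load 5 (var 31 + 1)) ++ store 13 0 0 ++ store 26 0 0 ++
      store 21 0 0).run σ = (((σ.upd 30 0 u).upd 13 0 0).upd 26 0 0).upd 21 0 0 := by
    simp [h.index, hu']
  rw [hσ₁] at f1 ⊢
  have h30 : ((((σ.upd 30 0 u).upd 13 0 0).upd 26 0 0).upd 21 0 0) 30 0 = u := by simp
  have h21 : ((((σ.upd 30 0 u).upd 13 0 0).upd 26 0 0).upd 21 0 0) 21 0 = 0 := by simp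
  have h13 : ((((σ.upd 30 0 u).upd 13 0 0).upd 26 0 0).upd 21 0 0) 13 0 = 0 := by simp
  have h26 : ((((σ.upd 30 0 u).upd 13 0 0).upd 26 0 0).upd 21 0 0) 26 0 = 0 := by simp
  generalize (((σ.upd 30 0 u).upd 13 0 0).upd 26 0 0).upd 21 0 0 = σ₁ at *
  have R1 : Ready α σ₁ := h.ready.frame (by decide) f1
  refine (Runs.append (t' := 9000 * (α.size * s)) ((runs_upPass rfl exitNode_pos (by decide)
    (α := α) R1.size h21).le (hc _)) fun σ₂ h2 f2 => ?_).le (time_add le_rfl le_rfl (by decide))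
  obtain ⟨h2p, h2e, -⟩ := exits α (o := 0) (u := u) h21 h30 R1.coded R1.table
  rw [← h2] at h2p h2e
  have R2 : Ready α σ₂ := R1.frame (by decide) f2
  -- the pass for entrances
  refine (Runs.step (t := 8900 * (α.size * s)) rfl ?_).le
    (time_add (time_const hM) le_rfl (by decide))
  have f3 := fun k hk => run_frame (p := store 8 (var 20 - 1) (le (var 20) (var 30)) ++
    store 9 (var 20 - 1) (var 20) ++ store 21 0 (var 20)) (k := k) hk σ₂
  have hσ₃ : (store 8 (var 20 - 1) (le (var 20) (var 30)) ++ store 9 (var 20 - 1) (var 20) ++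
      store 21 0 (var 20)).run σ₂ = ((σ₂.upd 8 (α.size - 1) (srcEntry α u)).upd 9 (α.size - 1)
        α.size).upd 21 0 α.size := by
    simp [R2.size, f2 30 (by decide), h30, srcEntry]
  rw [hσ₃] at f3 ⊢
  have h8 : (((σ₂.upd 8 (α.size - 1) (srcEntry α u)).upd 9 (α.size - 1) α.size).upd 21 0 α.size) 8
      (0 + α.size - 1) = srcEntry α u := by simp
  have h9 : (((σ₂.upd 8 (α.size - 1) (srcEntry α u)).upd 9 (α.size - 1) α.size).upd 21 0 α.size) 9
      (0 + α.size - 1) = α.size := by simp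
  have h21' : (((σ₂.upd 8 (α.size - 1) (srcEntry α u)).upd 9 (α.size - 1) α.size).upd 21 0
      α.size) 21 0 = 0 + α.size := by simp
  generalize ((σ₂.upd 8 (α.size - 1) (srcEntry α u)).upd 9 (α.size - 1) α.size).upd 21 0 α.size =
    σ₃ at *
  have R3 : Ready α σ₃ := R2.frame (by decide) f3
  refine (Runs.append (t' := 5000 * (α.size * s)) ((runs_downPass rfl enterNode_pos
    (α := α) (by simpa using h21')).le (hc _)) fun σ₄ h4 f4 => ?_).le
    (time_add le_rfl le_rfl (by decide))
  -- At the start no letter counts as met: the marks of earlier sources are at most `j`, and those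
  -- of this source will be `j + 1`.
  have hE := entered α (o := 0) (u := u) (n := srcEntry α u) (t := α.size) (τ := j)
    (B := σ 24 0 = 0) (F := []) (σ := σ₃) h21' R3.coded R3.table
    (h2e.congr_exits (f3 7 (by decide))) h8 h9
    (by rw [f3 31 (by decide), f2 31 (by decide), f1 31 (by decide), h.index])
    ⟨buf_nil (by rw [f3 13 (by decide), f2 13 (by decide), h13]), by simp, fun a => by
      have := h.seen a
      rw [f3 12 (by decide), f2 12 (by decide), f1 12 (by decide)]
      simp [lettersOf]
      omega, by rw [f3 26 (by decide), f2 26 (by decide), h26]; simp, by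
      rw [f3 24 (by decide), f2 24 (by decide), f1 24 (by decide)]; simp [lettersOf]⟩
    (by simp)
  rw [← h4] at hE
  have hFd := hE.found
  rw [List.nil_append] at hFd
  have R4 : Ready α σ₄ := R3.frame (by decide) f4
  have g : ∀ k ∉ [30, 13, 26, 21, 36, 7, 8, 9, 37, 24, 12], σ₄ k = σ k := fun k hk => by
    rw [f4 k fun h => hk ((show ∀ k ∈ (loop (var 21) enterNode).writes, k ∈
      [30, 13, 26, 21, 36, 7, 8, 9, 37, 24, 12] by decide) k h),
      f3 k fun h => hk ((show ∀ k ∈ (store 8 (var 20 - 1) (le (var 20) (var 30)) ++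
      store 9 (var 20 - 1) (var 20) ++ store 21 0 (var 20)).writes, k ∈
      [30, 13, 26, 21, 36, 7, 8, 9, 37, 24, 12] by
      decide) k h), f2 k fun h => hk ((show ∀ k ∈ (loop (var 20 - var 21) exitNode).writes,
      k ∈ [30, 13, 26, 21, 36, 7, 8, 9, 37, 24, 12] by decide) k h), f1 k fun h => hk ((show ∀ k ∈
      (store 30 0 (load 5 (var 31 + 1)) ++ store 13 0 0 ++ store 26 0 0 ++ store 21 0 0).writes,
      k ∈ [30, 13, 26, 21, 36, 7, 8, 9, 37, 24, 12] by decide) k h)]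
  have g30 : σ₄ 30 0 = u := by rw [f4 30 (by decide), f3 30 (by decide), f2 30 (by decide), h30]
  have g7 : σ₄ 7 (α.size - 1) = outLen u α 0 := by
    have := h2e.self
    rw [Exits, Nat.zero_add] at this
    rw [f4 7 (by decide), f3 7 (by decide), this]
  -- the checks
  refine (Runs.step (t := 4000 * (α.size * s)) rfl ?_).le
    (time_add (time_const hM) le_rfl (by decide))
  rw [run_append, run_checkVar]
  have h24 : ((if σ₄ 26 0 = 0 ∨ σ₄ 13 0 ≤ 1 then σ₄ 24 0 else 1) = 0) ↔
      σ 24 0 = 0 ∧ SourceOK α u := by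
    have hb := hFd.buf.length
    rw [List.length_map] at hb
    rw [ite_eq_zero_iff, hFd.fail, hFd.var, hb, SourceOK, srcReached]
    tauto
  have hfin := run_pushFinal (σ := σ₄.upd 24 0 (if σ₄ 26 0 = 0 ∨ σ₄ 13 0 ≤ 1 then σ₄ 24 0 else 1))
    (α := α) (u := u) (L := finalRows α j) R4.size g30
    (by have := R4.table.self.2; rwa [Nat.zero_add] at this) g7
    (h.finals.congr (g 14 (by decide)))
  have h24' : pushFinal.run (σ₄.upd 24 0 (if σ₄ 26 0 = 0 ∨ σ₄ 13 0 ≤ 1 then σ₄ 24 0 else 1)) 24 0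
      = 0 ↔ σ 24 0 = 0 ∧ SourceOK α u := by
    rw [run_frame (by decide), upd_self, h24]
  have f5 : ∀ k ∉ [24, 14], pushFinal.run (σ₄.upd 24 0
      (if σ₄ 26 0 = 0 ∨ σ₄ 13 0 ≤ 1 then σ₄ 24 0 else 1)) k = σ₄ k := fun k hk => by
    rw [run_frame_of hk (by decide), upd_of_ne fun h => hk (by simp [h])]
  rw [show (σ₄.upd 24 0 (if σ₄ 26 0 = 0 ∨ σ₄ 13 0 ≤ 1 then σ₄ 24 0 else 1)) 31 0 = j by
    rw [upd_of_ne (by decide), g 31 (by decide), h.index]] at hfin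
  generalize pushFinal.run (σ₄.upd 24 0 (if σ₄ 26 0 = 0 ∨ σ₄ 13 0 ≤ 1 then σ₄ 24 0 else 1)) =
    σ₅ at *
  have R5 : Ready α σ₅ := R4.congr fun k hk => f5 k ((show ∀ k ∈ [0, 2, 3, 4, 5, 6, 16, 20, 23, 27],
    k ∉ [24, 14] by decide) k hk)
  have hrows : transRows α (j + 1) = transRows α j ++ (srcReached α u).flatMap (targetRow α j u) := by
    rw [transRows, List.range_succ, List.flatMap_append, ← hu.symm]
    simp [transRows, ← hu]
  have hcount : transCount α (j + 1) = transCount α j + (srcReached α u).length := by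
    rw [transCount, List.range_succ, List.flatMap_append, List.length_append]
    simp [transCount, ← hu]
  have hok : (α.NullLenOK ∧ ∀ i < j + 1, SourceOK α (srcPos α i)) ↔ σ 24 0 = 0 ∧ SourceOK α u := by
    rw [h.fail, and_assoc, hu]
    refine and_congr_right fun _ => ⟨fun h => ⟨fun i hi => h i (by omega), h j (by omega)⟩,
      fun h i hi => ?_⟩
    rcases Nat.lt_or_ge i j with h' | h'
    · exact h.1 i h'
    · obtain rfl : i = j := by omega
      exact h.2
  -- the transitions
  refine (Runs.append (t := 3000 * (α.size * s)) (t' := 100 * (α.size * s)) (Q := fun σ' =>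
    (∀ i, σ' 11 i = 0) ∧ (σ 24 0 = 0 ∧ SourceOK α u → σ'.Buf 15 (transRows α (j + 1)) ∧
      σ' 28 0 = transCount α (j + 1))) ?_ fun σ₆ h6 f6 => ?_).le
      (time_add le_rfl le_rfl (by decide))
  · have h11 : ∀ i, σ₅ 11 i = 0 := fun i => by rw [f5 11 (by decide), g 11 (by decide), h.net]
    -- The failure cell guards the expensive part: only without a conflict is the number of targets
    -- bounded by `s`.
    by_cases hf : σ₅ 24 0 = 0
    · have hf' := h24'.1 hf
      refine ((Runs.cond_false (e := var 24) (t := 2000 * (α.size * s)) hf ((runs_emitAll (F := srcReached α u)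
        (T := transRows α j) (N := s) R5
        (by rw [f5 30 (by decide), g30]) (by rw [f5 31 (by decide), g 31 (by decide), h.index])
        (fun e he => shows_of_mem_reached R5.coded he) (hFd.buf.congr (f5 13 (by decide)))
        (fun e he => by rw [f5 9 (by decide), hFd.turn e he]) h11 ?_
        (length_srcReached_le hs R5.coded hf'.2) hs).mono le_rfl fun σ' h7 f7 => ?_)).le
        (time_add (a := 10) ?_ le_rfl (by decide)))
      · exact (h.trans hf'.1).1.congr ((f5 15 (by decide)).trans (g 15 (by decide)))
      · refine ⟨h7.2.1, fun _ => ⟨by rw [hrows]; exact h7.1, ?_⟩⟩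
        rw [h7.2.2, hcount, f5 28 (by decide), g 28 (by decide), (h.trans hf'.1).2]
      · change 3 ≤ _
        omega
    · refine ((Runs.cond_true (e := var 24) hf (runs_run (p := skip) rfl σ₅)).mono
        ?_ fun σ' h7 f7 => ?_)
      · change 4 ≤ _
        omega
      · rw [h7]
        exact ⟨h11, fun h => absurd (h24'.2 h) hf⟩
  · refine ((runs_of_loopFree rfl ?_).le ((time_const hM).trans (Nat.mul_le_mul_right _ (by decide))))
    have f7 := fun k hk => run_frame (p := store 31 0 (var 31 + 1)) (k := k) hk σ₆
    have h31 : (store 31 0 (var 31 + 1)).run σ₆ 31 0 = j + 1 := by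
      rw [run_store, eval_ofNat, upd_self, eval_add, eval_var, f6 31 (by decide),
        f5 31 (by decide), g 31 (by decide), h.index]
      rfl
    generalize (store 31 0 (var 31 + 1)).run σ₆ = σ₇ at *
    have R7 : Ready α σ₇ := (R5.frame (by decide) f6).frame (by decide) f7
    refine ⟨R7, h31, fun a => ?_, fun i => by rw [f7 11 (by decide), h6.1], ?_, ?_, ?_⟩
    · rw [f7 12 (by decide), f6 12 (by decide), f5 12 (by decide)]
      exact (hFd.seen a).1
    · refine Buf.congr (σ := σ₅) ?_ ((f7 14 (by decide)).trans (f6 14 (by decide)))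
      rw [finalRows, List.range_succ, List.filter_append, List.filter_cons, List.filter_nil, ← hu]
      simpa [finalRows] using hfin
    · rw [f7 24 (by decide), f6 24 (by decide), h24', hok]
    · rw [f7 24 (by decide), f6 24 (by decide), h24', f7 28 (by decide)]
      exact fun h => ⟨(h6.2 h).1.congr (f7 15 (by decide)), (h6.2 h).2⟩

end RamProg

/-! ### The program -/

namespace Regex

/-- A transition of the trap state. -/
def trapRow {A X : Type*} [DecidableEq X] (α : Regex A X) (a b : ℕ) : List ℕ :=
  [α.occ + 1, a, b, α.occ + 1] ++ List.replicate ((addVars [] α).length + 1) 3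

/-- The transitions of the trap state for the letters. -/
def trapRows {A X : Type*} [DecidableEq X] (α : Regex A X) (j : ℕ) : List ℕ :=
  (List.range j).flatMap fun a => trapRow α 0 a

/-- The output if there is no conflict. -/
def result {s : ℕ} (α : Regex (Fin s) ℕ) : List ℕ :=
  [1, α.occ + 2, s, (addVars [] α).length + 1, α.occ, α.occ + 1] ++
    ((finalRows α (α.occ + 1)).length :: finalRows α (α.occ + 1)) ++
    ((transCount α (α.occ + 1) + s + 1) ::
      (transRows α (α.occ + 1) ++ trapRows α s ++ trapRow α 1 0))

/-- There is no conflict. -/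
def Passed {A X : Type*} (α : Regex A X) : Prop :=
  α.NullLenOK ∧ ∀ j < α.occ + 1, SourceOK α (srcPos α j)

end Regex

namespace RamProg

open RamExpr RamStore Regex

/-- Append the list in array `k` to the output. -/
def copy (k : ℕ) : RamProg :=
  store 39 0 0 ++ loop (var k - var 39) (store 39 0 (var 39 + 1) ++ push 1 (load k (var 39)))

theorem runs_copy {k : ℕ} (h1 : k ≠ 1) (h39 : k ≠ 39) {σ : RamStore} {L M : List ℕ}
    (hL : σ.Buf k L) (hM : σ.Buf 1 M) {N : ℕ} (hN : L.length ≤ N) (hN1 : 1 ≤ N) :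
    Runs (copy k) σ (100 * N) fun σ' => σ'.Buf 1 (M ++ L) := by
  refine (Runs.step rfl ((runs_loop (N := L.length) (I := fun i σ' =>
    σ' k = σ k ∧ σ' 39 0 = i ∧ σ'.Buf 1 (M ++ L.take i)) ?_ (fun i hi σ₂ h2 =>
      ⟨?_, runs_of_loopFree rfl ?_⟩) fun σ₂ h2 => ?_).mono (loop_time hN hN1) ?_)).le
      (time_add (time_const hN1) le_rfl ?_)
  · refine ⟨upd_of_ne h39 _ _ _, rfl, ?_⟩
    rw [List.take_zero, List.append_nil]
    exact hM.congr rfl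
  · rw [eval_sub, eval_var, eval_var, h2.1, h2.2.1, hL.length]
    omega
  · obtain ⟨hk, hi39, hB⟩ := h2
    have h3 : (store 39 0 (var 39 + 1)).run σ₂ = σ₂.upd 39 0 (i + 1) := by simp [hi39]
    rw [run_append, h3]
    have h4 := buf_push (σ := σ₂.upd 39 0 (i + 1)) (e := load k (var 39)) (hB.congr rfl)
    refine ⟨?_, ?_, ?_⟩
    · rw [run_frame (show k ∉ [1, 1] by simpa using h1), upd_of_ne h39, hk]
    · rw [run_frame (show 39 ∉ [1, 1] by decide), upd_self]
    · rw [List.take_add_one, List.getElem?_eq_getElem hi, ← List.append_assoc]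
      refine (congrArg (Buf _ 1) ?_).mp h4
      rw [eval_load, eval_var, upd_self, upd_of_ne h39, hk, hL.getElem hi]
      rfl
  · rw [eval_sub, eval_var, eval_var, h2.1, h2.2.1, hL.length, Nat.sub_self]
  · rintro σ' ⟨-, -, h⟩ -
    rwa [List.take_length] at h
  · exact Nat.le_of_ble_eq_true rfl

def emitTrap (e f : RamExpr) : RamProg :=
  (push 15 (var 27 + 1) ++ (push 15 e ++ (push 15 f ++ (push 15 (var 27 + 1) ++
    (store 40 0 0 ++ store 28 0 (var 28 + 1)))))) ++
  loop (var 23 + 1 - var 40) (push 15 3 ++ store 40 0 (var 40 + 1))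

theorem runs_emitTrap {s : ℕ} {α : Regex (Fin s) ℕ} {e f : RamExpr} {σ : RamStore} {a b : ℕ} {T : List ℕ}
    (hR : Ready α σ) (hT : σ.Buf 15 T) (he : ∀ σ' : RamStore, σ' 39 = σ 39 → e.eval σ' = a)
    (hf : ∀ σ' : RamStore, σ' 39 = σ 39 → f.eval σ' = b) (hc : e.cost + f.cost ≤ 10) :
    Runs (emitTrap e f) σ (1000 * α.size) fun σ' => σ'.Buf 15 (T ++ trapRow α a b) ∧
      σ' 28 0 = σ 28 0 + 1 := by
  have hk : (addVars [] α).length + 1 ≤ 2 * α.size := by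
    have h1 := length_addVars [] α
    have h2 := α.size_pos
    rw [List.length_nil] at h1
    omega
  refine (Runs.step (t := 400 * α.size) rfl ?_).le (time_add (a := 600) ?_ le_rfl le_rfl)
  · have h1 := buf_push (e := var 27 + 1) hT
    have f1 := fun k hk => run_frame (p := push 15 (var 27 + 1)) (k := k) hk σ
    rw [run_append]
    generalize (push 15 (var 27 + 1)).run σ = σ₁ at *
    have h2 := buf_push (e := e) h1
    have f2 := fun k (hk : k ∉ [15, 15]) => run_frame (p := push 15 e) (k := k) hk σ₁
    rw [run_append]
    generalize (push 15 e).run σ₁ = σ₂ at *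
    have h3 := buf_push (e := f) h2
    have f3 := fun k (hk : k ∉ [15, 15]) => run_frame (p := push 15 f) (k := k) hk σ₂
    rw [run_append]
    generalize (push 15 f).run σ₂ = σ₃ at *
    have h4 := buf_push (e := var 27 + 1) h3
    have f4 := fun k hk => run_frame (p := push 15 (var 27 + 1)) (k := k) hk σ₃
    rw [run_append]
    generalize (push 15 (var 27 + 1)).run σ₃ = σ₄ at *
    have h5 := h4.congr (σ' := (store 40 0 0 ++ store 28 0 (var 28 + 1)).run σ₄) rfl
    have f5 := fun k hk => run_frame (p := store 40 0 0 ++ store 28 0 (var 28 + 1)) (k := k) hk σ₄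
    have h40 : (store 40 0 0 ++ store 28 0 (var 28 + 1)).run σ₄ 40 0 = 0 := rfl
    have h28 : (store 40 0 0 ++ store 28 0 (var 28 + 1)).run σ₄ 28 0 = σ 28 0 + 1 := by
      simp [f4 28 (by decide), f3 28 (by decide), f2 28 (by decide), f1 28 (by decide)]
    generalize (store 40 0 0 ++ store 28 0 (var 28 + 1)).run σ₄ = σ₅ at *
    have h27 : σ 27 0 = α.occ := hR.occ
    have h23 : σ₅ 23 0 = (addVars [] α).length := by
      rw [f5 23 (by decide), f4 23 (by decide), f3 23 (by decide), f2 23 (by decide),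
        f1 23 (by decide), hR.varCount]
    have h6 : σ₅.Buf 15 (T ++ [α.occ + 1, a, b, α.occ + 1]) := by
      refine (congrArg (Buf _ 15) ?_).mp h5
      rw [he _ (f1 39 (by decide)), hf _ ((f2 39 (by decide)).trans (f1 39 (by decide)))]
      simp [f3 27 (by decide), f2 27 (by decide), f1 27 (by decide), h27]
    refine (runs_loop (N := (addVars [] α).length + 1) (I := fun i σ' => σ' 23 = σ₅ 23 ∧
      σ' 28 = σ₅ 28 ∧ σ' 40 0 = i ∧ σ'.Buf 15 (T ++ [α.occ + 1, a, b, α.occ + 1] ++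
        List.replicate i 3)) ⟨rfl, rfl, h40, by simpa using h6⟩ (fun i hi σ' h' =>
          ⟨?_, runs_of_loopFree rfl ?_⟩) fun σ' h' => ?_).mono
          ((loop_time hk (by omega)).trans ?_) ?_
    · simp [h'.1, h23, h'.2.2.1]
      omega
    · obtain ⟨g23, g28, g40, hB⟩ := h'
      have h7 := buf_push (e := 3) hB
      have f7 := fun k hk => run_frame (p := push 15 3) (k := k) hk σ'
      rw [run_append]
      generalize (push 15 3).run σ' = σ₆ at *
      refine ⟨?_, ?_, ?_, ?_⟩
      · rw [run_frame (by decide), f7 23 (by decide), g23]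
      · rw [run_frame (by decide), f7 28 (by decide), g28]
      · simp [f7 40 (by decide), g40]
      · rw [List.replicate_succ', ← List.append_assoc]
        exact h7.congr rfl
    · simp [h'.1, h23, h'.2.2.1]
    · rw [show 400 * α.size = 200 * (2 * α.size) by ring]
      exact Nat.mul_le_mul_right _ (by decide)
    · rintro σ' ⟨-, g28, -, hB⟩ -
      rw [g28, h28, trapRow, ← List.append_assoc]
      exact ⟨hB, rfl⟩
  · refine le_trans ?_ (Nat.mul_le_mul_left 600 α.size_pos)
    change (4 + 4 + 1 + 6) + ((4 + e.cost + 1 + 6) + ((4 + f.cost + 1 + 6) +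
      ((4 + 4 + 1 + 6) + (3 + 6)))) ≤ 600 * 1
    omega

/-- Write the transitions of the trap state. -/
def emitTraps : RamProg :=
  store 39 0 0 ++ (loop (load 0 1 - var 39) (emitTrap 0 (var 39) ++ store 39 0 (var 39 + 1)) ++
    emitTrap 1 0)

theorem runs_emitTraps {s : ℕ} (hs : 1 ≤ s) {α : Regex (Fin s) ℕ} {σ : RamStore} {T : List ℕ}
    (hR : Ready α σ) (hT : σ.Buf 15 T) :
    Runs emitTraps σ (5000 * (α.size * s)) fun σ' =>
      σ'.Buf 15 (T ++ trapRows α s ++ trapRow α 1 0) ∧ σ' 28 0 = σ 28 0 + s + 1 := by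
  have hsz := α.size_pos
  have hM : 1 ≤ α.size * s := Nat.mul_pos hsz hs
  refine (Runs.step (t := 4900 * (α.size * s)) rfl ?_).le
    (time_add (time_const hM) le_rfl (by decide))
  have h1 : (store 39 0 0).run σ = σ.upd 39 0 0 := rfl
  have R1 : Ready α (σ.upd 39 0 0) := hR.frame (p := store 39 0 0) (by decide)
    fun k hk => run_frame hk σ
  rw [h1]
  refine (Runs.append (t := 3000 * (α.size * s)) (t' := 1000 * (α.size * s)) ((runs_loop (N := s)
    (t := 1100 * α.size)
    (I := fun i σ' => Ready α σ' ∧ σ' 39 0 = i ∧ σ'.Buf 15 (T ++ trapRows α i) ∧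
      σ' 28 0 = σ 28 0 + i) ⟨R1, rfl, by
        rw [trapRows, List.range_zero, List.flatMap_nil, List.append_nil]; exact hT.congr rfl, rfl⟩
      (fun i hi σ₂ h2 => ⟨?_, ?_⟩) fun σ₂ h2 => ?_).le ?_) fun σ₂ h2 f2 => ?_).le
        (time_add le_rfl le_rfl (by decide))
  · rw [eval_sub, eval_var, eval_load, eval_ofNat, h2.1.letters, h2.2.1]
    omega
  · obtain ⟨R2, h39, hB, h28⟩ := h2
    refine (Runs.append (t' := 100 * α.size) (runs_emitTrap (a := 0) (b := i) R2 hB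
      (fun _ _ => rfl) (fun σ' h' => by rw [eval_var, h', h39]) (by decide))
      fun σ₃ h3 f3 => runs_of_loopFree rfl ?_ |>.le (le_trans ?_ (Nat.mul_le_mul_left 100 hsz))).le
      (time_add le_rfl le_rfl (by decide))
    · have R3 := R2.frame (p := emitTrap 0 (var 39)) (by decide) f3
      refine ⟨R3.frame (p := store 39 0 (var 39 + 1)) (by decide) fun k hk => run_frame hk σ₃,
        ?_, ?_, ?_⟩
      · simp [f3 39 (by decide), h39]
      · rw [trapRows, List.range_succ, List.flatMap_append, ← List.append_assoc]
        refine Buf.congr (σ := σ₃) ?_ rfl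
        simpa [trapRows] using h3.1
      · rw [run_frame (by decide), h3.2, h28, Nat.add_assoc]
    · decide
  · rw [eval_sub, eval_var, eval_load, eval_ofNat, h2.1.letters, h2.2.1, Nat.sub_self]
  · have h8 : (load 0 1 - var 39).cost = 5 := rfl
    rw [h8]
    have h9 : s * (5 + 1 + 1100 * α.size) ≤ s * (1106 * α.size) :=
      Nat.mul_le_mul le_rfl (by omega)
    have h10 : s * (1106 * α.size) = 1106 * (α.size * s) := by ring
    omega
  · obtain ⟨R2, h39, hB, h28⟩ := h2
    refine (runs_emitTrap (a := 1) (b := 0) R2 hB (fun _ _ => rfl) (fun _ _ => rfl)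
      (by decide)).mono (Nat.mul_le_mul_left _ (Nat.le_mul_of_pos_right _ hs)) ?_
    rintro σ₃ ⟨h3, h4⟩ -
    exact ⟨h3, by rw [h4, h28]⟩

end RamProg

/-! ### Lengths of the rows of the output -/

namespace Regex

theorem length_targetRow_le {s : ℕ} {α : Regex (Fin s) ℕ} {j u : ℕ}
    (e : ℕ × ℕ × RefSym (Fin s) ℕ) : (targetRow α j u e).length ≤ 6 * α.size := by
  have h1 := length_addVars [] α
  have h2 := α.size_pos
  rw [List.length_nil] at h1
  obtain ⟨p, t, _ | _ | _ | _⟩ := e <;> simp [targetRow] <;> omega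

theorem length_trapRow_le {s : ℕ} (α : Regex (Fin s) ℕ) (a b : ℕ) :
    (trapRow α a b).length ≤ 6 * α.size := by
  have h1 := length_addVars [] α
  have h2 := α.size_pos
  rw [List.length_nil] at h1
  simp [trapRow]
  omega

theorem length_flatMap_le {B C : Type*} {L : List B} {f : B → List C} {c : ℕ}
    (h : ∀ b ∈ L, (f b).length ≤ c) : (L.flatMap f).length ≤ L.length * c := by
  induction L with
  | nil => simp
  | cons b L ih =>
    rw [List.flatMap_cons, List.length_append, List.length_cons, Nat.succ_mul, Nat.add_comm]
    exact Nat.add_le_add (ih fun b hb => h b (List.mem_cons_of_mem _ hb)) (h b List.mem_cons_self)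

end Regex

/-! ### The complete program and its running time -/

namespace RamProg

open RamExpr RamStore Regex

/-- Append the values of several expressions to the list in array `k`. -/
def pushAll (k : ℕ) : List RamExpr → RamProg
  | [] => skip
  | e :: es => push k e ++ pushAll k es

theorem buf_pushAll {k : ℕ} {es : List RamExpr} {σ : RamStore} {L : List ℕ} (hL : σ.Buf k L)
    (h : ∀ e ∈ es, ∀ σ' : RamStore, (∀ j, j ≠ k → σ' j = σ j) → e.eval σ' = e.eval σ) :
    ((pushAll k es).run σ).Buf k (L ++ es.map fun e => e.eval σ) := by
  suffices ∀ (σ' : RamStore) (L : List ℕ), σ'.Buf k L → (∀ j, j ≠ k → σ' j = σ j) →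
      ((pushAll k es).run σ').Buf k (L ++ es.map fun e => e.eval σ) from
    this σ L hL fun _ _ => rfl
  induction es with
  | nil => intro σ' L hL _; simpa [pushAll] using hL
  | cons e es ih =>
    intro σ' L hL h'
    have h1 := buf_push (e := e) hL
    rw [h e List.mem_cons_self σ' h'] at h1
    rw [pushAll, run_append, List.map_cons, ← List.singleton_append, ← List.append_assoc]
    refine ih (fun e he => h e (List.mem_cons_of_mem _ he)) _ _ h1 fun j hj => ?_
    rw [run_frame (show j ∉ [k, k] by simpa using hj), h' j hj]

/-- The first part of the program: prepare the tables. -/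
def prepare : RamProg :=
  (store 16 0 3 ++ store 16 1 1 ++ store 16 2 2) ++
  -- The input has length `1 + 2 * α.size`; the machine cannot divide, so the size is found by
  -- counting.
  (loop (load 0 0 - (1 + var 20 + var 20)) (store 20 0 (var 20 + 1)) ++
  (loop (var 20 - var 21) scanNode ++
  (store 27 0 (var 5) ++ push 5 (var 20))))

/-- Write the output if there is no conflict. -/
def success : RamProg :=
  emitTraps ++ (pushAll 1 [1, var 27 + 2, load 0 1, var 23 + 1, var 27, var 27 + 1, var 14] ++
    (copy 14 ++ (push 1 (var 28) ++ copy 15)))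

/-- The program that computes the automaton or reports a conflict. -/
def glushkovProgram : RamProg :=
  prepare ++ (loop (var 27 + 1 - var 31) source ++ cond (var 24) (push 1 0) success)

/-- All arrays but the input start with zeros, so most parts of the invariant for source `0` are
immediate; the others are the results of the first pass. The position `α.size` is appended to the
list of leaves and stands for the beginning. -/
theorem runs_prepare {s : ℕ} (α : Regex (Fin s) ℕ) :
    Runs prepare (initStore (s :: α.encode)) (1000 * α.size) (Running α 0) := by
  have hsz := α.size_pos
  have hk : ∀ k, k ≠ 0 → initStore (s :: α.encode) k = fun _ => 0 := fun k h => by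
    funext i; rw [initStore, if_neg h]
  have h00 : initStore (s :: α.encode) 0 0 = 1 + α.size + α.size := by
    simp [initStore, length_encode]; omega
  have h01 : initStore (s :: α.encode) 0 1 = s := by simp [initStore]
  have hc : α.Coded (initStore (s :: α.encode) 0) 0 := coded_of_eq α fun j hj => by
    rw [initStore, if_pos rfl, show 2 + 0 + 0 + j = j + 2 by omega]
    simp [hj]
  generalize initStore (s :: α.encode) = σ at *
  refine (Runs.step (t := 900 * α.size) rfl ?_).le (time_add (time_const hsz) le_rfl (by decide))
  have f1 := fun k hk => run_frame (p := store 16 0 3 ++ store 16 1 1 ++ store 16 2 2) (k := k) hk σ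
  have h16 : (store 16 0 3 ++ store 16 1 1 ++ store 16 2 2).run σ 16 = instrCode := by
    funext i
    simp only [run_append, run_store, eval_ofNat, upd_eq, hk 16 (by decide)]
    rcases i with _ | _ | _ | i <;> simp [instrCode]
  generalize (store 16 0 3 ++ store 16 1 1 ++ store 16 2 2).run σ = σ₁ at *
  refine (Runs.append (t := 100 * α.size) (t' := 800 * α.size) ((runs_loop (N := α.size)
    (I := fun i σ' => σ' 20 0 = i ∧ σ' 0 0 = 1 + α.size + α.size)
    ⟨by rw [f1 20 (by decide), hk 20 (by decide)], by rw [f1 0 (by decide), h00]⟩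
    (fun i hi σ₂ h2 => ⟨?_, runs_of_loopFree rfl ?_⟩) fun σ₂ h2 => ?_).le
    ((loop_time le_rfl hsz).trans (Nat.mul_le_mul_right _ (by decide)))) fun σ₂ h2 f2 => ?_).le
    (time_add le_rfl le_rfl (by decide))
  · simp only [eval_sub, eval_load, eval_add, eval_var, eval_ofNat, h2.1, h2.2]
    omega
  · simp [h2.1, h2.2]
  · simp only [eval_sub, eval_load, eval_add, eval_var, eval_ofNat, h2.1, h2.2]
    omega
  have g2 : ∀ k ∉ [16, 20], σ₂ k = σ k := fun k hk => by
    rw [f2 k fun h => hk ((show ∀ k ∈ (loop (load 0 0 - (1 + var 20 + var 20))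
      (store 20 0 (var 20 + 1))).writes, k ∈ [16, 20] by decide) k h), f1 k fun h => hk ((show ∀ k ∈
      (store 16 0 3 ++ store 16 1 1 ++ store 16 2 2).writes, k ∈ [16, 20] by decide) k h)]
  have z2 : ∀ k ∉ [16, 20], k ≠ 0 → ∀ i, σ₂ k i = 0 := fun k h h' i => by rw [g2 k h, hk k h']
  refine (Runs.append (t := 700 * α.size) (t' := 100 * α.size) ((runs_upPass (α := α) rfl scanNode_pos (by decide) h2.1
    (z2 21 (by decide) (by decide) 0)).le (Nat.mul_le_mul_right _ (by decide)))
    fun σ₃ h3 f3 => ?_).le (time_add le_rfl le_rfl (by decide))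
  have hS := scanned α (o := 0) (L := []) (S := []) (σ := σ₂) (z2 21 (by decide) (by decide) 0)
    (by rw [g2 0 (by decide)]; exact hc)
    ⟨buf_nil (z2 5 (by decide) (by decide) 0), by simp⟩ (by simp)
    ⟨List.nodup_nil, z2 23 (by decide) (by decide) 0, by simp,
      fun _ _ => z2 4 (by decide) (by decide) _⟩
  rw [← h3] at hS
  have z3 : ∀ k ∉ prepare.writes, k ≠ 0 → ∀ i, σ₃ k i = 0 := fun k h h' i => by
    rw [f3 k fun h1 => h ((show ∀ k ∈ (loop (var 20 - var 21) scanNode).writes,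
      k ∈ prepare.writes by decide) k h1), z2 k (fun h1 => h ((show ∀ k ∈ [16, 20],
      k ∈ prepare.writes by decide) k h1)) h']
  refine (runs_of_loopFree rfl ?_).le ((time_const hsz).trans (Nat.mul_le_mul_right _ (by decide)))
  have f4 := fun k hk => run_frame (p := store 27 0 (var 5) ++ push 5 (var 20)) (k := k) hk σ₃
  have hi := hS.indexed
  rw [List.nil_append] at hi
  have h27 : (store 27 0 (var 5) ++ push 5 (var 20)).run σ₃ 27 0 = α.occ := by
    rw [run_append, run_frame (by decide), run_store, eval_ofNat, upd_self, eval_var,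
      hi.1.length, length_leafPos]
  have h5 := buf_push (e := var 20) (hi.1.congr (σ' := (store 27 0 (var 5)).run σ₃) rfl)
  rw [← run_append, show (var 20).eval ((store 27 0 (var 5)).run σ₃) = α.size by
    rw [eval_var, run_frame (by decide), f3 20 (by decide), h2.1]] at h5
  have z4 : ∀ k ∉ prepare.writes, k ≠ 0 → ∀ i,
      (store 27 0 (var 5) ++ push 5 (var 20)).run σ₃ k i = 0 := fun k h h' i => by
    rw [f4 k fun h1 => h ((show ∀ k ∈ (store 27 0 (var 5) ++ push 5 (var 20)).writes,
      k ∈ prepare.writes by decide) k h1), z3 k h h']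
  have g0 : (store 27 0 (var 5) ++ push 5 (var 20)).run σ₃ 0 = σ 0 := by
    rw [f4 0 (by decide), f3 0 (by decide), g2 0 (by decide)]
  have h24 : (store 27 0 (var 5) ++ push 5 (var 20)).run σ₃ 24 0 = 0 ↔ α.NullLenOK := by
    rw [f4 24 (by decide), hS.fail, z2 24 (by decide) (by decide)]
    simp
  generalize (store 27 0 (var 5) ++ push 5 (var 20)).run σ₃ = σ₄ at *
  refine ⟨⟨by rw [g0]; exact hc, by rw [g0, h01],
    hS.table.congr_tabled (f4 2 (by decide)) (f4 3 (by decide)), ?_, ?_, h5, fun q hq => ?_, ?_,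
    ?_, h27⟩, z4 31 (by decide) (by decide) 0, fun a => (z4 12 (by decide) (by decide) a).le,
    z4 11 (by decide) (by decide), buf_nil (z4 14 (by decide) (by decide) 0), by simp [h24],
    fun _ => ⟨buf_nil (z4 15 (by decide) (by decide) 0), z4 28 (by decide) (by decide) 0⟩⟩
  · rw [f4 4 (by decide)]
    funext x
    rw [varNum]
    split_ifs with hx
    · have h6 := hS.numbered.eq _ (List.idxOf_lt_length_iff.2 hx)
      rwa [List.getElem_idxOf] at h6
    · exact hS.numbered.zero x hx
  · rw [f4 23 (by decide), hS.numbered.count]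
  · obtain ⟨j, hj, rfl⟩ := List.getElem_of_mem hq
    rw [f4 6 (by decide), hi.2 j hj, (nodup_leafPos α 0).idxOf_getElem]
  · rw [f4 16 (by decide), f3 16 (by decide), f2 16 (by decide), h16]
  · rw [f4 20 (by decide), f3 20 (by decide), h2.1]

/-- Every source has at most `s` transitions, there are `s + 1` transitions at the trap, and a
transition is described by at most `6 * α.size` numbers. So the length of the output, and the time
for copying it, stay within the bound. -/
theorem runs_success {s : ℕ} (hs : 1 ≤ s) {α : Regex (Fin s) ℕ} {σ : RamStore}
    (hR : Running α (α.occ + 1) σ) (h24 : σ 24 0 = 0) (h1 : σ.Buf 1 []) :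
    Runs success σ (9000 * (s * α.size * max α.occ 1)) fun σ' => σ'.Buf 1 (result α) := by
  have hsz := α.size_pos
  have hsS : 1 ≤ s * α.size := Nat.mul_pos hs hsz
  have hM : 1 ≤ s * α.size * max α.occ 1 := Nat.mul_pos hsS (by omega)
  have hSM : s * α.size ≤ s * α.size * max α.occ 1 := Nat.le_mul_of_pos_right _ (by omega)
  have hnM : max α.occ 1 ≤ s * α.size * max α.occ 1 := Nat.le_mul_of_pos_left _ hsS
  obtain ⟨hT, h28⟩ := hR.trans h24
  obtain ⟨M, hMe⟩ : ∃ M, M = s * α.size * max α.occ 1 := ⟨_, rfl⟩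
  have hF : (finalRows α (α.occ + 1)).length ≤ 2 * M := by
    have := List.length_filter_le (fun i => decide (SourceFinal α (srcPos α i)))
      (List.range (α.occ + 1))
    rw [List.length_range] at this
    rw [finalRows]
    omega
  have hB : (transRows α (α.occ + 1) ++ trapRows α s ++ trapRow α 1 0).length ≤ 24 * M := by
    have e1 : (transRows α (α.occ + 1)).length ≤ (α.occ + 1) * (s * (6 * α.size)) := by
      have := length_flatMap_le (L := List.range (α.occ + 1)) (f := fun i =>
        (srcReached α (srcPos α i)).flatMap (targetRow α i (srcPos α i))) (c := s * (6 * α.size))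
        fun i hi => (length_flatMap_le fun e _ => length_targetRow_le e).trans
          (Nat.mul_le_mul_right _ (length_srcReached_le hs hR.ready.coded
            ((hR.fail.1 h24).2 i (List.mem_range.1 hi))))
      rwa [List.length_range] at this
    have e2 := length_flatMap_le (L := List.range s) (f := fun a => trapRow α 0 a)
      fun a _ => length_trapRow_le α 0 a
    have e3 := length_trapRow_le α 1 0
    have e4 : (α.occ + 1) * (s * (6 * α.size)) ≤ 12 * M := by
      have : (α.occ + 1) * (s * (6 * α.size)) ≤ (2 * max α.occ 1) * (s * (6 * α.size)) :=
        Nat.mul_le_mul_right _ (by omega)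
      rw [hMe]
      linarith [this]
    have e5 : s * (6 * α.size) ≤ 6 * M := by
      rw [show s * (6 * α.size) = 6 * (s * α.size) by ring]; omega
    have e6 : α.size ≤ M := (Nat.le_mul_of_pos_left _ hs).trans (hSM.trans hMe.ge)
    rw [List.length_range] at e2
    rw [List.length_append, List.length_append, trapRows]
    omega
  rw [← hMe] at hM hSM ⊢
  refine (Runs.append (t := 5000 * M) (t' := 4000 * M) ((runs_emitTraps hs hR.ready hT).le
    (Nat.mul_le_mul_left _ (by rw [Nat.mul_comm]; exact hSM))) fun σ₁ h2 f1 => ?_).le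
    (time_add le_rfl le_rfl (by decide))
  have R1 : Ready α σ₁ := hR.ready.frame (by decide) f1
  refine (Runs.step (t := 3800 * M) rfl ?_).le (time_add (time_const hM) le_rfl (by decide))
  have f2 := fun k hk => run_frame (p := pushAll 1
    [1, var 27 + 2, load 0 1, var 23 + 1, var 27, var 27 + 1, var 14]) (k := k) hk σ₁
  have h3 := buf_pushAll (es := [1, var 27 + 2, load 0 1, var 23 + 1, var 27, var 27 + 1, var 14])
    (h1.congr (f1 1 (by decide))) fun e he σ' h' => by
      fin_cases he <;> simp [h']
  have hb14 := hR.finals.congr (f1 14 (by decide))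
  simp only [List.map_cons, List.map_nil, eval_ofNat, eval_add, eval_var, eval_load, R1.occ,
    R1.letters, R1.varCount, hb14.length, List.nil_append] at h3
  generalize (pushAll 1 [1, var 27 + 2, load 0 1, var 23 + 1, var 27, var 27 + 1, var 14]).run σ₁ =
    σ₂ at *
  refine (Runs.append (t := 200 * M) (t' := 3600 * M) ((runs_copy (k := 14) (by decide) (by decide)
    (hb14.congr (f2 14 (by decide))) h3 hF (by omega)).le (by omega)) fun σ₃ h4 f3 => ?_).le
    (time_add le_rfl le_rfl (by decide))
  refine (Runs.step (t := 2400 * M) rfl ?_).le (time_add (time_const hM) le_rfl (by decide))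
  have f4 := fun k hk => run_frame (p := push 1 (var 28)) (k := k) hk σ₃
  have h5 := buf_push (e := var 28) h4
  rw [eval_var, f3 28 (by decide), f2 28 (by decide), h2.2, h28] at h5
  generalize (push 1 (var 28)).run σ₃ = σ₄ at *
  refine (runs_copy (k := 15) (by decide) (by decide) (h2.1.congr (((f4 15 (by decide)).trans
    (f3 15 (by decide))).trans (f2 15 (by decide)))) h5 hB (by omega)).mono (by omega) ?_
  intro σ₅ h6 _
  refine (congrArg (Buf _ 1) ?_).mp h6
  simp [result]

/-- There are `α.occ + 1 ≤ 2 * max α.occ 1` sources, each treated in time proportional to `s *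
α.size`; preparation and output do not exceed this. -/
theorem runs_glushkovProgram {s : ℕ} (hs : 1 ≤ s) (α : Regex (Fin s) ℕ) :
    Runs glushkovProgram (initStore (s :: α.encode)) (40000 * (s * α.size * max α.occ 1)) fun σ' =>
      (Passed α ∧ σ'.Buf 1 (result α)) ∨ (¬Passed α ∧ σ'.Buf 1 [0]) := by
  have hsz := α.size_pos
  have hsS : 1 ≤ s * α.size := Nat.mul_pos hs hsz
  have hM : 1 ≤ s * α.size * max α.occ 1 := Nat.mul_pos hsS (by omega)
  have h1 : α.size ≤ s * α.size * max α.occ 1 :=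
    (Nat.le_mul_of_pos_left _ hs).trans (Nat.le_mul_of_pos_right _ (by omega))
  refine (Runs.append (t := 1000 * (s * α.size * max α.occ 1))
    (t' := 39000 * (s * α.size * max α.occ 1)) ((runs_prepare α).le (Nat.mul_le_mul_left _ h1))
    fun σ h2 f1 => ?_).le (time_add le_rfl le_rfl (by decide))
  refine (Runs.append (t := 29000 * (s * α.size * max α.occ 1))
    (t' := 10000 * (s * α.size * max α.occ 1)) ((runs_loop (N := α.occ + 1) (I := Running α) h2
      (fun j hj σ₁ h3 => ⟨?_, runs_source hs h3 hj⟩) fun σ₁ h3 => ?_).le ?_) fun σ₁ h3 f2 => ?_).le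
    (time_add le_rfl le_rfl (by decide))
  · rw [eval_sub, eval_add, eval_var, eval_var, eval_ofNat, h3.ready.occ, h3.index]
    exact Nat.sub_ne_zero_of_lt hj
  · rw [eval_sub, eval_add, eval_var, eval_var, eval_ofNat, h3.ready.occ, h3.index, Nat.sub_self]
  · have h8 : (var 27 + 1 - var 31).cost = 7 := rfl
    have h9 : (α.occ + 1) * (7 + 1 + 10000 * (α.size * s)) ≤
        (2 * max α.occ 1) * (10008 * (s * α.size)) :=
      Nat.mul_le_mul (by omega) (by rw [Nat.mul_comm α.size]; omega)
    have h10 : (2 * max α.occ 1) * (10008 * (s * α.size)) =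
        20016 * (s * α.size * max α.occ 1) := by ring
    rw [h8]
    omega
  · have hb : σ₁.Buf 1 [] := buf_nil (by
      rw [f2 1 (by decide), f1 1 (by decide)]
      rfl)
    by_cases h24 : σ₁ 24 0 = 0
    · refine ((Runs.cond_false (e := var 24) h24 (runs_success hs h3 h24 hb)).mono
        ?_ fun σ₂ h4 _ => Or.inl ⟨h3.fail.1 h24, h4⟩)
      change 3 + _ ≤ _
      omega
    · refine ((Runs.cond_true (e := var 24) h24 (runs_of_loopFree (Q := fun σ' => σ'.Buf 1 [0]) rfl
        (buf_push (e := 0) hb))).mono ?_ fun σ₂ h4 _ => Or.inr ⟨fun h => h24 (h3.fail.2 h), h4⟩)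
      refine le_trans ?_ (Nat.mul_le_mul_left _ hM)
      decide

theorem glushkovProgram_computes {s : ℕ} (hs : 1 ≤ s) (α : Regex (Fin s) ℕ) :
    ∃ output t, glushkovProgram.Computes (s :: α.encode) output t ∧
      t ≤ 40000 * (s * α.size * max α.occ 1) ∧
      ((Passed α ∧ output = result α) ∨ (¬Passed α ∧ output = [0])) := by
  obtain ⟨σ, t, h1, h2, h3, -⟩ := runs_glushkovProgram hs α
  rcases h3 with ⟨h3, h4⟩ | ⟨h3, h4⟩
  · exact ⟨_, t, ⟨σ, h1, h4⟩, h2, Or.inl ⟨h3, rfl⟩⟩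
  · exact ⟨_, t, ⟨σ, h1, h4⟩, h2, Or.inr ⟨h3, rfl⟩⟩

end RamProg

/-! ### The sources and their numbers -/

namespace Regex

open RamProg

variable {s : ℕ} {α : Regex (Fin s) ℕ}

local notation "Sym" => (RefSym (Fin s) ℕ × ℕ)

theorem Node.exists_leafAt (n : α.Node) : ∃ p, α.LeafAt 0 1 p n.1 := by
  classical
  have h : n.1 ∈ (leaves α 0 1).map Prod.snd := by
    rw [leaves_snd, List.mem_filter]
    exact ⟨n.2.1, by simpa using n.2.2⟩
  obtain ⟨⟨p, c⟩, h1, h2⟩ := List.mem_map.1 h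
  exact ⟨p, h2 ▸ mem_leaves.1 h1⟩

/-- The position of a node in the syntax tree. -/
noncomputable def Node.pos (n : α.Node) : ℕ := n.exists_leafAt.choose

theorem Node.leafAt (n : α.Node) : α.LeafAt 0 1 n.pos n.1 := n.exists_leafAt.choose_spec

theorem LeafAt.pos_eq {p : ℕ} {n : α.Node} (h : α.LeafAt 0 1 p n.1) : n.pos = p :=
  congrArg Prod.fst (List.inj_on_of_nodup_map (nodup_leaves_snd α 0 1) (mem_leaves.2 n.leafAt)
    (mem_leaves.2 h) rfl)

theorem Node.pos_mem (n : α.Node) : n.pos ∈ leafPos α 0 := by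
  rw [← leaves_fst α 0 1]
  exact List.mem_map_of_mem (mem_leaves.2 n.leafAt)

theorem Node.pos_inj {n n' : α.Node} (h : n.pos = n'.pos) : n = n' :=
  Subtype.ext (congrArg Prod.snd (List.inj_on_of_nodup_map
    (by rw [leaves_fst α 0 1]; exact nodup_leafPos α 0) (mem_leaves.2 n.leafAt)
    (mem_leaves.2 n'.leafAt) h))

theorem exists_pos_eq {p : ℕ} (h : p ∈ leafPos α 0) : ∃ n : α.Node, n.pos = p := by
  rw [← leaves_fst α 0 1] at h
  obtain ⟨⟨p, c⟩, h1, rfl⟩ := List.mem_map.1 h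
  have h2 := mem_leaves.1 h1
  exact ⟨⟨c, h2.spec.2⟩, LeafAt.pos_eq (n := ⟨c, h2.spec.2⟩) h2⟩

/-- The position of a source. -/
noncomputable def posOf : Option α.Node → ℕ
  | none => α.size
  | some n => n.pos

/-- The number of a source. -/
noncomputable def numOf : Option α.Node → ℕ
  | none => α.occ
  | some n => (leafPos α 0).idxOf n.pos

/-- The symbol that represents a source. -/
def symOf : Option α.Node → Sym
  | none => (RefSym.var 0, 0)
  | some n => n.1

/-- The entrance for a source. -/
def entryOf : Option α.Node → Option (List Sym × ℕ)
  | none => some ([], α.size)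
  | some _ => none

/-- The targets for a source. -/
noncomputable def targetsOf (u : Option α.Node) : List (Target (Fin s) ℕ) :=
  targets (symOf u) α 0 1 (entryOf u)

theorem isSource (u : Option α.Node) : α.IsSource u (symOf u) (entryOf u) := by
  rcases u with _ | n
  · exact ⟨id, rfl, rfl⟩
  · exact ⟨n.2.2, rfl, rfl⟩

theorem zero_not_mem_symbols {c : RefSym (Fin s) ℕ} : (c, 0) ∉ α.marked.symbols := fun h =>
  absurd (mark_pos_of_mem_symbols h) (by simp)

/-- The beginning lies outside of the tree in both respects: its position is `α.size`, and its mark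
is `0`. -/
theorem located (u : Option α.Node) : α.Located 0 1 (posOf u) (symOf u) := by
  rcases u with _ | n
  · exact Or.inr ⟨fun h => absurd h.2 (by simp [posOf]), zero_not_mem_symbols⟩
  · exact Or.inl n.leafAt

theorem numOf_lt (u : Option α.Node) : numOf u < α.occ + 1 := by
  rcases u with _ | n
  · exact Nat.lt_succ_self _
  · have := List.idxOf_lt_length_of_mem n.pos_mem
    rw [length_leafPos] at this
    exact this.trans (Nat.lt_succ_self _)

theorem numOf_inj {u u' : Option α.Node} (h : numOf u = numOf u') : u = u' := by
  have h1 : ∀ n : α.Node, (leafPos α 0).idxOf n.pos < α.occ := fun n => by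
    rw [← length_leafPos α 0]
    exact List.idxOf_lt_length_of_mem n.pos_mem
  rcases u with _ | n <;> rcases u' with _ | n'
  · rfl
  · exact absurd h (h1 n').ne'
  · exact absurd h (h1 n).ne
  · exact congrArg some (Node.pos_inj ((List.idxOf_inj n.pos_mem).1 h))

theorem exists_numOf_eq {j : ℕ} (h : j < α.occ + 1) : ∃ u : Option α.Node, numOf u = j := by
  rcases Nat.lt_succ_iff_lt_or_eq.1 h with h | rfl
  · rw [← length_leafPos α 0] at h
    obtain ⟨n, hn⟩ := exists_pos_eq (List.getElem_mem h)
    exact ⟨some n, by rw [numOf, hn, (nodup_leafPos α 0).idxOf_getElem]⟩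
  · exact ⟨none, rfl⟩

theorem srcPos_numOf (u : Option α.Node) : srcPos α (numOf u) = posOf u := by
  rcases u with _ | n
  · rw [srcPos, numOf, ← length_leafPos α 0]
    simp [posOf]
  · have h := List.idxOf_lt_length_of_mem n.pos_mem
    rw [srcPos, numOf, posOf, List.getD_eq_getElem _ _ (by rw [List.length_append]; omega),
      List.getElem_append_left h, List.getElem_idxOf]

theorem entryLen_entryOf (u : Option α.Node) : entryLen (entryOf u) = srcEntry α (posOf u) := by
  rcases u with _ | n
  · simp [entryOf, entryLen, codeLen, srcEntry, posOf]
  · have := n.leafAt.spec.1.2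
    rw [Nat.zero_add] at this
    rw [srcEntry, posOf, if_neg (by omega)]
    rfl

theorem srcReached_posOf (u : Option α.Node) :
    srcReached α (posOf u) = (targetsOf u).map Target.toReached := by
  rw [targetsOf, map_targets (located u), entryLen_entryOf, srcReached]
  intro v p h
  rcases u with _ | n
  · simp only [entryOf, Option.some.injEq, Prod.mk.injEq] at h
    exact h.2
  · cases h

theorem nodup_targetsOf (u : Option α.Node) : ((targetsOf u).map Target.node).Nodup :=
  nodup_nodes _ _ _ _ _

/-- At the root the condition `Recurs` is vacuous: the symbol for the beginning does not occur in
the expression, and a node has no entrance. -/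
theorem sourceOK_iff (h0 : α.WellFormed) (u : Option α.Node) : SourceOK α (posOf u) ↔
    α.InOK (symOf u) 0 1 (entryOf u) ∧ NoClash (targetsOf u) := by
  rw [noClash_iff (nodup_targetsOf u), inOK_iff h0 (located u), entryLen_entryOf, SourceOK,
    srcReached_posOf, List.length_map, and_assoc]
  rcases u with _ | n
  · exact fun h => absurd h zero_not_mem_symbols
  · exact fun _ v p h => by cases h

theorem edge_empty {u v : Option (empty : Regex (Fin s) ℕ).Node} {ν : List Sym} :
    ¬ Edge empty u ν v := fun h => by
  obtain ⟨-, l, r, h, -⟩ := h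
  exact h

/-- The tests of the program, translated back from lengths to words, are `NullOK`, `InOK` and
`NoClash` for all sources; their failure is a conflict, and together they exclude conflicts. For `∅`
there is nothing to test and there are no edges. -/
theorem passed_iff (hα : α.IsRX) : Passed α ↔ ¬ α.Conflict := by
  have hall : (∀ j < α.occ + 1, SourceOK α (srcPos α j)) ↔ ∀ u : Option α.Node,
      SourceOK α (posOf u) := by
    refine ⟨fun h u => srcPos_numOf u ▸ h _ (numOf_lt u), fun h j hj => ?_⟩
    obtain ⟨u, rfl⟩ := exists_numOf_eq hj
    rw [srcPos_numOf]
    exact h u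
  rw [Passed, hall]
  rcases hα with rfl | h0
  · refine iff_of_true ⟨trivial, fun u => ⟨⟨trivial, List.nodup_nil⟩, Or.inr (Nat.zero_le _)⟩⟩ ?_
    rintro ⟨u, ν, -, v, -, h, -⟩
    exact edge_empty h
  · simp only [sourceOK_iff h0, ← nullOK_iff α 1]
    refine ⟨fun h => not_conflict_of_sources h0 h.1 fun u => ⟨_, _, isSource u, h.2 u⟩,
      fun h => ?_⟩
    have hN : α.NullOK 1 := by
      by_contra hN
      exact h (conflict_of_not_nullOK (l := []) (r := []) h0 (fun y hy => by
        rw [List.nil_append, List.append_nil]; exact hy) hN)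
    refine ⟨hN, fun u => ?_⟩
    by_contra hI
    exact h (conflict_of_source (isSource u) h0 hN hI)

/-- The targets describe the edges. -/
theorem edge_some_iff_targetsOf (hα : α.IsRX) (h : Passed α) (u : Option α.Node) (ν : List Sym)
    (n : α.Node) : α.Edge u ν (some n) ↔ ∃ e ∈ targetsOf u, e.node = n.1 ∧ e.word = ν := by
  rcases hα with rfl | h0
  · refine iff_of_false edge_empty ?_
    rintro ⟨e, he, -⟩
    cases he
  · refine edge_some_iff (isSource u) h0 ((nullOK_iff α 1).2 h.1) ?_ ν n
    have h1 := h.2 _ (numOf_lt u)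
    rw [srcPos_numOf, sourceOK_iff h0] at h1
    exact h1.1

theorem sourceFinal_iff (hα : α.IsRX) (h : Passed α) (u : Option α.Node) :
    SourceFinal α (posOf u) ↔ ∃ ν, α.Edge u ν none := by
  rcases u with _ | n
  · rw [SourceFinal, posOf, if_pos le_rfl, ← codeLen_nullW α 1, codeLen_ne_zero,
      Option.isSome_iff_exists]
    simp only [edge_none_none_iff ((nullOK_iff α 1).2 h.1)]
  · have := n.leafAt.spec.1.2
    rw [Nat.zero_add] at this
    rw [SourceFinal, posOf, if_neg (by omega), ← codeLen_outW (Or.inl n.leafAt), codeLen_ne_zero,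
      Option.isSome_iff_exists]
    rcases hα with rfl | h0
    · exact absurd n.2.1 List.not_mem_nil
    · simp only [edge_some_none_iff h0 ((nullOK_iff α 1).2 h.1)]

theorem targetsOf_spec (hα : α.IsRX) (h : Passed α) {u : Option α.Node} {e : Target (Fin s) ℕ}
    (he : e ∈ targetsOf u) : α.LeafAt 0 1 e.pos e.node ∧
      ∀ x, netPrio e.word x = ev (posOf u) e.pos e.turn α 0 1 false x := by
  rcases hα with rfl | h0
  · cases he
  · have hN := (nullOK_iff α 1).2 h.1
    exact ⟨(netPrio_target h0 hN (located u) he).1, netPrio_source (isSource u) h0 hN (located u) he⟩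

theorem numOf_eq {p : ℕ} {n : α.Node} (h : α.LeafAt 0 1 p n.1) :
    numOf (some n) = (leafPos α 0).idxOf p := by
  rw [numOf, h.pos_eq]

end Regex

/-! ### The output of the program describes the automaton -/

namespace Regex

open RamProg

theorem nodup_addVars {A X : Type*} [DecidableEq X] {β : Regex A X} {S : List X} (h : S.Nodup) :
    (addVars S β).Nodup := by
  have h1 : ∀ {S : List X} {x : X}, S.Nodup → (addVar S x).Nodup := fun {S x} h => by
    rw [addVar]
    split_ifs with hx
    · exact h
    · exact List.nodup_append.2 ⟨h, List.nodup_singleton x, fun a ha b hb => by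
        rw [List.mem_singleton.1 hb]; rintro rfl; exact hx ha⟩
  induction β generalizing S with
  | empty => exact h
  | eps => exact h
  | sym a => exact h
  | ref x => exact h1 h
  | cat β γ hβ hγ => exact hγ (hβ h)
  | alt β γ hβ hγ => exact hγ (hβ h)
  | plus β hβ => exact hβ h
  | bind x β hβ => exact h1 (hβ h)

variable {s : ℕ} {α : Regex (Fin s) ℕ}

local notation "Sym" => (RefSym (Fin s) ℕ × ℕ)

/-- The number of a state. -/
noncomputable def stateNum : α.GState → ℕ
  | GState.trap => α.occ + 1
  | GState.init => α.occ
  | GState.node n => numOf (some n)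

theorem stateNum_srcState (u : Option α.Node) : stateNum (srcState u) = numOf u := by
  cases u <;> rfl

/-- The nodes are numbered from left to right, followed by the initial state and the trap. The
numbering is injective, and the number of states is known. -/
theorem exists_stateEquiv (α : Regex (Fin s) ℕ) :
    ∃ e : α.GState ≃ Fin (α.occ + 2), ∀ q, (e q : ℕ) = stateNum q := by
  have hlt : ∀ q : α.GState, stateNum q < α.occ + 2 := fun q => by
    rcases q with _ | _ | n
    · exact Nat.lt_succ_self _
    · exact Nat.lt_add_of_pos_right (by decide)
    · exact Nat.lt_succ_of_lt (numOf_lt (some n))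
  have hinj : Function.Injective fun q : α.GState => (⟨stateNum q, hlt q⟩ : Fin (α.occ + 2)) := by
    intro q q' h
    have h : stateNum q = stateNum q' := congrArg Fin.val h
    by_cases hq : q = GState.trap
    · by_cases hq' : q' = GState.trap
      · rw [hq, hq']
      · obtain ⟨u, rfl⟩ := exists_srcState_eq hq'
        rw [hq, stateNum_srcState] at h
        exact absurd h (numOf_lt u).ne'
    · obtain ⟨u, rfl⟩ := exists_srcState_eq hq
      by_cases hq' : q' = GState.trap
      · rw [hq', stateNum_srcState] at h
        exact absurd h (numOf_lt u).ne
      · obtain ⟨u', rfl⟩ := exists_srcState_eq hq'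
        rw [stateNum_srcState, stateNum_srcState] at h
        rw [numOf_inj h]
  exact ⟨Equiv.ofBijective _ (hinj.bijective_of_nat_card_le (by
    rw [card_gState, Nat.card_eq_fintype_card, Fintype.card_fin])), fun q => rfl⟩

/-- The number of a memory. -/
def memNum : α.GMem → ℕ
  | none => 0
  | some x => varNum α x

theorem exists_memEquiv (α : Regex (Fin s) ℕ) :
    ∃ e : α.GMem ≃ Fin ((addVars [] α).length + 1), ∀ m, (e m : ℕ) = memNum m := by
  have hlt : ∀ m : α.GMem, memNum m < (addVars [] α).length + 1 := fun m => by
    rcases m with _ | x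
    · exact Nat.succ_pos _
    · exact Nat.lt_succ_of_le varNum_le
  refine ⟨Equiv.ofBijective (fun m => ⟨memNum m, hlt m⟩) ⟨fun m m' h => ?_, fun i => ?_⟩,
    fun m => rfl⟩
  · have h := congrArg Fin.val h
    rcases m with _ | x <;> rcases m' with _ | y
    · rfl
    · exact absurd h.symm (varNum_pos y.2)
    · exact absurd h (varNum_pos x.2)
    · exact congrArg some (Subtype.ext ((varNum_inj y.2).1 h))
  · obtain ⟨_ | j, hj⟩ := i
    · exact ⟨none, rfl⟩
    · have hj' := Nat.lt_of_succ_lt_succ hj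
      have hx := List.getElem_mem hj'
      refine ⟨some ⟨_, (mem_addVars.1 hx).resolve_left List.not_mem_nil⟩, Fin.ext ?_⟩
      simp only [memNum, varNum]
      rw [if_pos hx, (nodup_addVars List.nodup_nil).idxOf_getElem]

theorem encode_eq_instrCode (m : MemInstr) : m.encode = instrCode m.prio := by
  cases m <;> rfl

/-- `IsTransitionFor u e t`: the target `e` of the source `u` gives the transition `t`. -/
def IsTransitionFor (u : Option α.Node) (e : Target (Fin s) ℕ)
    (t : α.GState × TransLabel (Fin s) α.GMem × α.GState × (α.GMem → MemInstr)) : Prop :=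
  t.1 = srcState u ∧ ∃ n : α.Node, e.node = n.1 ∧ t.2.2.1 = GState.node n ∧
    α.IsEdgeTransition e.word n t.2.1 t.2.2.2

theorem IsTransitionFor.unique {u : Option α.Node} {e : Target (Fin s) ℕ}
    {t t' : α.GState × TransLabel (Fin s) α.GMem × α.GState × (α.GMem → MemInstr)}
    (h : IsTransitionFor u e t) (h' : IsTransitionFor u e t') : t = t' := by
  obtain ⟨q, b, p, f⟩ := t
  obtain ⟨q', b', p', f'⟩ := t'
  obtain ⟨rfl, n, h1, rfl, h2⟩ := h
  obtain ⟨rfl, n', h1', rfl, h2'⟩ := h'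
  obtain rfl : n = n' := Subtype.ext (h1.symm.trans h1')
  obtain ⟨rfl, rfl⟩ : b = b' ∧ f = f' := h2.unique h2'
  rfl

theorem exists_isTransitionFor (hα : α.IsRX) (h : Passed α) {u : Option α.Node}
    {e : Target (Fin s) ℕ} (he : e ∈ targetsOf u) : ∃ t, IsTransitionFor u e t := by
  have h1 := (targetsOf_spec hα h he).1.spec.2
  obtain ⟨b, f, hbf⟩ := exists_isEdgeTransition e.word (⟨e.node, h1⟩ : α.Node)
  exact ⟨(_, b, _, f), rfl, _, rfl, rfl, hbf⟩

/-- The description of a transition. -/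
noncomputable def codeOf (eK : α.GMem ≃ Fin ((addVars [] α).length + 1))
    (t : α.GState × TransLabel (Fin s) α.GMem × α.GState × (α.GMem → MemInstr)) : List ℕ :=
  stateNum t.1 :: t.2.1.encode eK ++
    stateNum t.2.2.1 :: List.ofFn fun i => (t.2.2.2 (eK.symm i)).encode

theorem ofFn_encode {eK : α.GMem ≃ Fin ((addVars [] α).length + 1)}
    (hK : ∀ m, (eK m : ℕ) = memNum m) {f : α.GMem → MemInstr} {g : ℕ → ℕ}
    (h : ∀ m, (f m).encode = g (memNum m)) : (List.ofFn fun i => (f (eK.symm i)).encode) =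
      (List.range ((addVars [] α).length + 1)).map g := by
  refine List.ext_getElem (by simp) fun i h1 h2 => ?_
  rw [List.getElem_ofFn, h, ← hK, Equiv.apply_symm_apply]
  simp

theorem memNum_inj {m m' : α.GMem} : memNum m = memNum m' ↔ m = m' := by
  obtain ⟨e, he⟩ := exists_memEquiv α
  rw [← he, ← he, ← Fin.ext_iff, e.apply_eq_iff_eq]

/-- The priorities computed from the tree are those of the actual label, by `targetsOf_spec` and
`netNum_eq`. No variable has the number 0, so the additional memory gets priority 0, which is
encoded as unchanged. -/
theorem codeOf_eq_targetRow (hα : α.IsRX) (h : Passed α)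
    {eK : α.GMem ≃ Fin ((addVars [] α).length + 1)} (hK : ∀ m, (eK m : ℕ) = memNum m)
    {u : Option α.Node} {e : Target (Fin s) ℕ} (he : e ∈ targetsOf u)
    {t : α.GState × TransLabel (Fin s) α.GMem × α.GState × (α.GMem → MemInstr)}
    (ht : IsTransitionFor u e t) :
    codeOf eK t = targetRow α (numOf u) (posOf u) e.toReached := by
  obtain ⟨h1, h2⟩ := targetsOf_spec hα h he
  have hnet : ∀ m, (α.edgeInstr e.word m).prio = reachedNet α (posOf u) e.toReached (memNum m) := by
    rintro (_ | x)
    · exact (netNum_eq_zero fun y hy => varNum_pos hy).symm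
    · exact (h2 x).trans (netNum_eq fun y hy => varNum_inj x.2).symm
  have hrec : ∀ x : α.var, recalled α (posOf u) e.toReached x =
      if (α.edgeInstr e.word (some x)).prio = 2 then 0 else memNum (some x) := fun x => by
    rw [recalled, ← show _ = reachedNet α (posOf u) e.toReached (varNum α x) from hnet (some x)]
    rfl
  obtain ⟨q, b, p, f⟩ := t
  obtain ⟨rfl, n, hn, rfl, hbf⟩ := ht
  have hq : stateNum (GState.node n) = (leafPos α 0).idxOf e.toReached.1 := numOf_eq (hn ▸ h1)
  have hupd : ∀ (_ : DecidableEq α.GMem) (i m : α.GMem),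
      (Function.update (α.edgeInstr e.word) i MemInstr.cls m).encode =
        instrCode (if memNum m = memNum i then 1 else
          reachedNet α (posOf u) e.toReached (memNum m)) := fun _ i m => by
    by_cases hm : m = i
    · rw [hm, Function.update_self, if_pos rfl]
      rfl
    · rw [Function.update_of_ne hm, if_neg (mt memNum_inj.1 hm), ← hnet, encode_eq_instrCode]
  have hnode : e.toReached.2.2 = n.1.1 := congrArg Prod.fst hn
  rcases hbf with ⟨a, ha, rfl, rfl⟩ | ⟨x, hx, hr, rfl, rfl⟩ | ⟨x, hx, hr, rfl, rfl⟩
  · simp only [codeOf, targetRow, hnode, ha, stateNum_srcState, hq, TransLabel.encode]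
    rw [ofFn_encode hK (g := fun i => instrCode (reachedNet α (posOf u) e.toReached i))
      fun m => by rw [encode_eq_instrCode, hnet]]
    rfl
  · have hr' : recalled α (posOf u) e.toReached x = memNum (some x) := by 
      rw [hrec, if_neg (by revert hr; cases α.edgeInstr e.word (some x) <;> simp [MemInstr.prio])]
    simp only [codeOf, targetRow, hnode, hx, stateNum_srcState, hq, TransLabel.encode, hK, hr']
    exact congrArg (fun l => [numOf u, 2, memNum (some x), (leafPos α 0).idxOf e.toReached.1] ++ l)
      (ofFn_encode hK fun m => hupd _ (some x) m)
  · have hr' : recalled α (posOf u) e.toReached x = memNum (none : α.GMem) := by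
      rw [hrec, hr]; rfl
    simp only [codeOf, targetRow, hnode, hx, stateNum_srcState, hq, TransLabel.encode, hK, hr']
    exact congrArg (fun l => [numOf u, 2, memNum (none : α.GMem), (leafPos α 0).idxOf e.toReached.1] ++ l)
      (ofFn_encode hK fun m => hupd _ none m)

end Regex

/-! ### The output lists exactly the final states and transitions of the automaton -/

namespace Regex

open RamProg

variable {s : ℕ} {α : Regex (Fin s) ℕ}

theorem srcState_mem_final (u : Option α.Node) :
    srcState u ∈ α.glushkov.final ↔ ∃ ν, α.Edge u ν none := by
  cases u <;> rfl

theorem srcState_ne_trap (u : Option α.Node) : srcState u ≠ GState.trap := by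
  cases u <;> exact fun h => by cases h

theorem srcState_inj {u u' : Option α.Node} (h : srcState u = srcState u') : u = u' :=
  numOf_inj (by rw [← stateNum_srcState, h, stateNum_srcState])

theorem mem_δ_iff (hα : α.IsRX) (h : Passed α) (u : Option α.Node)
    (b : TransLabel (Fin s) α.GMem) (p : α.GState) (f : α.GMem → MemInstr) :
    (p, f) ∈ α.glushkov.δ (srcState u) b ↔
      ∃ e ∈ targetsOf u, IsTransitionFor u e (srcState u, b, p, f) := by
  rw [glushkov_δ_subset_of_not_conflict ((passed_iff hα).1 h)]
  constructor
  · rintro ⟨n, ν, hp, he, ht⟩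
    obtain ⟨e, he', hn, rfl⟩ := (edge_some_iff_targetsOf hα h u ν n).1 he
    exact ⟨e, he', rfl, n, hn, hp, ht⟩
  · rintro ⟨e, he, -, n, hn, hp, ht⟩
    exact ⟨n, e.word, hp, (edge_some_iff_targetsOf hα h u _ n).2 ⟨e, he, hn, rfl⟩, ht⟩

theorem codeOf_trap (eK : α.GMem ≃ Fin ((addVars [] α).length + 1))
    {b : TransLabel (Fin s) α.GMem} {m n : ℕ} (hb : b.encode eK = [m, n]) :
    codeOf eK (GState.trap, b, GState.trap, fun _ => MemInstr.unch) = trapRow α m n := by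
  simp [codeOf, hb, trapRow, stateNum, MemInstr.encode, List.replicate_succ]

/-- The output of the program for a regex without conflicts. -/
theorem exists_isEncoding (hα : α.IsRX) (h : Passed α) :
    ∃ code, result α = 1 :: code ∧ α.glushkov.IsEncoding code := by
  obtain ⟨eQ, hQ⟩ := exists_stateEquiv α
  obtain ⟨eK, hK⟩ := exists_memEquiv α
  have : Nonempty (α.GState × TransLabel (Fin s) α.GMem × α.GState × (α.GMem → MemInstr)) :=
    ⟨(GState.init, TransLabel.eps, GState.init, fun _ => MemInstr.unch)⟩
  -- `F` picks the transition that belongs to a target; `S` will invert the numbering of the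
  -- sources.
  choose! F hF using fun (u : Option α.Node) (e : Target (Fin s) ℕ) (he : e ∈ targetsOf u) =>
    exists_isTransitionFor hα h he
  choose! S hS using fun (j : ℕ) (hj : j < α.occ + 1) => exists_numOf_eq (α := α) hj
  have hSn : ∀ u : Option α.Node, S (numOf u) = u := fun u => numOf_inj (hS _ (numOf_lt u))
  have hpos : ∀ j < α.occ + 1, srcPos α j = posOf (S j) := fun j hj => by
    rw [← srcPos_numOf, hS j hj]
  have hfin : ∀ j, j ∈ finalRows α (α.occ + 1) ↔ j < α.occ + 1 ∧ SourceFinal α (srcPos α j) :=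
    fun j => by rw [finalRows, List.mem_filter, List.mem_range, decide_eq_true_iff]
  have hfs : ((finalRows α (α.occ + 1)).map fun j => srcState (S j)).map
      (fun q => (eQ q : ℕ)) = finalRows α (α.occ + 1) := by
    rw [List.map_map]
    refine (List.map_congr_left fun j hj => ?_).trans (List.map_id _)
    rw [Function.comp_apply, hQ, stateNum_srcState, hS j ((hfin j).1 hj).1, id]
  have hreach : ∀ j ∈ List.range (α.occ + 1),
      srcReached α (srcPos α j) = (targetsOf (S j)).map Target.toReached := fun j hj => by
    rw [hpos j (List.mem_range.1 hj), srcReached_posOf]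
  refine ⟨(result α).tail, rfl, α.occ + 2, (addVars [] α).length + 1, eQ, eK,
    (finalRows α (α.occ + 1)).map fun j => srcState (S j),
    (List.range (α.occ + 1)).flatMap (fun j => (targetsOf (S j)).map (F (S j))) ++
      (List.finRange s).map (fun a => (GState.trap, TransLabel.letter a, GState.trap,
        fun _ => MemInstr.unch)) ++
      [(GState.trap, TransLabel.eps, GState.trap, fun _ => MemInstr.unch)],
    -- The numbers of the listed final states form a filtered range, so they are distinct, and hence
    -- so are the states.
    List.Nodup.of_map _ (by rw [hfs]; exact List.nodup_range.filter _), fun q => ?_, ?_, ?_, ?_⟩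
  · rw [List.mem_map]
    constructor
    · rintro ⟨j, hj, rfl⟩
      have hj := (hfin j).1 hj
      rw [srcState_mem_final, ← sourceFinal_iff hα h, ← hpos j hj.1]
      exact hj.2
    · intro hq
      obtain ⟨u, rfl⟩ := exists_srcState_eq (q := q) (by rintro rfl; exact hq)
      refine ⟨numOf u, (hfin _).2 ⟨numOf_lt u, ?_⟩, by rw [hSn]⟩
      rw [srcPos_numOf, sourceFinal_iff hα h]
      exact (srcState_mem_final u).1 hq
  · refine List.nodup_append.2 ⟨List.nodup_append.2 ⟨List.nodup_flatMap.2 ⟨fun j hj => ?_, ?_⟩,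
      (List.nodup_finRange s).map fun a a' haa => ?_, ?_⟩, List.nodup_singleton _, ?_⟩
    -- A transition determines its target node, and a node occurs at most once among the targets of
    -- a source; transitions of different sources differ in their source state, and those of the
    -- trap start nowhere else.
    · refine List.Nodup.map_on (fun e he e' he' hee => ?_) (nodup_targetsOf (S j)).of_map
      obtain ⟨-, n, h1, h2, -⟩ := hF _ e he
      obtain ⟨-, n', h1', h2', -⟩ := hF _ e' he'
      rw [hee, h2'] at h2
      cases h2
      exact List.inj_on_of_nodup_map (nodup_targetsOf (S j)) he he' (h1.trans h1'.symm)
    · refine List.nodup_range.pairwise_of_forall_ne fun j hj j' hj' hne => ?_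
      refine List.disjoint_left.2 fun t ht ht' => hne ?_
      obtain ⟨e, he, rfl⟩ := List.mem_map.1 ht
      obtain ⟨e', he', hee⟩ := List.mem_map.1 ht'
      have h3 := srcState_inj ((hF _ e he).1.symm.trans ((congrArg Prod.fst hee).symm.trans
        (hF _ e' he').1))
      rw [← hS j (List.mem_range.1 hj), ← hS j' (List.mem_range.1 hj'), h3]
    · simpa using haa
    · intro t ht t' ht' htt
      obtain ⟨j, -, ht⟩ := List.mem_flatMap.1 ht
      obtain ⟨e, he, rfl⟩ := List.mem_map.1 ht
      obtain ⟨a, -, rfl⟩ := List.mem_map.1 ht'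
      exact srcState_ne_trap _ ((hF _ e he).1.symm.trans (congrArg Prod.fst htt))
    · intro t ht t' ht' htt
      rw [List.mem_singleton.1 ht'] at htt
      rw [htt] at ht
      rcases List.mem_append.1 ht with ht | ht
      · obtain ⟨j, -, ht⟩ := List.mem_flatMap.1 ht
        obtain ⟨e, he, h3⟩ := List.mem_map.1 ht
        exact srcState_ne_trap _ ((hF _ e he).1.symm.trans (congrArg Prod.fst h3))
      · obtain ⟨a, -, h3⟩ := List.mem_map.1 ht
        cases h3
  · rintro ⟨q, b, p, f⟩
    rw [List.mem_append, List.mem_append, List.mem_flatMap, List.mem_map, List.mem_singleton]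
    by_cases hq : q = GState.trap
    · subst hq
      have hno : ¬ ∃ j ∈ List.range (α.occ + 1),
          (GState.trap, b, p, f) ∈ (targetsOf (S j)).map (F (S j)) := by
        rintro ⟨j, -, ht⟩
        obtain ⟨e, he, h3⟩ := List.mem_map.1 ht
        exact srcState_ne_trap _ ((hF _ e he).1.symm.trans (congrArg Prod.fst h3))
      rw [or_iff_right hno]
      rcases b with a | _ | i
      · change _ ↔ (p, f) ∈ ({(GState.trap, fun _ => MemInstr.unch)} : Set _)
        simp [eq_comm]
      · change _ ↔ (p, f) ∈ ({(GState.trap, fun _ => MemInstr.unch)} : Set _)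
        simp
      · change _ ↔ (p, f) ∈ (∅ : Set _)
        simp
    · obtain ⟨u, rfl⟩ := exists_srcState_eq hq
      rw [mem_δ_iff hα h]
      constructor
      · rintro ((⟨j, hj, ht⟩ | ⟨a, -, ht⟩) | ht)
        · obtain ⟨e, he, h3⟩ := List.mem_map.1 ht
          have h4 := hF _ e he
          rw [h3] at h4
          obtain rfl : u = S j := srcState_inj h4.1
          exact ⟨e, he, h4⟩
        · exact absurd (congrArg Prod.fst ht).symm hq
        · exact absurd (congrArg Prod.fst ht) hq
      · rintro ⟨e, he, ht⟩
        refine Or.inl (Or.inl ⟨numOf u, List.mem_range.2 (numOf_lt u), ?_⟩)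
        rw [hSn]
        exact List.mem_map.2 ⟨e, he, (hF u e he).unique ht⟩
  · have hcode : (fun t : α.GState × TransLabel (Fin s) α.GMem × α.GState × (α.GMem → MemInstr) =>
        (eQ t.1 : ℕ) :: t.2.1.encode eK ++ (eQ t.2.2.1 : ℕ) ::
          List.ofFn fun i => (t.2.2.2 (eK.symm i)).encode) = codeOf eK := by
      funext t
      rw [codeOf, hQ, hQ]
    have hrows : ((List.range (α.occ + 1)).flatMap fun j => (targetsOf (S j)).map (F (S j))).flatMap
        (codeOf eK) = transRows α (α.occ + 1) := by
      rw [List.flatMap_assoc, transRows]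
      refine List.flatMap_congr fun j hj => ?_
      rw [hreach j hj, List.flatMap_map, List.flatMap_map]
      refine List.flatMap_congr fun e he => ?_
      rw [codeOf_eq_targetRow hα h hK he (hF _ e he), hS j (List.mem_range.1 hj),
        hpos j (List.mem_range.1 hj)]
    have hcount : ((List.range (α.occ + 1)).flatMap fun j =>
        (targetsOf (S j)).map (F (S j))).length = transCount α (α.occ + 1) := by
      rw [transCount, List.length_flatMap, List.length_flatMap]
      refine congrArg List.sum (List.map_congr_left fun j hj => ?_)
      rw [hreach j hj, List.length_map, List.length_map]
    have htrap : ((List.finRange s).map fun a => ((GState.trap, TransLabel.letter a, GState.trap,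
        fun _ => MemInstr.unch) : α.GState × TransLabel (Fin s) α.GMem × α.GState ×
          (α.GMem → MemInstr))).flatMap (codeOf eK) = trapRows α s := by
      rw [trapRows, ← List.map_coe_finRange_eq_range, List.flatMap_map, List.flatMap_map]
      exact List.flatMap_congr fun a _ => codeOf_trap eK rfl
    rw [hcode, hfs, List.length_map, List.flatMap_append, List.flatMap_append, hrows, htrap,
      List.flatMap_singleton, codeOf_trap eK (m := 1) (n := 0) rfl, List.length_append,
      List.length_append, hcount, List.length_map, List.length_finRange, hQ, hQ]
    rfl

end Regex
-- The main theorem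
theorem mainTheorem1 :
    (∀ (A : Type*) (X : Type*) [Finite A] (α : Regex A X), α.IsRX →
      Nat.card α.GState = α.occ + 2 ∧
      α.glushkov.EpsFree ∧
      α.glushkov.RejectingTrap ∧
      α.glushkov.lang = α.lang ∧
      (α.glushkov.Deterministic ↔ α.Deterministic)) ∧
    (∃ (P : RamProg) (C : ℕ), ∀ (s : ℕ), 1 ≤ s → ∀ (α : Regex (Fin s) ℕ), α.IsRX →
      ∃ (output : List ℕ) (t : ℕ),
        P.Computes (s :: α.encode) output t ∧
        t ≤ C * (s * α.size * max α.occ 1) ∧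
        ((α.Deterministic ∧ ∃ code, output = 1 :: code ∧ α.glushkov.IsEncoding code) ∨
         (¬ α.Deterministic ∧ output = [0]))) := by
  refine ⟨fun A X _ α hα => ⟨α.card_gState, α.glushkov_epsFree, α.glushkov_rejectingTrap,
    Regex.glushkov_lang hα, α.glushkov_deterministic_iff⟩, ?_⟩
  refine ⟨RamProg.glushkovProgram, 40000, fun s hs α hα => ?_⟩
  obtain ⟨output, t, h1, h2, h3⟩ := RamProg.glushkovProgram_computes hs α
  have h4 : α.Passed ↔ α.Deterministic :=
    (Regex.passed_iff hα).trans α.deterministic_iff_not_conflict.symm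
  refine ⟨output, t, h1, h2, ?_⟩
  rcases h3 with ⟨h3, rfl⟩ | ⟨h3, rfl⟩
  · exact Or.inl ⟨h4.1 h3, Regex.exists_isEncoding hα h3⟩
  · exact Or.inr ⟨mt h4.2 h3, rfl⟩
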